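/- All manifolds are real, smooth, finite-dimensional, Hausdorff and second countable, and vector bundles are smooth and of finite rank. A Lie algebroid over $M$ is a vector bundle $A\to M$ with an anchor $\#:A\to TM$ (a vector bundle map over the identity) and a Lie bracket on $\Gamma(A)$ such that $[\alpha,f\beta]=f[\alpha,\beta]+(\#\alpha)(f)\,\beta$ and $\#[\alpha,\beta]=[\#\alpha,\#\beta]$. An $A$-path is a smooth path $a:[0,1]\to A$ with $\frac{d}{dt}\pi(a(t))=\#a(t)$, where $\pi:A\to M$ is the projection. The leaves (orbits) of $A$ are the classes of the equivalence relation on $M$ in which two points are equivalent if they are joined by the base paths of finitely many concatenated $A$-paths, i.e. the equivalence relation generated by $\pi(a(0))\sim\pi(a(1))$ for $A$-paths $a$; the tangent space of the leaf through $x$ is $\#(A_x)$. If $\phi:Q\to M$ is a smooth map transverse to the anchor (for instance a submersion), the pull-back Lie algebroid $\phi^\star A\to Q$ has fibers $\{(\alpha,X)\in A_{\phi(q)}\times T_qQ:\ \#\alpha=d\phi(X)\}$, anchor $(\alpha,X)\mapsto X$, and the bracket determined, for local expressions $\alpha=\sum_i f_i\,\phi^*a_i$ and $\beta=\sum_j g_j\,\phi^*b_j$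 with $a_i,b_j\in\Gamma(A)$ and smooth functions $f_i,g_j$ on $Q$, by $$[(\alpha,X),(\beta,Y)]=\Big(\sum_{i,j} f_ig_j\,\phi^*[a_i,b_j]+\sum_j X(g_j)\,\phi^*b_j-\sum_i Y(f_i)\,\phi^*a_i,\ [X,Y]\Big).$$ A transversal to a leaf $L$ of $A$ at $x\in L$ is an embedded submanifold $\iota:N\hookrightarrow M$ through $x$ with $T_yN+\#(A_y)=T_yM$ for all $y\in N$ and $T_xM=T_xN\oplus T_xL$. The transverse Lie algebroid structure of $L$ at $x$ is the germ at $x$ of the Lie algebroid $A_N=\{\alpha\in A|_N:\#\alpha\in TN\}=\iota^\star A$. **Theorem.** Let $A_1\to M_1$ and $A_2\to M_2$ be Morita equivalent Lie algebroids: there are a manifold $Q$ and surjective submersions $\phi_1:Q\to M_1$, $\phi_2:Q\to M_2$ with simply connected fibers such that $\phi_1^\star A_1$ and $\phi_2^\star A_2$ are isomorphic Lie algebroids over $Q$ (by an isomorphism covering the identity of $Q$). Then, for every such $Q,\phi_1,\phi_2$, the assignment $L\mapsto\phi_2(\phi_1^{-1}(L))$ is a bijection from the set of leaves of $A_1$ onto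 the set of leaves of $A_2$. Moreover, the transverse Lie algebroid structures of corresponding leaves are isomorphic: for every leaf $L$ of $A_1$, all points $x_1\in L$ and $x_2\in\phi_2(\phi_1^{-1}(L))$, every transversal $N_1$ to $L$ at $x_1$ and every transversal $N_2$ to $\phi_2(\phi_1^{-1}(L))$ at $x_2$, there is an isomorphism of Lie algebroids between the restrictions of $(A_1)_{N_1}$ and $(A_2)_{N_2}$ to open neighbourhoods of $x_1$ in $N_1$ and of $x_2$ in $N_2$, covering a diffeomorphism that sends $x_1$ to $x_2$. -/

import Mathlib

open Set Bundle
open scoped Manifold ContDiff Topology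

noncomputable section LieAlgebroidTheory

/-- A (real, smooth) Lie algebroid structure on the smooth vector bundle `A → M` with typical
fibre `F`: a smooth bundle map `anchor : A → TM` over the identity, and a Lie bracket on the space
`Γ(A)` of global smooth sections which satisfies the Leibniz rule and for which the anchor is a
homomorphism into the Lie algebra of vector fields. -/
structure LieAlgebroid (E : Type*) [NormedAddCommGroup E] [NormedSpace ℝ E]
    {M : Type*} [TopologicalSpace M] [ChartedSpace E M] [IsManifold 𝓘(ℝ, E) ∞ M]
    (F : Type*) [NormedAddCommGroup F] [NormedSpace ℝ F]
    (A : M → Type*) [TopologicalSpace (TotalSpace F A)]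
    [∀ x, AddCommGroup (A x)] [∀ x, Module ℝ (A x)] [∀ x, TopologicalSpace (A x)]
    [FiberBundle F A] [VectorBundle ℝ F A] where
  /-- The anchor `# : A → TM`, linear on the fibres. -/
  anchor : ∀ x : M, A x →ₗ[ℝ] TangentSpace 𝓘(ℝ, E) x
  contMDiff_anchor : ContMDiff (𝓘(ℝ, E).prod 𝓘(ℝ, F)) (𝓘(ℝ, E).prod 𝓘(ℝ, E)) ∞
    (fun p : TotalSpace F A => (⟨p.proj, anchor p.proj p.snd⟩ : TangentBundle 𝓘(ℝ, E) M))
  /-- The Lie bracket on the smooth sections of `A`. -/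
  bracket : Cₛ^∞⟮𝓘(ℝ, E); F, A⟯ → Cₛ^∞⟮𝓘(ℝ, E); F, A⟯ → Cₛ^∞⟮𝓘(ℝ, E); F, A⟯
  bracket_add : ∀ a b c, bracket a (b + c) = bracket a b + bracket a c
  bracket_smul : ∀ (r : ℝ) (a b), bracket a (r • b) = r • bracket a b
  bracket_skew : ∀ a b, bracket a b = -bracket b a
  jacobi : ∀ a b c,
    bracket a (bracket b c) + bracket b (bracket c a) + bracket c (bracket a b) = 0
  /-- The Leibniz rule `[a, f b] = f [a, b] + (#a)(f) b`. -/
  leibniz : ∀ (a b c : Cₛ^∞⟮𝓘(ℝ, E); F, A⟯) (f : M → ℝ), ContMDiff 𝓘(ℝ, E) 𝓘(ℝ, ℝ) ∞ f →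
    (∀ x, c x = f x • b x) → ∀ x, bracket a c x =
      f x • bracket a b x + mvfderiv 𝓘(ℝ, E) f x (anchor x (a x)) • b x
  anchor_bracket : ∀ a b x, anchor x (bracket a b x) =
    VectorField.mlieBracket 𝓘(ℝ, E) (fun y => anchor y (a y)) (fun y => anchor y (b y)) x

namespace LieAlgebroid

section Leaves

variable {E : Type*} [NormedAddCommGroup E] [NormedSpace ℝ E]
  {M : Type*} [TopologicalSpace M] [ChartedSpace E M] [IsManifold 𝓘(ℝ, E) ∞ M]
  {F : Type*} [NormedAddCommGroup F] [NormedSpace ℝ F]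
  {A : M → Type*} [TopologicalSpace (TotalSpace F A)]
  [∀ x, AddCommGroup (A x)] [∀ x, Module ℝ (A x)] [∀ x, TopologicalSpace (A x)]
  [FiberBundle F A] [VectorBundle ℝ F A]

/-- A smooth `A`-path: `a : [0, 1] → A` smooth with `d/dt π(a(t)) = #a(t)`.
Values of `a` outside `[0, 1]` are irrelevant. -/
def IsAPath (𝒜 : LieAlgebroid E F A) (a : ℝ → TotalSpace F A) : Prop :=
  ContMDiffOn 𝓘(ℝ, ℝ) (𝓘(ℝ, E).prod 𝓘(ℝ, F)) ∞ a (Icc 0 1) ∧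
    ∀ t ∈ Icc (0 : ℝ) 1,
      HasMFDerivWithinAt 𝓘(ℝ, ℝ) 𝓘(ℝ, E) (fun τ => (a τ).proj) (Icc 0 1) t
        ((1 : ℝ →L[ℝ] ℝ).smulRight (𝒜.anchor (a t).proj (a t).snd))

/-- The orbit equivalence relation: two points are equivalent if they are joined by a finite
concatenation of `A`-paths. -/
def orbitSetoid (𝒜 : LieAlgebroid E F A) : Setoid M :=
  Relation.EqvGen.setoid
    (fun x y => ∃ a : ℝ → TotalSpace F A, 𝒜.IsAPath a ∧ (a 0).proj = x ∧ (a 1).proj = y)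

/-- The leaves (orbits) of a Lie algebroid, as subsets of the base: the classes of the orbit
equivalence relation. -/
def leaves (𝒜 : LieAlgebroid E F A) : Set (Set M) := 𝒜.orbitSetoid.classes

/-- `ι : N → M` is a transversal to the leaf through `ι n₀`, at that point: `ι` is a smooth
embedding, `N` is transverse to the orbit foliation, and `T N` is a complement of the tangent
space of the leaf at `ι n₀`. (The tangent space of a leaf at `x` is the image of the anchor
at `x`.) -/
structure IsTransversal (𝒜 : LieAlgebroid E F A)
    {EN : Type*} [NormedAddCommGroup EN] [NormedSpace ℝ EN]
    {N : Type*} [TopologicalSpace N] [ChartedSpace EN N] [IsManifold 𝓘(ℝ, EN) ∞ N]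
    (ι : N → M) (n₀ : N) : Prop where
  isSmoothEmbedding : Manifold.IsSmoothEmbedding 𝓘(ℝ, EN) 𝓘(ℝ, E) ∞ ι
  transverse : ∀ n : N, (mfderiv 𝓘(ℝ, EN) 𝓘(ℝ, E) ι n).toLinearMap.range ⊔
    (𝒜.anchor (ι n)).range = ⊤
  isCompl : IsCompl (mfderiv 𝓘(ℝ, EN) 𝓘(ℝ, E) ι n₀).toLinearMap.range (𝒜.anchor (ι n₀)).range

end Leaves

section Pullback

variable {E : Type*} [NormedAddCommGroup E] [NormedSpace ℝ E]
  {M : Type*} [TopologicalSpace M] [ChartedSpace E M] [IsManifold 𝓘(ℝ, E) ∞ M]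
  {F : Type*} [NormedAddCommGroup F] [NormedSpace ℝ F]
  {A : M → Type*} [TopologicalSpace (TotalSpace F A)]
  [∀ x, AddCommGroup (A x)] [∀ x, Module ℝ (A x)] [∀ x, TopologicalSpace (A x)]
  [FiberBundle F A] [VectorBundle ℝ F A]
  {EQ : Type*} [NormedAddCommGroup EQ] [NormedSpace ℝ EQ]
  {Q : Type*} [TopologicalSpace Q] [ChartedSpace EQ Q] [IsManifold 𝓘(ℝ, EQ) ∞ Q]

/-! ### The pull-back Lie algebroid `φ⋆A` along a smooth map `φ : Q → M`

It is used when `φ` is a submersion, and when `φ` is the embedding of a submanifold `N` transverse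
to the leaves. In general `φ` has to be transverse to the anchor, so that the fibres below form a
smooth vector bundle. In the case of a transversal `N`, the pair `(α, X)` is determined by `α`, and
the construction gives the transverse Lie algebroid `A_N = {α ∈ A|_N : #α ∈ TN}` with the bracket
induced from that of `A`. -/

/-- The fibre of `φ⋆A` at `q`: the pairs `(α, X)`, `α ∈ A_{φ(q)}`, `X ∈ T_q Q`, such that
`#α = dφ(X)`. -/
def pullbackFiber (𝒜 : LieAlgebroid E F A) (φ : Q → M) (q : Q) :
    Submodule ℝ (A (φ q) × TangentSpace 𝓘(ℝ, EQ) q) :=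
  LinearMap.eqLocus
    (𝒜.anchor (φ q) ∘ₗ LinearMap.fst ℝ (A (φ q)) (TangentSpace 𝓘(ℝ, EQ) q))
    ((mfderiv 𝓘(ℝ, EQ) 𝓘(ℝ, E) φ q).toLinearMap ∘ₗ
      LinearMap.snd ℝ (A (φ q)) (TangentSpace 𝓘(ℝ, EQ) q))

/-- The section `(α, X)` of `φ⋆A` is smooth on `U`: the component `α` is a smooth section along `φ`
and the component `X` is a smooth vector field. -/
def IsSmoothPullbackSection (𝒜 : LieAlgebroid E F A) (φ : Q → M)
    (s : ∀ q, 𝒜.pullbackFiber (EQ := EQ) φ q) (U : Set Q) : Prop :=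
  ContMDiffOn 𝓘(ℝ, EQ) (𝓘(ℝ, E).prod 𝓘(ℝ, F)) ∞
      (fun q => (⟨φ q, (s q).1.1⟩ : TotalSpace F A)) U ∧
    ContMDiffOn 𝓘(ℝ, EQ) (𝓘(ℝ, EQ).prod 𝓘(ℝ, EQ)) ∞
      (fun q => (⟨q, (s q).1.2⟩ : TangentBundle 𝓘(ℝ, EQ) Q)) U

/-- `w` is the value at `q` of the bracket of the sections `s = (α, X)` and `t = (β, Y)` of `φ⋆A`.
If `α = ∑ fᵢ φ^*aᵢ` and `β = ∑ gⱼ φ^*bⱼ` near `q`, with `aᵢ, bⱼ ∈ Γ(A)` and `fᵢ, gⱼ` smooth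
functions, then
`[s, t] = (∑ fᵢ gⱼ φ^*[aᵢ, bⱼ] + ∑ X(gⱼ) φ^*bⱼ - ∑ Y(fᵢ) φ^*aᵢ, [X, Y])`. -/
def HasPullbackBracketAt (𝒜 : LieAlgebroid E F A) (φ : Q → M)
    (s t : ∀ q, 𝒜.pullbackFiber (EQ := EQ) φ q) (q : Q)
    (w : 𝒜.pullbackFiber (EQ := EQ) φ q) : Prop :=
  ∃ (m n : ℕ) (f : Fin m → Q → ℝ) (a : Fin m → Cₛ^∞⟮𝓘(ℝ, E); F, A⟯)
    (g : Fin n → Q → ℝ) (b : Fin n → Cₛ^∞⟮𝓘(ℝ, E); F, A⟯), ∃ W ∈ 𝓝 q,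
    (∀ i, ContMDiffOn 𝓘(ℝ, EQ) 𝓘(ℝ, ℝ) ∞ (f i) W) ∧
    (∀ j, ContMDiffOn 𝓘(ℝ, EQ) 𝓘(ℝ, ℝ) ∞ (g j) W) ∧
    (∀ p ∈ W, (s p).1.1 = ∑ i, f i p • a i (φ p)) ∧
    (∀ p ∈ W, (t p).1.1 = ∑ j, g j p • b j (φ p)) ∧
    w.1.1 = ∑ i, ∑ j, (f i q * g j q) • 𝒜.bracket (a i) (b j) (φ q)
      + ∑ j, mvfderiv 𝓘(ℝ, EQ) (g j) q (s q).1.2 • b j (φ q)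
      - ∑ i, mvfderiv 𝓘(ℝ, EQ) (f i) q (t q).1.2 • a i (φ q) ∧
    w.1.2 = VectorField.mlieBracket 𝓘(ℝ, EQ) (fun p => (s p).1.2) (fun p => (t p).1.2) q

end Pullback

section Isomorphism

variable
  {E₁ : Type*} [NormedAddCommGroup E₁] [NormedSpace ℝ E₁]
  {M₁ : Type*} [TopologicalSpace M₁] [ChartedSpace E₁ M₁] [IsManifold 𝓘(ℝ, E₁) ∞ M₁]
  {F₁ : Type*} [NormedAddCommGroup F₁] [NormedSpace ℝ F₁]
  {A₁ : M₁ → Type*} [TopologicalSpace (TotalSpace F₁ A₁)]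
  [∀ x, AddCommGroup (A₁ x)] [∀ x, Module ℝ (A₁ x)] [∀ x, TopologicalSpace (A₁ x)]
  [FiberBundle F₁ A₁] [VectorBundle ℝ F₁ A₁]
  {E₂ : Type*} [NormedAddCommGroup E₂] [NormedSpace ℝ E₂]
  {M₂ : Type*} [TopologicalSpace M₂] [ChartedSpace E₂ M₂] [IsManifold 𝓘(ℝ, E₂) ∞ M₂]
  {F₂ : Type*} [NormedAddCommGroup F₂] [NormedSpace ℝ F₂]
  {A₂ : M₂ → Type*} [TopologicalSpace (TotalSpace F₂ A₂)]
  [∀ x, AddCommGroup (A₂ x)] [∀ x, Module ℝ (A₂ x)] [∀ x, TopologicalSpace (A₂ x)]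
  [FiberBundle F₂ A₂] [VectorBundle ℝ F₂ A₂]

section

variable
  {EQ₁ : Type*} [NormedAddCommGroup EQ₁] [NormedSpace ℝ EQ₁]
  {Q₁ : Type*} [TopologicalSpace Q₁] [ChartedSpace EQ₁ Q₁] [IsManifold 𝓘(ℝ, EQ₁) ∞ Q₁]
  {EQ₂ : Type*} [NormedAddCommGroup EQ₂] [NormedSpace ℝ EQ₂]
  {Q₂ : Type*} [TopologicalSpace Q₂] [ChartedSpace EQ₂ Q₂] [IsManifold 𝓘(ℝ, EQ₂) ∞ Q₂]

/-- `Ψ` is an isomorphism of Lie algebroids `φ₁⋆A₁|_U → φ₂⋆A₂|_V` covering the diffeomorphism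
`ψ : U → V` between the open sets `U = ψ.source ⊆ Q₁` and `V = ψ.target ⊆ Q₂`: it is fibrewise
linear and bijective, it is compatible with the anchors `(α, X) ↦ X`, smooth sections over `U`
correspond to smooth sections over `V` (that is, `Ψ` is a diffeomorphism), and brackets of smooth
sections correspond to each other. The values of `Ψ` outside `U` are irrelevant. -/
structure IsPullbackIso (𝒜₁ : LieAlgebroid E₁ F₁ A₁) (φ₁ : Q₁ → M₁)
    (𝒜₂ : LieAlgebroid E₂ F₂ A₂) (φ₂ : Q₂ → M₂) (ψ : OpenPartialHomeomorph Q₁ Q₂)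
    (Ψ : ∀ q : Q₁, 𝒜₁.pullbackFiber (EQ := EQ₁) φ₁ q →ₗ[ℝ]
      𝒜₂.pullbackFiber (EQ := EQ₂) φ₂ (ψ q)) : Prop where
  contMDiffOn : ContMDiffOn 𝓘(ℝ, EQ₁) 𝓘(ℝ, EQ₂) ∞ ψ ψ.source
  contMDiffOn_symm : ContMDiffOn 𝓘(ℝ, EQ₂) 𝓘(ℝ, EQ₁) ∞ ψ.symm ψ.target
  bijective : ∀ q ∈ ψ.source, Function.Bijective (Ψ q)
  anchor : ∀ q ∈ ψ.source, ∀ v, (Ψ q v).1.2 = mfderiv 𝓘(ℝ, EQ₁) 𝓘(ℝ, EQ₂) ψ q v.1.2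
  smooth_iff : ∀ (s : ∀ q, 𝒜₁.pullbackFiber (EQ := EQ₁) φ₁ q)
    (s' : ∀ q, 𝒜₂.pullbackFiber (EQ := EQ₂) φ₂ q),
    (∀ q ∈ ψ.source, s' (ψ q) = Ψ q (s q)) →
    (𝒜₁.IsSmoothPullbackSection φ₁ s ψ.source ↔ 𝒜₂.IsSmoothPullbackSection φ₂ s' ψ.target)
  bracket_iff : ∀ (s t : ∀ q, 𝒜₁.pullbackFiber (EQ := EQ₁) φ₁ q)
    (s' t' : ∀ q, 𝒜₂.pullbackFiber (EQ := EQ₂) φ₂ q),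
    (∀ q ∈ ψ.source, s' (ψ q) = Ψ q (s q)) → (∀ q ∈ ψ.source, t' (ψ q) = Ψ q (t q)) →
    𝒜₁.IsSmoothPullbackSection φ₁ s ψ.source → 𝒜₁.IsSmoothPullbackSection φ₁ t ψ.source →
    ∀ q ∈ ψ.source, ∀ w, 𝒜₁.HasPullbackBracketAt φ₁ s t q w ↔
      𝒜₂.HasPullbackBracketAt φ₂ s' t' (ψ q) (Ψ q w)

/-- The germs at `q₁` of `φ₁⋆A₁` and at `q₂` of `φ₂⋆A₂` are isomorphic: there is an isomorphism of
Lie algebroids between their restrictions to open neighbourhoods of `q₁` and `q₂`, which covers a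
diffeomorphism sending `q₁` to `q₂`. -/
def PullbackGermsIsomorphic (𝒜₁ : LieAlgebroid E₁ F₁ A₁) (φ₁ : Q₁ → M₁) (q₁ : Q₁)
    (𝒜₂ : LieAlgebroid E₂ F₂ A₂) (φ₂ : Q₂ → M₂) (q₂ : Q₂) : Prop :=
  ∃ ψ : OpenPartialHomeomorph Q₁ Q₂, q₁ ∈ ψ.source ∧ ψ q₁ = q₂ ∧
    ∃ Ψ : ∀ q : Q₁, 𝒜₁.pullbackFiber (EQ := EQ₁) φ₁ q →ₗ[ℝ]
      𝒜₂.pullbackFiber (EQ := EQ₂) φ₂ (ψ q), IsPullbackIso 𝒜₁ φ₁ 𝒜₂ φ₂ ψ Ψ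

end

/-- A Morita equivalence `M₁ ←φ₁- Q -φ₂→ M₂` between `A₁ → M₁` and `A₂ → M₂`: surjective
submersions with simply connected fibres such that `φ₁⋆A₁` and `φ₂⋆A₂` are isomorphic Lie
algebroids over `Q` (by an isomorphism covering the identity of `Q`). -/
structure IsMoritaEquivalence (𝒜₁ : LieAlgebroid E₁ F₁ A₁) (𝒜₂ : LieAlgebroid E₂ F₂ A₂)
    {EQ : Type*} [NormedAddCommGroup EQ] [NormedSpace ℝ EQ]
    {Q : Type*} [TopologicalSpace Q] [ChartedSpace EQ Q] [IsManifold 𝓘(ℝ, EQ) ∞ Q]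
    (φ₁ : Q → M₁) (φ₂ : Q → M₂) : Prop where
  surjective₁ : Function.Surjective φ₁
  surjective₂ : Function.Surjective φ₂
  isSubmersion₁ : Manifold.IsSubmersion 𝓘(ℝ, EQ) 𝓘(ℝ, E₁) ∞ φ₁
  isSubmersion₂ : Manifold.IsSubmersion 𝓘(ℝ, EQ) 𝓘(ℝ, E₂) ∞ φ₂
  simplyConnected₁ : ∀ x : M₁, SimplyConnectedSpace (φ₁ ⁻¹' {x})
  simplyConnected₂ : ∀ x : M₂, SimplyConnectedSpace (φ₂ ⁻¹' {x})
  isomorphic : ∃ Ψ : ∀ q : Q, 𝒜₁.pullbackFiber (EQ := EQ) φ₁ q →ₗ[ℝ]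
      𝒜₂.pullbackFiber (EQ := EQ) φ₂ (OpenPartialHomeomorph.refl Q q),
    IsPullbackIso 𝒜₁ φ₁ 𝒜₂ φ₂ (OpenPartialHomeomorph.refl Q) Ψ

end Isomorphism

end LieAlgebroid

end LieAlgebroidTheory

/-! The proof attaches to each point `z` of a Lie algebroid `A` a transverse model. Near `z`, `A` is
the pull-back along a submersion `p` of a Lie algebroid on a trivial bundle over an open subset of a
vector space (`LocalModel`), and `p` can be chosen so that the anchor of the model vanishes at `y =
p z` (`LieAlgebroid.exists_hasNF`). This is the part of the splitting theorem that is needed. Where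
the anchor of a model is nonzero, flow along a constant section, use the flow and a frame parallel
along it as new coordinates, and divide out the time direction. The dimension of the base drops, and
induction applies. `HasNF C y z` records that `C`, at `y`, is a model for `A` at `z`.

Models are compared through slices. Suppose a pull-back algebroid over `Q` is itself pulled back
from `C₀` by `u₀` and from `C` by `u`, both submersive at `q₀`, and the anchor of `C` vanishes at `u
q₀`. A vector killed by `du₀` is the anchor of an element that is zero in `C₀`, and every anchor is
killed by `du` at `q₀`. So `du` factors through `du₀` there, and restricting `u` to a slice for `u₀`
gives a submersive cartesian morphism `C₀ → C` (`IsPNF.exists_isHom`). Such morphisms compose with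
normal forms (`HasNF.comp_isHom`), so models can be carried from one place to another.

Along the leaves: the `p`-image of an `A`-path solves `x' = ρ(x) g`, so it stays at a zero of `ρ`.
The path therefore moves inside a fibre of `p`, over which the model is the same
(`HasNF.of_orbitSetoid`). Across the equivalence: a normal form of `A₁` pulls back to `Q`, becomes
one of `φ₂⋆A₂` through the isomorphism, and descends to `M₂` by comparison with a chart there
(`IsIsoOverId.hasNF`).

For the leaves, a vector tangent to a fibre of `p ∘ φ₁` lifts to an element of the pull-back that is
zero in the model, so `φ₂` maps these fibres locally into leaves of `A₂`. Connectedness of the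
fibres of `φ₁`, openness of `φ₁` and the invariance of fibres under `A₁`-paths turn the orbit
relation of `A₁` into that of `A₂`. By symmetry this is an equivalence
(`IsMoritaEquivalence.orbitSetoid_iff`), which gives the bijection.

For the transversals, the kernel of `dp` at `z` is the tangent space of the leaf, so `p` restricts
to a local diffeomorphism on a transversal and identifies the transverse algebroid with `C` near `y`
(`IsTransversal.exists_isPNF`). Transversals to corresponding leaves share `C` and `y`, hence are
isomorphic near their base points (`IsPNF.pullbackGermsIsomorphic`). -/

/-! ### Calculus on spaces of curves, and the smooth inverse function theorem. -/

noncomputable section SmoothFlows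

attribute [-instance]
  Bundle.instNormedAddCommGroupOfRiemannianBundleOfIsTopologicalAddGroupOfContinuousConstSMulReal

universe u

variable {α : Type*} [TopologicalSpace α] [CompactSpace α]
  {E : Type u} [NormedAddCommGroup E] [NormedSpace ℝ E]

/-- Pointwise application of a continuous family of operators to a continuous function. -/
def ContinuousMap.applyCLM {F G : Type*} [NormedAddCommGroup F] [NormedSpace ℝ F]
    [NormedAddCommGroup G] [NormedSpace ℝ G] (B : G →L[ℝ] E →L[ℝ] F) :
    C(α, G) →L[ℝ] C(α, E) →L[ℝ] C(α, F) :=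
  LinearMap.mkContinuous₂
    (LinearMap.mk₂ ℝ (fun (T : C(α, G)) (h : C(α, E)) =>
        (⟨fun t => B (T t) (h t), (B.continuous.comp T.continuous).clm_apply h.continuous⟩ :
          C(α, F)))
      (fun _ _ _ => by ext; simp) (fun _ _ _ => by ext; simp)
      (fun _ _ _ => by ext; simp) (fun _ _ _ => by ext; simp)) ‖B‖
    (fun T h => by
      refine (ContinuousMap.norm_le _ (by positivity)).2 fun t => ?_
      refine (B.le_opNorm₂ (T t) (h t)).trans ?_
      gcongr
      · exact T.norm_coe_le_norm t
      · exact h.norm_coe_le_norm t)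

/-- The mean value inequality is applied at each parameter. The estimate is uniform because `γ ↦ f'
∘ γ` is continuous for the sup norm, which is where compactness of `α` enters. -/
theorem ContinuousMap.hasFDerivAt_comp {F G : Type*} [NormedAddCommGroup F] [NormedSpace ℝ F]
    [NormedAddCommGroup G] [NormedSpace ℝ G] (B : G →L[ℝ] E →L[ℝ] F)
    (f : C(E, F)) (f' : C(E, G)) (hf : ∀ x, HasFDerivAt f (B (f' x)) x) (γ : C(α, E)) :
    HasFDerivAt (fun γ : C(α, E) => f.comp γ) (ContinuousMap.applyCLM B (f'.comp γ)) γ := by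
  rw [hasFDerivAt_iff_isLittleO, Asymptotics.isLittleO_iff]
  intro ε hε
  have hc : ContinuousAt (fun γ : C(α, E) => f'.comp γ) γ :=
    (ContinuousMap.continuous_postcomp f').continuousAt
  obtain ⟨δ, hδ, hd⟩ := Metric.continuousAt_iff.1 hc (ε / (‖B‖ + 1)) (by positivity)
  filter_upwards [Metric.ball_mem_nhds γ hδ] with γ' hγ'
  refine (ContinuousMap.norm_le _ (by positivity)).2 fun t => ?_
  have key : ∀ v ∈ Metric.ball (γ t) δ, ‖B (f' v) - B (f' (γ t))‖ ≤ ε := by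
    intro v hv
    -- Translating the whole curve makes it pass through `v` at parameter `t`, so continuity of `γ ↦
    -- f' ∘ γ` controls `f' v`.
    have h1 : dist (γ + ContinuousMap.const α (v - γ t)) γ < δ := by
      rw [dist_eq_norm, add_sub_cancel_left, ContinuousMap.norm_lt_iff _ hδ]
      intro _
      simpa [dist_eq_norm] using hv
    have h2 := (ContinuousMap.dist_apply_le_dist t).trans_lt (hd h1)
    have h3 : ‖f' v - f' (γ t)‖ ≤ ε / (‖B‖ + 1) := by simpa [dist_eq_norm] using h2.le
    rw [← map_sub]
    refine (B.le_opNorm _).trans ((mul_le_mul_of_nonneg_left h3 (norm_nonneg _)).trans ?_)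
    rw [← mul_div_assoc, div_le_iff₀ (by positivity)]
    nlinarith [norm_nonneg B]
  have hγt : γ' t ∈ Metric.ball (γ t) δ :=
    (ContinuousMap.dist_apply_le_dist t).trans_lt hγ'
  have := (convex_ball (γ t) δ).norm_image_sub_le_of_norm_hasFDerivWithin_le'
    (fun x _ => (hf x).hasFDerivWithinAt) key (Metric.mem_ball_self hδ) hγt
  refine this.trans ?_
  exact mul_le_mul_of_nonneg_left ((γ' - γ).norm_coe_le_norm t) hε.le

theorem ContinuousMap.contDiff_comp_succ {F G : Type*} [NormedAddCommGroup F]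
    [NormedSpace ℝ F] [NormedAddCommGroup G] [NormedSpace ℝ G] (B : G →L[ℝ] E →L[ℝ] F) {n : ℕ}
    (f : C(E, F)) (f' : C(E, G)) (hf : ∀ x, HasFDerivAt f (B (f' x)) x)
    (h : ContDiff ℝ n (fun γ : C(α, E) => f'.comp γ)) :
    ContDiff ℝ (n + 1) (fun γ : C(α, E) => f.comp γ) :=
  contDiff_succ_iff_hasFDerivAt.2 ⟨_, (ContinuousMap.applyCLM (α := α) B).contDiff.comp h,
    fun γ => ContinuousMap.hasFDerivAt_comp B f f' hf γ⟩

/-- The induction quantifies over the target because the derivative takes values in `E →L[ℝ] F`;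
sharing one universe between `E` and `F` keeps that space in range of the induction hypothesis. -/
theorem ContinuousMap.contDiff_comp_nat (n : ℕ) : ∀ {F : Type u} [NormedAddCommGroup F]
    [NormedSpace ℝ F] (f : E → F) (hf : ContDiff ℝ n f),
    ContDiff ℝ n (fun γ : C(α, E) => (⟨f, hf.continuous⟩ : C(E, F)).comp γ) := by
  induction n with
  | zero =>
    intro F _ _ f hf
    exact contDiff_zero.2 (ContinuousMap.continuous_postcomp _)
  | succ n ih =>
    intro F _ _ f hf
    obtain ⟨f', hf', hd⟩ := contDiff_succ_iff_hasFDerivAt.1 (by exact_mod_cast hf)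
    exact ContinuousMap.contDiff_comp_succ (ContinuousLinearMap.id ℝ _) _ _ hd (ih f' hf')

theorem ContinuousMap.contDiff_comp {F : Type u} [NormedAddCommGroup F] [NormedSpace ℝ F]
    (f : C(E, F)) (hf : ContDiff ℝ ∞ f) : ContDiff ℝ ∞ (fun γ : C(α, E) => f.comp γ) :=
  contDiff_infty.2 fun n => ContinuousMap.contDiff_comp_nat n f (contDiff_infty.1 hf n)

/-- The smooth inverse function theorem. -/
theorem exists_openPartialHomeomorph_of_hasFDerivAt {E F : Type*} [NormedAddCommGroup E]
    [NormedSpace ℝ E] [CompleteSpace E] [NormedAddCommGroup F] [NormedSpace ℝ F]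
    {f : E → F} {U : Set E} (hU : IsOpen U) (hf : ContDiffOn ℝ ∞ f U) {x : E} (hx : x ∈ U)
    (f' : E ≃L[ℝ] F) (hf' : HasFDerivAt f (f' : E →L[ℝ] F) x) :
    ∃ e : OpenPartialHomeomorph E F, (∀ y, e y = f y) ∧ x ∈ e.source ∧ e.source ⊆ U ∧
      ContDiffOn ℝ ∞ e.symm e.target ∧
      ∀ y ∈ e.source, ∃ T : E ≃L[ℝ] F, HasFDerivAt f (T : E →L[ℝ] F) y := by
  have hfx : ContDiffAt ℝ ∞ f x := hf.contDiffAt (hU.mem_nhds hx)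
  have hne : (∞ : WithTop ℕ∞) ≠ 0 := by simp
  let e₀ := hfx.toOpenPartialHomeomorph f hf' hne
  -- Invertibility of the derivative is an open condition. The source is cut down to where it holds,
  -- so that the inverse is smooth on the whole target.
  have hcont : ContinuousAt (fderiv ℝ f) x :=
    (hfx.fderiv_right (m := 0) (by simp)).continuousAt
  have hN : (fderiv ℝ f) ⁻¹' (range ((↑) : (E ≃L[ℝ] F) → E →L[ℝ] F)) ∈ 𝓝 x := by
    apply hcont
    rw [hf'.fderiv]
    exact ContinuousLinearEquiv.nhds f'
  obtain ⟨O, hO, hOo, hxO⟩ := mem_nhds_iff.1 (Filter.inter_mem hN (hU.mem_nhds hx))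
  let e := e₀.restrOpen O hOo
  have hsub : e.source ⊆ O := fun y hy => hy.2
  have hder : ∀ y ∈ e.source, ∃ T : E ≃L[ℝ] F, HasFDerivAt f (T : E →L[ℝ] F) y := by
    intro y hy
    obtain ⟨T, hT⟩ := (hO (hsub hy)).1
    refine ⟨T, ?_⟩
    have hd : DifferentiableAt ℝ f y :=
      (hf.contDiffAt (hU.mem_nhds (hO (hsub hy)).2)).differentiableAt hne
    have := hd.hasFDerivAt
    rwa [← hT] at this
  refine ⟨e, fun y => rfl, ⟨hfx.mem_toOpenPartialHomeomorph_source hf' hne, hxO⟩,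
    fun y hy => (hO (hsub hy)).2, ?_, hder⟩
  intro y hy
  have hs := e.map_target hy
  obtain ⟨T, hT⟩ := hder _ hs
  exact (e.contDiffAt_symm hy hT
    (hf.contDiffAt (hU.mem_nhds (hO (hsub hs)).2))).contDiffWithinAt

/-- Integration from `0` as an operator on `C([-1, 1], E)`. -/
def integralCLM [CompleteSpace E] : C(Icc (-1 : ℝ) 1, E) →L[ℝ] C(Icc (-1 : ℝ) 1, E) :=
  LinearMap.mkContinuous
    { toFun := fun γ => ⟨fun s => ∫ τ in (0 : ℝ)..s, γ (projIcc (-1) 1 (neg_le_self zero_le_one) τ),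
        (intervalIntegral.continuous_primitive (fun a b =>
          (γ.continuous.comp (continuous_projIcc (h := neg_le_self zero_le_one))).intervalIntegrable a b) 0).comp
          continuous_subtype_val⟩
      map_add' := fun γ γ' => by
        ext s
        exact intervalIntegral.integral_add
          ((γ.continuous.comp (continuous_projIcc (h := neg_le_self zero_le_one))).intervalIntegrable _ _)
          ((γ'.continuous.comp (continuous_projIcc (h := neg_le_self zero_le_one))).intervalIntegrable _ _)
      map_smul' := fun r γ => by
        ext s
        exact intervalIntegral.integral_smul r _ } 1
    (fun γ => by
      refine (ContinuousMap.norm_le _ (by positivity)).2 fun s => ?_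
      have h := intervalIntegral.norm_integral_le_of_norm_le_const (a := (0 : ℝ)) (b := s)
        (f := fun τ => γ (projIcc (-1) 1 (neg_le_self zero_le_one) τ)) (C := ‖γ‖)
        (fun τ _ => γ.norm_coe_le_norm _)
      refine h.trans ?_
      rw [mul_comm]
      refine mul_le_mul_of_nonneg_right ?_ (norm_nonneg _)
      rw [sub_zero]
      exact abs_le.2 s.2)

theorem integralCLM_apply [CompleteSpace E] (γ : C(Icc (-1 : ℝ) 1, E)) (s : Icc (-1 : ℝ) 1) :
    integralCLM γ s = ∫ τ in (0 : ℝ)..s, γ (projIcc (-1) 1 (neg_le_self zero_le_one) τ) := rfl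

/-- Constant functions as an operator. -/
def constCLM : E →L[ℝ] C(Icc (-1 : ℝ) 1, E) :=
  LinearMap.mkContinuous
    { toFun := fun x => ContinuousMap.const _ x
      map_add' := fun _ _ => rfl
      map_smul' := fun _ _ => rfl } 1
    (fun x => (ContinuousMap.norm_le _ (by positivity)).2 fun s => (one_mul ‖x‖).ge)

theorem constCLM_apply (x : E) (s : Icc (-1 : ℝ) 1) : constCLM x s = x := rfl

end SmoothFlows

/-! ### Smooth local flows of vector fields. -/

noncomputable section SmoothFlows

attribute [-instance]
  Bundle.instNormedAddCommGroupOfRiemannianBundleOfIsTopologicalAddGroupOfContinuousConstSMulReal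

universe u

theorem continuous_projIcc_curve {E : Type u} [NormedAddCommGroup E] (γ : C(Icc (-1 : ℝ) 1, E)) :
    Continuous fun s : ℝ => γ (projIcc (-1) 1 (neg_le_self zero_le_one) s) :=
  γ.continuous.comp continuous_projIcc

variable {E : Type u} [NormedAddCommGroup E] [NormedSpace ℝ E] [CompleteSpace E]

/-- The hypothesis is the Picard equation on the fixed interval `[-1, 1]`, with time absorbed into
the speed `t`. This keeps all solutions in one Banach space, with `t` as a parameter. -/
theorem hasDerivAt_of_eq_integralCLM {f : C(E, E)} {x : E} {t : ℝ} {γ : C(Icc (-1 : ℝ) 1, E)}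
    (hγ : γ = constCLM x + t • integralCLM (f.comp γ)) {s : ℝ} (hs : s ∈ Ioo (-1 : ℝ) 1) :
    HasDerivAt (fun s : ℝ => γ (projIcc (-1) 1 (neg_le_self zero_le_one) s))
      (t • f (γ (projIcc (-1) 1 (neg_le_self zero_le_one) s))) s := by
  have hcont : Continuous fun s : ℝ => f (γ (projIcc (-1) 1 (neg_le_self zero_le_one) s)) :=
    f.continuous.comp (continuous_projIcc_curve γ)
  have h1 : HasDerivAt (fun s : ℝ => x + t • ∫ τ in (0 : ℝ)..s,
      f (γ (projIcc (-1) 1 (neg_le_self zero_le_one) τ)))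
      (t • f (γ (projIcc (-1) 1 (neg_le_self zero_le_one) s))) s :=
    ((hcont.integral_hasStrictDerivAt 0 s).hasDerivAt.const_smul t).const_add x
  refine h1.congr_of_eventuallyEq ?_
  filter_upwards [isOpen_Ioo.mem_nhds hs] with r hr
  have := congrArg (fun δ : C(Icc (-1 : ℝ) 1, E) => δ ⟨r, hr.1.le, hr.2.le⟩) hγ
  rw [projIcc_of_mem _ ⟨hr.1.le, hr.2.le⟩]
  exact this

theorem eq_of_eq_integralCLM {f : C(E, E)} {x : E} {t : ℝ} {γ : C(Icc (-1 : ℝ) 1, E)}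
    (hγ : γ = constCLM x + t • integralCLM (f.comp γ)) :
    γ (projIcc (-1) 1 (neg_le_self zero_le_one) 0) = x := by
  have h0 : (0 : ℝ) ∈ Icc (-1 : ℝ) 1 := by norm_num
  have := congrArg (fun δ : C(Icc (-1 : ℝ) 1, E) => δ ⟨0, h0⟩) hγ
  rw [projIcc_of_mem _ h0]
  simpa [constCLM_apply, integralCLM_apply] using this

/-- Solutions of `γ' = t f(γ)` on `[-1, 1]` with the same initial value are related by a change
of the speed `t`. -/
theorem eq_of_eq_integralCLM_of_lt {f : C(E, E)} {K : NNReal} (hf : LipschitzWith K f) {x : E}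
    {r T : ℝ} {γ δ : C(Icc (-1 : ℝ) 1, E)} (hrT : |r| < T)
    (hγ : γ = constCLM x + r • integralCLM (f.comp γ))
    (hδ : δ = constCLM x + T • integralCLM (f.comp δ)) :
    γ (projIcc (-1) 1 (neg_le_self zero_le_one) 1) =
      δ (projIcc (-1) 1 (neg_le_self zero_le_one) (r / T)) := by
  have hT : 0 < T := (abs_nonneg r).trans_lt hrT
  have hlt : |r / T| < 1 := by rwa [abs_div, abs_of_pos hT, div_lt_one hT]
  have hmem : ∀ s ∈ Ioo (-1 : ℝ) 1, s * (r / T) ∈ Ioo (-1 : ℝ) 1 := by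
    intro s hs
    have h1 : |s| < 1 := abs_lt.2 hs
    refine abs_lt.1 ?_
    rw [abs_mul]
    nlinarith [abs_nonneg s, abs_nonneg (r / T)]
  have hlip : LipschitzWith (Real.nnabs r * K) (fun y => r • f y) := by
    refine LipschitzWith.of_dist_le_mul fun y z => ?_
    rw [dist_smul₀, NNReal.coe_mul, mul_assoc]
    exact mul_le_mul_of_nonneg_left (hf.dist_le_mul y z) (norm_nonneg r)
  have key := ODE_solution_unique_of_mem_Icc (E := E) (v := fun _ y => r • f y)
    (s := fun _ => univ) (K := Real.nnabs r * K) (a := -1) (b := 1) (t₀ := 0)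
    (f := fun s : ℝ => γ (projIcc (-1) 1 (neg_le_self zero_le_one) s))
    (g := fun s : ℝ => δ (projIcc (-1) 1 (neg_le_self zero_le_one) (s * (r / T))))
    (fun _ _ => hlip.lipschitzOnWith) (by norm_num) (continuous_projIcc_curve γ).continuousOn
    (fun s hs => hasDerivAt_of_eq_integralCLM hγ hs) (fun _ _ => mem_univ _)
    ((continuous_projIcc_curve δ).comp (continuous_mul_const _)).continuousOn
    (fun s hs => by
      have h := (hasDerivAt_of_eq_integralCLM hδ (hmem s hs)).scomp s
        ((hasDerivAt_id s).mul_const (r / T))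
      convert! h using 1
      rw [smul_smul]
      congr 1
      field_simp) (fun _ _ => mem_univ _)
    (by
      simp only [zero_mul]
      rw [eq_of_eq_integralCLM hγ, eq_of_eq_integralCLM hδ])
  simpa using key (right_mem_Icc.2 (by norm_num : (-1 : ℝ) ≤ 1))

/-- The Picard equation is solved by the inverse function theorem in `ℝ × E × C([-1, 1], E)`, so the
solution depends smoothly on the speed and the initial value. -/
theorem exists_contDiffOn_flow_of_lipschitzWith {f : C(E, E)} (hf : ContDiff ℝ ∞ f) {K : NNReal}
    (hK : LipschitzWith K f) (x₀ : E) :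
    ∃ ε > 0, ∃ V : Set E, IsOpen V ∧ x₀ ∈ V ∧ ∃ Φ : ℝ × E → E,
      ContDiffOn ℝ ∞ Φ (Ioo (-ε) ε ×ˢ V) ∧ ∀ x ∈ V, Φ (0, x) = x ∧
        ∀ t ∈ Ioo (-ε) ε, HasDerivAt (fun s => Φ (s, x)) (f (Φ (t, x))) t := by
  let X := C(Icc (-1 : ℝ) 1, E)
  let N : X → X := fun γ => f.comp γ
  have hN : ContDiff ℝ ∞ N := ContinuousMap.contDiff_comp f hf
  let J : X →L[ℝ] X := integralCLM
  -- Solutions are the points where the third component vanishes. At time `0` the nonlinear term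
  -- contributes to the derivative only through the speed, so the derivative is unipotent, with the
  -- explicit inverse given in `T`.
  let G : ℝ × E × X → ℝ × E × X :=
    fun p => (p.1, p.2.1, p.2.2 - constCLM p.2.1 - p.1 • J (N p.2.2))
  have hJN : ContDiff ℝ ∞ fun p : ℝ × E × X => J (N p.2.2) :=
    J.contDiff.comp (hN.comp (contDiff_snd.comp contDiff_snd))
  have hG : ContDiff ℝ ∞ G := by
    refine contDiff_fst.prodMk ((contDiff_fst.comp contDiff_snd).prodMk ?_)
    exact ((contDiff_snd.comp contDiff_snd).sub
      (constCLM.contDiff.comp (contDiff_fst.comp contDiff_snd))).sub (contDiff_fst.smul hJN)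
  let p₀ : ℝ × E × X := (0, x₀, constCLM x₀)
  let w : X := J (N (constCLM x₀))
  let π₁ : ℝ × E × X →L[ℝ] ℝ := .fst ℝ ℝ (E × X)
  let π₂ : ℝ × E × X →L[ℝ] E := (ContinuousLinearMap.fst ℝ E X).comp (.snd ℝ ℝ (E × X))
  let π₃ : ℝ × E × X →L[ℝ] X := (ContinuousLinearMap.snd ℝ E X).comp (.snd ℝ ℝ (E × X))
  let T : (ℝ × E × X) ≃L[ℝ] (ℝ × E × X) := ContinuousLinearEquiv.equivOfInverse
    (π₁.prod (π₂.prod (π₃ - constCLM.comp π₂ - π₁.smulRight w)))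
    (π₁.prod (π₂.prod (π₃ + constCLM.comp π₂ + π₁.smulRight w)))
    (fun p => by
      refine Prod.ext rfl (Prod.ext rfl ?_)
      change (p.2.2 - constCLM p.2.1 - p.1 • w) + constCLM p.2.1 + p.1 • w = p.2.2
      abel)
    (fun p => by
      refine Prod.ext rfl (Prod.ext rfl ?_)
      change (p.2.2 + constCLM p.2.1 + p.1 • w) - constCLM p.2.1 - p.1 • w = p.2.2
      abel)
  have hT : HasFDerivAt G (T : (ℝ × E × X) →L[ℝ] (ℝ × E × X)) p₀ := by
    refine (π₁.hasFDerivAt).prodMk ((π₂.hasFDerivAt).prodMk ?_)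
    refine ((π₃.hasFDerivAt).sub ((constCLM.comp π₂).hasFDerivAt)).sub ?_
    have hd := ((hJN.differentiable (by simp)) p₀).hasFDerivAt
    have := (π₁.hasFDerivAt (x := p₀)).smul hd
    refine this.congr_fderiv ?_
    refine ContinuousLinearMap.ext fun p => ?_
    change (0 : ℝ) • _ + p.1 • J (N (constCLM x₀)) = p.1 • w
    rw [zero_smul, zero_add]
  obtain ⟨e, he, hp₀, -, hsymm, -⟩ := exists_openPartialHomeomorph_of_hasFDerivAt isOpen_univ
    hG.contDiffOn (mem_univ p₀) T hT
  have hep : e p₀ = (0, x₀, 0) := by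
    rw [he]
    refine Prod.ext rfl (Prod.ext rfl ?_)
    change constCLM x₀ - constCLM x₀ - (0 : ℝ) • _ = 0
    simp
  let j : ℝ × E → ℝ × E × X := fun p => (p.1, p.2, 0)
  have hj : ContDiff ℝ ∞ j := contDiff_fst.prodMk (contDiff_snd.prodMk contDiff_const)
  have hnhds : j ⁻¹' e.target ∈ 𝓝 ((0 : ℝ), x₀) := by
    refine hj.continuous.continuousAt.preimage_mem_nhds (e.open_target.mem_nhds ?_)
    change ((0 : ℝ), x₀, (0 : X)) ∈ e.target
    rw [← hep]
    exact e.map_source hp₀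
  obtain ⟨S, hS, V, hV, hSV⟩ := mem_nhds_prod_iff.1 hnhds
  obtain ⟨ε, hε, hεS⟩ := Metric.mem_nhds_iff.1 hS
  obtain ⟨V', hV'V, hV'o, hx₀V'⟩ := mem_nhds_iff.1 hV
  rw [Real.ball_eq_Ioo, zero_sub, zero_add] at hεS
  have htar : ∀ p ∈ Ioo (-ε) ε ×ˢ V', j p ∈ e.target :=
    fun p hp => hSV ⟨hεS hp.1, hV'V hp.2⟩
  let Γ : ℝ × E → X := fun p => (e.symm (j p)).2.2
  have hΓ : ∀ t ∈ Ioo (-ε) ε, ∀ x ∈ V',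
      Γ (t, x) = constCLM x + t • integralCLM (f.comp (Γ (t, x))) := by
    intro t ht x hx
    have h := e.right_inv (htar (t, x) ⟨ht, hx⟩)
    rw [he] at h
    have h1 : (e.symm (j (t, x))).1 = t := congrArg Prod.fst h
    have h2 : (e.symm (j (t, x))).2.1 = x := congrArg (fun p => p.2.1) h
    have h3 : (e.symm (j (t, x))).2.2 - constCLM (e.symm (j (t, x))).2.1 -
      (e.symm (j (t, x))).1 • J (N (e.symm (j (t, x))).2.2) = 0 := congrArg (fun p => p.2.2) h
    rw [h1, h2] at h3
    rw [sub_sub, sub_eq_zero] at h3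
    exact h3
  -- The flow at time `t` is the endpoint, at parameter `1`, of the solution with speed `t`.
  let one' : Icc (-1 : ℝ) 1 := projIcc (-1) 1 (neg_le_self zero_le_one) 1
  refine ⟨ε, hε, V', hV'o, hx₀V', fun p => Γ p one', ?_, fun x hx => ⟨?_, fun t ht => ?_⟩⟩
  · have hΓc : ContDiffOn ℝ ∞ Γ (Ioo (-ε) ε ×ˢ V') :=
      (contDiff_snd.comp contDiff_snd).comp_contDiffOn
        (hsymm.comp hj.contDiffOn fun p hp => htar p hp)
    exact (ContinuousMap.evalCLM ℝ one').contDiff.comp_contDiffOn hΓc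
  · have h := hΓ 0 ⟨by linarith, hε⟩ x hx
    rw [zero_smul, add_zero] at h
    change Γ (0, x) one' = x
    rw [h, constCLM_apply]
  · have ht' : |t| < ε := abs_lt.2 ht
    -- One curve of larger speed `T` contains all flow times near `t`, at parameters `r / T`
    -- interior to `[-1, 1]`. Its own equation then gives the derivative in time.
    obtain ⟨T, htT, hTε⟩ := exists_between ht'
    have hT : 0 < T := (abs_nonneg t).trans_lt htT
    have hTm : T ∈ Ioo (-ε) ε := ⟨by linarith, hTε⟩
    have heq : ∀ r : ℝ, |r| < T → Γ (r, x) one' =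
        Γ (T, x) (projIcc (-1) 1 (neg_le_self zero_le_one) (r / T)) := fun r hr =>
      eq_of_eq_integralCLM_of_lt hK hr
        (hΓ r (abs_lt.1 (hr.trans hTε)) x hx) (hΓ T hTm x hx)
    have hmem : t / T ∈ Ioo (-1 : ℝ) 1 := by
      refine abs_lt.1 ?_
      rwa [abs_div, abs_of_pos hT, div_lt_one hT]
    have hd := (hasDerivAt_of_eq_integralCLM (hΓ T hTm x hx) hmem).scomp t
      ((hasDerivAt_id t).div_const T)
    have hd' : HasDerivAt (fun r : ℝ =>
        Γ (T, x) (projIcc (-1) 1 (neg_le_self zero_le_one) (r / T))) (f (Γ (t, x) one')) t := by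
      convert! hd using 1
      rw [heq t htT, smul_smul, one_div_mul_cancel hT.ne', one_smul]
    refine hd'.congr_of_eventuallyEq ?_
    filter_upwards [(isOpen_lt continuous_abs continuous_const).mem_nhds htT] with r hr
    exact heq r hr

/-- A smooth vector field has a smooth local flow. -/
theorem exists_contDiffOn_flow {E : Type u} [NormedAddCommGroup E] [NormedSpace ℝ E]
    [FiniteDimensional ℝ E] {f : E → E} {U : Set E} (hU : IsOpen U) (hf : ContDiffOn ℝ ∞ f U)
    {x₀ : E} (hx₀ : x₀ ∈ U) :
    ∃ ε > 0, ∃ V : Set E, IsOpen V ∧ x₀ ∈ V ∧ ∃ Φ : ℝ × E → E,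
      ContDiffOn ℝ ∞ Φ (Ioo (-ε) ε ×ˢ V) ∧ ∀ x ∈ V, Φ (0, x) = x ∧
        ∀ t ∈ Ioo (-ε) ε, Φ (t, x) ∈ U ∧
          HasDerivAt (fun s => Φ (s, x)) (f (Φ (t, x))) t := by
  have : CompleteSpace E := FiniteDimensional.complete ℝ E
  -- Multiplying by a bump function supported in `U` gives a compactly supported field, hence a
  -- globally Lipschitz one.
  let χ : ContDiffBump x₀ := by
    have h := Metric.isOpen_iff.1 hU x₀ hx₀
    exact ⟨h.choose / 3, h.choose / 2, by have := h.choose_spec.1; positivity,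
      by have := h.choose_spec.1; linarith⟩
  have hsupp : tsupport χ ⊆ U := by
    rw [χ.tsupport_eq]
    have h := Metric.isOpen_iff.1 hU x₀ hx₀
    refine (Metric.closedBall_subset_ball ?_).trans h.choose_spec.2
    change h.choose / 2 < h.choose
    have := h.choose_spec.1
    linarith
  let g : E → E := fun x => χ x • f x
  have hg : ContDiff ℝ ∞ g := by
    rw [contDiff_iff_contDiffAt]
    intro x
    by_cases hx : x ∈ tsupport χ
    · exact χ.contDiff.contDiffAt.smul (hf.contDiffAt (hU.mem_nhds (hsupp hx)))
    · have : g =ᶠ[𝓝 x] fun _ => 0 := by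
        filter_upwards [(isClosed_tsupport χ).isOpen_compl.mem_nhds hx] with y hy
        simp [g, image_eq_zero_of_notMem_tsupport hy]
      exact contDiffAt_const.congr_of_eventuallyEq this
  have hgs : HasCompactSupport g := χ.hasCompactSupport.smul_right
  obtain ⟨K, hK⟩ := hg.lipschitzWith_of_hasCompactSupport hgs (by simp)
  obtain ⟨ε, hε, V, hV, hxV, Φ, hΦ, hΦ'⟩ := exists_contDiffOn_flow_of_lipschitzWith
    (f := ⟨g, hg.continuous⟩) hg hK x₀
  have hO : IsOpen (Ioo (-ε) ε ×ˢ V) := isOpen_Ioo.prod hV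
  have h0 : ((0 : ℝ), x₀) ∈ Ioo (-ε) ε ×ˢ V := ⟨⟨by linarith, hε⟩, hxV⟩
  -- For short times trajectories stay in the ball where the bump function is `1`, so there they are
  -- trajectories of `f` itself.
  have hball : Metric.ball x₀ χ.rIn ∈ 𝓝 (Φ (0, x₀)) := by
    rw [(hΦ' x₀ hxV).1]
    exact Metric.ball_mem_nhds _ χ.rIn_pos
  have hn := (hΦ.continuousOn.continuousAt (hO.mem_nhds h0)).preimage_mem_nhds hball
  obtain ⟨S, hS, W, hW, hSW⟩ := mem_nhds_prod_iff.1 (Filter.inter_mem hn (hO.mem_nhds h0))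
  obtain ⟨δ, hδ, hδS⟩ := Metric.mem_nhds_iff.1 hS
  obtain ⟨W', hW'W, hW'o, hxW'⟩ := mem_nhds_iff.1 hW
  rw [Real.ball_eq_Ioo, zero_sub, zero_add] at hδS
  have hsub : Ioo (-δ) δ ×ˢ W' ⊆ Φ ⁻¹' Metric.ball x₀ χ.rIn ∩ Ioo (-ε) ε ×ˢ V :=
    fun p hp => hSW ⟨hδS hp.1, hW'W hp.2⟩
  have h0δ : (0 : ℝ) ∈ Ioo (-δ) δ := ⟨by linarith, hδ⟩
  refine ⟨δ, hδ, W', hW'o, hxW', Φ, hΦ.mono fun p hp => (hsub hp).2, fun x hx =>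
    ⟨(hΦ' x (@hsub (0, x) ⟨h0δ, hx⟩).2.2).1, fun t ht => ?_⟩⟩
  have hm := @hsub (t, x) ⟨ht, hx⟩
  have h1 : χ (Φ (t, x)) = 1 := χ.one_of_mem_closedBall (Metric.ball_subset_closedBall hm.1)
  refine ⟨hsupp (subset_tsupport _ ?_), ?_⟩
  · rw [Function.mem_support, h1]
    exact one_ne_zero
  · have := (hΦ' x hm.2.2).2 t hm.2.1
    change HasDerivAt _ (χ (Φ (t, x)) • f (Φ (t, x))) t at this
    rwa [h1, one_smul] at this

end SmoothFlows

/-! ### Local models, their morphisms, and changes of coordinates and frame. -/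

noncomputable section LocalModels

attribute [-instance]
  Bundle.instNormedAddCommGroupOfRiemannianBundleOfIsTopologicalAddGroupOfContinuousConstSMulReal

section

variable {E F : Type*} [NormedAddCommGroup E] [NormedSpace ℝ E] [NormedAddCommGroup F]
  [NormedSpace ℝ F]

/-- The bracket of `F`-valued functions determined by an anchor and a tensor:
`[a, b] = Db(ρ a) - Da(ρ b) + c(a, b)`. -/
def functionBracket (ρ : E → F →L[ℝ] E) (c : E → F →L[ℝ] F →L[ℝ] F) (a b : E → F) (x : E) : F :=
  fderiv ℝ b x (ρ x (a x)) - fderiv ℝ a x (ρ x (b x)) + c x (a x) (b x)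

theorem functionBracket_congr {ρ : E → F →L[ℝ] E} {c : E → F →L[ℝ] F →L[ℝ] F} {a a' b b' : E → F}
    {x : E} (ha : a =ᶠ[𝓝 x] a') (hb : b =ᶠ[𝓝 x] b') :
    functionBracket ρ c a b x = functionBracket ρ c a' b' x := by
  simp only [functionBracket, ha.fderiv_eq, hb.fderiv_eq, ha.eq_of_nhds, hb.eq_of_nhds]

end

/-- A Lie algebroid structure on the trivial bundle with fibre `F` over an open subset of `E`. -/
structure LocalModel (E F : Type*) [NormedAddCommGroup E] [NormedSpace ℝ E]
    [NormedAddCommGroup F] [NormedSpace ℝ F] where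
  dom : Set E
  isOpen_dom : IsOpen dom
  anchor : E → F →L[ℝ] E
  tensor : E → F →L[ℝ] F →L[ℝ] F
  contDiffOn_anchor : ContDiffOn ℝ ∞ anchor dom
  contDiffOn_tensor : ContDiffOn ℝ ∞ tensor dom
  skew : ∀ x ∈ dom, ∀ a b, tensor x a b = -tensor x b a
  anchor_bracket : ∀ V : Set E, IsOpen V → V ⊆ dom → ∀ a b : E → F, ContDiffOn ℝ ∞ a V →
    ContDiffOn ℝ ∞ b V → ∀ x ∈ V, anchor x (functionBracket anchor tensor a b x) =
      VectorField.lieBracket ℝ (fun y => anchor y (a y)) (fun y => anchor y (b y)) x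
  jacobi : ∀ V : Set E, IsOpen V → V ⊆ dom → ∀ a b d : E → F, ContDiffOn ℝ ∞ a V →
    ContDiffOn ℝ ∞ b V → ContDiffOn ℝ ∞ d V → ∀ x ∈ V,
    functionBracket anchor tensor a (functionBracket anchor tensor b d) x +
      functionBracket anchor tensor b (functionBracket anchor tensor d a) x +
      functionBracket anchor tensor d (functionBracket anchor tensor a b) x = 0

namespace LocalModel

variable {E F : Type*} [NormedAddCommGroup E] [NormedSpace ℝ E] [NormedAddCommGroup F]
  [NormedSpace ℝ F] {E' F' : Type*} [NormedAddCommGroup E'] [NormedSpace ℝ E']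
  [NormedAddCommGroup F'] [NormedSpace ℝ F']

/-- The bracket of functions of a local model. -/
def bracket (C : LocalModel E F) : (E → F) → (E → F) → E → F := functionBracket C.anchor C.tensor

theorem bracket_apply (C : LocalModel E F) (a b : E → F) (x : E) : C.bracket a b x =
    fderiv ℝ b x (C.anchor x (a x)) - fderiv ℝ a x (C.anchor x (b x)) + C.tensor x (a x) (b x) :=
  rfl

theorem bracket_const (C : LocalModel E F) (a b : F) (x : E) :
    C.bracket (fun _ => a) (fun _ => b) x = C.tensor x a b := by
  simp [bracket_apply]

/-- A submersive morphism of local models which identifies the source with the pull-back of the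
target. -/
structure IsHom (C : LocalModel E F) (C' : LocalModel E' F') (W : Set E) (u : E → E')
    (θ : E → F →L[ℝ] F') : Prop where
  isOpen : IsOpen W
  mapsTo : MapsTo u W C'.dom
  contDiffOn_base : ContDiffOn ℝ ∞ u W
  contDiffOn_fiber : ContDiffOn ℝ ∞ θ W
  surjective : ∀ y ∈ W, Function.Surjective (fderiv ℝ u y)
  anchor : ∀ y ∈ W, ∀ k, C'.anchor (u y) (θ y k) = fderiv ℝ u y (C.anchor y k)
  cartesian : ∀ y ∈ W, ∀ k' X, C'.anchor (u y) k' = fderiv ℝ u y X →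
    ∃! k, θ y k = k' ∧ C.anchor y k = X
  tensor : ∀ y ∈ W, ∀ k l, θ y (C.tensor y k l) = fderiv ℝ θ y (C.anchor y k) l -
    fderiv ℝ θ y (C.anchor y l) k + C'.tensor (u y) (θ y k) (θ y l)

end LocalModel

section Transport

variable {E F : Type*} [NormedAddCommGroup E] [NormedSpace ℝ E] [NormedAddCommGroup F]
  [NormedSpace ℝ F] {E₁ F₁ : Type*} [NormedAddCommGroup E₁] [NormedSpace ℝ E₁]
  [NormedAddCommGroup F₁] [NormedSpace ℝ F₁]

/-- A smooth change of coordinates `e` together with a smooth change of frame `G`. -/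
structure IsFrameChange (e : OpenPartialHomeomorph E₁ E) (G : E₁ → F₁ →L[ℝ] F)
    (G' : E₁ → F →L[ℝ] F₁) : Prop where
  contDiffOn : ContDiffOn ℝ ∞ e e.source
  contDiffOn_symm : ContDiffOn ℝ ∞ e.symm e.target
  contDiffOn_frame : ContDiffOn ℝ ∞ G e.source
  contDiffOn_frame_symm : ContDiffOn ℝ ∞ G' e.source
  left_inv : ∀ y ∈ e.source, ∀ k, G' y (G y k) = k
  right_inv : ∀ y ∈ e.source, ∀ k, G y (G' y k) = k

namespace IsFrameChange

variable {e : OpenPartialHomeomorph E₁ E} {G : E₁ → F₁ →L[ℝ] F} {G' : E₁ → F →L[ℝ] F₁}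
  (h : IsFrameChange e G G')
include h

theorem differentiableAt {y : E₁} (hy : y ∈ e.source) : DifferentiableAt ℝ e y :=
  (h.contDiffOn.contDiffAt (e.open_source.mem_nhds hy)).differentiableAt (by simp)

theorem differentiableAt_symm {x : E} (hx : x ∈ e.target) : DifferentiableAt ℝ e.symm x :=
  (h.contDiffOn_symm.contDiffAt (e.open_target.mem_nhds hx)).differentiableAt (by simp)

theorem fderiv_symm_fderiv {y : E₁} (hy : y ∈ e.source) (v : E₁) :
    fderiv ℝ e.symm (e y) (fderiv ℝ e y v) = v := by
  have h1 : HasFDerivAt (e.symm ∘ e) ((fderiv ℝ e.symm (e y)).comp (fderiv ℝ e y)) y :=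
    (h.differentiableAt_symm (e.map_source hy)).hasFDerivAt.comp y
      (h.differentiableAt hy).hasFDerivAt
  have h2 : e.symm ∘ e =ᶠ[𝓝 y] id := by
    filter_upwards [e.open_source.mem_nhds hy] with z hz using e.left_inv hz
  have h3 := h1.congr_of_eventuallyEq h2.symm
  exact DFunLike.congr_fun (h3.unique (hasFDerivAt_id y)) v

theorem fderiv_fderiv_symm {y : E₁} (hy : y ∈ e.source) (v : E) :
    fderiv ℝ e y (fderiv ℝ e.symm (e y) v) = v := by
  have h0 : HasFDerivAt e (fderiv ℝ e y) (e.symm (e y)) := by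
    rw [e.left_inv hy]
    exact (h.differentiableAt hy).hasFDerivAt
  have h1 : HasFDerivAt (e ∘ e.symm) ((fderiv ℝ e y).comp (fderiv ℝ e.symm (e y))) (e y) :=
    h0.comp (e y) (h.differentiableAt_symm (e.map_source hy)).hasFDerivAt
  have h2 : e ∘ e.symm =ᶠ[𝓝 (e y)] id := by
    filter_upwards [e.open_target.mem_nhds (e.map_source hy)] with z hz using e.right_inv hz
  have h3 := h1.congr_of_eventuallyEq h2.symm
  exact DFunLike.congr_fun (h3.unique (hasFDerivAt_id _)) v

theorem inverse_fderiv {y : E₁} (hy : y ∈ e.source) :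
    (fderiv ℝ e y).inverse = fderiv ℝ e.symm (e y) :=
  ContinuousLinearMap.inverse_eq
    (ContinuousLinearMap.ext fun v => h.fderiv_fderiv_symm hy v)
    (ContinuousLinearMap.ext fun v => h.fderiv_symm_fderiv hy v)

end IsFrameChange

/-- The anchor in new coordinates. -/
def transportAnchor (C : LocalModel E F) (e : OpenPartialHomeomorph E₁ E) (G : E₁ → F₁ →L[ℝ] F)
    (y : E₁) : F₁ →L[ℝ] E₁ :=
  (fderiv ℝ e.symm (e y)).comp ((C.anchor (e y)).comp (G y))

/-- The bracket tensor in new coordinates. -/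
def transportTensor (C : LocalModel E F) (e : OpenPartialHomeomorph E₁ E) (G : E₁ → F₁ →L[ℝ] F)
    (G' : E₁ → F →L[ℝ] F₁) (y : E₁) : F₁ →L[ℝ] F₁ →L[ℝ] F₁ :=
  (ContinuousLinearMap.compL ℝ F₁ F F₁ (G' y)).comp
    (((ContinuousLinearMap.compL ℝ F₁ F F).flip (G y)).comp ((C.tensor (e y)).comp (G y)) +
      (fderiv ℝ G y).comp (transportAnchor C e G y) -
      ((fderiv ℝ G y).comp (transportAnchor C e G y)).flip)

theorem transportTensor_apply (C : LocalModel E F) (e : OpenPartialHomeomorph E₁ E)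
    (G : E₁ → F₁ →L[ℝ] F) (G' : E₁ → F →L[ℝ] F₁) (y : E₁) (k l : F₁) :
    transportTensor C e G G' y k l = G' y (C.tensor (e y) (G y k) (G y l) +
      fderiv ℝ G y (transportAnchor C e G y k) l - fderiv ℝ G y (transportAnchor C e G y l) k) :=
  rfl

variable (C : LocalModel E F) {e : OpenPartialHomeomorph E₁ E} {G : E₁ → F₁ →L[ℝ] F}
  {G' : E₁ → F →L[ℝ] F₁} (h : IsFrameChange e G G')
include h

theorem fderiv_transportAnchor {y : E₁} (hy : y ∈ e.source) (k : F₁) :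
    fderiv ℝ e y (transportAnchor C e G y k) = C.anchor (e y) (G y k) :=
  h.fderiv_fderiv_symm hy _

theorem frame_transportTensor {y : E₁} (hy : y ∈ e.source) (k l : F₁) :
    G y (transportTensor C e G G' y k l) = C.tensor (e y) (G y k) (G y l) +
      fderiv ℝ G y (transportAnchor C e G y k) l - fderiv ℝ G y (transportAnchor C e G y l) k := by
  rw [transportTensor_apply, h.right_inv y hy]

theorem contDiffOn_push {V : Set E₁} (hVs : V ⊆ e.source) {a : E₁ → F₁}
    (ha : ContDiffOn ℝ ∞ a V) :
    ContDiffOn ℝ ∞ (fun x => G (e.symm x) (a (e.symm x))) (e '' V) := by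
  have hs : ContDiffOn ℝ ∞ e.symm (e '' V) :=
    h.contDiffOn_symm.mono (by rintro _ ⟨y, hy, rfl⟩; exact e.map_source (hVs hy))
  have hm : MapsTo e.symm (e '' V) V := by
    rintro _ ⟨y, hy, rfl⟩
    rwa [e.left_inv (hVs hy)]
  exact ((h.contDiffOn_frame.mono hVs).comp hs hm).clm_apply (ha.comp hs hm)

theorem fderiv_push {y : E₁} (hy : y ∈ e.source) {b : E₁ → F₁} (hb : DifferentiableAt ℝ b y)
    (v : E₁) : fderiv ℝ (fun x => G (e.symm x) (b (e.symm x))) (e y) (fderiv ℝ e y v) =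
      fderiv ℝ G y v (b y) + G y (fderiv ℝ b y v) := by
  have hG : DifferentiableAt ℝ G y :=
    (h.contDiffOn_frame.contDiffAt (e.open_source.mem_nhds hy)).differentiableAt (by simp)
  have hGb : DifferentiableAt ℝ (fun z => G z (b z)) y := hG.clm_apply hb
  have hsymm := (h.differentiableAt_symm (e.map_source hy)).hasFDerivAt
  have h0 : HasFDerivAt (fun z => G z (b z)) (fderiv ℝ (fun z => G z (b z)) y) (e.symm (e y)) := by
    rw [e.left_inv hy]
    exact hGb.hasFDerivAt
  have h1 := (h0.comp (e y) hsymm).fderiv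
  change fderiv ℝ (fun x => G (e.symm x) (b (e.symm x))) (e y) = _ at h1
  rw [h1, ContinuousLinearMap.comp_apply, h.fderiv_symm_fderiv hy,
    fderiv_clm_apply hG hb]
  simp [add_comm]

/-- The transported tensor is defined so that this holds: the derivative of the frame in the product
rule is what its two extra terms compensate. -/
theorem bracket_push {y : E₁} (hy : y ∈ e.source) {a b : E₁ → F₁} (ha : DifferentiableAt ℝ a y)
    (hb : DifferentiableAt ℝ b y) :
    C.bracket (fun x => G (e.symm x) (a (e.symm x))) (fun x => G (e.symm x) (b (e.symm x))) (e y) =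
      G y (functionBracket (transportAnchor C e G) (transportTensor C e G G') a b y) := by
  rw [LocalModel.bracket_apply, functionBracket]
  simp only [e.left_inv hy]
  rw [← fderiv_transportAnchor C h hy, ← fderiv_transportAnchor C h hy, fderiv_push h hy hb,
    fderiv_push h hy ha, map_add, map_sub, frame_transportTensor C h hy]
  abel

theorem contDiffOn_transportAnchor (hC : e.target ⊆ C.dom) :
    ContDiffOn ℝ ∞ (transportAnchor C e G) e.source := by
  have hd : ContDiffOn ℝ ∞ (fderiv ℝ e.symm) e.target :=
    h.contDiffOn_symm.fderiv_of_isOpen e.open_target (by simp)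
  exact (hd.comp h.contDiffOn e.mapsTo).clm_comp
    (((C.contDiffOn_anchor.mono hC).comp h.contDiffOn e.mapsTo).clm_comp h.contDiffOn_frame)

theorem contDiffOn_transportTensor [FiniteDimensional ℝ F₁] (hC : e.target ⊆ C.dom) :
    ContDiffOn ℝ ∞ (transportTensor C e G G') e.source := by
  have hρ := contDiffOn_transportAnchor C h hC
  have hc := (C.contDiffOn_tensor.mono hC).comp h.contDiffOn e.mapsTo
  have hd : ContDiffOn ℝ ∞ (fderiv ℝ G) e.source :=
    h.contDiffOn_frame.fderiv_of_isOpen e.open_source (by simp)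
  refine contDiffOn_clm_apply.2 fun k => contDiffOn_clm_apply.2 fun l => ?_
  have hGk : ∀ k, ContDiffOn ℝ ∞ (fun y => G y k) e.source :=
    fun k => h.contDiffOn_frame.clm_apply contDiffOn_const
  have hρk : ∀ k, ContDiffOn ℝ ∞ (fun y => transportAnchor C e G y k) e.source :=
    fun k => hρ.clm_apply contDiffOn_const
  exact h.contDiffOn_frame_symm.clm_apply
    ((((hc.clm_apply (hGk k)).clm_apply (hGk l)).add
      ((hd.clm_apply (hρk k)).clm_apply contDiffOn_const)).sub
      ((hd.clm_apply (hρk l)).clm_apply contDiffOn_const))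

end Transport

end LocalModels

/-! ### The local model obtained by a change of coordinates and frame. -/

noncomputable section TransportModel

attribute [-instance]
  Bundle.instNormedAddCommGroupOfRiemannianBundleOfIsTopologicalAddGroupOfContinuousConstSMulReal

theorem minSmoothness_two_le_infty : minSmoothness ℝ 2 ≤ ∞ := by
  rw [minSmoothness_of_isRCLikeNormedField]
  exact WithTop.coe_le_coe.2 (le_top : (2 : ℕ∞) ≤ ⊤)

theorem ContDiffOn.differentiableAt_of_isOpen {E F : Type*} [NormedAddCommGroup E] [NormedSpace ℝ E]
    [NormedAddCommGroup F] [NormedSpace ℝ F] {f : E → F} {V : Set E} (hf : ContDiffOn ℝ ∞ f V)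
    (hV : IsOpen V) {x : E} (hx : x ∈ V) : DifferentiableAt ℝ f x :=
  (hf.contDiffAt (hV.mem_nhds hx)).differentiableAt (by simp)

theorem ContDiffOn.functionBracket {E F : Type*} [NormedAddCommGroup E] [NormedSpace ℝ E]
    [NormedAddCommGroup F] [NormedSpace ℝ F] {ρ : E → F →L[ℝ] E} {c : E → F →L[ℝ] F →L[ℝ] F}
    {V : Set E} (hV : IsOpen V) (hρ : ContDiffOn ℝ ∞ ρ V) (hc : ContDiffOn ℝ ∞ c V) {a b : E → F}
    (ha : ContDiffOn ℝ ∞ a V) (hb : ContDiffOn ℝ ∞ b V) :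
    ContDiffOn ℝ ∞ (functionBracket ρ c a b) V :=
  (((hb.fderiv_of_isOpen hV (by simp)).clm_apply (hρ.clm_apply ha)).sub
    ((ha.fderiv_of_isOpen hV (by simp)).clm_apply (hρ.clm_apply hb))).add
    ((hc.clm_apply ha).clm_apply hb)

variable {E F : Type*} [NormedAddCommGroup E] [NormedSpace ℝ E] [NormedAddCommGroup F]
  [NormedSpace ℝ F] {E₁ F₁ : Type*} [NormedAddCommGroup E₁] [NormedSpace ℝ E₁]
  [NormedAddCommGroup F₁] [NormedSpace ℝ F₁] (C : LocalModel E F)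
  {e : OpenPartialHomeomorph E₁ E} {G : E₁ → F₁ →L[ℝ] F} {G' : E₁ → F →L[ℝ] F₁}

/-- Naturality of the Lie bracket under the diffeomorphism `e`: the anchors of transported sections
are the `e`-pull-backs of the anchors of the pushed sections. -/
theorem anchor_bracket_transport [CompleteSpace E] [CompleteSpace E₁] (h : IsFrameChange e G G')
    (hC : e.target ⊆ C.dom) {V : Set E₁} (hV : IsOpen V) (hVe : V ⊆ e.source) {a b : E₁ → F₁}
    (ha : ContDiffOn ℝ ∞ a V) (hb : ContDiffOn ℝ ∞ b V) {x : E₁} (hx : x ∈ V) :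
    transportAnchor C e G x
        (functionBracket (transportAnchor C e G) (transportTensor C e G G') a b x) =
      VectorField.lieBracket ℝ (fun y => transportAnchor C e G y (a y))
        (fun y => transportAnchor C e G y (b y)) x := by
  have hVo : IsOpen (e '' V) := e.isOpen_image_of_subset_source hV hVe
  have hVC : e '' V ⊆ C.dom := by
    rintro _ ⟨y, hy, rfl⟩
    exact hC (e.map_source (hVe hy))
  have hpa := contDiffOn_push h hVe ha
  have hpb := contDiffOn_push h hVe hb
  have hex : e x ∈ e '' V := mem_image_of_mem e hx
  rw [transportAnchor, ContinuousLinearMap.comp_apply, ContinuousLinearMap.comp_apply,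
    ← bracket_push C h (hVe hx) (ha.differentiableAt_of_isOpen hV hx)
      (hb.differentiableAt_of_isOpen hV hx)]
  have h1 := C.anchor_bracket _ hVo hVC _ _ hpa hpb _ hex
  have hA := C.contDiffOn_anchor.mono hVC
  have h2 := VectorField.pullback_lieBracket (𝕜 := ℝ) (n := ∞) minSmoothness_two_le_infty
    (h.contDiffOn.contDiffAt (e.open_source.mem_nhds (hVe hx)))
    ((hA.clm_apply hpa).differentiableAt_of_isOpen hVo hex)
    ((hA.clm_apply hpb).differentiableAt_of_isOpen hVo hex)
  have h3 : ∀ a : E₁ → F₁, VectorField.pullback ℝ e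
      (fun y => C.anchor y (G (e.symm y) (a (e.symm y)))) =ᶠ[𝓝 x]
        fun y => transportAnchor C e G y (a y) := fun a => by
    filter_upwards [e.open_source.mem_nhds (hVe hx)] with y hy
    rw [VectorField.pullback, h.inverse_fderiv hy, e.left_inv hy]
    rfl
  have h4 := Filter.EventuallyEq.lieBracket_vectorField_eq (𝕜 := ℝ) (h3 a) (h3 b)
  rw [← h4, ← h2, VectorField.pullback, h.inverse_fderiv (hVe hx), ← h1]
  rfl

/-- Pushing sections forward intertwines the two brackets, and the frame `G` is injective, so the
identity is inherited from `C`. -/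
theorem jacobi_transport [FiniteDimensional ℝ F₁] (h : IsFrameChange e G G')
    (hC : e.target ⊆ C.dom) {V : Set E₁} (hV : IsOpen V) (hVe : V ⊆ e.source) {a b d : E₁ → F₁}
    (ha : ContDiffOn ℝ ∞ a V) (hb : ContDiffOn ℝ ∞ b V) (hd : ContDiffOn ℝ ∞ d V) {x : E₁}
    (hx : x ∈ V) :
    let br := functionBracket (transportAnchor C e G) (transportTensor C e G G')
    br a (br b d) x + br b (br d a) x + br d (br a b) x = 0 := by
  intro br
  have hVo : IsOpen (e '' V) := e.isOpen_image_of_subset_source hV hVe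
  have hVC : e '' V ⊆ C.dom := by
    rintro _ ⟨y, hy, rfl⟩
    exact hC (e.map_source (hVe hy))
  have hex : e x ∈ e '' V := mem_image_of_mem e hx
  set P : (E₁ → F₁) → E → F := fun a x => G (e.symm x) (a (e.symm x)) with hP
  have hbr : ∀ {a b : E₁ → F₁}, ContDiffOn ℝ ∞ a V → ContDiffOn ℝ ∞ b V →
      ContDiffOn ℝ ∞ (br a b) V := fun ha hb =>
    ContDiffOn.functionBracket hV ((contDiffOn_transportAnchor C h hC).mono hVe)
      ((contDiffOn_transportTensor C h hC).mono hVe) ha hb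
  have key : ∀ {a b : E₁ → F₁}, ContDiffOn ℝ ∞ a V → ContDiffOn ℝ ∞ b V →
      ∀ y ∈ V, C.bracket (P a) (P b) (e y) = G y (br a b y) := fun ha hb y hy =>
    bracket_push C h (hVe hy) (ha.differentiableAt_of_isOpen hV hy)
      (hb.differentiableAt_of_isOpen hV hy)
  have key2 : ∀ {a b d : E₁ → F₁}, ContDiffOn ℝ ∞ a V → ContDiffOn ℝ ∞ b V →
      ContDiffOn ℝ ∞ d V →
      C.bracket (P a) (C.bracket (P b) (P d)) (e x) = G x (br a (br b d) x) := by
    intro a b d ha hb hd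
    rw [← key ha (hbr hb hd) x hx]
    refine functionBracket_congr Filter.EventuallyEq.rfl ?_
    filter_upwards [hVo.mem_nhds hex]
    rintro _ ⟨y, hy, rfl⟩
    rw [key hb hd y hy, hP]
    simp only [e.left_inv (hVe hy)]
  have hj := C.jacobi _ hVo hVC _ _ _ (contDiffOn_push h hVe ha) (contDiffOn_push h hVe hb)
    (contDiffOn_push h hVe hd) _ hex
  have hj' : G x (br a (br b d) x) + G x (br b (br d a) x) + G x (br d (br a b) x) = 0 := by
    rw [← key2 ha hb hd, ← key2 hb hd ha, ← key2 hd ha hb]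
    exact hj
  rw [← map_add, ← map_add] at hj'
  rw [← h.left_inv x (hVe hx) (br a (br b d) x + br b (br d a) x + br d (br a b) x), hj', map_zero]

/-- A local model in new coordinates and a new frame. -/
def LocalModel.transport [FiniteDimensional ℝ E] [FiniteDimensional ℝ E₁] [FiniteDimensional ℝ F₁]
    (h : IsFrameChange e G G') (hC : e.target ⊆ C.dom) : LocalModel E₁ F₁ where
  dom := e.source
  isOpen_dom := e.open_source
  anchor := transportAnchor C e G
  tensor := transportTensor C e G G'
  contDiffOn_anchor := contDiffOn_transportAnchor C h hC
  contDiffOn_tensor := contDiffOn_transportTensor C h hC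
  skew x hx a b := by
    rw [transportTensor_apply, transportTensor_apply, C.skew _ (hC (e.map_source hx)) (G x a) (G x b), ← map_neg (G' x)]
    congr 1
    abel
  anchor_bracket V hV hVe a b ha hb x hx := by
    have : CompleteSpace E := FiniteDimensional.complete ℝ E
    have : CompleteSpace E₁ := FiniteDimensional.complete ℝ E₁
    exact anchor_bracket_transport C h hC hV hVe ha hb hx
  jacobi V hV hVe a b d ha hb hd x hx := jacobi_transport C h hC hV hVe ha hb hd hx

theorem LocalModel.isHom_transport [FiniteDimensional ℝ E] [FiniteDimensional ℝ E₁]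
    [FiniteDimensional ℝ F₁] (h : IsFrameChange e G G') (hC : e.target ⊆ C.dom) :
    C.IsHom (C.transport h hC) e.target e.symm (fun x => G' (e.symm x)) where
  isOpen := e.open_target
  mapsTo := e.symm.mapsTo
  contDiffOn_base := h.contDiffOn_symm
  contDiffOn_fiber := h.contDiffOn_frame_symm.comp h.contDiffOn_symm e.symm.mapsTo
  surjective y hy v := by
    refine ⟨fderiv ℝ e (e.symm y) v, ?_⟩
    have := h.fderiv_symm_fderiv (e.map_target hy) v
    rwa [e.right_inv hy] at this
  anchor y hy k := by
    change fderiv ℝ e.symm (e (e.symm y)) (C.anchor (e (e.symm y)) (G (e.symm y) _)) = _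
    rw [h.right_inv _ (e.map_target hy), e.right_inv hy]
  cartesian y hy k' X hX := by
    refine ⟨G (e.symm y) k', ⟨h.left_inv _ (e.map_target hy) k', ?_⟩, ?_⟩
    · have h1 : transportAnchor C e G (e.symm y) k' = fderiv ℝ e.symm y X := hX
      have h2 := fderiv_transportAnchor C h (e.map_target hy) k'
      have h3 := h.fderiv_fderiv_symm (e.map_target hy) X
      rw [e.right_inv hy] at h2 h3
      rw [← h2, h1, h3]
    · rintro k ⟨rfl, -⟩
      exact (h.right_inv _ (e.map_target hy) k).symm
  tensor y hy k l := by
    have hys := e.map_target hy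
    have hG' : ContDiffOn ℝ ∞ G' e.source := h.contDiffOn_frame_symm
    -- The sections `z ↦ G' z k` push forward to constants, whose bracket is the tensor of `C`.
    -- Comparing with `bracket_push` gives the identity.
    have hd : ∀ k, DifferentiableAt ℝ (fun z => G' z k) (e.symm y) := fun k =>
      (hG'.clm_apply contDiffOn_const).differentiableAt_of_isOpen e.open_source hys
    have h1 := bracket_push C h hys (hd k) (hd l)
    have h2 : ∀ k, (fun x => G (e.symm x) (G' (e.symm x) k)) =ᶠ[𝓝 y] fun _ => k := fun k => by
      filter_upwards [e.open_target.mem_nhds hy] with x hx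
      exact h.right_inv _ (e.map_target hx) k
    rw [e.right_inv hy, LocalModel.bracket, functionBracket_congr (h2 k) (h2 l)] at h1
    have h3 := C.bracket_const k l y
    rw [LocalModel.bracket] at h3
    rw [h3] at h1
    rw [h1, h.left_inv _ hys, functionBracket]
    have h4 : ∀ k v, fderiv ℝ (fun z => G' z k) (e.symm y) (fderiv ℝ e.symm y v) =
        fderiv ℝ (fun x => G' (e.symm x)) y v k := by
      intro k v
      have hG'y := hG'.differentiableAt_of_isOpen e.open_source hys
      have h5 := (hG'y.hasFDerivAt.comp y (h.differentiableAt_symm hy).hasFDerivAt).fderiv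
      change fderiv ℝ (fun x => G' (e.symm x)) y = _ at h5
      rw [h5, fderiv_clm_apply hG'y (differentiableAt_const k)]
      simp
    have h6 : ∀ k, transportAnchor C e G (e.symm y) (G' (e.symm y) k) =
        fderiv ℝ e.symm y (C.anchor y k) := fun k => by
      simp only [transportAnchor, ContinuousLinearMap.comp_apply, h.right_inv _ hys,
        e.right_inv hy]
    rw [h6, h6, h4, h4]
    rfl

end TransportModel

/-! ### Straight models split off a factor `Tℝ`. -/

noncomputable section StraightenedModel

attribute [-instance]
  Bundle.instNormedAddCommGroupOfRiemannianBundleOfIsTopologicalAddGroupOfContinuousConstSMulReal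

section

variable {E G : Type*} [NormedAddCommGroup E] [NormedSpace ℝ E] [NormedAddCommGroup G]
  [NormedSpace ℝ G]

theorem eq_zero_section_of_fderiv_eq_zero {δ : ℝ} (hδ : 0 < δ) {B : Set E} {f : ℝ × E → G}
    (hf : ∀ p ∈ Ioo (-δ) δ ×ˢ B, DifferentiableAt ℝ f p)
    (hf' : ∀ p ∈ Ioo (-δ) δ ×ˢ B, fderiv ℝ f p (1, 0) = 0) {p : ℝ × E}
    (hp : p ∈ Ioo (-δ) δ ×ˢ B) : f p = f (0, p.2) := by
  have hd : ∀ t ∈ Ioo (-δ) δ, HasDerivAt (fun t => f (t, p.2)) 0 t := by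
    intro t ht
    have h1 : HasDerivAt (fun t : ℝ => (t, p.2)) ((1 : ℝ), (0 : E)) t :=
      (hasDerivAt_id t).prodMk (hasDerivAt_const t p.2)
    have h2 := (hf (t, p.2) ⟨ht, hp.2⟩).hasFDerivAt.comp_hasDerivAt t h1
    rwa [hf' (t, p.2) ⟨ht, hp.2⟩] at h2
  have h := isOpen_Ioo.is_const_of_deriv_eq_zero isPreconnected_Ioo
    (fun t ht => (hd t ht).differentiableAt.differentiableWithinAt)
    (fun t ht => (hd t ht).deriv) hp.1 (show (0 : ℝ) ∈ Ioo (-δ) δ by constructor <;> linarith)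
  exact h

end

variable {E F : Type*} [NormedAddCommGroup E] [NormedSpace ℝ E] [NormedAddCommGroup F]
  [NormedSpace ℝ F]

/-- A local model in which the first frame section is constant along the first coordinate. -/
structure LocalModel.IsStraight (C : LocalModel (ℝ × E) (ℝ × F)) (δ : ℝ) (B : Set E) : Prop where
  pos : 0 < δ
  isOpen : IsOpen B
  dom_eq : C.dom = Ioo (-δ) δ ×ˢ B
  anchor_one : ∀ p ∈ C.dom, C.anchor p (1, 0) = (1, 0)
  tensor_one : ∀ p ∈ C.dom, ∀ k, C.tensor p (1, 0) (0, k) = 0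
  anchor_fst : ∀ y ∈ B, ∀ k, (C.anchor (0, y) (0, k)).1 = 0

namespace LocalModel.IsStraight

variable {C : LocalModel (ℝ × E) (ℝ × F)} {δ : ℝ} {B : Set E}

theorem _root_.LocalModel.contDiffOn_anchor_const (C : LocalModel (ℝ × E) (ℝ × F)) (k : ℝ × F) : ContDiffOn ℝ ∞ (fun p => C.anchor p k) C.dom :=
  C.contDiffOn_anchor.clm_apply contDiffOn_const

theorem _root_.LocalModel.contDiffOn_tensor_const (C : LocalModel (ℝ × E) (ℝ × F)) (k l : ℝ × F) :
    ContDiffOn ℝ ∞ (fun p => C.tensor p k l) C.dom :=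
  (C.contDiffOn_tensor.clm_apply contDiffOn_const).clm_apply contDiffOn_const

/-- The anchor of the quotient by the first coordinate. -/
def quotAnchor (C : LocalModel (ℝ × E) (ℝ × F)) (y : E) : F →L[ℝ] E :=
  (ContinuousLinearMap.snd ℝ ℝ E).comp ((C.anchor (0, y)).comp (ContinuousLinearMap.inr ℝ ℝ F))

/-- The tensor of the quotient by the first coordinate. -/
def quotTensor (C : LocalModel (ℝ × E) (ℝ × F)) (y : E) : F →L[ℝ] F →L[ℝ] F :=
  (ContinuousLinearMap.compL ℝ F (ℝ × F) F (ContinuousLinearMap.snd ℝ ℝ F)).comp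
    (((ContinuousLinearMap.compL ℝ F (ℝ × F) (ℝ × F)).flip (ContinuousLinearMap.inr ℝ ℝ F)).comp
      ((C.tensor (0, y)).comp (ContinuousLinearMap.inr ℝ ℝ F)))

theorem quotAnchor_apply (C : LocalModel (ℝ × E) (ℝ × F)) (y : E) (k : F) :
    quotAnchor C y k = (C.anchor (0, y) (0, k)).2 := rfl

theorem quotTensor_apply (C : LocalModel (ℝ × E) (ℝ × F)) (y : E) (k l : F) :
    quotTensor C y k l = (C.tensor (0, y) (0, k) (0, l)).2 := rfl

theorem contDiffOn_lift (δ : ℝ) {V : Set E} {a : E → F} (ha : ContDiffOn ℝ ∞ a V) :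
    ContDiffOn ℝ ∞ (fun q : ℝ × E => ((0 : ℝ), a q.2)) (Ioo (-δ) δ ×ˢ V) :=
  contDiffOn_const.prodMk (ha.comp contDiff_snd.contDiffOn fun _ hq => hq.2)

variable (h : C.IsStraight δ B)
include h

theorem zero_mem {y : E} (hy : y ∈ B) : ((0 : ℝ), y) ∈ C.dom := by
  rw [h.dom_eq]
  exact ⟨⟨by linarith [h.pos], h.pos⟩, hy⟩

theorem snd_mem {p : ℝ × E} (hp : p ∈ C.dom) : p.2 ∈ B := by
  rw [h.dom_eq] at hp
  exact hp.2

/-- The section `(1, 0)` commutes with `(0, k)`, so `∂/∂t` commutes with the anchor of `(0, k)`,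
which is therefore independent of `t`. This spreads the condition `anchor_fst` from `t = 0` to the
whole domain. -/
theorem anchor_eq {p : ℝ × E} (hp : p ∈ C.dom) (k : F) :
    C.anchor p (0, k) = C.anchor (0, p.2) (0, k) := by
  refine eq_zero_section_of_fderiv_eq_zero (f := fun p => C.anchor p (0, k)) h.pos
    (fun q hq => ?_) (fun q hq => ?_) (h.dom_eq ▸ hp)
  · rw [← h.dom_eq] at hq
    exact (C.contDiffOn_anchor_const _).differentiableAt_of_isOpen C.isOpen_dom hq
  · rw [← h.dom_eq] at hq
    have h1 := C.anchor_bracket C.dom C.isOpen_dom subset_rfl (fun _ => (1, 0)) (fun _ => (0, k))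
      contDiffOn_const contDiffOn_const q hq
    have h2 := C.bracket_const (1, 0) (0, k) q
    rw [LocalModel.bracket] at h2
    rw [h2, h.tensor_one q hq, map_zero] at h1
    have h3 : (fun y => C.anchor y ((1 : ℝ), (0 : F))) =ᶠ[𝓝 q] fun _ => (1, 0) := by
      filter_upwards [C.isOpen_dom.mem_nhds hq] with y hy using h.anchor_one y hy
    rw [VectorField.lieBracket, h3.fderiv_eq, h.anchor_one q hq] at h1
    simpa using h1.symm

theorem anchor_fst_eq {p : ℝ × E} (hp : p ∈ C.dom) (k : F) : (C.anchor p (0, k)).1 = 0 := by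
  rw [h.anchor_eq hp, h.anchor_fst _ (h.snd_mem hp)]

theorem anchor_fst_apply {p : ℝ × E} (hp : p ∈ C.dom) (k : ℝ × F) : (C.anchor p k).1 = k.1 := by
  have h1 : k = k.1 • ((1 : ℝ), (0 : F)) + (0, k.2) := by ext <;> simp
  rw [h1, map_add, map_smul, h.anchor_one p hp]
  simp [h.anchor_fst_eq hp]

/-- The first component of a section is the `t`-component of its anchor, and a bracket of vector
fields without `t`-component has none. -/
theorem tensor_fst_eq {p : ℝ × E} (hp : p ∈ C.dom) (k l : F) :
    (C.tensor p (0, k) (0, l)).1 = 0 := by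
  have h1 := C.anchor_bracket C.dom C.isOpen_dom subset_rfl (fun _ => (0, k)) (fun _ => (0, l))
    contDiffOn_const contDiffOn_const p hp
  have h2 := C.bracket_const (0, k) (0, l) p
  rw [LocalModel.bracket] at h2
  rw [h2] at h1
  have h3 : ∀ (k : F) (v : ℝ × E), (fderiv ℝ (fun y => C.anchor y (0, k)) p v).1 = 0 := by
    intro k v
    have hd : HasFDerivAt (fun y => C.anchor y (0, k)) (fderiv ℝ (fun y => C.anchor y (0, k)) p) p :=
      ((C.contDiffOn_anchor_const _).differentiableAt_of_isOpen C.isOpen_dom hp).hasFDerivAt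
    have h4 := hd.fst.fderiv
    have h5 : (fun y => (C.anchor y ((0 : ℝ), k)).1) =ᶠ[𝓝 p] fun _ => 0 := by
      filter_upwards [C.isOpen_dom.mem_nhds hp] with y hy using h.anchor_fst_eq hy k
    rw [h5.fderiv_eq] at h4
    have := DFunLike.congr_fun h4 v
    simpa using this.symm
  rw [← h.anchor_fst_apply hp, h1, VectorField.lieBracket, Prod.fst_sub, h3, h3, sub_zero]

/-- The Jacobi identity for `(1, 0)`, `(0, k)`, `(0, l)`: two terms vanish because `(1, 0)` commutes
with constants, and what remains is the `t`-derivative of the tensor. -/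
theorem tensor_eq {p : ℝ × E} (hp : p ∈ C.dom) (k l : F) :
    C.tensor p (0, k) (0, l) = C.tensor (0, p.2) (0, k) (0, l) := by
  refine eq_zero_section_of_fderiv_eq_zero (f := fun p => C.tensor p (0, k) (0, l)) h.pos
    (fun q hq => ?_) (fun q hq => ?_) (h.dom_eq ▸ hp)
  · rw [← h.dom_eq] at hq
    exact (C.contDiffOn_tensor_const _ _).differentiableAt_of_isOpen C.isOpen_dom hq
  · rw [← h.dom_eq] at hq
    have h1 := C.jacobi C.dom C.isOpen_dom subset_rfl (fun _ => (1, 0)) (fun _ => (0, k))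
      (fun _ => (0, l)) contDiffOn_const contDiffOn_const contDiffOn_const q hq
    have hbr : ∀ k l : ℝ × F, functionBracket C.anchor C.tensor (fun _ => k) (fun _ => l) =
        fun x => C.tensor x k l := fun k l => funext (C.bracket_const k l)
    have h2 : (fun x => C.tensor x ((1 : ℝ), (0 : F)) (0, k)) =ᶠ[𝓝 q] fun _ => 0 := by
      filter_upwards [C.isOpen_dom.mem_nhds hq] with y hy using h.tensor_one y hy k
    have h3 : (fun x => C.tensor x ((0 : ℝ), l) (1, 0)) =ᶠ[𝓝 q] fun _ => 0 := by
      filter_upwards [C.isOpen_dom.mem_nhds hq] with y hy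
      rw [C.skew y hy, h.tensor_one y hy l, neg_zero]
    rw [hbr, hbr, hbr, functionBracket_congr Filter.EventuallyEq.rfl h2,
      functionBracket_congr Filter.EventuallyEq.rfl h3, hbr, hbr, functionBracket] at h1
    have h4 : C.tensor q (0, k) (0, l) = (0, (C.tensor q (0, k) (0, l)).2) :=
      Prod.ext (h.tensor_fst_eq hq k l) rfl
    rw [h.anchor_one q hq, h4, h.tensor_one q hq] at h1
    simpa using h1

theorem anchor_apply {p : ℝ × E} (hp : p ∈ C.dom) (k : ℝ × F) :
    C.anchor p k = (k.1, quotAnchor C p.2 k.2) := by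
  have h1 : k = k.1 • ((1 : ℝ), (0 : F)) + (0, k.2) := by ext <;> simp
  refine Prod.ext (h.anchor_fst_apply hp k) ?_
  conv_lhs => rw [h1, map_add, map_smul, h.anchor_one p hp, h.anchor_eq hp]
  simp [quotAnchor_apply]

theorem tensor_apply {p : ℝ × E} (hp : p ∈ C.dom) (k l : ℝ × F) :
    C.tensor p k l = (0, quotTensor C p.2 k.2 l.2) := by
  have h1 : ∀ k : ℝ × F, k = k.1 • ((1 : ℝ), (0 : F)) + (0, k.2) := fun k => by ext <;> simp
  have h2 : C.tensor p (1, 0) (1, 0) = 0 := by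
    have h0 : (2 : ℝ) • C.tensor p (1, 0) (1, 0) = 0 := by
      rw [two_smul]
      nth_rewrite 1 [C.skew p hp]
      exact neg_add_cancel _
    exact (smul_eq_zero.1 h0).resolve_left two_ne_zero
  have h3 : C.tensor p (0, k.2) (1, 0) = 0 := by
    rw [C.skew p hp, h.tensor_one p hp, neg_zero]
  have h4 : C.tensor p k l = C.tensor p (0, k.2) (0, l.2) := by
    conv_lhs => rw [h1 k, h1 l]
    simp only [map_add, map_smul, add_apply, smul_apply,
      h.tensor_one p hp, h2, h3, smul_zero, zero_add, add_zero]
  rw [h4, quotTensor_apply, ← h.tensor_eq hp]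
  exact Prod.ext (h.tensor_fst_eq hp _ _) rfl

/-- The `t`-independent sections with zero first component are closed under the bracket. They
represent the quotient, so each axiom of the quotient is the axiom of `C` for such sections. -/
theorem functionBracket_lift {V : Set E} (hV : IsOpen V) (hVB : V ⊆ B) {a b : E → F}
    (ha : ContDiffOn ℝ ∞ a V) (hb : ContDiffOn ℝ ∞ b V) {p : ℝ × E} (hp : p ∈ Ioo (-δ) δ ×ˢ V) :
    functionBracket C.anchor C.tensor (fun q => (0, a q.2)) (fun q => (0, b q.2)) p =
      (0, functionBracket (quotAnchor C) (quotTensor C) a b p.2) := by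
  have hpd : p ∈ C.dom := by
    rw [h.dom_eq]
    exact ⟨hp.1, hVB hp.2⟩
  have hd : ∀ {a : E → F}, ContDiffOn ℝ ∞ a V → ∀ v,
      fderiv ℝ (fun q : ℝ × E => ((0 : ℝ), a q.2)) p v = (0, fderiv ℝ a p.2 v.2) := fun {a} ha v => by
    have h1 : HasFDerivAt (fun q : ℝ × E => a q.2) _ p :=
      (ha.differentiableAt_of_isOpen hV hp.2).hasFDerivAt.comp p hasFDerivAt_snd
    rw [((hasFDerivAt_const (0 : ℝ) p).prodMk h1).fderiv]
    rfl
  rw [functionBracket, hd ha, hd hb, h.anchor_apply hpd, h.anchor_apply hpd, h.tensor_apply hpd]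
  simp [functionBracket]

theorem contDiffOn_quotAnchor : ContDiffOn ℝ ∞ (quotAnchor C) B := by
  have h1 : ContDiffOn ℝ ∞ (fun y : E => C.anchor ((0 : ℝ), y)) B :=
    C.contDiffOn_anchor.comp (contDiff_prodMk_right (0 : ℝ)).contDiffOn fun y hy => h.zero_mem hy
  exact contDiffOn_const.clm_comp (h1.clm_comp contDiffOn_const)

theorem contDiffOn_quotTensor [FiniteDimensional ℝ F] : ContDiffOn ℝ ∞ (quotTensor C) B := by
  refine contDiffOn_clm_apply.2 fun k => contDiffOn_clm_apply.2 fun l => ?_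
  exact contDiff_snd.comp_contDiffOn ((C.contDiffOn_tensor_const (0, k) (0, l)).comp
    (contDiff_prodMk_right (0 : ℝ)).contDiffOn fun y hy => h.zero_mem hy)

theorem lift_subset {V : Set E} (hVB : V ⊆ B) : Ioo (-δ) δ ×ˢ V ⊆ C.dom := by
  rw [h.dom_eq]
  exact prod_mono_right hVB

theorem zero_mem_lift {V : Set E} {y : E} (hy : y ∈ V) : ((0 : ℝ), y) ∈ Ioo (-δ) δ ×ˢ V :=
  ⟨⟨by linarith [h.pos], h.pos⟩, hy⟩

theorem quotAnchor_functionBracket {V : Set E} (hV : IsOpen V) (hVB : V ⊆ B) {a b : E → F}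
    (ha : ContDiffOn ℝ ∞ a V) (hb : ContDiffOn ℝ ∞ b V) {x : E} (hx : x ∈ V) :
    quotAnchor C x (functionBracket (quotAnchor C) (quotTensor C) a b x) =
      VectorField.lieBracket ℝ (fun y => quotAnchor C y (a y)) (fun y => quotAnchor C y (b y)) x := by
  have hxl := h.zero_mem_lift hx
  have hxd := h.lift_subset hVB hxl
  have h1 := C.anchor_bracket _ (isOpen_Ioo.prod hV) (h.lift_subset hVB) _ _
    (contDiffOn_lift δ ha) (contDiffOn_lift δ hb) _ hxl
  rw [h.functionBracket_lift hV hVB ha hb hxl, h.anchor_apply hxd] at h1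
  have h2 := congrArg Prod.snd h1
  simp only at h2
  rw [h2]
  have h3 : ∀ a : E → F, (fun y => C.anchor y ((0 : ℝ), a y.2)) =ᶠ[𝓝 (0, x)]
      fun y => (0, quotAnchor C y.2 (a y.2)) := fun a => by
    filter_upwards [C.isOpen_dom.mem_nhds hxd] with y hy using h.anchor_apply hy _
  have hq := h.contDiffOn_quotAnchor.mono hVB
  have h4 : ∀ {a : E → F}, ContDiffOn ℝ ∞ a V → ∀ v,
      fderiv ℝ (fun y : ℝ × E => ((0 : ℝ), quotAnchor C y.2 (a y.2))) (0, x) v =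
        (0, fderiv ℝ (fun y => quotAnchor C y (a y)) x v.2) := fun {a} ha v => by
    have h5 : HasFDerivAt (fun y : ℝ × E => quotAnchor C y.2 (a y.2)) _ ((0 : ℝ), x) :=
      HasFDerivAt.comp (g := fun y => quotAnchor C y (a y)) ((0 : ℝ), x)
        ((hq.clm_apply ha).differentiableAt_of_isOpen hV hx).hasFDerivAt hasFDerivAt_snd
    rw [((hasFDerivAt_const (0 : ℝ) _).prodMk h5).fderiv]
    rfl
  rw [(h3 a).lieBracket_vectorField_eq (h3 b), VectorField.lieBracket, h4 ha, h4 hb]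
  rfl

theorem jacobi_quot [FiniteDimensional ℝ F] {V : Set E} (hV : IsOpen V) (hVB : V ⊆ B)
    {a b d : E → F} (ha : ContDiffOn ℝ ∞ a V) (hb : ContDiffOn ℝ ∞ b V) (hd : ContDiffOn ℝ ∞ d V)
    {x : E} (hx : x ∈ V) :
    let br := functionBracket (quotAnchor C) (quotTensor C)
    br a (br b d) x + br b (br d a) x + br d (br a b) x = 0 := by
  intro br
  have hxl := h.zero_mem_lift hx
  have hxd := h.lift_subset hVB hxl
  have hbr : ∀ {a b : E → F}, ContDiffOn ℝ ∞ a V → ContDiffOn ℝ ∞ b V →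
      ContDiffOn ℝ ∞ (br a b) V := fun ha hb =>
    ContDiffOn.functionBracket hV (h.contDiffOn_quotAnchor.mono hVB)
      (h.contDiffOn_quotTensor.mono hVB) ha hb
  have key : ∀ {a b d : E → F}, ContDiffOn ℝ ∞ a V → ContDiffOn ℝ ∞ b V →
      ContDiffOn ℝ ∞ d V →
      functionBracket C.anchor C.tensor (fun q => (0, a q.2))
        (functionBracket C.anchor C.tensor (fun q => (0, b q.2)) (fun q => (0, d q.2))) (0, x) =
      (0, br a (br b d) x) := by
    intro a b d ha hb hd
    rw [← h.functionBracket_lift hV hVB ha (hbr hb hd) hxl]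
    refine functionBracket_congr Filter.EventuallyEq.rfl ?_
    filter_upwards [(isOpen_Ioo.prod hV).mem_nhds hxl] with q hq
    exact h.functionBracket_lift hV hVB hb hd hq
  have h1 := C.jacobi _ (isOpen_Ioo.prod hV) (h.lift_subset hVB) _ _ _
    (contDiffOn_lift δ ha) (contDiffOn_lift δ hb) (contDiffOn_lift δ hd) _ hxl
  rw [key ha hb hd, key hb hd ha, key hd ha hb] at h1
  exact congrArg Prod.snd h1

end LocalModel.IsStraight

/-- The quotient of a straight local model by its first coordinate. -/
def LocalModel.quot [FiniteDimensional ℝ F] {C : LocalModel (ℝ × E) (ℝ × F)} {δ : ℝ} {B : Set E}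
    (h : C.IsStraight δ B) : LocalModel E F where
  dom := B
  isOpen_dom := h.isOpen
  anchor := IsStraight.quotAnchor C
  tensor := IsStraight.quotTensor C
  contDiffOn_anchor := h.contDiffOn_quotAnchor
  contDiffOn_tensor := h.contDiffOn_quotTensor
  skew x hx a b := by
    rw [IsStraight.quotTensor_apply, IsStraight.quotTensor_apply, C.skew _ (h.zero_mem hx)]
    rfl
  anchor_bracket V hV hVB a b ha hb x hx := h.quotAnchor_functionBracket hV hVB ha hb hx
  jacobi V hV hVB a b d ha hb hd x hx := h.jacobi_quot hV hVB ha hb hd hx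

theorem LocalModel.isHom_quot [FiniteDimensional ℝ F] {C : LocalModel (ℝ × E) (ℝ × F)} {δ : ℝ}
    {B : Set E} (h : C.IsStraight δ B) :
    C.IsHom (LocalModel.quot h) C.dom Prod.snd (fun _ => ContinuousLinearMap.snd ℝ ℝ F) where
  isOpen := C.isOpen_dom
  mapsTo p hp := h.snd_mem hp
  contDiffOn_base := contDiff_snd.contDiffOn
  contDiffOn_fiber := contDiffOn_const
  surjective y hy v := ⟨(0, v), by rw [fderiv_snd]; rfl⟩
  anchor y hy k := by
    rw [fderiv_snd, h.anchor_apply hy]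
    rfl
  cartesian y hy k' X hX := by
    rw [fderiv_snd] at hX
    refine ⟨(X.1, k'), ⟨rfl, ?_⟩, ?_⟩
    · rw [h.anchor_apply hy]
      exact Prod.ext rfl hX
    · rintro k ⟨hk, rfl⟩
      exact Prod.ext (h.anchor_fst_apply hy k).symm hk
  tensor y hy k l := by
    rw [h.tensor_apply hy, (hasFDerivAt_const _ y).fderiv]
    simp [LocalModel.quot]

end StraightenedModel

/-! ### The flow of a constant section and the frame adapted to it. -/

noncomputable section Straightening

attribute [-instance]
  Bundle.instNormedAddCommGroupOfRiemannianBundleOfIsTopologicalAddGroupOfContinuousConstSMulReal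

universe u v

theorem exists_continuousLinearEquiv_of_bijective {E F : Type*} [NormedAddCommGroup E]
    [NormedSpace ℝ E] [FiniteDimensional ℝ E] [NormedAddCommGroup F] [NormedSpace ℝ F]
    (f : E →L[ℝ] F) (hf : Function.Bijective f) : ∃ T : E ≃L[ℝ] F, (T : E →L[ℝ] F) = f :=
  ⟨(LinearEquiv.ofBijective (f : E →ₗ[ℝ] F) hf).toContinuousLinearEquiv, by ext; rfl⟩

/-- For a functional `l` with `l x₀ = 1`, the decomposition of a space along `x₀` and `ker l`. -/
theorem bijective_smulRight_add_subtype {E : Type*} [NormedAddCommGroup E] [NormedSpace ℝ E]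
    (l : E →L[ℝ] ℝ) {x₀ : E} (h : l x₀ = 1) :
    Function.Bijective fun p : ℝ × l.ker => p.1 • x₀ + (p.2 : E) := by
  refine ⟨fun p q hpq => ?_, fun x => ⟨(l x, ⟨x - l x • x₀, by simp [h]⟩), by simp⟩⟩
  simp only at hpq
  have h0 : ∀ r : l.ker, l r = 0 := fun r => r.2
  have h1 : p.1 = q.1 := by simpa [h, h0] using congrArg l hpq
  rw [h1] at hpq
  exact Prod.ext h1 (Subtype.ext (add_left_cancel hpq))

theorem exists_box_subset {E : Type*} [NormedAddCommGroup E] {S : Set (ℝ × E)} (hS : IsOpen S)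
    (h0 : (0 : ℝ × E) ∈ S) :
    ∃ δ > 0, ∃ B : Set E, IsOpen B ∧ 0 ∈ B ∧ Ioo (-δ) δ ×ˢ B ⊆ S := by
  obtain ⟨u, v, hu, hv, h0u, h0v, huv⟩ := isOpen_prod_iff.1 hS 0 0 h0
  obtain ⟨δ, hδ, hb⟩ := Metric.isOpen_iff.1 hu 0 h0u
  refine ⟨δ, hδ, v, hv, h0v, (prod_mono_left ?_).trans huv⟩
  rw [Real.ball_eq_Ioo, zero_sub, zero_add] at hb
  exact hb

section

variable {E : Type u} {F : Type v} [NormedAddCommGroup E] [NormedSpace ℝ E] [NormedAddCommGroup F]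
  [NormedSpace ℝ F]

/-- The flow of a constant section `a` of a local model, together with the parallel frame. -/
structure LocalModel.IsSectionFlow (C : LocalModel E F) (a : F) (y₀ : E) (S : Submodule ℝ E)
    (D : Set (ℝ × S)) (H : ℝ × S → E) (g : ℝ × S → F →L[ℝ] F) : Prop where
  isOpen : IsOpen D
  zero_mem : 0 ∈ D
  mapsTo : MapsTo H D C.dom
  contDiffOn_base : ContDiffOn ℝ ∞ H D
  contDiffOn_frame : ContDiffOn ℝ ∞ g D
  base_zero : ∀ y : S, (0, y) ∈ D → H (0, y) = y₀ + y
  frame_zero : ∀ y : S, (0, y) ∈ D → g (0, y) = ContinuousLinearMap.id ℝ F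
  hasDerivAt_base : ∀ p ∈ D, HasDerivAt (fun s => H (s, p.2)) (C.anchor (H p) a) p.1
  hasDerivAt_frame : ∀ p ∈ D,
    HasDerivAt (fun s => g (s, p.2)) (-(C.tensor (H p) a).comp (g p)) p.1

theorem LocalModel.exists_isSectionFlow [FiniteDimensional ℝ E] [FiniteDimensional ℝ F]
    (C : LocalModel E F) (a : F) {y₀ : E} (hy₀ : y₀ ∈ C.dom) (S : Submodule ℝ E) :
    ∃ D H g, C.IsSectionFlow a y₀ S D H g := by
  -- One autonomous system for the base point and the frame. The second equation says that the
  -- bracket of `a` with the moving frame vanishes along the flow.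
  let Z : E × (F →L[ℝ] F) → E × (F →L[ℝ] F) :=
    fun p => (C.anchor p.1 a, -(C.tensor p.1 a).comp p.2)
  let U : Set (E × (F →L[ℝ] F)) := C.dom ×ˢ univ
  have hU : IsOpen U := C.isOpen_dom.prod isOpen_univ
  have hfst : ContDiffOn ℝ ∞ (Prod.fst : E × (F →L[ℝ] F) → E) U := contDiff_fst.contDiffOn
  have hm : MapsTo (Prod.fst : E × (F →L[ℝ] F) → E) U C.dom := fun p hp => hp.1
  have hZ : ContDiffOn ℝ ∞ Z U := by
    refine ((C.contDiffOn_anchor.comp hfst hm).clm_apply contDiffOn_const).prodMk ?_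
    exact (((C.contDiffOn_tensor.comp hfst hm).clm_apply contDiffOn_const).clm_comp
      contDiff_snd.contDiffOn).neg
  obtain ⟨ε, hε, V, hV, h0V, Φ, hΦ, hflow⟩ := exists_contDiffOn_flow hU hZ
    (x₀ := (y₀, ContinuousLinearMap.id ℝ F)) ⟨hy₀, mem_univ _⟩
  let i : S → E × (F →L[ℝ] F) := fun y => (y₀ + y, ContinuousLinearMap.id ℝ F)
  have hi : ContDiff ℝ ∞ i := (contDiff_const.add S.subtypeL.contDiff).prodMk contDiff_const
  let j : ℝ × S → ℝ × (E × (F →L[ℝ] F)) := fun p => (p.1, i p.2)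
  have hj : ContDiff ℝ ∞ j := contDiff_fst.prodMk (hi.comp contDiff_snd)
  have hjD : ContDiffOn ℝ ∞ (Φ ∘ j) (j ⁻¹' (Ioo (-ε) ε ×ˢ V)) :=
    hΦ.comp hj.contDiffOn (mapsTo_preimage _ _)
  refine ⟨j ⁻¹' (Ioo (-ε) ε ×ˢ V), fun p => (Φ (j p)).1, fun p => (Φ (j p)).2,
    (isOpen_Ioo.prod hV).preimage hj.continuous, ?_, ?_, contDiff_fst.comp_contDiffOn hjD,
    contDiff_snd.comp_contDiffOn hjD, ?_, ?_, ?_, ?_⟩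
  · refine ⟨⟨by simpa [j] using hε, by simpa [j] using hε⟩, ?_⟩
    simpa [j, i] using h0V
  · intro p hp
    exact ((hflow _ hp.2).2 _ hp.1).1.1
  · intro y hy
    change (Φ (0, i y)).1 = _
    rw [(hflow _ hy.2).1]
  · intro y hy
    change (Φ (0, i y)).2 = _
    rw [(hflow _ hy.2).1]
  · intro p hp
    exact (hasFDerivAt_fst.comp_hasDerivAt p.1 ((hflow _ hp.2).2 _ hp.1).2)
  · intro p hp
    exact (hasFDerivAt_snd.comp_hasDerivAt p.1 ((hflow _ hp.2).2 _ hp.1).2)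

/-- The frame adapted to the flow of a constant section. -/
def adaptedFrame (C : LocalModel E F) (a : F) (y₀ : E) (l : E →L[ℝ] ℝ) (S : Submodule ℝ E)
    (T : Submodule ℝ F) (g : ℝ × S → F →L[ℝ] F) (p : ℝ × S) : ℝ × T →L[ℝ] F :=
  (ContinuousLinearMap.fst ℝ ℝ T).smulRight a + (g p).comp
    ((ContinuousLinearMap.id ℝ F - (l (C.anchor (y₀ + p.2) a))⁻¹ •
      (l.comp (C.anchor (y₀ + p.2))).smulRight a).comp
        (T.subtypeL.comp (ContinuousLinearMap.snd ℝ ℝ T)))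

theorem adaptedFrame_apply (C : LocalModel E F) (a : F) (y₀ : E) (l : E →L[ℝ] ℝ)
    (S : Submodule ℝ E) (T : Submodule ℝ F) (g : ℝ × S → F →L[ℝ] F) (p : ℝ × S) (k : ℝ × T) :
    adaptedFrame C a y₀ l S T g p k = k.1 • a + g p (k.2 - (l (C.anchor (y₀ + p.2) a))⁻¹ •
      l (C.anchor (y₀ + p.2) k.2) • a) := rfl

end

section

variable {E F : Type*} [NormedAddCommGroup E] [NormedSpace ℝ E] [NormedAddCommGroup F]
  [NormedSpace ℝ F] {C : LocalModel E F} {a : F} {y₀ : E} {l : E →L[ℝ] ℝ}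
  {D : Set (ℝ × l.ker)} {H : ℝ × l.ker → E} {g : ℝ × l.ker → F →L[ℝ] F}

theorem LocalModel.IsSectionFlow.fderiv_one (h : C.IsSectionFlow a y₀ l.ker D H g)
    {p : ℝ × l.ker} (hp : p ∈ D) : fderiv ℝ H p (1, 0) = C.anchor (H p) a := by
  have h1 : HasDerivAt (fun t : ℝ => (t, p.2)) ((1 : ℝ), (0 : l.ker)) p.1 :=
    (hasDerivAt_id _).prodMk (hasDerivAt_const _ _)
  have h2 := (h.contDiffOn_base.differentiableAt_of_isOpen h.isOpen hp).hasFDerivAt.comp_hasDerivAt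
    p.1 h1
  exact h2.unique (h.hasDerivAt_base p hp)

theorem LocalModel.IsSectionFlow.fderiv_zero (h : C.IsSectionFlow a y₀ l.ker D H g)
    {y : l.ker} (hy : (0, y) ∈ D) (v : ℝ × l.ker) :
    fderiv ℝ H (0, y) v = v.1 • C.anchor (y₀ + y) a + v.2 := by
  have h1 : HasFDerivAt (fun z : l.ker => ((0 : ℝ), z)) (ContinuousLinearMap.inr ℝ ℝ l.ker) y :=
    hasFDerivAt_prodMk_right 0 y
  have hH := (h.contDiffOn_base.differentiableAt_of_isOpen h.isOpen hy).hasFDerivAt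
  have h2 := hH.comp y h1
  have h3 : (H ∘ fun z : l.ker => ((0 : ℝ), z)) =ᶠ[𝓝 y] fun z => y₀ + z := by
    have hc : ContinuousAt (fun z : l.ker => ((0 : ℝ), z)) y := h1.continuousAt
    filter_upwards [hc.preimage_mem_nhds (h.isOpen.mem_nhds hy)] with z hz
    exact h.base_zero z hz
  have h4 : HasFDerivAt (fun z : l.ker => y₀ + (z : E)) l.ker.subtypeL y :=
    l.ker.subtypeL.hasFDerivAt.const_add y₀
  have h5 := DFunLike.congr_fun (h2.unique (h4.congr_of_eventuallyEq h3)) v.2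
  have h6 : fderiv ℝ H (0, y) (0, v.2) = v.2 := h5
  have h7 := h.fderiv_one hy
  rw [h.base_zero y hy] at h7
  have h8 : v = v.1 • ((1 : ℝ), (0 : l.ker)) + (0, v.2) := by ext <;> simp
  conv_lhs => rw [h8, map_add, map_smul, h6, h7]

/-- The correction by a multiple of `a` depends only on the point of the slice, so along the flow a
fixed vector is carried by the parallel frame `g`. -/
theorem LocalModel.IsSectionFlow.fderiv_frame (h : C.IsSectionFlow a y₀ l.ker D H g)
    {p : ℝ × l.ker} (hp : p ∈ D) (T : Submodule ℝ F)
    (hG : DifferentiableAt ℝ (adaptedFrame C a y₀ l l.ker T g) p) (k : T) :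
    fderiv ℝ (adaptedFrame C a y₀ l l.ker T g) p (1, 0) (0, k) =
      -C.tensor (H p) a (adaptedFrame C a y₀ l l.ker T g p (0, k)) := by
  have h1 : HasDerivAt (fun t : ℝ => (t, p.2)) ((1 : ℝ), (0 : l.ker)) p.1 :=
    (hasDerivAt_id _).prodMk (hasDerivAt_const _ _)
  obtain ⟨G, hGdef⟩ : ∃ G, G = adaptedFrame C a y₀ l l.ker T g := ⟨_, rfl⟩
  obtain ⟨w, hw⟩ : ∃ w : F, ∀ t, G (t, p.2) (0, k) = g (t, p.2) w :=
    ⟨(k : F) - (l (C.anchor (y₀ + p.2) a))⁻¹ • l (C.anchor (y₀ + p.2) k) • a, fun t => by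
      rw [hGdef, adaptedFrame_apply, zero_smul, zero_add]⟩
  rw [← hGdef] at hG ⊢
  have h2 : HasDerivAt (fun t => G (t, p.2)) (fderiv ℝ G p (1, 0)) p.1 :=
    HasFDerivAt.comp_hasDerivAt (l := G) p.1 hG.hasFDerivAt h1
  have h3 := h2.clm_apply (hasDerivAt_const p.1 ((0 : ℝ), k))
  have h4 := (h.hasDerivAt_frame p hp).clm_apply (hasDerivAt_const p.1 w)
  rw [map_zero, add_zero] at h3 h4
  rw [funext hw] at h3
  rw [h3.unique h4, hw p.1]
  rfl

/-- The inverse of `l (C.anchor (y₀ + p.2) a)` is smooth only where this number is nonzero, that is,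
where the section stays transverse to the slice. -/
theorem LocalModel.IsSectionFlow.contDiffOn_adaptedFrame (h : C.IsSectionFlow a y₀ l.ker D H g)
    (T : Submodule ℝ F) {D' : Set (ℝ × l.ker)} (hD' : D' ⊆ D)
    (hdom : ∀ p ∈ D', y₀ + p.2 ∈ C.dom ∧ l (C.anchor (y₀ + p.2) a) ≠ 0) :
    ContDiffOn ℝ ∞ (adaptedFrame C a y₀ l l.ker T g) D' := by
  have h1 : ContDiff ℝ ∞ (fun p : ℝ × l.ker => y₀ + (p.2 : E)) :=
    contDiff_const.add (l.ker.subtypeL.contDiff.comp contDiff_snd)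
  have h2 : ContDiffOn ℝ ∞ (fun p : ℝ × l.ker => C.anchor (y₀ + p.2)) D' :=
    C.contDiffOn_anchor.comp h1.contDiffOn fun p hp => (hdom p hp).1
  refine contDiffOn_const.add ((h.contDiffOn_frame.mono hD').clm_comp
    (ContDiffOn.clm_comp (contDiffOn_const.sub (ContDiffOn.fun_smul ?_ ?_)) contDiffOn_const))
  · exact (l.contDiff.comp_contDiffOn (h2.clm_apply contDiffOn_const)).inv fun p hp => (hdom p hp).2
  · exact (contDiffOn_const.clm_comp h2).smulRight contDiffOn_const

end

end Straightening

/-! ### Straightening a model where its anchor does not vanish. -/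

noncomputable section StraighteningStep

attribute [-instance]
  Bundle.instNormedAddCommGroupOfRiemannianBundleOfIsTopologicalAddGroupOfContinuousConstSMulReal

section

variable {E F : Type*} [NormedAddCommGroup E] [NormedSpace ℝ E] [NormedAddCommGroup F]
  [NormedSpace ℝ F] {C : LocalModel E F} {a : F} {y₀ : E} {l : E →L[ℝ] ℝ}
  {D : Set (ℝ × l.ker)} {H : ℝ × l.ker → E} {g : ℝ × l.ker → F →L[ℝ] F}

/-- At the origin, the derivative of the flow map and the adapted frame are the decompositions of
`E` along `l` and of `F` along `l ∘ C.anchor y₀`. Both are invertible since `l (C.anchor y₀ a) = 1`.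
Openness of invertibility and a small box do the rest. -/
theorem LocalModel.IsSectionFlow.exists_isFrameChange [FiniteDimensional ℝ E]
    [FiniteDimensional ℝ F] (h : C.IsSectionFlow a y₀ l.ker D H g) (hy₀ : y₀ ∈ C.dom)
    (hl : l (C.anchor y₀ a) = 1) :
    ∃ (e : OpenPartialHomeomorph (ℝ × l.ker) E) (G' : ℝ × l.ker → F →L[ℝ] ℝ × (l.comp (C.anchor y₀)).ker)
      (δ : ℝ) (B : Set l.ker), 0 < δ ∧ IsOpen B ∧ 0 ∈ B ∧ e.source = Ioo (-δ) δ ×ˢ B ∧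
      (∀ p, e p = H p) ∧ e.source ⊆ D ∧
      (∀ y ∈ B, y₀ + y ∈ C.dom ∧ l (C.anchor (y₀ + y) a) ≠ 0) ∧
      IsFrameChange e (adaptedFrame C a y₀ l l.ker (l.comp (C.anchor y₀)).ker g) G' := by
  set T := (l.comp (C.anchor y₀)).ker
  set G := adaptedFrame C a y₀ l l.ker T g with hG
  have h0D := h.zero_mem
  have hbase : ContDiff ℝ ∞ (fun p : ℝ × l.ker => y₀ + (p.2 : E)) :=
    contDiff_const.add (l.ker.subtypeL.contDiff.comp contDiff_snd)
  have hDH : Function.Bijective (fderiv ℝ H 0) := by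
    convert bijective_smulRight_add_subtype l hl using 1
    ext v
    have := h.fderiv_zero (y := 0) h0D v
    rw [Submodule.coe_zero, add_zero] at this
    exact this
  obtain ⟨TH, hTH⟩ := exists_continuousLinearEquiv_of_bijective _ hDH
  have hG0 : Function.Bijective (G 0) := by
    convert bijective_smulRight_add_subtype (l.comp (C.anchor y₀)) hl using 1
    ext v
    have hv : l (C.anchor y₀ v.2) = 0 := v.2.2
    rw [hG, adaptedFrame_apply, Prod.snd_zero, Submodule.coe_zero, add_zero, hv, zero_smul,
      smul_zero, sub_zero]
    have := h.frame_zero 0 h0D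
    rw [Prod.mk_zero_zero] at this
    rw [this]
    rfl
  obtain ⟨TG, hTG⟩ := exists_continuousLinearEquiv_of_bijective _ hG0
  let D₁ : Set (ℝ × l.ker) := D ∩ (fun p : ℝ × l.ker => y₀ + (p.2 : E)) ⁻¹'
    (C.dom ∩ (fun y => l (C.anchor y a)) ⁻¹' {0}ᶜ)
  have hD₁ : IsOpen D₁ := by
    refine h.isOpen.inter (IsOpen.preimage hbase.continuous ?_)
    exact (l.continuous.comp_continuousOn
      (C.contDiffOn_anchor.continuousOn.clm_apply continuousOn_const)).isOpen_inter_preimage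
      C.isOpen_dom isOpen_compl_singleton
  have h0D₁ : (0 : ℝ × l.ker) ∈ D₁ := by
    refine ⟨h0D, ?_⟩
    simp [hy₀, hl]
  have hGs : ContDiffOn ℝ ∞ G D₁ :=
    h.contDiffOn_adaptedFrame T inter_subset_left fun p hp => ⟨hp.2.1, hp.2.2⟩
  let D₂ : Set (ℝ × l.ker) :=
    D₁ ∩ G ⁻¹' range ((↑) : ((ℝ × T) ≃L[ℝ] F) → ((ℝ × T) →L[ℝ] F))
  have hD₂ : IsOpen D₂ := hGs.continuousOn.isOpen_inter_preimage hD₁ ContinuousLinearEquiv.isOpen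
  have h0D₂ : (0 : ℝ × l.ker) ∈ D₂ := ⟨h0D₁, TG, hTG⟩
  have hsub : D₂ ⊆ D := fun p hp => hp.1.1
  have hH0 : HasFDerivAt H (TH : (ℝ × l.ker) →L[ℝ] E) 0 := by
    rw [hTH]
    exact (h.contDiffOn_base.differentiableAt_of_isOpen h.isOpen h0D).hasFDerivAt
  obtain ⟨e, he, h0e, hes, hesymm, -⟩ := exists_openPartialHomeomorph_of_hasFDerivAt hD₂
    (h.contDiffOn_base.mono hsub) h0D₂ TH hH0
  obtain ⟨δ, hδ, B, hB, h0B, hbox⟩ := exists_box_subset e.open_source h0e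
  have hes' : (e.restrOpen (Ioo (-δ) δ ×ˢ B) (isOpen_Ioo.prod hB)).source = Ioo (-δ) δ ×ˢ B := by
    rw [OpenPartialHomeomorph.restrOpen_source, inter_eq_right.2 hbox]
  have hsD₂ : (e.restrOpen (Ioo (-δ) δ ×ˢ B) (isOpen_Ioo.prod hB)).source ⊆ D₂ := hes'.trans_subset (hbox.trans hes)
  refine ⟨e.restrOpen (Ioo (-δ) δ ×ˢ B) (isOpen_Ioo.prod hB), fun p => (G p).inverse, δ, B, hδ, hB, h0B, hes', he,
    hsD₂.trans hsub, fun y hy => ?_, ?_, ?_, ?_, ?_, ?_, ?_⟩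
  · have : ((0 : ℝ), y) ∈ D₂ := hes (hbox ⟨⟨by simpa using hδ, hδ⟩, hy⟩)
    exact this.1.2
  · exact ((h.contDiffOn_base.mono hsub).mono hsD₂).congr fun p _ => he p
  · refine hesymm.mono fun x hx => ?_
    have hx' := hx
    simp only [mfld_simps] at hx'
    exact hx'.1
  · exact hGs.mono fun p hp => (hsD₂ hp).1
  · intro p hp
    obtain ⟨A, hA⟩ := (hsD₂ hp).2
    have h1 : ContDiffAt ℝ ∞ ContinuousLinearMap.inverse (G p) := by
      rw [← hA]
      exact contDiffAt_map_inverse A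
    exact (h1.comp p (hGs.contDiffAt (hD₁.mem_nhds (hsD₂ hp).1))).contDiffWithinAt
  · intro p hp k
    obtain ⟨A, hA⟩ := (hsD₂ hp).2
    rw [← hA, ContinuousLinearMap.inverse_equiv]
    exact A.symm_apply_apply k
  · intro p hp k
    obtain ⟨A, hA⟩ := (hsD₂ hp).2
    rw [← hA, ContinuousLinearMap.inverse_equiv]
    exact A.apply_symm_apply k

/-- Flow coordinates turn the anchor of `a` into `∂/∂t`, parallelism makes the frame commute with
`a`, and the correction by multiples of `a` makes the remaining anchors tangent to the slice at `t =
0`. -/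
theorem LocalModel.IsSectionFlow.isStraight [FiniteDimensional ℝ E] [FiniteDimensional ℝ F]
    (h : C.IsSectionFlow a y₀ l.ker D H g) {e : OpenPartialHomeomorph (ℝ × l.ker) E}
    {T : Submodule ℝ F} {G' : ℝ × l.ker → F →L[ℝ] ℝ × T} {δ : ℝ} {B : Set l.ker} (hδ : 0 < δ)
    (hB : IsOpen B) (hes : e.source = Ioo (-δ) δ ×ˢ B) (he : ∀ p, e p = H p) (heD : e.source ⊆ D)
    (hy : ∀ y ∈ B, y₀ + y ∈ C.dom ∧ l (C.anchor (y₀ + y) a) ≠ 0)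
    (hf : IsFrameChange e (adaptedFrame C a y₀ l l.ker T g) G') (hC : e.target ⊆ C.dom) :
    (C.transport hf hC).IsStraight δ B := by
  have hd : (e : ℝ × l.ker → E) = H := funext he
  have hG1 : ∀ p, adaptedFrame C a y₀ l l.ker T g p (1, 0) = a := fun p => by
    simp [adaptedFrame_apply]
  have h1 : ∀ p ∈ e.source,
      transportAnchor C e (adaptedFrame C a y₀ l l.ker T g) p (1, 0) = (1, 0) := fun p hp => by
    rw [transportAnchor, ContinuousLinearMap.comp_apply, ContinuousLinearMap.comp_apply, hG1]
    have h2 := h.fderiv_one (heD hp)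
    rw [← hd] at h2
    rw [← h2, hf.fderiv_symm_fderiv hp]
  refine ⟨hδ, hB, hes, h1, fun p hp k => ?_, fun y hyB k => ?_⟩
  · change transportTensor C e _ G' p (1, 0) (0, k) = 0
    have hGd := hf.contDiffOn_frame.differentiableAt_of_isOpen e.open_source hp
    rw [transportTensor_apply, h1 p hp, h.fderiv_frame (heD hp) T hGd k, hG1, he]
    have h3 : ∀ v, fderiv ℝ (adaptedFrame C a y₀ l l.ker T g) p v (1, 0) = 0 := fun v => by
      have h4 := fderiv_clm_apply hGd (differentiableAt_const ((1 : ℝ), (0 : T)))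
      rw [funext hG1] at h4
      have h5 := DFunLike.congr_fun h4 v
      simpa using h5.symm
    rw [h3, sub_zero, add_neg_cancel, map_zero]
  · have hp : ((0 : ℝ), y) ∈ e.source := hes ▸ ⟨⟨by simpa using hδ, hδ⟩, hyB⟩
    change (transportAnchor C e (adaptedFrame C a y₀ l l.ker T g) (0, y) (0, k)).1 = 0
    set v := transportAnchor C e (adaptedFrame C a y₀ l l.ker T g) (0, y) (0, k) with hv
    have h2 := fderiv_transportAnchor C hf hp (0, k)
    rw [← hv, hd, h.fderiv_zero (heD hp), h.base_zero y (heD hp), adaptedFrame_apply,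
      h.frame_zero y (heD hp)] at h2
    -- Applying `l` isolates the time component: `l` kills the slice directions and the anchor of
    -- the corrected vector.
    have h3 := congrArg l h2
    have h4 : l (v.2 : E) = 0 := v.2.2
    have h5 := (hy y hyB).2
    simp only [map_add, map_smul, map_sub, h4, zero_smul, zero_add, smul_eq_mul, add_zero,
      ContinuousLinearMap.id_apply] at h3
    rw [mul_comm (l _)⁻¹, mul_assoc, mul_inv_cancel₀ h5, mul_one, sub_self] at h3
    exact (mul_eq_zero.1 h3).resolve_right h5

end

/-- Near a point where the anchor does not vanish, a local model is a product of an interval and a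
local model of smaller dimension. -/
theorem LocalModel.exists_isHom_of_anchor_ne_zero {E F : Type*} [NormedAddCommGroup E]
    [NormedSpace ℝ E] [NormedAddCommGroup F] [NormedSpace ℝ F] [FiniteDimensional ℝ E]
    [FiniteDimensional ℝ F] (C : LocalModel E F) {y₀ : E} (hy₀ : y₀ ∈ C.dom)
    (ha : C.anchor y₀ ≠ 0) :
    ∃ (S : Submodule ℝ E) (T : Submodule ℝ F), S ≠ ⊤ ∧
      ∃ (C₁ : LocalModel (ℝ × S) (ℝ × T)) (C' : LocalModel S T) (W : Set E) (u : E → ℝ × S)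
        (θ : E → F →L[ℝ] ℝ × T), C.IsHom C₁ W u θ ∧ y₀ ∈ W ∧
          C₁.IsHom C' C₁.dom Prod.snd (fun _ => ContinuousLinearMap.snd ℝ ℝ T) := by
  obtain ⟨a, ha⟩ : ∃ a, C.anchor y₀ a ≠ 0 := by
    by_contra! hcon
    exact ha (ContinuousLinearMap.ext hcon)
  -- The slice is `ker l`; it is a proper subspace because `l` does not vanish on the anchor of `a`,
  -- which is what lowers the dimension.
  obtain ⟨l, hl⟩ := SeparatingDual.exists_eq_one (R := ℝ) ha
  obtain ⟨D, H, g, h⟩ := C.exists_isSectionFlow a hy₀ l.ker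
  obtain ⟨e, G', δ, B, hδ, hB, h0B, hes, he, heD, hy, hf⟩ := h.exists_isFrameChange hy₀ hl
  have hC : e.target ⊆ C.dom := by
    rw [← e.image_source_eq_target]
    rintro _ ⟨p, hp, rfl⟩
    rw [he]
    exact h.mapsTo (heD hp)
  have hst := h.isStraight hδ hB hes he heD hy hf hC
  have h0 : (0 : ℝ × l.ker) ∈ e.source := hes ▸ ⟨⟨by simpa using hδ, hδ⟩, h0B⟩
  have hy0e : y₀ = e 0 := by
    have := h.base_zero 0 (heD h0)
    rw [Submodule.coe_zero, add_zero] at this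
    rw [he]
    exact this.symm
  refine ⟨l.ker, _, ?_, C.transport hf hC, LocalModel.quot hst, _, _, _, C.isHom_transport hf hC,
    hy0e ▸ e.map_source h0, LocalModel.isHom_quot hst⟩
  intro htop
  have : C.anchor y₀ a ∈ l.ker := htop ▸ Submodule.mem_top
  rw [LinearMap.mem_ker] at this
  exact one_ne_zero (hl.symm.trans this)

end StraighteningStep

/-! ### Derivatives of vector-valued functions on manifolds. -/

noncomputable section ManifoldCalculus

attribute [-instance]
  Bundle.instNormedAddCommGroupOfRiemannianBundleOfIsTopologicalAddGroupOfContinuousConstSMulReal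

variable {E : Type*} [NormedAddCommGroup E] [NormedSpace ℝ E]
  {M : Type*} [TopologicalSpace M] [ChartedSpace E M]
  {E₁ : Type*} [NormedAddCommGroup E₁] [NormedSpace ℝ E₁]
  {N : Type*} [TopologicalSpace N] [ChartedSpace E₁ N]
  {V W : Type*} [NormedAddCommGroup V] [NormedSpace ℝ V] [NormedAddCommGroup W] [NormedSpace ℝ W]

theorem ContMDiffOn.mdifferentiableAt_of_isOpen {f : M → N} {U : Set M}
    (hf : ContMDiffOn 𝓘(ℝ, E) 𝓘(ℝ, E₁) ∞ f U) (hU : IsOpen U) {x : M} (hx : x ∈ U) :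
    MDifferentiableAt 𝓘(ℝ, E) 𝓘(ℝ, E₁) f x :=
  (hf.contMDiffAt (hU.mem_nhds hx)).mdifferentiableAt (by simp)

theorem mvfderiv_eq_fderiv (f : E → V) (x v : E) : mvfderiv 𝓘(ℝ, E) f x v = fderiv ℝ f x v :=
  DFunLike.congr_fun (mfderiv_eq_fderiv (f := f) (x := x)) v

theorem mvfderiv_comp_mfderiv {f : M → N} {g : N → V} {x : M}
    (hg : MDifferentiableAt 𝓘(ℝ, E₁) 𝓘(ℝ, V) g (f x))
    (hf : MDifferentiableAt 𝓘(ℝ, E) 𝓘(ℝ, E₁) f x) (v : TangentSpace 𝓘(ℝ, E) x) :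
    mvfderiv 𝓘(ℝ, E) (fun y => g (f y)) x v =
      mvfderiv 𝓘(ℝ, E₁) g (f x) (mfderiv 𝓘(ℝ, E) 𝓘(ℝ, E₁) f x v) :=
  mfderiv_comp_apply x hg hf v

theorem mvfderiv_comp_fderiv {f : M → V} {g : V → W} {x : M}
    (hg : DifferentiableAt ℝ g (f x)) (hf : MDifferentiableAt 𝓘(ℝ, E) 𝓘(ℝ, V) f x)
    (v : TangentSpace 𝓘(ℝ, E) x) :
    mvfderiv 𝓘(ℝ, E) (fun y => g (f y)) x v = fderiv ℝ g (f x) (mvfderiv 𝓘(ℝ, E) f x v) :=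
  (mvfderiv_comp_mfderiv hg.mdifferentiableAt hf v).trans (mvfderiv_eq_fderiv g (f x) _)

theorem Filter.EventuallyEq.mvfderiv_eq {f g : M → V} {x : M} (h : f =ᶠ[𝓝 x] g)
    (v : TangentSpace 𝓘(ℝ, E) x) : mvfderiv 𝓘(ℝ, E) f x v = mvfderiv 𝓘(ℝ, E) g x v := by
  have := DFunLike.congr_fun (h.mfderiv_eq (I := 𝓘(ℝ, E)) (I' := 𝓘(ℝ, V))) v
  exact this

theorem mvfderiv_prodMk {f : M → V} {g : M → W} {x : M}
    (hf : MDifferentiableAt 𝓘(ℝ, E) 𝓘(ℝ, V) f x) (hg : MDifferentiableAt 𝓘(ℝ, E) 𝓘(ℝ, W) g x)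
    (v : TangentSpace 𝓘(ℝ, E) x) :
    mvfderiv 𝓘(ℝ, E) (fun y => (f y, g y)) x v =
      (mvfderiv 𝓘(ℝ, E) f x v, mvfderiv 𝓘(ℝ, E) g x v) := by
  have hfg : MDifferentiableAt 𝓘(ℝ, E) 𝓘(ℝ, V × W) (fun y => (f y, g y)) x := hf.prodMk_space hg
  have h1 := mvfderiv_comp_fderiv (g := Prod.fst) differentiableAt_fst hfg v
  have h2 := mvfderiv_comp_fderiv (g := Prod.snd) differentiableAt_snd hfg v
  rw [fderiv_fst] at h1
  rw [fderiv_snd] at h2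
  exact Prod.ext h1.symm h2.symm

theorem mvfderiv_clm_apply {f : M → V →L[ℝ] W} {g : M → V} {x : M}
    (hf : MDifferentiableAt 𝓘(ℝ, E) 𝓘(ℝ, V →L[ℝ] W) f x)
    (hg : MDifferentiableAt 𝓘(ℝ, E) 𝓘(ℝ, V) g x) (v : TangentSpace 𝓘(ℝ, E) x) :
    mvfderiv 𝓘(ℝ, E) (fun y => f y (g y)) x v =
      mvfderiv 𝓘(ℝ, E) f x v (g x) + f x (mvfderiv 𝓘(ℝ, E) g x v) := by
  have hfg : MDifferentiableAt 𝓘(ℝ, E) 𝓘(ℝ, (V →L[ℝ] W) × V) (fun y => (f y, g y)) x :=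
    hf.prodMk_space hg
  have hev : HasFDerivAt (fun p : (V →L[ℝ] W) × V => p.1 p.2) _ (f x, g x) :=
    (hasFDerivAt_fst).clm_apply hasFDerivAt_snd
  have h1 := mvfderiv_comp_fderiv (f := fun y => (f y, g y))
    (g := fun p : (V →L[ℝ] W) × V => p.1 p.2)
    hev.differentiableAt hfg v
  rw [hev.fderiv, mvfderiv_prodMk hf hg] at h1
  rw [h1, add_comm]
  rfl

section

variable [IsManifold 𝓘(ℝ, E) ∞ M]

/-- The derivative of a smooth function along a smooth vector field along a map is smooth. -/
theorem contMDiffOn_mvfderiv_apply {f : M → V} {U : Set M} (hU : IsOpen U)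
    (hf : ContMDiffOn 𝓘(ℝ, E) 𝓘(ℝ, V) ∞ f U) {E₂ H₂ : Type*} [NormedAddCommGroup E₂]
    [NormedSpace ℝ E₂] [TopologicalSpace H₂] {I₂ : ModelWithCorners ℝ E₂ H₂} {P : Type*}
    [TopologicalSpace P] [ChartedSpace H₂ P] {S : Set P} {X : P → TangentBundle 𝓘(ℝ, E) M}
    (hX : ContMDiffOn I₂ 𝓘(ℝ, E).tangent ∞ X S) (hXU : ∀ y ∈ S, (X y).proj ∈ U) :
    ContMDiffOn I₂ 𝓘(ℝ, V) ∞ (fun y => mvfderiv 𝓘(ℝ, E) f (X y).proj (X y).snd) S := by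
  have h1 : ContMDiffOn 𝓘(ℝ, E).tangent 𝓘(ℝ, V).tangent ∞
      (tangentMapWithin 𝓘(ℝ, E) 𝓘(ℝ, V) f U) (TotalSpace.proj ⁻¹' U) :=
    hf.contMDiffOn_tangentMapWithin (by simp) hU.uniqueMDiffOn
  have h2 := (contMDiff_snd_tangentBundle_modelSpace (n := ∞) V 𝓘(ℝ, V)).comp_contMDiffOn
    (h1.comp hX fun y hy => hXU y hy)
  refine h2.congr fun y hy => ?_
  change _ = mfderivWithin 𝓘(ℝ, E) 𝓘(ℝ, V) f U (X y).proj (X y).snd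
  rw [mfderivWithin_of_isOpen hU (hXU y hy)]
  rfl

variable [CompleteSpace E]

/-- The formula `[X, Y] f = X Y f - Y X f`, proved in a chart, where the coordinate representatives
`R X` of the fields have the bracket that defines `mlieBracket`. Applied to charts, it is later used
to compute brackets in coordinates. -/
theorem mvfderiv_mlieBracket {f : M → V} {U : Set M} (hU : IsOpen U)
    (hf : ContMDiffOn 𝓘(ℝ, E) 𝓘(ℝ, V) ∞ f U) {X Y : ∀ x : M, TangentSpace 𝓘(ℝ, E) x}
    (hX : ContMDiffOn 𝓘(ℝ, E) 𝓘(ℝ, E).tangent ∞ (fun x => (⟨x, X x⟩ : TangentBundle 𝓘(ℝ, E) M)) U)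
    (hY : ContMDiffOn 𝓘(ℝ, E) 𝓘(ℝ, E).tangent ∞ (fun x => (⟨x, Y x⟩ : TangentBundle 𝓘(ℝ, E) M)) U)
    {x : M} (hx : x ∈ U) :
    mvfderiv 𝓘(ℝ, E) f x (VectorField.mlieBracket 𝓘(ℝ, E) X Y x) =
      mvfderiv 𝓘(ℝ, E) (fun y => mvfderiv 𝓘(ℝ, E) f y (Y y)) x (X x) -
        mvfderiv 𝓘(ℝ, E) (fun y => mvfderiv 𝓘(ℝ, E) f y (X y)) x (Y x) := by
  have : IsManifold 𝓘(ℝ, E) 2 M := IsManifold.of_le (n := ∞)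
    (WithTop.coe_le_coe.2 (le_top : (2 : ℕ∞) ≤ ⊤))
  set e := extChartAt 𝓘(ℝ, E) x with he
  have hes : IsOpen e.source := isOpen_extChartAt_source x
  have het : IsOpen e.target := isOpen_extChartAt_target x
  have hxs : x ∈ e.source := mem_extChartAt_source x
  have hxt : e x ∈ e.target := mem_extChartAt_target x
  let R : (∀ x : M, TangentSpace 𝓘(ℝ, E) x) → E → E := fun X =>
    VectorField.mpullbackWithin 𝓘(ℝ, E) 𝓘(ℝ, E) e.symm X (range 𝓘(ℝ, E))
  have hsymm : ContMDiffOn 𝓘(ℝ, E) 𝓘(ℝ, E) ∞ e.symm e.target := contMDiffOn_extChartAt_symm x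
  have hinv : ∀ y ∈ e.target, ∀ v : TangentSpace 𝓘(ℝ, E) (e.symm y),
      mfderiv 𝓘(ℝ, E) 𝓘(ℝ, E) e.symm y ((mfderiv 𝓘(ℝ, E) 𝓘(ℝ, E) e.symm y).inverse v) = v := by
    intro y hy v
    have h1 := isInvertible_mfderivWithin_extChartAt_symm (I := 𝓘(ℝ, E)) hy
    rw [ModelWithCorners.range_eq_univ, mfderivWithin_univ] at h1
    exact DFunLike.congr_fun h1.self_comp_inverse v
  have hR : ∀ X : ∀ x : M, TangentSpace 𝓘(ℝ, E) x, ∀ y,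
      R X y = (mfderiv 𝓘(ℝ, E) 𝓘(ℝ, E) e.symm y).inverse (X (e.symm y)) := by
    intro X y
    change (mfderivWithin 𝓘(ℝ, E) 𝓘(ℝ, E) e.symm (range 𝓘(ℝ, E)) y).inverse (X (e.symm y)) = _
    rw [ModelWithCorners.range_eq_univ, mfderivWithin_univ]
  have hA : ∀ (g : M → V) (X : ∀ x : M, TangentSpace 𝓘(ℝ, E) x) (y : E), y ∈ e.target →
      MDifferentiableAt 𝓘(ℝ, E) 𝓘(ℝ, V) g (e.symm y) →
      fderiv ℝ (fun y => g (e.symm y)) y (R X y) = mvfderiv 𝓘(ℝ, E) g (e.symm y) (X (e.symm y)) := by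
    intro g X y hy hg
    have h1 := mvfderiv_comp_mfderiv hg (hsymm.mdifferentiableAt_of_isOpen het hy) (R X y)
    have h2 := mvfderiv_eq_fderiv (fun y => g (e.symm y)) y (R X y)
    refine h2.symm.trans (h1.trans (congrArg _ ?_))
    have h3 := hinv y hy (X (e.symm y))
    rw [← hR X y] at h3
    exact h3
  have hdR : ∀ X : ∀ x : M, TangentSpace 𝓘(ℝ, E) x,
      ContMDiffOn 𝓘(ℝ, E) 𝓘(ℝ, E).tangent ∞ (fun x => (⟨x, X x⟩ : TangentBundle 𝓘(ℝ, E) M)) U →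
      DifferentiableAt ℝ (R X) (e x) := by
    intro X hX
    have h1 := ((hX.contMDiffAt (hU.mem_nhds hx)).mdifferentiableAt
      (by simp)).mdifferentiableWithinAt (s := univ)
    have h2 : DifferentiableWithinAt ℝ (R X) (e.symm ⁻¹' univ ∩ range 𝓘(ℝ, E)) (e x) :=
      h1.differentiableWithinAt_mpullbackWithin_vectorField
    rwa [preimage_univ, univ_inter, ModelWithCorners.range_eq_univ,
      differentiableWithinAt_univ] at h2
  set f' : E → V := fun y => f (e.symm y) with hf'
  set U' : Set E := e.target ∩ e.symm ⁻¹' U with hU'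
  have hU'o : IsOpen U' := hsymm.continuousOn.isOpen_inter_preimage het hU
  have hxU' : e x ∈ U' := ⟨hxt, by rwa [mem_preimage, e.left_inv hxs]⟩
  have hf's : ContDiffOn ℝ ∞ f' U' :=
    (hf.comp (hsymm.mono inter_subset_left) fun y hy => hy.2).contDiffOn
  have hev : ∀ X : ∀ x : M, TangentSpace 𝓘(ℝ, E) x, (fun y => fderiv ℝ f' y (R X y)) =ᶠ[𝓝 (e x)]
      fun y => (fun z => mvfderiv 𝓘(ℝ, E) f z (X z)) (e.symm y) := by
    intro X
    filter_upwards [hU'o.mem_nhds hxU'] with y hy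
    exact hA f X y hy.1 (hf.mdifferentiableAt_of_isOpen hU hy.2)
  have hXf : ∀ X : ∀ x : M, TangentSpace 𝓘(ℝ, E) x,
      ContMDiffOn 𝓘(ℝ, E) 𝓘(ℝ, E).tangent ∞ (fun x => (⟨x, X x⟩ : TangentBundle 𝓘(ℝ, E) M)) U →
      MDifferentiableAt 𝓘(ℝ, E) 𝓘(ℝ, V) (fun z => mvfderiv 𝓘(ℝ, E) f z (X z)) (e.symm (e x)) := by
    intro X hX
    rw [e.left_inv hxs]
    exact (contMDiffOn_mvfderiv_apply hU hf hX fun y hy => hy).mdifferentiableAt_of_isOpen hU hx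
  have hmain := VectorField.fderiv_apply_lieBracket (hf's.contDiffAt (hU'o.mem_nhds hxU'))
    minSmoothness_two_le_infty (hdR Y hY) (hdR X hX)
  rw [(hev X).fderiv_eq, (hev Y).fderiv_eq, hA _ X _ hxt (hXf Y hY), hA _ Y _ hxt (hXf X hX),
    e.left_inv hxs] at hmain
  rw [← hmain]
  have hbr : VectorField.mlieBracket 𝓘(ℝ, E) X Y x =
      (mfderiv 𝓘(ℝ, E) 𝓘(ℝ, E) e x).inverse (VectorField.lieBracketWithin (E := E) ℝ (R X) (R Y)
        (e.symm ⁻¹' univ ∩ range 𝓘(ℝ, E)) (e x) : E) := by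
    rw [← VectorField.mlieBracketWithin_univ]
    exact VectorField.mlieBracketWithin_apply
  rw [preimage_univ, univ_inter, ModelWithCorners.range_eq_univ,
    VectorField.lieBracketWithin_univ] at hbr
  have hfe : f =ᶠ[𝓝 x] fun y => f' (e y) := by
    filter_upwards [hes.mem_nhds hxs] with y hy
    exact congrArg f (e.left_inv hy).symm
  have he' : MDifferentiableAt 𝓘(ℝ, E) 𝓘(ℝ, E) e x := mdifferentiableAt_extChartAt (by simp)
  rw [hfe.mvfderiv_eq, hbr]
  refine (mvfderiv_comp_fderiv (hf's.differentiableAt_of_isOpen hU'o hxU') he' _).trans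
    (congrArg _ ?_)
  exact DFunLike.congr_fun (isInvertible_mfderiv_extChartAt hxs).self_comp_inverse _

end

end ManifoldCalculus

/-! ### Smooth one-forms on a vector bundle, cut-offs, and tensoriality. -/

noncomputable section BracketDefect

set_option linter.unusedSectionVars false

attribute [-instance]
  Bundle.instNormedAddCommGroupOfRiemannianBundleOfIsTopologicalAddGroupOfContinuousConstSMulReal

section

variable {E : Type*} [NormedAddCommGroup E] [NormedSpace ℝ E] [FiniteDimensional ℝ E]
  {M : Type*} [TopologicalSpace M] [ChartedSpace E M] [T2Space M] [IsManifold 𝓘(ℝ, E) ∞ M]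
  {V : Type*} [NormedAddCommGroup V] [NormedSpace ℝ V]

theorem exists_contMDiff_bump {U : Set M} (hU : IsOpen U) {z : M} (hz : z ∈ U) :
    ∃ χ : M → ℝ, ContMDiff 𝓘(ℝ, E) 𝓘(ℝ, ℝ) ∞ χ ∧ tsupport χ ⊆ U ∧ χ =ᶠ[𝓝 z] 1 := by
  obtain ⟨f, -, hf⟩ := (SmoothBumpFunction.nhds_basis_tsupport (I := 𝓘(ℝ, E)) z).mem_iff.1
    (hU.mem_nhds hz)
  exact ⟨f, f.contMDiff, hf, f.eventuallyEq_one⟩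

theorem ContMDiffOn.contMDiff_smul_of_tsupport {U : Set M} (hU : IsOpen U) {χ : M → ℝ}
    (hχ : ContMDiff 𝓘(ℝ, E) 𝓘(ℝ, ℝ) ∞ χ) (hs : tsupport χ ⊆ U) {f : M → V}
    (hf : ContMDiffOn 𝓘(ℝ, E) 𝓘(ℝ, V) ∞ f U) :
    ContMDiff 𝓘(ℝ, E) 𝓘(ℝ, V) ∞ (fun x => χ x • f x) :=
  contMDiff_of_tsupport fun _ hx => hχ.contMDiffAt.smul
    (hf.contMDiffAt (hU.mem_nhds (hs (tsupport_smul_subset_left χ f hx))))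

end

variable {E : Type*} [NormedAddCommGroup E] [NormedSpace ℝ E]
  {M : Type*} [TopologicalSpace M] [ChartedSpace E M] [IsManifold 𝓘(ℝ, E) ∞ M]
  {F : Type*} [NormedAddCommGroup F] [NormedSpace ℝ F]
  {A : M → Type*} [TopologicalSpace (TotalSpace F A)]
  [∀ x, AddCommGroup (A x)] [∀ x, Module ℝ (A x)] [∀ x, TopologicalSpace (A x)]
  [FiberBundle F A] [VectorBundle ℝ F A]
  {V : Type*} [NormedAddCommGroup V] [NormedSpace ℝ V]

/-- The `V`-valued one-form `θ` on the vector bundle `A` is smooth over `U`. -/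
def IsSmoothForm (E F : Type*) [NormedAddCommGroup E] [NormedSpace ℝ E] {M : Type*}
    [TopologicalSpace M] [ChartedSpace E M] [NormedAddCommGroup F] [NormedSpace ℝ F]
    {A : M → Type*} [TopologicalSpace (TotalSpace F A)]
    [∀ x, AddCommGroup (A x)] [∀ x, Module ℝ (A x)] [∀ x, TopologicalSpace (A x)]
    [FiberBundle F A] {V : Type*} [NormedAddCommGroup V] [NormedSpace ℝ V]
    (θ : ∀ z, A z →ₗ[ℝ] V) (U : Set M) : Prop :=
  ContMDiffOn (𝓘(ℝ, E).prod 𝓘(ℝ, F)) 𝓘(ℝ, V) ∞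
    (fun z : TotalSpace F A => θ z.proj z.snd) (TotalSpace.proj ⁻¹' U)

theorem IsSmoothForm.comp {θ : ∀ z, A z →ₗ[ℝ] V} {U : Set M} (h : IsSmoothForm E F θ U)
    {E₂ H₂ : Type*} [NormedAddCommGroup E₂]
    [NormedSpace ℝ E₂] [TopologicalSpace H₂] {I₂ : ModelWithCorners ℝ E₂ H₂} {P : Type*}
    [TopologicalSpace P] [ChartedSpace H₂ P] {S : Set P} {f : P → M} {s : ∀ y, A (f y)}
    (hs : ContMDiffOn I₂ (𝓘(ℝ, E).prod 𝓘(ℝ, F)) ∞ (fun y => (⟨f y, s y⟩ : TotalSpace F A)) S)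
    (hf : MapsTo f S U) : ContMDiffOn I₂ 𝓘(ℝ, V) ∞ (fun y => θ (f y) (s y)) S :=
  ContMDiffOn.comp h hs fun _ hy => hf hy

theorem IsSmoothForm.section {θ : ∀ z, A z →ₗ[ℝ] V} {U : Set M} (h : IsSmoothForm E F θ U)
    (a : Cₛ^∞⟮𝓘(ℝ, E); F, A⟯) : ContMDiffOn 𝓘(ℝ, E) 𝓘(ℝ, V) ∞ (fun y => θ y (a y)) U :=
  IsSmoothForm.comp h a.contMDiff.contMDiffOn (mapsTo_id U)

section Trivialization

variable [ContMDiffVectorBundle ∞ F A 𝓘(ℝ, E)]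
  (e : Trivialization F (TotalSpace.proj : TotalSpace F A → M)) [MemTrivializationAtlas e]

theorem isSmoothForm_linearMapAt : IsSmoothForm E F (fun z => e.linearMapAt ℝ z) e.baseSet := by
  have h1 : ContMDiffOn (𝓘(ℝ, E).prod 𝓘(ℝ, F)) 𝓘(ℝ, F) ∞ (fun z => (e z).2) e.source :=
    contMDiff_snd.comp_contMDiffOn e.contMDiffOn
  rw [e.source_eq] at h1
  refine h1.congr fun z hz => ?_
  rw [e.coe_linearMapAt_of_mem hz]

theorem contMDiffOn_symmₗ {U : Set M} (hU : IsOpen U) (hUe : U ⊆ e.baseSet) {k : M → F}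
    (hk : ContMDiffOn 𝓘(ℝ, E) 𝓘(ℝ, F) ∞ k U) :
    ContMDiffOn 𝓘(ℝ, E) (𝓘(ℝ, E).prod 𝓘(ℝ, F)) ∞
      (fun y => (⟨y, e.symmₗ ℝ y (k y)⟩ : TotalSpace F A)) U := by
  refine (e.contMDiffOn_section_iff hU hUe).2 (hk.congr fun y hy => ?_)
  have h1 := e.linearMapAt_symmₗ (R := ℝ) (hUe hy) (k y)
  rwa [e.coe_linearMapAt_of_mem (hUe hy)] at h1

end Trivialization

/-- The product of a smooth function and a smooth section. -/
def ContMDiffSection.funSMul (f : M → ℝ) (hf : ContMDiff 𝓘(ℝ, E) 𝓘(ℝ, ℝ) ∞ f)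
    (a : Cₛ^∞⟮𝓘(ℝ, E); F, A⟯) : Cₛ^∞⟮𝓘(ℝ, E); F, A⟯ :=
  ⟨fun x => f x • a x, hf.smul_section a.contMDiff⟩

theorem ContMDiffSection.sum_apply {ι : Type*} (s : Finset ι) (a : ι → Cₛ^∞⟮𝓘(ℝ, E); F, A⟯) (x : M) :
    (∑ i ∈ s, a i) x = ∑ i ∈ s, a i x := by
  exact (congrFun (map_sum (ContMDiffSection.coeAddHom 𝓘(ℝ, E) F ∞ A) a s) x).trans
    (Finset.sum_apply x s _)

section

variable [FiniteDimensional ℝ E] [T2Space M] [ContMDiffVectorBundle ∞ F A 𝓘(ℝ, E)]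

theorem exists_section_eventuallyEq {U : Set M} (hU : IsOpen U) {z : M} (hz : z ∈ U)
    {σ : ∀ x, A x} (hσ : ContMDiffOn 𝓘(ℝ, E) (𝓘(ℝ, E).prod 𝓘(ℝ, F)) ∞
      (fun y => (⟨y, σ y⟩ : TotalSpace F A)) U) :
    ∃ s : Cₛ^∞⟮𝓘(ℝ, E); F, A⟯, ∀ᶠ y in 𝓝 z, s y = σ y := by
  obtain ⟨χ, hχ, hs, h1⟩ := exists_contMDiff_bump (E := E) hU hz
  refine ⟨⟨fun y => χ y • σ y, ContMDiffOn.smul_section_of_tsupport hχ.contMDiffOn hU hs hσ⟩, ?_⟩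
  filter_upwards [h1] with y hy
  change χ y • σ y = σ y
  rw [hy, Pi.one_apply, one_smul]

variable [FiniteDimensional ℝ F]

theorem exists_section_apply_eq (z : M) (v : A z) : ∃ s : Cₛ^∞⟮𝓘(ℝ, E); F, A⟯, s z = v := by
  let e := trivializationAt F A z
  have hz : z ∈ e.baseSet := mem_baseSet_trivializationAt F A z
  obtain ⟨s, hs⟩ := exists_section_eventuallyEq e.open_baseSet hz (contMDiffOn_symmₗ (E := E) e
    e.open_baseSet subset_rfl (k := fun _ => e.linearMapAt ℝ z v) contMDiffOn_const)
  exact ⟨s, hs.self_of_nhds.trans (e.symmₗ_linearMapAt hz v)⟩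

/-- A functional on sections that is linear over functions, up to evaluation at a point, vanishes on
sections that vanish at that point. -/
theorem eq_zero_of_tensorial (z : M) (T : Cₛ^∞⟮𝓘(ℝ, E); F, A⟯ →+ V)
    (hT : ∀ f hf a, T (ContMDiffSection.funSMul f hf a) = f z • T a) (b : Cₛ^∞⟮𝓘(ℝ, E); F, A⟯)
    (hb : b z = 0) : T b = 0 := by
  let e := trivializationAt F A z
  have hz : z ∈ e.baseSet := mem_baseSet_trivializationAt F A z
  obtain ⟨χ, hχ, hs, h1⟩ := exists_contMDiff_bump (E := E) e.open_baseSet hz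
  let B := Module.finBasis ℝ F
  have hE : ∀ k, ContMDiff 𝓘(ℝ, E) (𝓘(ℝ, E).prod 𝓘(ℝ, F)) ∞
      (fun y => (⟨y, χ y • e.symmₗ ℝ y k⟩ : TotalSpace F A)) := fun k =>
    ContMDiffOn.smul_section_of_tsupport hχ.contMDiffOn e.open_baseSet hs
      (contMDiffOn_symmₗ (E := E) e e.open_baseSet subset_rfl contMDiffOn_const)
  have hf : ∀ i, ContMDiff 𝓘(ℝ, E) 𝓘(ℝ, ℝ) ∞
      (fun y => χ y • B.repr (e.linearMapAt ℝ y (b y)) i) := fun i => by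
    have hc : ContDiff ℝ ∞ (fun k => B.repr k i) :=
      (LinearMap.toContinuousLinearMap (B.coord i)).contDiff
    exact ContMDiffOn.contMDiff_smul_of_tsupport e.open_baseSet hχ hs
      (hc.contMDiff.comp_contMDiffOn ((isSmoothForm_linearMapAt e).section b))
  have hg : ContMDiff 𝓘(ℝ, E) 𝓘(ℝ, ℝ) ∞ (fun y => 1 - χ y * χ y) :=
    contMDiff_const.sub (hχ.mul hχ)
  -- With `χ = 1` at `z`, every term has a factor that vanishes at `z`: `1 - χ²` in the first, a
  -- coordinate of `b z = 0` in the others. Using `χ` twice makes both the coefficient functions and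
  -- the frame sections global.
  have hdec : b = ContMDiffSection.funSMul _ hg b +
      ∑ i, ContMDiffSection.funSMul _ (hf i) ⟨_, hE (B i)⟩ := by
    ext y
    rw [ContMDiffSection.coe_add, Pi.add_apply, ContMDiffSection.sum_apply]
    change b y = (1 - χ y * χ y) • b y +
      ∑ i, (χ y • B.repr (e.linearMapAt ℝ y (b y)) i) • (χ y • e.symmₗ ℝ y (B i))
    by_cases hy : y ∈ e.baseSet
    · have h2 : ∑ i, (χ y • B.repr (e.linearMapAt ℝ y (b y)) i) • (χ y • e.symmₗ ℝ y (B i)) =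
          (χ y * χ y) • e.symmₗ ℝ y (∑ i, B.repr (e.linearMapAt ℝ y (b y)) i • B i) := by
        rw [map_sum, Finset.smul_sum]
        refine Finset.sum_congr rfl fun i _ => ?_
        rw [map_smul, smul_smul, smul_smul, smul_eq_mul]
        congr 1
        ring
      rw [h2, B.sum_repr, e.symmₗ_linearMapAt hy, ← add_smul, sub_add_cancel, one_smul]
    · have h2 : χ y = 0 := image_eq_zero_of_notMem_tsupport fun h => hy (hs h)
      simp [h2]
  rw [hdec, map_add, map_sum, hT, h1.self_of_nhds, Finset.sum_eq_zero]
  · simp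
  · intro i _
    rw [hT, hb]
    simp

end

end BracketDefect

/-! ### The bracket defect of a one-form is a tensor. -/

noncomputable section BracketDefectTensorial

set_option linter.unusedSectionVars false

attribute [-instance]
  Bundle.instNormedAddCommGroupOfRiemannianBundleOfIsTopologicalAddGroupOfContinuousConstSMulReal

variable {E : Type*} [NormedAddCommGroup E] [NormedSpace ℝ E]
  {M : Type*} [TopologicalSpace M] [ChartedSpace E M] [IsManifold 𝓘(ℝ, E) ∞ M]
  {F : Type*} [NormedAddCommGroup F] [NormedSpace ℝ F]
  {A : M → Type*} [TopologicalSpace (TotalSpace F A)]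
  [∀ x, AddCommGroup (A x)] [∀ x, Module ℝ (A x)] [∀ x, TopologicalSpace (A x)]
  [FiberBundle F A] [VectorBundle ℝ F A]
  {V : Type*} [NormedAddCommGroup V] [NormedSpace ℝ V]

namespace LieAlgebroid

/-- The failure of a one-form `θ` to intertwine the bracket of sections with the canonical bracket
of functions. -/
def bracketDefect (𝒜 : LieAlgebroid E F A) (θ : ∀ z, A z →ₗ[ℝ] V) (z : M)
    (a b : Cₛ^∞⟮𝓘(ℝ, E); F, A⟯) : V :=
  θ z (𝒜.bracket a b z) - mvfderiv 𝓘(ℝ, E) (fun y => θ y (b y)) z (𝒜.anchor z (a z)) +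
    mvfderiv 𝓘(ℝ, E) (fun y => θ y (a y)) z (𝒜.anchor z (b z))

variable (𝒜 : LieAlgebroid E F A) {θ : ∀ z, A z →ₗ[ℝ] V} {U : Set M}

theorem bracketDefect_skew (z : M) (a b : Cₛ^∞⟮𝓘(ℝ, E); F, A⟯) :
    𝒜.bracketDefect θ z a b = -𝒜.bracketDefect θ z b a := by
  rw [bracketDefect, bracketDefect, 𝒜.bracket_skew a b, ContMDiffSection.coe_neg, Pi.neg_apply,
    map_neg]
  abel

theorem bracketDefect_add (hU : IsOpen U) (hθ : IsSmoothForm E F θ U) {z : M} (hz : z ∈ U)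
    (a b c : Cₛ^∞⟮𝓘(ℝ, E); F, A⟯) :
    𝒜.bracketDefect θ z a (b + c) = 𝒜.bracketDefect θ z a b + 𝒜.bracketDefect θ z a c := by
  have h1 : (fun y => θ y ((b + c) y)) = (fun y => θ y (b y)) + fun y => θ y (c y) := by
    ext y
    rw [ContMDiffSection.coe_add, Pi.add_apply, map_add, Pi.add_apply]
  rw [bracketDefect, h1, mvfderiv_add ((hθ.section b).mdifferentiableAt_of_isOpen hU hz)
    ((hθ.section c).mdifferentiableAt_of_isOpen hU hz), 𝒜.bracket_add, ContMDiffSection.coe_add,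
    ContMDiffSection.coe_add, Pi.add_apply, Pi.add_apply, map_add, map_add, map_add,
    add_apply, bracketDefect, bracketDefect]
  abel

/-- Up to sign the defect is the Lie algebroid differential of `θ`: the derivative term of the
Leibniz rule cancels against that of the product rule. -/
theorem bracketDefect_funSMul (hU : IsOpen U) (hθ : IsSmoothForm E F θ U) {z : M} (hz : z ∈ U)
    (f : M → ℝ) (hf : ContMDiff 𝓘(ℝ, E) 𝓘(ℝ, ℝ) ∞ f) (a b : Cₛ^∞⟮𝓘(ℝ, E); F, A⟯) :
    𝒜.bracketDefect θ z a (ContMDiffSection.funSMul f hf b) =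
      f z • 𝒜.bracketDefect θ z a b := by
  have h1 : (fun y => θ y (ContMDiffSection.funSMul f hf b y)) = f • fun y => θ y (b y) := by
    ext y
    exact map_smul (θ y) (f y) (b y)
  have h2 := 𝒜.leibniz a b (ContMDiffSection.funSMul f hf b) f hf (fun x => rfl) z
  have h3 : ContMDiffSection.funSMul f hf b z = f z • b z := rfl
  rw [bracketDefect, h1, mvfderiv_smul ((hf z).mdifferentiableAt (by simp))
    ((hθ.section b).mdifferentiableAt_of_isOpen hU hz), h2, h3, map_add, map_smul, map_smul,
    map_smul, map_smul, bracketDefect, add_apply, smul_apply, ContinuousLinearMap.smulRight_apply,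
    smul_add, smul_sub]
  abel

variable [FiniteDimensional ℝ E] [T2Space M] [ContMDiffVectorBundle ∞ F A 𝓘(ℝ, E)]
  [FiniteDimensional ℝ F]

theorem bracketDefect_congr_right (hU : IsOpen U) (hθ : IsSmoothForm E F θ U) {z : M}
    (hz : z ∈ U) (a : Cₛ^∞⟮𝓘(ℝ, E); F, A⟯) {b b' : Cₛ^∞⟮𝓘(ℝ, E); F, A⟯} (hb : b z = b' z) :
    𝒜.bracketDefect θ z a b = 𝒜.bracketDefect θ z a b' := by
  let T : Cₛ^∞⟮𝓘(ℝ, E); F, A⟯ →+ V :=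
    AddMonoidHom.mk' (𝒜.bracketDefect θ z a) (bracketDefect_add 𝒜 hU hθ hz a)
  have h1 : T (b - b') = 0 := eq_zero_of_tensorial z T
    (fun f hf c => bracketDefect_funSMul 𝒜 hU hθ hz f hf a c) _ (by
      rw [ContMDiffSection.coe_sub, Pi.sub_apply, hb, sub_self])
  rw [map_sub, sub_eq_zero] at h1
  exact h1

/-- Tensoriality in the second argument, together with skew-symmetry. Thus the defect can be
computed from any sections with given values at `z`. -/
theorem bracketDefect_congr (hU : IsOpen U) (hθ : IsSmoothForm E F θ U) {z : M}
    (hz : z ∈ U) {a a' b b' : Cₛ^∞⟮𝓘(ℝ, E); F, A⟯} (ha : a z = a' z) (hb : b z = b' z) :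
    𝒜.bracketDefect θ z a b = 𝒜.bracketDefect θ z a' b' := by
  rw [bracketDefect_congr_right 𝒜 hU hθ hz a hb, bracketDefect_skew,
    bracketDefect_congr_right 𝒜 hU hθ hz b' ha, ← bracketDefect_skew]

end LieAlgebroid

end BracketDefectTensorial

/-! ### Normal forms of Lie algebroids over open sets. -/

noncomputable section NormalForms

set_option linter.unusedSectionVars false

attribute [-instance]
  Bundle.instNormedAddCommGroupOfRiemannianBundleOfIsTopologicalAddGroupOfContinuousConstSMulReal

variable {E : Type*} [NormedAddCommGroup E] [NormedSpace ℝ E]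
  {M : Type*} [TopologicalSpace M] [ChartedSpace E M] [IsManifold 𝓘(ℝ, E) ∞ M]
  {F : Type*} [NormedAddCommGroup F] [NormedSpace ℝ F]
  {A : M → Type*} [TopologicalSpace (TotalSpace F A)]
  [∀ x, AddCommGroup (A x)] [∀ x, Module ℝ (A x)] [∀ x, TopologicalSpace (A x)]
  [FiberBundle F A] [VectorBundle ℝ F A]
  {V : Type*} [NormedAddCommGroup V] [NormedSpace ℝ V]
  {E' F' : Type*} [NormedAddCommGroup E'] [NormedSpace ℝ E'] [NormedAddCommGroup F']
  [NormedSpace ℝ F']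

namespace LieAlgebroid

/-- A submersion `p` on an open set `U`, covered by a one-form `θ`, which identifies a Lie algebroid
over `U` with the pull-back of the Lie algebroid with anchor `ρ` and bracket tensor `c`. -/
structure IsNF (𝒜 : LieAlgebroid E F A) (ρ : E' → F' →L[ℝ] E') (c : E' → F' →L[ℝ] F' →L[ℝ] F')
    (U : Set M) (p : M → E') (θ : ∀ z, A z →ₗ[ℝ] F') : Prop where
  isOpen : IsOpen U
  contMDiffOn_base : ContMDiffOn 𝓘(ℝ, E) 𝓘(ℝ, E') ∞ p U
  isSmoothForm : IsSmoothForm E F θ U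
  surjective : ∀ z ∈ U, Function.Surjective (mvfderiv 𝓘(ℝ, E) p z)
  anchor : ∀ z ∈ U, ∀ v, ρ (p z) (θ z v) = mvfderiv 𝓘(ℝ, E) p z (𝒜.anchor z v)
  cartesian : ∀ z ∈ U, ∀ k' X, ρ (p z) k' = mvfderiv 𝓘(ℝ, E) p z X →
    ∃! v, θ z v = k' ∧ 𝒜.anchor z v = X
  defect : ∀ z ∈ U, ∀ a b : Cₛ^∞⟮𝓘(ℝ, E); F, A⟯,
    𝒜.bracketDefect θ z a b = c (p z) (θ z (a z)) (θ z (b z))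

variable {𝒜 : LieAlgebroid E F A}

theorem contMDiff_anchor_section (𝒜 : LieAlgebroid E F A) (a : Cₛ^∞⟮𝓘(ℝ, E); F, A⟯) :
    ContMDiff 𝓘(ℝ, E) 𝓘(ℝ, E).tangent ∞
      (fun x => (⟨x, 𝒜.anchor x (a x)⟩ : TangentBundle 𝓘(ℝ, E) M)) :=
  𝒜.contMDiff_anchor.comp a.contMDiff

theorem contMDiffOn_bracketDefect {θ : ∀ z, A z →ₗ[ℝ] V} {U : Set M} (hU : IsOpen U)
    (hθ : IsSmoothForm E F θ U) (a b : Cₛ^∞⟮𝓘(ℝ, E); F, A⟯) :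
    ContMDiffOn 𝓘(ℝ, E) 𝓘(ℝ, V) ∞ (fun z => 𝒜.bracketDefect θ z a b) U :=
  ((hθ.section _).sub (contMDiffOn_mvfderiv_apply hU (hθ.section b)
    (𝒜.contMDiff_anchor_section a).contMDiffOn fun _ hy => hy)).add
    (contMDiffOn_mvfderiv_apply hU (hθ.section a)
      (𝒜.contMDiff_anchor_section b).contMDiffOn fun _ hy => hy)

/-- The one-form on `A` obtained by composing the anchor with the differential of a function. -/
def anchorForm (𝒜 : LieAlgebroid E F A) (f : M → V) (z : M) : A z →ₗ[ℝ] V :=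
  (mvfderiv 𝓘(ℝ, E) f z).toLinearMap ∘ₗ 𝒜.anchor z

theorem anchorForm_apply (f : M → V) (z : M) (v : A z) :
    𝒜.anchorForm f z v = mvfderiv 𝓘(ℝ, E) f z (𝒜.anchor z v) := rfl

theorem isSmoothForm_anchorForm {f : M → V} {U : Set M} (hU : IsOpen U)
    (hf : ContMDiffOn 𝓘(ℝ, E) 𝓘(ℝ, V) ∞ f U) : IsSmoothForm E F (𝒜.anchorForm f) U :=
  contMDiffOn_mvfderiv_apply hU hf 𝒜.contMDiff_anchor.contMDiffOn fun _ hy => hy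

/-- The form `df ∘ #` is closed, because the anchor preserves brackets and `[X, Y] f = X Y f - Y X
f`. Taking `f` a chart, this expresses the compatibility of anchor and bracket in terms of defects.
-/
theorem bracketDefect_anchorForm [CompleteSpace E] {f : M → V} {U : Set M} (hU : IsOpen U)
    (hf : ContMDiffOn 𝓘(ℝ, E) 𝓘(ℝ, V) ∞ f U) {z : M} (hz : z ∈ U)
    (a b : Cₛ^∞⟮𝓘(ℝ, E); F, A⟯) : 𝒜.bracketDefect (𝒜.anchorForm f) z a b = 0 := by
  have h := mvfderiv_mlieBracket hU hf (𝒜.contMDiff_anchor_section a).contMDiffOn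
    (𝒜.contMDiff_anchor_section b).contMDiffOn hz
  rw [bracketDefect, anchorForm_apply, 𝒜.anchor_bracket, h]
  simp only [anchorForm_apply]
  abel

section Pushforward

variable {ρ : E' → F' →L[ℝ] E'} {c : E' → F' →L[ℝ] F' →L[ℝ] F'} {U : Set M} {p : M → E'}
  {θ : ∀ z, A z →ₗ[ℝ] F'}

/-- The defect identity is pointwise, but it makes projectable sections behave well: if `a` and `b`
project to functions on the base, so does their bracket. This is how the axioms descend to the
model. -/
theorem IsNF.bracket_apply (h : 𝒜.IsNF ρ c U p θ) {z : M} (hz : z ∈ U)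
    {a b : Cₛ^∞⟮𝓘(ℝ, E); F, A⟯} {k l : E' → F'} (ha : ∀ᶠ y in 𝓝 z, θ y (a y) = k (p y))
    (hb : ∀ᶠ y in 𝓝 z, θ y (b y) = l (p y)) (hk : DifferentiableAt ℝ k (p z))
    (hl : DifferentiableAt ℝ l (p z)) :
    θ z (𝒜.bracket a b z) = functionBracket ρ c k l (p z) := by
  have hp := h.contMDiffOn_base.mdifferentiableAt_of_isOpen h.isOpen hz
  have h1 := h.defect z hz a b
  rw [bracketDefect, Filter.EventuallyEq.mvfderiv_eq ha, Filter.EventuallyEq.mvfderiv_eq hb,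
    mvfderiv_comp_fderiv hk hp, mvfderiv_comp_fderiv hl hp, ← h.anchor z hz, ← h.anchor z hz,
    ha.self_of_nhds, hb.self_of_nhds] at h1
  rw [functionBracket, ← h1]
  abel

theorem IsNF.eventually_bracket_apply (h : 𝒜.IsNF ρ c U p θ) {z : M} (hz : z ∈ U)
    {a b : Cₛ^∞⟮𝓘(ℝ, E); F, A⟯} {k l : E' → F'} (ha : ∀ᶠ y in 𝓝 z, θ y (a y) = k (p y))
    (hb : ∀ᶠ y in 𝓝 z, θ y (b y) = l (p y)) {D : Set E'} (hD : IsOpen D) (hzD : p z ∈ D)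
    (hk : ContDiffOn ℝ ∞ k D) (hl : ContDiffOn ℝ ∞ l D) :
    ∀ᶠ y in 𝓝 z, θ y (𝒜.bracket a b y) = functionBracket ρ c k l (p y) := by
  have hp : ContinuousAt p z := (h.contMDiffOn_base.contMDiffAt (h.isOpen.mem_nhds hz)).continuousAt
  filter_upwards [ha.eventually_nhds, hb.eventually_nhds, h.isOpen.mem_nhds hz,
    hp.preimage_mem_nhds (hD.mem_nhds hzD)] with y hay hby hy hyD
  exact h.bracket_apply hy hay hby (hk.differentiableAt_of_isOpen hD hyD)
    (hl.differentiableAt_of_isOpen hD hyD)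

/-- Functions on the base of a normal form lift to sections of the Lie algebroid. -/
def HasLifts (_ : LieAlgebroid E F A) (p : M → E') (θ : ∀ z, A z →ₗ[ℝ] F') (x : E') (z : M) :
    Prop :=
  p z = x ∧ ∀ D : Set E', IsOpen D → x ∈ D → ∀ k : E' → F', ContDiffOn ℝ ∞ k D →
    ∃ a : Cₛ^∞⟮𝓘(ℝ, E); F, A⟯, ∀ᶠ y in 𝓝 z, θ y (a y) = k (p y)

variable {D : Set E'}

/-- Lift both functions to sections and use that `dp ∘ #` has zero defect. -/
theorem IsNF.anchor_functionBracket [CompleteSpace E] (h : 𝒜.IsNF ρ c U p θ) {z : M} (hz : z ∈ U)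
    (hD : IsOpen D) (hρ : ContDiffOn ℝ ∞ ρ D) {x : E'} (hx : x ∈ D)
    (hz' : 𝒜.HasLifts p θ x z) {k l : E' → F'} (hk : ContDiffOn ℝ ∞ k D)
    (hl : ContDiffOn ℝ ∞ l D) : ρ x (functionBracket ρ c k l x) =
      VectorField.lieBracket ℝ (fun y => ρ y (k y)) (fun y => ρ y (l y)) x := by
  obtain ⟨rfl, hlift⟩ := hz'
  obtain ⟨a, ha⟩ := hlift D hD hx k hk
  obtain ⟨b, hb⟩ := hlift D hD hx l hl
  have hp := h.contMDiffOn_base.mdifferentiableAt_of_isOpen h.isOpen hz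
  have h1 := bracketDefect_anchorForm (𝒜 := 𝒜) h.isOpen h.contMDiffOn_base hz a b
  have h2 : ∀ {a : Cₛ^∞⟮𝓘(ℝ, E); F, A⟯} {k : E' → F'}, (∀ᶠ y in 𝓝 z, θ y (a y) = k (p y)) →
      (fun y => 𝒜.anchorForm p y (a y)) =ᶠ[𝓝 z] fun y => (fun x => ρ x (k x)) (p y) := by
    intro a k ha
    filter_upwards [ha, h.isOpen.mem_nhds hz] with y hy hyU
    rw [anchorForm_apply, ← h.anchor y hyU, hy]
  have h3 : ∀ {k : E' → F'}, ContDiffOn ℝ ∞ k D → DifferentiableAt ℝ (fun x => ρ x (k x)) (p z) :=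
    fun hk => (hρ.clm_apply hk).differentiableAt_of_isOpen hD hx
  rw [bracketDefect, (h2 ha).mvfderiv_eq, (h2 hb).mvfderiv_eq, anchorForm_apply, ← h.anchor z hz,
    mvfderiv_comp_fderiv (h3 hk) hp, mvfderiv_comp_fderiv (h3 hl) hp, ← h.anchor z hz,
    ← h.anchor z hz, h.bracket_apply hz ha hb (hk.differentiableAt_of_isOpen hD hx)
      (hl.differentiableAt_of_isOpen hD hx), ha.self_of_nhds, hb.self_of_nhds] at h1
  rw [VectorField.lieBracket, ← sub_eq_zero, ← h1]
  abel

theorem IsNF.jacobi_functionBracket (h : 𝒜.IsNF ρ c U p θ) {z : M} (hz : z ∈ U)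
    (hD : IsOpen D) (hρ : ContDiffOn ℝ ∞ ρ D) (hc : ContDiffOn ℝ ∞ c D) {x : E'} (hx : x ∈ D)
    (hz' : 𝒜.HasLifts p θ x z) {k l m : E' → F'} (hk : ContDiffOn ℝ ∞ k D)
    (hl : ContDiffOn ℝ ∞ l D) (hm : ContDiffOn ℝ ∞ m D) :
    functionBracket ρ c k (functionBracket ρ c l m) x +
      functionBracket ρ c l (functionBracket ρ c m k) x +
      functionBracket ρ c m (functionBracket ρ c k l) x = 0 := by
  obtain ⟨rfl, hlift⟩ := hz'
  obtain ⟨a, ha⟩ := hlift D hD hx k hk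
  obtain ⟨b, hb⟩ := hlift D hD hx l hl
  obtain ⟨d, hd⟩ := hlift D hD hx m hm
  have h1 : ∀ {a b d : Cₛ^∞⟮𝓘(ℝ, E); F, A⟯} {k l m : E' → F'},
      (∀ᶠ y in 𝓝 z, θ y (a y) = k (p y)) → (∀ᶠ y in 𝓝 z, θ y (b y) = l (p y)) →
      (∀ᶠ y in 𝓝 z, θ y (d y) = m (p y)) → ContDiffOn ℝ ∞ k D → ContDiffOn ℝ ∞ l D →
      ContDiffOn ℝ ∞ m D → θ z (𝒜.bracket a (𝒜.bracket b d) z) =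
        functionBracket ρ c k (functionBracket ρ c l m) (p z) := by
    intro a b d k l m ha hb hd hk hl hm
    exact h.bracket_apply hz ha (h.eventually_bracket_apply hz hb hd hD hx hl hm)
      (hk.differentiableAt_of_isOpen hD hx)
      ((ContDiffOn.functionBracket hD hρ hc hl hm).differentiableAt_of_isOpen hD hx)
  rw [← h1 ha hb hd hk hl hm, ← h1 hb hd ha hl hm hk, ← h1 hd ha hb hm hk hl, ← map_add,
    ← map_add]
  have h2 := congrArg (fun s : Cₛ^∞⟮𝓘(ℝ, E); F, A⟯ => s z) (𝒜.jacobi a b d)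
  simp only [ContMDiffSection.coe_add, Pi.add_apply, ContMDiffSection.coe_zero, Pi.zero_apply] at h2
  rw [h2, map_zero]

/-- The local model defined by a normal form with enough lifts. -/
def IsNF.localModel [CompleteSpace E] (h : 𝒜.IsNF ρ c U p θ) (hD : IsOpen D)
    (hρ : ContDiffOn ℝ ∞ ρ D) (hc : ContDiffOn ℝ ∞ c D)
    (hskew : ∀ x ∈ D, ∀ k l, c x k l = -c x l k)
    (hlift : ∀ x ∈ D, ∃ z ∈ U, 𝒜.HasLifts p θ x z) : LocalModel E' F' where
  dom := D
  isOpen_dom := hD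
  anchor := ρ
  tensor := c
  contDiffOn_anchor := hρ
  contDiffOn_tensor := hc
  skew := hskew
  anchor_bracket O hO hOD a b ha hb x hx := by
    obtain ⟨z, hz, hz'⟩ := hlift x (hOD hx)
    exact h.anchor_functionBracket hz hO (hρ.mono hOD) hx hz' ha hb
  jacobi O hO hOD a b d ha hb hd x hx := by
    obtain ⟨z, hz, hz'⟩ := hlift x (hOD hx)
    exact h.jacobi_functionBracket hz hO (hρ.mono hOD) (hc.mono hOD) hx hz' ha hb hd

end Pushforward

end LieAlgebroid

end NormalForms

/-! ### The normal form given by a chart and a trivialization. -/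

noncomputable section ChartNormalForm

set_option linter.unusedSectionVars false

attribute [-instance]
  Bundle.instNormedAddCommGroupOfRiemannianBundleOfIsTopologicalAddGroupOfContinuousConstSMulReal

variable {E : Type*} [NormedAddCommGroup E] [NormedSpace ℝ E] [FiniteDimensional ℝ E]
  {M : Type*} [TopologicalSpace M] [T2Space M] [ChartedSpace E M] [IsManifold 𝓘(ℝ, E) ∞ M]
  {F : Type*} [NormedAddCommGroup F] [NormedSpace ℝ F] [FiniteDimensional ℝ F]
  {A : M → Type*} [TopologicalSpace (TotalSpace F A)]
  [∀ x, AddCommGroup (A x)] [∀ x, Module ℝ (A x)] [∀ x, TopologicalSpace (A x)]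
  [FiberBundle F A] [VectorBundle ℝ F A] [ContMDiffVectorBundle ∞ F A 𝓘(ℝ, E)]
  {V : Type*} [NormedAddCommGroup V] [NormedSpace ℝ V]

namespace LieAlgebroid

variable (𝒜 : LieAlgebroid E F A)

theorem bracketDefect_sum {θ : ∀ z, A z →ₗ[ℝ] V} {U : Set M} (hU : IsOpen U)
    (hθ : IsSmoothForm E F θ U) {z : M} (hz : z ∈ U) {ι : Type*} (s : Finset ι) (r : ι → ℝ)
    (a : Cₛ^∞⟮𝓘(ℝ, E); F, A⟯) (b : ι → Cₛ^∞⟮𝓘(ℝ, E); F, A⟯) :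
    𝒜.bracketDefect θ z a (∑ i ∈ s, r i • b i) = ∑ i ∈ s, r i • 𝒜.bracketDefect θ z a (b i) := by
  let T : Cₛ^∞⟮𝓘(ℝ, E); F, A⟯ →+ V :=
    AddMonoidHom.mk' (𝒜.bracketDefect θ z a) (bracketDefect_add 𝒜 hU hθ hz a)
  have h1 : T (∑ i ∈ s, r i • b i) = ∑ i ∈ s, T (r i • b i) := map_sum T _ s
  refine h1.trans (Finset.sum_congr rfl fun i _ => ?_)
  exact bracketDefect_funSMul 𝒜 hU hθ hz (fun _ => r i) contMDiff_const a (b i)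

/-- By tensoriality the sections may be replaced by combinations of the `s i` with constant
coefficients, on which the defect is bilinear. -/
theorem bracketDefect_eq_sum {θ : ∀ z, A z →ₗ[ℝ] V} {U : Set M} (hU : IsOpen U)
    (hθ : IsSmoothForm E F θ U) {z : M} (hz : z ∈ U) {ι : Type*} [Fintype ι] (r q : ι → ℝ)
    (s : ι → Cₛ^∞⟮𝓘(ℝ, E); F, A⟯) {a b : Cₛ^∞⟮𝓘(ℝ, E); F, A⟯} (ha : a z = ∑ i, r i • s i z)
    (hb : b z = ∑ i, q i • s i z) : 𝒜.bracketDefect θ z a b =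
      ∑ i, ∑ j, r i • q j • 𝒜.bracketDefect θ z (s i) (s j) := by
  have h1 : ∀ r : ι → ℝ, (∑ i, r i • s i) z = ∑ i, r i • s i z := fun r => by
    rw [ContMDiffSection.sum_apply]
    rfl
  rw [bracketDefect_congr 𝒜 hU hθ hz (ha.trans (h1 r).symm) (hb.trans (h1 q).symm),
    bracketDefect_skew, bracketDefect_sum 𝒜 hU hθ hz, ← Finset.sum_neg_distrib]
  refine Finset.sum_congr rfl fun i _ => ?_
  rw [← smul_neg, ← bracketDefect_skew, bracketDefect_sum 𝒜 hU hθ hz, Finset.smul_sum]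

/-- Every point of a Lie algebroid has a neighbourhood on which the Lie algebroid is identified with
a local model by a chart and a trivialization. -/
theorem exists_isNF_chart (x₀ : M) : ∃ (C : LocalModel E F) (U : Set M) (p : M → E)
    (θ : ∀ z, A z →ₗ[ℝ] F), x₀ ∈ U ∧ MapsTo p U C.dom ∧ 𝒜.IsNF C.anchor C.tensor U p θ := by
  have : CompleteSpace E := FiniteDimensional.complete ℝ E
  let t := trivializationAt F A x₀
  let e := extChartAt 𝓘(ℝ, E) x₀
  let B := Module.finBasis ℝ F
  have hes : IsOpen e.source := isOpen_extChartAt_source x₀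
  have het : IsOpen e.target := isOpen_extChartAt_target x₀
  have hx₀t : x₀ ∈ t.baseSet := mem_baseSet_trivializationAt F A x₀
  have hs : ∀ k, ∃ s : Cₛ^∞⟮𝓘(ℝ, E); F, A⟯, ∀ᶠ y in 𝓝 x₀, s y = t.symmₗ ℝ y k := fun k =>
    exists_section_eventuallyEq t.open_baseSet hx₀t
      (contMDiffOn_symmₗ (E := E) t t.open_baseSet subset_rfl contMDiffOn_const)
  -- Brackets are available only for global sections, so the local frame is extended; on `W` all
  -- frame sections agree with the trivialization.
  choose s hs using fun i => hs (B i)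
  obtain ⟨W, hW, hWo, hxW⟩ := eventually_nhds_iff.1 ((Filter.eventually_all.2 hs).and
    ((hes.eventually_mem (mem_extChartAt_source x₀)).and (t.open_baseSet.eventually_mem hx₀t)))
  have hWe : W ⊆ e.source := fun y hy => (hW y hy).2.1
  have hWt : W ⊆ t.baseSet := fun y hy => (hW y hy).2.2
  have hsW : ∀ y ∈ W, ∀ i, s i y = t.symmₗ ℝ y (B i) := fun y hy => (hW y hy).1
  let θ : ∀ z, A z →ₗ[ℝ] F := fun z => t.linearMapAt ℝ z
  have hθ : IsSmoothForm E F θ W := (isSmoothForm_linearMapAt t).mono (preimage_mono hWt)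
  have hesm : ContMDiffOn 𝓘(ℝ, E) 𝓘(ℝ, E) ∞ e W := (contMDiffOn_extChartAt (n := ∞)).mono
    (by rw [← extChartAt_source 𝓘(ℝ, E)]; exact hWe)
  have hesymm : ContMDiffOn 𝓘(ℝ, E) 𝓘(ℝ, E) ∞ e.symm e.target := contMDiffOn_extChartAt_symm x₀
  have hinv : ∀ z ∈ W, (mfderiv 𝓘(ℝ, E) 𝓘(ℝ, E) e z).IsInvertible := fun z hz =>
    isInvertible_mfderiv_extChartAt (hWe hz)
  let ρ₀ : M → F →L[ℝ] E := fun z =>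
    LinearMap.toContinuousLinearMap (𝒜.anchorForm e z ∘ₗ t.symmₗ ℝ z)
  -- The tensor of the model is the defect of the trivialization, written out in the frame.
  let c₀ : M → F →L[ℝ] F →L[ℝ] F := fun z => ∑ i, ∑ j,
    (LinearMap.toContinuousLinearMap (B.coord i)).smulRight
      ((LinearMap.toContinuousLinearMap (B.coord j)).smulRight (𝒜.bracketDefect θ z (s i) (s j)))
  have hc₀ : ∀ z k l, c₀ z k l =
      ∑ i, ∑ j, B.repr k i • B.repr l j • 𝒜.bracketDefect θ z (s i) (s j) := fun z k l => by
    simp [c₀]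
  let ρ : E → F →L[ℝ] E := fun y => ρ₀ (e.symm y)
  let c : E → F →L[ℝ] F →L[ℝ] F := fun y => c₀ (e.symm y)
  have hρ₀ : ∀ z ∈ W, ρ (e z) = ρ₀ z := fun z hz => congrArg ρ₀ (e.left_inv (hWe hz))
  have hc₀' : ∀ z ∈ W, c (e z) = c₀ z := fun z hz => congrArg c₀ (e.left_inv (hWe hz))
  have hθs : ∀ z ∈ W, ∀ v, t.symmₗ ℝ z (θ z v) = v := fun z hz v => t.symmₗ_linearMapAt (hWt hz) v
  have hsθ : ∀ z ∈ W, ∀ k, θ z (t.symmₗ ℝ z k) = k := fun z hz v => t.linearMapAt_symmₗ (hWt hz) v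
  have hsum : ∀ z ∈ W, ∀ v, v = ∑ i, B.repr (θ z v) i • s i z := fun z hz v => by
    conv_lhs => rw [← hθs z hz v, ← B.sum_repr (θ z v), map_sum]
    refine Finset.sum_congr rfl fun i _ => ?_
    rw [map_smul, hsW z hz]
  have hdef : ∀ z ∈ W, ∀ a b : Cₛ^∞⟮𝓘(ℝ, E); F, A⟯,
      𝒜.bracketDefect θ z a b = c₀ z (θ z (a z)) (θ z (b z)) := fun z hz a b => by
    rw [hc₀]
    exact bracketDefect_eq_sum 𝒜 hWo hθ hz _ _ s (hsum z hz _) (hsum z hz _)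
  have hNF : 𝒜.IsNF ρ c W e θ :=
    { isOpen := hWo
      contMDiffOn_base := hesm
      isSmoothForm := hθ
      surjective := fun z hz v => ⟨(mfderiv 𝓘(ℝ, E) 𝓘(ℝ, E) e z).inverse v,
        DFunLike.congr_fun (hinv z hz).self_comp_inverse v⟩
      anchor := fun z hz v => by
        rw [hρ₀ z hz]
        exact congrArg (𝒜.anchorForm e z) (hθs z hz v)
      cartesian := fun z hz k' X hX => by
        refine ⟨t.symmₗ ℝ z k', ⟨hsθ z hz k', ?_⟩, ?_⟩
        · rw [hρ₀ z hz] at hX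
          have h1 := congrArg (mfderiv 𝓘(ℝ, E) 𝓘(ℝ, E) e z).inverse hX
          have h2 : ∀ Y : TangentSpace 𝓘(ℝ, E) z, (mfderiv 𝓘(ℝ, E) 𝓘(ℝ, E) e z).inverse
              (mfderiv 𝓘(ℝ, E) 𝓘(ℝ, E) e z Y) = Y :=
            DFunLike.congr_fun (hinv z hz).inverse_comp_self
          exact ((h2 _).symm.trans h1).trans (h2 X)
        · rintro v ⟨rfl, -⟩
          exact (hθs z hz v).symm
      defect := fun z hz a b => by
        rw [hc₀' z hz]
        exact hdef z hz a b }
  let D : Set E := e.target ∩ e.symm ⁻¹' W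
  have hD : IsOpen D := hesymm.continuousOn.isOpen_inter_preimage het hWo
  have hDm : ContMDiffOn 𝓘(ℝ, E) 𝓘(ℝ, E) ∞ e.symm D := hesymm.mono inter_subset_left
  have hDW : MapsTo e.symm D W := fun y hy => hy.2
  have hρD : ContDiffOn ℝ ∞ ρ D := contDiffOn_clm_apply.2 fun k => by
    have h1 : ContMDiffOn 𝓘(ℝ, E) 𝓘(ℝ, E) ∞ (fun z => 𝒜.anchorForm e z (t.symmₗ ℝ z k)) W :=
      IsSmoothForm.comp (isSmoothForm_anchorForm hWo hesm)
        (contMDiffOn_symmₗ t hWo hWt contMDiffOn_const) (mapsTo_id W)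
    exact (h1.comp hDm hDW).contDiffOn
  have hcD : ContDiffOn ℝ ∞ c D := contDiffOn_clm_apply.2 fun k => contDiffOn_clm_apply.2 fun l => by
    have h1 : ∀ i j, ContDiffOn ℝ ∞ (fun y => 𝒜.bracketDefect θ (e.symm y) (s i) (s j)) D :=
      fun i j => ((contMDiffOn_bracketDefect hWo hθ (s i) (s j)).comp hDm hDW).contDiffOn
    refine ContDiffOn.congr (ContDiffOn.sum fun i _ => ContDiffOn.sum fun j _ =>
      ((h1 i j).const_smul (B.repr l j)).const_smul (B.repr k i)) fun y _ => hc₀ _ k l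
  have hlift : ∀ x ∈ D, ∃ z ∈ W, 𝒜.HasLifts e θ x z := by
    intro x hx
    refine ⟨e.symm x, hx.2, e.right_inv hx.1, fun D' hD' hxD' k hk => ?_⟩
    have ho : IsOpen (W ∩ e ⁻¹' D') := hesm.continuousOn.isOpen_inter_preimage hWo hD'
    obtain ⟨a, ha⟩ := exists_section_eventuallyEq ho (z := e.symm x)
      ⟨hx.2, by rwa [mem_preimage, e.right_inv hx.1]⟩ (contMDiffOn_symmₗ (E := E) t ho
        (inter_subset_left.trans hWt) (k := fun y => k (e y))
        (hk.contMDiffOn.comp (hesm.mono inter_subset_left) fun y hy => hy.2))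
    refine ⟨a, ?_⟩
    filter_upwards [ha, hWo.mem_nhds hx.2] with y hy hyW
    rw [hy, hsθ y hyW]
  -- Any two values at a point are taken by global sections, so skew-symmetry of the defect passes
  -- to the tensor.
  have hskew : ∀ x ∈ D, ∀ k l, c x k l = -c x l k := by
    intro x hx k l
    obtain ⟨a, ha⟩ := exists_section_apply_eq (E := E) (F := F) (e.symm x) (t.symmₗ ℝ (e.symm x) k)
    obtain ⟨b, hb⟩ := exists_section_apply_eq (E := E) (F := F) (e.symm x) (t.symmₗ ℝ (e.symm x) l)
    have h1 := hdef _ hx.2 a b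
    have h2 := hdef _ hx.2 b a
    rw [ha, hb, hsθ _ hx.2, hsθ _ hx.2] at h1 h2
    change c₀ _ k l = -c₀ _ l k
    rw [← h1, ← h2, bracketDefect_skew]
  refine ⟨hNF.localModel hD hρD hcD hskew hlift, W, e, θ, hxW, fun z hz => ?_, hNF⟩
  refine ⟨e.map_source (hWe hz), ?_⟩
  rw [mem_preimage, e.left_inv (hWe hz)]
  exact hz

end LieAlgebroid

end ChartNormalForm

/-! ### Reduction to a model whose anchor vanishes at the base point. -/

noncomputable section ZeroAnchorNormalForm

set_option linter.unusedSectionVars false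

attribute [-instance]
  Bundle.instNormedAddCommGroupOfRiemannianBundleOfIsTopologicalAddGroupOfContinuousConstSMulReal

universe u v

section

variable {E : Type*} [NormedAddCommGroup E] [NormedSpace ℝ E]
  {M : Type*} [TopologicalSpace M] [ChartedSpace E M] [IsManifold 𝓘(ℝ, E) ∞ M]
  {F : Type*} [NormedAddCommGroup F] [NormedSpace ℝ F]
  {A : M → Type*} [TopologicalSpace (TotalSpace F A)]
  [∀ x, AddCommGroup (A x)] [∀ x, Module ℝ (A x)] [∀ x, TopologicalSpace (A x)]
  [FiberBundle F A] [VectorBundle ℝ F A]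
  {E' F' : Type*} [NormedAddCommGroup E'] [NormedSpace ℝ E'] [NormedAddCommGroup F']
  [NormedSpace ℝ F'] {E'' F'' : Type*} [NormedAddCommGroup E''] [NormedSpace ℝ E'']
  [NormedAddCommGroup F''] [NormedSpace ℝ F'']

namespace LieAlgebroid

variable {𝒜 : LieAlgebroid E F A} {C : LocalModel E' F'} {C' : LocalModel E'' F''} {U : Set M}
  {p : M → E'} {θ : ∀ z, A z →ₗ[ℝ] F'} {W : Set E'} {u : E' → E''} {η : E' → F' →L[ℝ] F''}

/-- Pull-backs compose. For the defect, differentiating `η (p z)` in the product rule produces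
exactly the derivative terms in the tensor condition on a morphism. -/
theorem IsNF.comp_isHom (h : 𝒜.IsNF C.anchor C.tensor U p θ) (hom : C.IsHom C' W u η) :
    𝒜.IsNF C'.anchor C'.tensor (U ∩ p ⁻¹' W) (fun z => u (p z))
      (fun z => (η (p z)).toLinearMap ∘ₗ θ z) where
  isOpen := h.contMDiffOn_base.continuousOn.isOpen_inter_preimage h.isOpen hom.isOpen
  contMDiffOn_base := hom.contDiffOn_base.contMDiffOn.comp
    (h.contMDiffOn_base.mono inter_subset_left) fun _ hz => hz.2
  isSmoothForm := by
    have h1 : ContMDiffOn (𝓘(ℝ, E).prod 𝓘(ℝ, F)) 𝓘(ℝ, F' →L[ℝ] F'') ∞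
        (fun z : TotalSpace F A => η (p z.proj)) (TotalSpace.proj ⁻¹' (U ∩ p ⁻¹' W)) :=
      hom.contDiffOn_fiber.contMDiffOn.comp (h.contMDiffOn_base.comp
        (contMDiff_proj A).contMDiffOn fun _ hz => hz.1) fun _ hz => hz.2
    exact h1.clm_apply (h.isSmoothForm.mono (preimage_mono inter_subset_left))
  surjective z hz v := by
    obtain ⟨w, hw⟩ := hom.surjective _ hz.2 v
    obtain ⟨X, hX⟩ := h.surjective z hz.1 w
    refine ⟨X, ?_⟩
    rw [mvfderiv_comp_fderiv (hom.contDiffOn_base.differentiableAt_of_isOpen hom.isOpen hz.2)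
      (h.contMDiffOn_base.mdifferentiableAt_of_isOpen h.isOpen hz.1), hX, hw]
  anchor z hz v := by
    rw [mvfderiv_comp_fderiv (hom.contDiffOn_base.differentiableAt_of_isOpen hom.isOpen hz.2)
      (h.contMDiffOn_base.mdifferentiableAt_of_isOpen h.isOpen hz.1), ← h.anchor z hz.1,
      ← hom.anchor _ hz.2]
    rfl
  cartesian z hz k' X hX := by
    rw [mvfderiv_comp_fderiv (hom.contDiffOn_base.differentiableAt_of_isOpen hom.isOpen hz.2)
      (h.contMDiffOn_base.mdifferentiableAt_of_isOpen h.isOpen hz.1)] at hX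
    obtain ⟨k, ⟨hk, hk'⟩, hku⟩ := hom.cartesian _ hz.2 k' _ hX
    obtain ⟨v, ⟨hv, hv'⟩, hvu⟩ := h.cartesian z hz.1 k X hk'
    refine ⟨v, ⟨(congrArg _ hv).trans hk, hv'⟩, ?_⟩
    rintro w ⟨hw, hw'⟩
    refine hvu w ⟨hku _ ⟨hw, ?_⟩, hw'⟩
    rw [h.anchor z hz.1, hw']
  defect z hz a b := by
    have hη : DifferentiableAt ℝ η (p z) :=
      hom.contDiffOn_fiber.differentiableAt_of_isOpen hom.isOpen hz.2
    have hp := h.contMDiffOn_base.mdifferentiableAt_of_isOpen h.isOpen hz.1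
    have hηp : MDifferentiableAt 𝓘(ℝ, E) 𝓘(ℝ, F' →L[ℝ] F'') (fun y => η (p y)) z :=
      hη.mdifferentiableAt.comp z hp
    have h1 : ∀ (a : Cₛ^∞⟮𝓘(ℝ, E); F, A⟯) v,
        mvfderiv 𝓘(ℝ, E) (fun y => ((η (p y)).toLinearMap ∘ₗ θ y) (a y)) z (𝒜.anchor z v) =
          fderiv ℝ η (p z) (C.anchor (p z) (θ z v)) (θ z (a z)) +
            η (p z) (mvfderiv 𝓘(ℝ, E) (fun y => θ y (a y)) z (𝒜.anchor z v)) := by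
      intro a v
      rw [h.anchor z hz.1, ← mvfderiv_comp_fderiv hη hp]
      exact mvfderiv_clm_apply hηp
        ((h.isSmoothForm.section a).mdifferentiableAt_of_isOpen h.isOpen hz.1) _
    have h2 := congrArg (η (p z)) (h.defect z hz.1 a b)
    rw [hom.tensor _ hz.2, bracketDefect, map_add, map_sub] at h2
    have h3 : ((η (p z)).toLinearMap ∘ₗ θ z) (𝒜.bracket a b z) =
      η (p z) (θ z (𝒜.bracket a b z)) := rfl
    rw [bracketDefect, h1, h1, h3]
    have h4 : ∀ {x y d₁ e₁ e₂ t : F''}, x - y + d₁ = e₁ - e₂ + t →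
      x - (e₁ + y) + (e₂ + d₁) = t := fun {x y d₁ e₁ e₂ t} hh => by
        rw [← sub_eq_zero] at hh ⊢
        rw [← hh]
        abel
    exact h4 h2

/-- The Lie algebroid is isomorphic, near `z`, to a pull-back of the local model `C`, by a submersion
sending `z` to `y`. -/
def HasNF (𝒜 : LieAlgebroid E F A) (C : LocalModel E' F') (y : E') (z : M) : Prop :=
  ∃ (U : Set M) (p : M → E') (θ : ∀ z, A z →ₗ[ℝ] F'), z ∈ U ∧ p z = y ∧ MapsTo p U C.dom ∧
    𝒜.IsNF C.anchor C.tensor U p θ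

theorem HasNF.comp_isHom {y : E'} {z : M} (h : 𝒜.HasNF C y z) (hom : C.IsHom C' W u η)
    (hy : y ∈ W) : 𝒜.HasNF C' (u y) z := by
  obtain ⟨U, p, θ, hz, rfl, hm, hNF⟩ := h
  exact ⟨U ∩ p ⁻¹' W, fun z => u (p z), _, ⟨hz, hy⟩, rfl, fun x hx => hom.mapsTo hx.2,
    hNF.comp_isHom hom⟩

end LieAlgebroid

end

variable {E : Type u} [NormedAddCommGroup E] [NormedSpace ℝ E] [FiniteDimensional ℝ E]
  {M : Type*} [TopologicalSpace M] [T2Space M] [ChartedSpace E M] [IsManifold 𝓘(ℝ, E) ∞ M]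
  {F : Type v} [NormedAddCommGroup F] [NormedSpace ℝ F] [FiniteDimensional ℝ F]
  {A : M → Type*} [TopologicalSpace (TotalSpace F A)]
  [∀ x, AddCommGroup (A x)] [∀ x, Module ℝ (A x)] [∀ x, TopologicalSpace (A x)]
  [FiberBundle F A] [VectorBundle ℝ F A] [ContMDiffVectorBundle ∞ F A 𝓘(ℝ, E)]

namespace LieAlgebroid

/-- Strong induction on the dimension of the base of the model: a nonzero anchor allows a
straightening followed by the quotient. The new model lives on subspaces, hence in the same
universes. -/
theorem HasNF.exists_anchor_eq_zero {𝒜 : LieAlgebroid E F A} {z : M} (n : ℕ) :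
    ∀ (E' : Type u) (F' : Type v) [NormedAddCommGroup E'] [NormedSpace ℝ E']
      [FiniteDimensional ℝ E'] [NormedAddCommGroup F'] [NormedSpace ℝ F'] [FiniteDimensional ℝ F']
      (C : LocalModel E' F') (y : E'), Module.finrank ℝ E' = n → 𝒜.HasNF C y z →
      ∃ (E'' : Type u) (F'' : Type v) (_ : NormedAddCommGroup E'') (_ : NormedSpace ℝ E'')
        (_ : FiniteDimensional ℝ E'') (_ : NormedAddCommGroup F'') (_ : NormedSpace ℝ F'')
        (_ : FiniteDimensional ℝ F'') (C' : LocalModel E'' F'') (y' : E''),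
        C'.anchor y' = 0 ∧ 𝒜.HasNF C' y' z := by
  induction n using Nat.strong_induction_on with
  | _ n ih =>
    intro E' F' _ _ _ _ _ _ C y hn h
    by_cases hy : C.anchor y = 0
    · exact ⟨E', F', _, _, inferInstance, _, _, inferInstance, C, y, hy, h⟩
    · have hyd : y ∈ C.dom := by
        obtain ⟨U, p, θ, hz, rfl, hm, -⟩ := h
        exact hm hz
      obtain ⟨S, T, hS, C₁, C', W, u, θ, h1, hyW, h2⟩ := C.exists_isHom_of_anchor_ne_zero hyd hy
      have h3 := (h.comp_isHom h1 hyW).comp_isHom h2 (h1.mapsTo hyW)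
      exact ih _ (hn ▸ Submodule.finrank_lt hS) S T C' _ rfl h3

/-- Near every point, a Lie algebroid is a pull-back of a local model whose anchor vanishes at the
corresponding point. -/
theorem exists_hasNF (𝒜 : LieAlgebroid E F A) (z : M) :
    ∃ (E' : Type u) (F' : Type v) (_ : NormedAddCommGroup E') (_ : NormedSpace ℝ E')
      (_ : FiniteDimensional ℝ E') (_ : NormedAddCommGroup F') (_ : NormedSpace ℝ F')
      (_ : FiniteDimensional ℝ F') (C : LocalModel E' F') (y : E'),
      C.anchor y = 0 ∧ 𝒜.HasNF C y z := by
  obtain ⟨C, U, p, θ, hz, hm, hNF⟩ := 𝒜.exists_isNF_chart z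
  exact HasNF.exists_anchor_eq_zero _ E F C (p z) rfl ⟨U, p, θ, hz, rfl, hm, hNF⟩

end LieAlgebroid

end ZeroAnchorNormalForm

/-! ### The pull-back bracket seen through a one-form. -/

noncomputable section PullbackBracket

set_option linter.unusedSectionVars false

attribute [-instance]
  Bundle.instNormedAddCommGroupOfRiemannianBundleOfIsTopologicalAddGroupOfContinuousConstSMulReal

section

variable {E : Type*} [NormedAddCommGroup E] [NormedSpace ℝ E]
  {M : Type*} [TopologicalSpace M] [ChartedSpace E M]
  {V W : Type*} [NormedAddCommGroup V] [NormedSpace ℝ V] [NormedAddCommGroup W] [NormedSpace ℝ W]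

theorem mvfderiv_sum_smul {ι : Type*} (s : Finset ι) {f : ι → M → ℝ} {h : ι → M → V} {x : M}
    (hf : ∀ i, MDifferentiableAt 𝓘(ℝ, E) 𝓘(ℝ, ℝ) (f i) x)
    (hh : ∀ i, MDifferentiableAt 𝓘(ℝ, E) 𝓘(ℝ, V) (h i) x) (v : TangentSpace 𝓘(ℝ, E) x) :
    MDifferentiableAt 𝓘(ℝ, E) 𝓘(ℝ, V) (fun y => ∑ i ∈ s, f i y • h i y) x ∧
    mvfderiv 𝓘(ℝ, E) (fun y => ∑ i ∈ s, f i y • h i y) x v =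
      ∑ i ∈ s, (f i x • mvfderiv 𝓘(ℝ, E) (h i) x v + mvfderiv 𝓘(ℝ, E) (f i) x v • h i x) := by
  classical
  induction s using Finset.induction_on with
  | empty =>
    simp only [Finset.sum_empty]
    refine ⟨mdifferentiableAt_const, ?_⟩
    rw [mvfderiv_const]
    rfl
  | insert i s hi ih =>
    simp only [Finset.sum_insert hi]
    have h1 : MDifferentiableAt 𝓘(ℝ, E) 𝓘(ℝ, V) (fun y => f i y • h i y) x := (hf i).smul (hh i)
    refine ⟨h1.add ih.1, ?_⟩
    rw [mvfderiv_fun_add h1 ih.1, add_apply, ih.2, mvfderiv_fun_smul (hf i) (hh i)]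
    rfl

theorem contMDiffOn_clm_of_apply [FiniteDimensional ℝ V] {H : Type*} [TopologicalSpace H]
    {J : ModelWithCorners ℝ E H} {P : Type*} [TopologicalSpace P] [ChartedSpace H P]
    {L : P → V →L[ℝ] W} {U : Set P} (h : ∀ k, ContMDiffOn J 𝓘(ℝ, W) ∞ (fun z => L z k) U) :
    ContMDiffOn J 𝓘(ℝ, V →L[ℝ] W) ∞ L U := by
  let B := Module.finBasis ℝ V
  let S : ∀ i, W →L[ℝ] V →L[ℝ] W := fun i =>
    ContinuousLinearMap.smulRightL ℝ V W (LinearMap.toContinuousLinearMap (B.coord i))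
  have h1 : ∀ z, L z = ∑ i, S i (L z (B i)) := fun z => by
    ext k
    conv_lhs => rw [← B.sum_repr k, map_sum]
    simp [S]
  have h2 : ContMDiffOn J 𝓘(ℝ, V →L[ℝ] W) ∞ (fun z => ∑ i, S i (L z (B i))) U :=
    contMDiffOn_finsetSum fun i _ => (S i).contMDiff.comp_contMDiffOn (h (B i))
  exact h2.congr fun z _ => h1 z

end



variable {E : Type*} [NormedAddCommGroup E] [NormedSpace ℝ E]
  {M : Type*} [TopologicalSpace M] [ChartedSpace E M] [IsManifold 𝓘(ℝ, E) ∞ M]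
  {F : Type*} [NormedAddCommGroup F] [NormedSpace ℝ F]
  {A : M → Type*} [TopologicalSpace (TotalSpace F A)]
  [∀ x, AddCommGroup (A x)] [∀ x, Module ℝ (A x)] [∀ x, TopologicalSpace (A x)]
  [FiberBundle F A] [VectorBundle ℝ F A]
  {EQ : Type*} [NormedAddCommGroup EQ] [NormedSpace ℝ EQ]
  {Q : Type*} [TopologicalSpace Q] [ChartedSpace EQ Q] [IsManifold 𝓘(ℝ, EQ) ∞ Q]
  {V : Type*} [NormedAddCommGroup V] [NormedSpace ℝ V]

namespace LieAlgebroid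

variable {𝒜 : LieAlgebroid E F A} {φ : Q → M}

theorem anchor_fst (q : Q) (w : 𝒜.pullbackFiber (EQ := EQ) φ q) :
    𝒜.anchor (φ q) w.1.1 = mfderiv 𝓘(ℝ, EQ) 𝓘(ℝ, E) φ q w.1.2 := w.2

/-- The formula for the pull-back bracket, evaluated on a one-form. -/
theorem pullbackBracket_formula {q : Q} (hφ : MDifferentiableAt 𝓘(ℝ, EQ) 𝓘(ℝ, E) φ q)
    {s t : ∀ q, 𝒜.pullbackFiber (EQ := EQ) φ q} {m n : ℕ} {f : Fin m → Q → ℝ}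
    {a : Fin m → Cₛ^∞⟮𝓘(ℝ, E); F, A⟯} {g : Fin n → Q → ℝ} {b : Fin n → Cₛ^∞⟮𝓘(ℝ, E); F, A⟯}
    (hf : ∀ i, MDifferentiableAt 𝓘(ℝ, EQ) 𝓘(ℝ, ℝ) (f i) q)
    (hg : ∀ j, MDifferentiableAt 𝓘(ℝ, EQ) 𝓘(ℝ, ℝ) (g j) q)
    (hs : ∀ᶠ p in 𝓝 q, (s p).1.1 = ∑ i, f i p • a i (φ p))
    (ht : ∀ᶠ p in 𝓝 q, (t p).1.1 = ∑ j, g j p • b j (φ p))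
    {θ : ∀ z, A z →ₗ[ℝ] V} {O : Set M} (hO : IsOpen O) (hθ : IsSmoothForm E F θ O) (hq : φ q ∈ O)
    (κ : A (φ q) →ₗ[ℝ] A (φ q) →ₗ[ℝ] V)
    (hκ : ∀ a b : Cₛ^∞⟮𝓘(ℝ, E); F, A⟯,
      𝒜.bracketDefect θ (φ q) a b = κ (a (φ q)) (b (φ q))) :
    θ (φ q) (∑ i, ∑ j, (f i q * g j q) • 𝒜.bracket (a i) (b j) (φ q)
      + ∑ j, mvfderiv 𝓘(ℝ, EQ) (g j) q (s q).1.2 • b j (φ q)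
      - ∑ i, mvfderiv 𝓘(ℝ, EQ) (f i) q (t q).1.2 • a i (φ q)) =
      mvfderiv 𝓘(ℝ, EQ) (fun p => θ (φ p) (t p).1.1) q (s q).1.2 -
        mvfderiv 𝓘(ℝ, EQ) (fun p => θ (φ p) (s p).1.1) q (t q).1.2 +
        κ (s q).1.1 (t q).1.1 := by
  have hsec : ∀ a : Cₛ^∞⟮𝓘(ℝ, E); F, A⟯,
      MDifferentiableAt 𝓘(ℝ, E) 𝓘(ℝ, V) (fun y => θ y (a y)) (φ q) := fun a =>
    (hθ.section a).mdifferentiableAt_of_isOpen hO hq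
  have hpull : ∀ a : Cₛ^∞⟮𝓘(ℝ, E); F, A⟯,
      MDifferentiableAt 𝓘(ℝ, EQ) 𝓘(ℝ, V) (fun p => θ (φ p) (a (φ p))) q := fun a =>
    (hsec a).comp q hφ
  have hder : ∀ {t : ∀ q, 𝒜.pullbackFiber (EQ := EQ) φ q} {n : ℕ} {g : Fin n → Q → ℝ}
      {b : Fin n → Cₛ^∞⟮𝓘(ℝ, E); F, A⟯} (_ : ∀ j, MDifferentiableAt 𝓘(ℝ, EQ) 𝓘(ℝ, ℝ) (g j) q)
      (_ : ∀ᶠ p in 𝓝 q, (t p).1.1 = ∑ j, g j p • b j (φ p)) (w : 𝒜.pullbackFiber (EQ := EQ) φ q),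
      mvfderiv 𝓘(ℝ, EQ) (fun p => θ (φ p) (t p).1.1) q w.1.2 =
        ∑ j, (g j q • mvfderiv 𝓘(ℝ, E) (fun y => θ y (b j y)) (φ q) (𝒜.anchor (φ q) w.1.1) +
          mvfderiv 𝓘(ℝ, EQ) (g j) q w.1.2 • θ (φ q) (b j (φ q))) := by
    intro t n g b hg ht w
    have h1 : (fun p => θ (φ p) (t p).1.1) =ᶠ[𝓝 q]
        fun p => ∑ j, g j p • θ (φ p) (b j (φ p)) := by
      filter_upwards [ht] with p hp
      simp only [hp, map_sum, map_smul]
    rw [h1.mvfderiv_eq, (mvfderiv_sum_smul _ hg (fun j => hpull (b j)) _).2]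
    refine Finset.sum_congr rfl fun j _ => ?_
    have h2 := mvfderiv_comp_mfderiv (hsec (b j)) hφ w.1.2
    rw [anchor_fst]
    exact congrArg (fun x => g j q • x + _) h2
  -- The brackets of the `a i` and `b j` become `κ` plus derivatives along anchors. Since `#α =
  -- dφ(X)`, these combine with the derivatives of the coefficients into derivatives along `Q`, and
  -- the decomposition disappears.
  have hbr : ∀ i j, θ (φ q) (𝒜.bracket (a i) (b j) (φ q)) = κ (a i (φ q)) (b j (φ q)) +
      mvfderiv 𝓘(ℝ, E) (fun y => θ y (b j y)) (φ q) (𝒜.anchor (φ q) (a i (φ q))) -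
      mvfderiv 𝓘(ℝ, E) (fun y => θ y (a i y)) (φ q) (𝒜.anchor (φ q) (b j (φ q))) := by
    intro i j
    rw [← hκ, bracketDefect]
    abel
  have h1 : ∑ i, ∑ j, (f i q * g j q) • κ (a i (φ q)) (b j (φ q)) = κ (s q).1.1 (t q).1.1 := by
    rw [hs.self_of_nhds, ht.self_of_nhds]
    simp only [map_sum, map_smul, LinearMap.sum_apply, LinearMap.smul_apply, Finset.smul_sum,
      smul_smul]
    exact Finset.sum_comm' (by simp) |>.trans (Finset.sum_congr rfl fun j _ =>
      Finset.sum_congr rfl fun i _ => by rw [mul_comm])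
  have h2 : ∑ i, ∑ j, (f i q * g j q) •
      mvfderiv 𝓘(ℝ, E) (fun y => θ y (b j y)) (φ q) (𝒜.anchor (φ q) (a i (φ q))) =
      ∑ j, g j q • mvfderiv 𝓘(ℝ, E) (fun y => θ y (b j y)) (φ q) (𝒜.anchor (φ q) (s q).1.1) := by
    rw [Finset.sum_comm]
    refine Finset.sum_congr rfl fun j _ => ?_
    rw [hs.self_of_nhds]
    simp only [map_sum, map_smul, Finset.smul_sum, smul_smul]
    exact Finset.sum_congr rfl fun i _ => by rw [mul_comm]
  have h3 : ∑ i, ∑ j, (f i q * g j q) •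
      mvfderiv 𝓘(ℝ, E) (fun y => θ y (a i y)) (φ q) (𝒜.anchor (φ q) (b j (φ q))) =
      ∑ i, f i q • mvfderiv 𝓘(ℝ, E) (fun y => θ y (a i y)) (φ q) (𝒜.anchor (φ q) (t q).1.1) := by
    refine Finset.sum_congr rfl fun i _ => ?_
    rw [ht.self_of_nhds]
    simp only [map_sum, map_smul, Finset.smul_sum, smul_smul]
  rw [hder hg ht, hder hf hs, ← h1, Finset.sum_add_distrib, Finset.sum_add_distrib, ← h2, ← h3]
  simp only [map_add, map_sub, map_sum, map_smul, hbr, smul_add, smul_sub, Finset.sum_add_distrib,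
    Finset.sum_sub_distrib]
  abel

end LieAlgebroid

end PullbackBracket

/-! ### Normal forms of pull-backs and smoothness of their sections. -/

noncomputable section PullbackNormalForm

set_option linter.unusedSectionVars false

attribute [-instance]
  Bundle.instNormedAddCommGroupOfRiemannianBundleOfIsTopologicalAddGroupOfContinuousConstSMulReal

/-- Compose with a fixed left inverse `R` of `L q`: near `q` the operators `R ∘ L p` are invertible,
with smooth inverse, and recover `k p` from `L p (k p)`. -/
theorem contMDiffAt_of_injective_family {V W : Type*} [NormedAddCommGroup V] [NormedSpace ℝ V]
    [FiniteDimensional ℝ V] [NormedAddCommGroup W] [NormedSpace ℝ W] [FiniteDimensional ℝ W]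
    {EP : Type*} [NormedAddCommGroup EP] [NormedSpace ℝ EP] {P : Type*} [TopologicalSpace P]
    [ChartedSpace EP P] {L : P → V →L[ℝ] W} {k : P → V} {q : P}
    (hL : ContMDiffAt 𝓘(ℝ, EP) 𝓘(ℝ, V →L[ℝ] W) ∞ L q) (hq : Function.Injective (L q))
    (hk : ContMDiffAt 𝓘(ℝ, EP) 𝓘(ℝ, W) ∞ (fun p => L p (k p)) q) :
    ContMDiffAt 𝓘(ℝ, EP) 𝓘(ℝ, V) ∞ k q := by
  have : CompleteSpace V := FiniteDimensional.complete ℝ V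
  obtain ⟨R₀, hR₀⟩ := (L q).toLinearMap.exists_leftInverse_of_injective (LinearMap.ker_eq_bot.2 hq)
  let R : W →L[ℝ] V := LinearMap.toContinuousLinearMap R₀
  let G : P → V →L[ℝ] V := fun p => R.comp (L p)
  have hG : ContMDiffAt 𝓘(ℝ, EP) 𝓘(ℝ, V →L[ℝ] V) ∞ G q := contMDiffAt_const.clm_comp hL
  have hGq : G q = (ContinuousLinearEquiv.refl ℝ V : V →L[ℝ] V) := by
    ext x
    exact DFunLike.congr_fun hR₀ x
  have hi : ContMDiffAt 𝓘(ℝ, EP) 𝓘(ℝ, V →L[ℝ] V) ∞ (fun p => (G p).inverse) q := by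
    have h1 : ContDiffAt ℝ ∞ ContinuousLinearMap.inverse (G q) := by
      rw [hGq]
      exact contDiffAt_map_inverse _
    exact h1.contMDiffAt.comp q hG
  have h2 : ∀ᶠ p in 𝓝 q, (G p).inverse (R (L p (k p))) = k p := by
    have h3 : ∀ᶠ p in 𝓝 q, G p ∈ range ((↑) : (V ≃L[ℝ] V) → V →L[ℝ] V) := by
      refine hG.continuousAt.eventually_mem ?_
      rw [hGq]
      exact ContinuousLinearEquiv.nhds _
    filter_upwards [h3] with p hp
    obtain ⟨e, he⟩ := hp
    change (G p).inverse (G p (k p)) = k p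
    rw [← he, ContinuousLinearMap.inverse_equiv]
    exact e.symm_apply_apply _
  exact (hi.clm_apply ((contMDiffAt_const (c := R)).clm_apply hk)).congr_of_eventuallyEq
    (h2.mono fun p hp => hp.symm)

variable {E : Type*} [NormedAddCommGroup E] [NormedSpace ℝ E]
  {M : Type*} [TopologicalSpace M] [ChartedSpace E M] [IsManifold 𝓘(ℝ, E) ∞ M]
  {F : Type*} [NormedAddCommGroup F] [NormedSpace ℝ F]
  {A : M → Type*} [TopologicalSpace (TotalSpace F A)]
  [∀ x, AddCommGroup (A x)] [∀ x, Module ℝ (A x)] [∀ x, TopologicalSpace (A x)]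
  [FiberBundle F A] [VectorBundle ℝ F A]
  {EQ : Type*} [NormedAddCommGroup EQ] [NormedSpace ℝ EQ]
  {Q : Type*} [TopologicalSpace Q] [ChartedSpace EQ Q] [IsManifold 𝓘(ℝ, EQ) ∞ Q]
  {E' F' : Type*} [NormedAddCommGroup E'] [NormedSpace ℝ E'] [NormedAddCommGroup F']
  [NormedSpace ℝ F']

namespace LieAlgebroid

/-- A map `u` on an open set `U`, covered by a one-form `Θ` on the pull-back `φ⋆A`, which identifies
`φ⋆A` over `U` with the pull-back of the local model `C`. -/
structure IsPNF (𝒜 : LieAlgebroid E F A) (φ : Q → M) (C : LocalModel E' F') (U : Set Q)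
    (u : Q → E') (Θ : ∀ q, 𝒜.pullbackFiber (EQ := EQ) φ q →ₗ[ℝ] F') : Prop where
  isOpen : IsOpen U
  mapsTo : MapsTo u U C.dom
  contMDiffOn_base : ContMDiffOn 𝓘(ℝ, EQ) 𝓘(ℝ, E') ∞ u U
  anchor : ∀ q ∈ U, ∀ w, C.anchor (u q) (Θ q w) = mvfderiv 𝓘(ℝ, EQ) u q w.1.2
  cartesian : ∀ q ∈ U, ∀ k' X, C.anchor (u q) k' = mvfderiv 𝓘(ℝ, EQ) u q X →
    ∃! w, Θ q w = k' ∧ w.1.2 = X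
  smooth_iff : ∀ V, IsOpen V → V ⊆ U → ∀ s, 𝒜.IsSmoothPullbackSection φ s V ↔
    ContMDiffOn 𝓘(ℝ, EQ) 𝓘(ℝ, F') ∞ (fun q => Θ q (s q)) V ∧
    ContMDiffOn 𝓘(ℝ, EQ) (𝓘(ℝ, EQ).prod 𝓘(ℝ, EQ)) ∞
      (fun q => (⟨q, (s q).1.2⟩ : TangentBundle 𝓘(ℝ, EQ) Q)) V
  bracket_iff : ∀ V, IsOpen V → V ⊆ U → ∀ s t, 𝒜.IsSmoothPullbackSection φ s V →
    𝒜.IsSmoothPullbackSection φ t V → ∀ q ∈ V, ∀ w, 𝒜.HasPullbackBracketAt φ s t q w ↔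
      Θ q w = mvfderiv 𝓘(ℝ, EQ) (fun p => Θ p (t p)) q (s q).1.2 -
        mvfderiv 𝓘(ℝ, EQ) (fun p => Θ p (s p)) q (t q).1.2 +
        C.tensor (u q) (Θ q (s q)) (Θ q (t q)) ∧
      w.1.2 = VectorField.mlieBracket 𝓘(ℝ, EQ) (fun p => (s p).1.2) (fun p => (t p).1.2) q

/-- The restriction to `φ⋆A` of a one-form on `A`. -/
def pullbackForm (𝒜 : LieAlgebroid E F A) (φ : Q → M) (θ : ∀ z, A z →ₗ[ℝ] F') (q : Q) :
    𝒜.pullbackFiber (EQ := EQ) φ q →ₗ[ℝ] F' :=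
  θ (φ q) ∘ₗ LinearMap.fst ℝ _ _ ∘ₗ (𝒜.pullbackFiber (EQ := EQ) φ q).subtype

variable {𝒜 : LieAlgebroid E F A} {φ : Q → M} {ρ : E' → F' →L[ℝ] E'}
  {c : E' → F' →L[ℝ] F' →L[ℝ] F'} {U : Set M} {p : M → E'} {θ : ∀ z, A z →ₗ[ℝ] F'}

/-- Uniqueness in the cartesian property: an element of `A` is determined by its value in the model
together with its anchor. -/
theorem IsNF.injective (h : 𝒜.IsNF ρ c U p θ) {z : M} (hz : z ∈ U) {v w : A z}
    (h1 : θ z v = θ z w) (h2 : 𝒜.anchor z v = 𝒜.anchor z w) : v = w :=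
  (h.cartesian z hz _ _ (h.anchor z hz w)).unique ⟨h1, h2⟩ ⟨rfl, rfl⟩

variable [FiniteDimensional ℝ E] [T2Space M] [ContMDiffVectorBundle ∞ F A 𝓘(ℝ, E)]
  [FiniteDimensional ℝ F]

theorem exists_section_decomposition {V : Set Q} (hV : IsOpen V) {q : Q} (hq : q ∈ V)
    (hφ : ContinuousAt φ q) {α : ∀ q, A (φ q)}
    (hα : ContMDiffOn 𝓘(ℝ, EQ) (𝓘(ℝ, E).prod 𝓘(ℝ, F)) ∞
      (fun q => (⟨φ q, α q⟩ : TotalSpace F A)) V) :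
    ∃ (m : ℕ) (f : Fin m → Q → ℝ) (a : Fin m → Cₛ^∞⟮𝓘(ℝ, E); F, A⟯), ∃ W ∈ 𝓝 q,
      (∀ i, ContMDiffOn 𝓘(ℝ, EQ) 𝓘(ℝ, ℝ) ∞ (f i) W) ∧
      ∀ p ∈ W, α p = ∑ i, f i p • a i (φ p) := by
  let t := trivializationAt F A (φ q)
  let B := Module.finBasis ℝ F
  have hqt : φ q ∈ t.baseSet := mem_baseSet_trivializationAt F A (φ q)
  have hs : ∀ k, ∃ s : Cₛ^∞⟮𝓘(ℝ, E); F, A⟯, ∀ᶠ y in 𝓝 (φ q), s y = t.symmₗ ℝ y k := fun k =>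
    exists_section_eventuallyEq t.open_baseSet hqt
      (contMDiffOn_symmₗ (E := E) t t.open_baseSet subset_rfl contMDiffOn_const)
  choose s hs using fun i => hs (B i)
  obtain ⟨W, hW, hWo, hqW⟩ := eventually_nhds_iff.1 ((hφ.eventually
    ((Filter.eventually_all.2 hs).and (t.open_baseSet.eventually_mem hqt))).and
    (hV.eventually_mem hq))
  refine ⟨_, fun i p => B.repr (t.linearMapAt ℝ (φ p) (α p)) i, s, W, hWo.mem_nhds hqW,
    fun i => ?_, fun p hp => ?_⟩
  · have h1 : ContMDiffOn 𝓘(ℝ, EQ) 𝓘(ℝ, F) ∞ (fun p => t.linearMapAt ℝ (φ p) (α p)) W :=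
      (isSmoothForm_linearMapAt t).comp (hα.mono fun p hp => (hW p hp).2)
        fun p hp => (hW p hp).1.2
    exact (LinearMap.toContinuousLinearMap (B.coord i)).contMDiff.comp_contMDiffOn h1
  · conv_lhs => rw [← t.symmₗ_linearMapAt (R := ℝ) (hW p hp).1.2 (α p),
      ← B.sum_repr (t.linearMapAt ℝ (φ p) (α p)), map_sum]
    refine Finset.sum_congr rfl fun i _ => ?_
    rw [map_smul, (hW p hp).1.1]

/-- The pair `(θ, #)` is injective on fibres, and on `α` both components are smooth: the first by
assumption, the second because `#α = dφ(X)`. -/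
theorem IsNF.contMDiffAt_section [FiniteDimensional ℝ F'] (h : 𝒜.IsNF ρ c U p θ) {V : Set Q}
    (hV : IsOpen V) (hφ : ContMDiffOn 𝓘(ℝ, EQ) 𝓘(ℝ, E) ∞ φ V) (hVU : MapsTo φ V U)
    {s : ∀ q, 𝒜.pullbackFiber (EQ := EQ) φ q}
    (h1 : ContMDiffOn 𝓘(ℝ, EQ) 𝓘(ℝ, F') ∞ (fun q => θ (φ q) (s q).1.1) V)
    (h2 : ContMDiffOn 𝓘(ℝ, EQ) (𝓘(ℝ, EQ).prod 𝓘(ℝ, EQ)) ∞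
      (fun q => (⟨q, (s q).1.2⟩ : TangentBundle 𝓘(ℝ, EQ) Q)) V) {q : Q} (hq : q ∈ V) :
    ContMDiffAt 𝓘(ℝ, EQ) (𝓘(ℝ, E).prod 𝓘(ℝ, F)) ∞
      (fun q => (⟨φ q, (s q).1.1⟩ : TotalSpace F A)) q := by
  let t := trivializationAt F A (φ q)
  let e := extChartAt 𝓘(ℝ, E) (φ q)
  have hqt : φ q ∈ t.baseSet := mem_baseSet_trivializationAt F A (φ q)
  have hqe : φ q ∈ e.source := mem_extChartAt_source (φ q)
  have hes : IsOpen e.source := isOpen_extChartAt_source (φ q)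
  have he : ContMDiffOn 𝓘(ℝ, E) 𝓘(ℝ, E) ∞ e e.source := by
    have := contMDiffOn_extChartAt (I := 𝓘(ℝ, E)) (n := ∞) (x := φ q)
    rwa [← extChartAt_source 𝓘(ℝ, E)] at this
  let O : Set M := U ∩ t.baseSet ∩ e.source
  have hO : IsOpen O := (h.isOpen.inter t.open_baseSet).inter hes
  have hqO : φ q ∈ O := ⟨⟨hVU hq, hqt⟩, hqe⟩
  -- The pair `(θ, #)` in the trivialization and a chart of `M`, as a smooth family of injective
  -- operators between fixed spaces.
  let L : M → F →L[ℝ] F' × E := fun z => LinearMap.toContinuousLinearMap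
    (((θ z).prod (𝒜.anchorForm e z)) ∘ₗ t.symmₗ ℝ z)
  have hL : ContMDiffOn 𝓘(ℝ, E) 𝓘(ℝ, F →L[ℝ] F' × E) ∞ L O := by
    refine contMDiffOn_clm_of_apply fun k => ?_
    have hk : ContMDiffOn 𝓘(ℝ, E) (𝓘(ℝ, E).prod 𝓘(ℝ, F)) ∞
        (fun y => (⟨y, t.symmₗ ℝ y k⟩ : TotalSpace F A)) O :=
      contMDiffOn_symmₗ (E := E) t hO (fun y hy => hy.1.2) (k := fun _ => k) contMDiffOn_const
    exact ((h.isSmoothForm.comp hk fun y hy => hy.1.1).prodMk_space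
      ((isSmoothForm_anchorForm hes he).comp hk fun y hy => hy.2))
  have hLi : ∀ z ∈ O, Function.Injective (L z) := by
    intro z hz k l hkl
    have h3 : θ z (t.symmₗ ℝ z k) = θ z (t.symmₗ ℝ z l) := congrArg Prod.fst hkl
    have h4 : 𝒜.anchorForm e z (t.symmₗ ℝ z k) = 𝒜.anchorForm e z (t.symmₗ ℝ z l) :=
      congrArg Prod.snd hkl
    have h5 : 𝒜.anchor z (t.symmₗ ℝ z k) = 𝒜.anchor z (t.symmₗ ℝ z l) :=
      (isInvertible_mfderiv_extChartAt hz.2).injective h4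
    have h6 := h.injective hz.1.1 h3 h5
    have h7 := congrArg (t.linearMapAt ℝ z) h6
    rwa [t.linearMapAt_symmₗ hz.1.2, t.linearMapAt_symmₗ hz.1.2] at h7
  have hφq : ContMDiffAt 𝓘(ℝ, EQ) 𝓘(ℝ, E) ∞ φ q := hφ.contMDiffAt (hV.mem_nhds hq)
  rw [contMDiffAt_totalSpace]
  refine ⟨hφq, ?_⟩
  have hev : ∀ᶠ y in 𝓝 q, y ∈ V ∧ φ y ∈ O := (hV.eventually_mem hq).and
    (hφq.continuousAt.eventually_mem (hO.mem_nhds hqO))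
  have h8 : ContMDiffAt 𝓘(ℝ, EQ) 𝓘(ℝ, F) ∞ (fun y => t.linearMapAt ℝ (φ y) (s y).1.1) q := by
    refine contMDiffAt_of_injective_family
      ((hL.contMDiffAt (hO.mem_nhds hqO)).comp q hφq) (hLi _ hqO) ?_
    have h9 : ∀ᶠ y in 𝓝 q, L (φ y) (t.linearMapAt ℝ (φ y) (s y).1.1) =
        (θ (φ y) (s y).1.1, mvfderiv 𝓘(ℝ, EQ) (fun y => e (φ y)) y (s y).1.2) := by
      filter_upwards [hev] with y hy
      have h10 : L (φ y) (t.linearMapAt ℝ (φ y) (s y).1.1) =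
          (θ (φ y) (s y).1.1, 𝒜.anchorForm e (φ y) (s y).1.1) := by
        change (_, _) = (_, _)
        rw [t.symmₗ_linearMapAt hy.2.1.2]
      rw [h10, anchorForm_apply, anchor_fst, mvfderiv_comp_mfderiv
        (he.mdifferentiableAt_of_isOpen hes hy.2.2) (hφ.mdifferentiableAt_of_isOpen hV hy.1)]
    refine ContMDiffAt.congr_of_eventuallyEq ?_ h9
    refine (h1.contMDiffAt (hV.mem_nhds hq)).prodMk_space ?_
    have hV' : IsOpen (V ∩ φ ⁻¹' e.source) := hφ.continuousOn.isOpen_inter_preimage hV hes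
    refine (contMDiffOn_mvfderiv_apply hV' (he.comp (hφ.mono inter_subset_left) fun y hy => hy.2)
      (h2.mono inter_subset_left) fun y hy => hy).contMDiffAt (hV'.mem_nhds ⟨hq, hqe⟩)
  refine h8.congr_of_eventuallyEq ?_
  filter_upwards [hev] with y hy
  rw [t.coe_linearMapAt_of_mem hy.2.1.2]

end LieAlgebroid

end PullbackNormalForm

/-! ### Pulling back a normal form along a smooth map. -/

noncomputable section PullbackOfNormalForm

set_option linter.unusedSectionVars false

attribute [-instance]
  Bundle.instNormedAddCommGroupOfRiemannianBundleOfIsTopologicalAddGroupOfContinuousConstSMulReal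

variable {E : Type*} [NormedAddCommGroup E] [NormedSpace ℝ E] [FiniteDimensional ℝ E]
  {M : Type*} [TopologicalSpace M] [T2Space M] [ChartedSpace E M] [IsManifold 𝓘(ℝ, E) ∞ M]
  {F : Type*} [NormedAddCommGroup F] [NormedSpace ℝ F] [FiniteDimensional ℝ F]
  {A : M → Type*} [TopologicalSpace (TotalSpace F A)]
  [∀ x, AddCommGroup (A x)] [∀ x, Module ℝ (A x)] [∀ x, TopologicalSpace (A x)]
  [FiberBundle F A] [VectorBundle ℝ F A] [ContMDiffVectorBundle ∞ F A 𝓘(ℝ, E)]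
  {EQ : Type*} [NormedAddCommGroup EQ] [NormedSpace ℝ EQ] [FiniteDimensional ℝ EQ]
  {Q : Type*} [TopologicalSpace Q] [ChartedSpace EQ Q] [IsManifold 𝓘(ℝ, EQ) ∞ Q]
  {E' F' : Type*} [NormedAddCommGroup E'] [NormedSpace ℝ E'] [NormedAddCommGroup F']
  [NormedSpace ℝ F'] [FiniteDimensional ℝ F']

namespace LieAlgebroid

variable {𝒜 : LieAlgebroid E F A} {φ : Q → M} {C : LocalModel E' F'} {U : Set M} {p : M → E'}
  {θ : ∀ z, A z →ₗ[ℝ] F'}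

/-- The formula for the bracket, seen through `θ`, does not involve the decompositions. Conversely,
any decompositions give a vector with the prescribed `θ`-value and anchor, and these two determine
it. -/
theorem IsNF.hasPullbackBracketAt_iff (h : 𝒜.IsNF C.anchor C.tensor U p θ)
    (hφ : ContMDiff 𝓘(ℝ, EQ) 𝓘(ℝ, E) ∞ φ) {V : Set Q} (hV : IsOpen V) (hVU : MapsTo φ V U)
    {s t : ∀ q, 𝒜.pullbackFiber (EQ := EQ) φ q} (hs : 𝒜.IsSmoothPullbackSection φ s V)
    (ht : 𝒜.IsSmoothPullbackSection φ t V) {q : Q} (hq : q ∈ V)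
    (w : 𝒜.pullbackFiber (EQ := EQ) φ q) :
    𝒜.HasPullbackBracketAt φ s t q w ↔
      θ (φ q) w.1.1 = mvfderiv 𝓘(ℝ, EQ) (fun p => θ (φ p) (t p).1.1) q (s q).1.2 -
        mvfderiv 𝓘(ℝ, EQ) (fun p => θ (φ p) (s p).1.1) q (t q).1.2 +
        C.tensor (p (φ q)) (θ (φ q) (s q).1.1) (θ (φ q) (t q).1.1) ∧
      w.1.2 = VectorField.mlieBracket 𝓘(ℝ, EQ) (fun p => (s p).1.2) (fun p => (t p).1.2) q := by
  have hφq : MDifferentiableAt 𝓘(ℝ, EQ) 𝓘(ℝ, E) φ q := (hφ q).mdifferentiableAt (by simp)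
  let κ : A (φ q) →ₗ[ℝ] A (φ q) →ₗ[ℝ] F' :=
    ((ContinuousLinearMap.coeLM ℝ).comp (C.tensor (p (φ q))).toLinearMap).compl₁₂
      (θ (φ q)) (θ (φ q))
  have hκ : ∀ a b : Cₛ^∞⟮𝓘(ℝ, E); F, A⟯,
      𝒜.bracketDefect θ (φ q) a b = κ (a (φ q)) (b (φ q)) := h.defect _ (hVU hq)
  constructor
  · rintro ⟨m, n, f, a, g, b, W, hW, hf, hg, hsf, htg, hw, hw'⟩
    refine ⟨?_, hw'⟩
    rw [hw]
    exact pullbackBracket_formula hφq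
      (fun i => ((hf i).contMDiffAt hW).mdifferentiableAt (by simp))
      (fun i => ((hg i).contMDiffAt hW).mdifferentiableAt (by simp))
      (Filter.mem_of_superset hW hsf) (Filter.mem_of_superset hW htg) h.isOpen h.isSmoothForm
      (hVU hq) κ hκ
  · rintro ⟨hw, hw'⟩
    obtain ⟨m, f, a, W₁, hW₁, hf, hsf⟩ :=
      exists_section_decomposition hV hq hφ.continuous.continuousAt hs.1
    obtain ⟨n, g, b, W₂, hW₂, hg, htg⟩ :=
      exists_section_decomposition hV hq hφ.continuous.continuousAt ht.1
    refine ⟨m, n, f, a, g, b, W₁ ∩ W₂, Filter.inter_mem hW₁ hW₂,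
      fun i => (hf i).mono inter_subset_left, fun i => (hg i).mono inter_subset_right,
      fun p hp => hsf p hp.1, fun p hp => htg p hp.2, ?_, hw'⟩
    refine h.injective (hVU hq) ?_ ?_
    · rw [hw]
      exact (pullbackBracket_formula hφq
        (fun i => ((hf i).contMDiffAt hW₁).mdifferentiableAt (by simp))
        (fun i => ((hg i).contMDiffAt hW₂).mdifferentiableAt (by simp))
        (Filter.mem_of_superset hW₁ hsf) (Filter.mem_of_superset hW₂ htg) h.isOpen h.isSmoothForm
        (hVU hq) κ hκ).symm
    -- The anchors are compared in a chart `e`. The form `de ∘ #` has zero defect, so the same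
    -- formula with `κ = 0` gives the derivative of `e ∘ φ` along `[X, Y]`.
    · let e := extChartAt 𝓘(ℝ, E) (φ q)
      have hqe : φ q ∈ e.source := mem_extChartAt_source (φ q)
      have hes : IsOpen e.source := isOpen_extChartAt_source (φ q)
      have he : ContMDiffOn 𝓘(ℝ, E) 𝓘(ℝ, E) ∞ e e.source := by
        have := contMDiffOn_extChartAt (I := 𝓘(ℝ, E)) (n := ∞) (x := φ q)
        rwa [← extChartAt_source 𝓘(ℝ, E)] at this
      have : CompleteSpace E := FiniteDimensional.complete ℝ E
      have : CompleteSpace EQ := FiniteDimensional.complete ℝ EQ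
      refine (isInvertible_mfderiv_extChartAt hqe).injective ?_
      have h1 := pullbackBracket_formula (θ := 𝒜.anchorForm e) hφq
        (fun i => ((hf i).contMDiffAt hW₁).mdifferentiableAt (by simp))
        (fun i => ((hg i).contMDiffAt hW₂).mdifferentiableAt (by simp))
        (Filter.mem_of_superset hW₁ hsf) (Filter.mem_of_superset hW₂ htg) hes
        (isSmoothForm_anchorForm hes he) hqe 0 fun a b => bracketDefect_anchorForm hes he hqe a b
      refine Eq.trans ?_ h1.symm
      have hV' : IsOpen (V ∩ φ ⁻¹' e.source) := hV.inter (hes.preimage hφ.continuous)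
      have hqV' : q ∈ V ∩ φ ⁻¹' e.source := ⟨hq, hqe⟩
      have heφ : ContMDiffOn 𝓘(ℝ, EQ) 𝓘(ℝ, E) ∞ (fun y => e (φ y)) (V ∩ φ ⁻¹' e.source) :=
        he.comp hφ.contMDiffOn fun y hy => hy.2
      have h2 : ∀ y ∈ φ ⁻¹' e.source, ∀ w : 𝒜.pullbackFiber (EQ := EQ) φ y,
          𝒜.anchorForm e (φ y) w.1.1 = mvfderiv 𝓘(ℝ, EQ) (fun y => e (φ y)) y w.1.2 := by
        intro y hy w
        rw [anchorForm_apply, anchor_fst, mvfderiv_comp_mfderiv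
          (he.mdifferentiableAt_of_isOpen hes hy) ((hφ y).mdifferentiableAt (by simp))]
      have h3 : ∀ t : ∀ q, 𝒜.pullbackFiber (EQ := EQ) φ q,
          (fun y => 𝒜.anchorForm e (φ y) (t y).1.1) =ᶠ[𝓝 q]
            fun y => mvfderiv 𝓘(ℝ, EQ) (fun y => e (φ y)) y (t y).1.2 := fun t => by
        filter_upwards [hV'.mem_nhds hqV'] with y hy using h2 y hy.2 _
      have h4 := mvfderiv_mlieBracket hV' heφ (hs.2.mono inter_subset_left)
        (ht.2.mono inter_subset_left) hqV'
      rw [← hw'] at h4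
      refine (h2 q hqe w).trans (h4.trans ?_)
      rw [(h3 t).mvfderiv_eq, (h3 s).mvfderiv_eq]
      exact (add_zero _).symm

/-- A normal form of a Lie algebroid induces one of its pull-back. -/
theorem IsNF.isPNF (h : 𝒜.IsNF C.anchor C.tensor U p θ) (hp : MapsTo p U C.dom)
    (hφ : ContMDiff 𝓘(ℝ, EQ) 𝓘(ℝ, E) ∞ φ) :
    𝒜.IsPNF φ C (φ ⁻¹' U) (fun q => p (φ q)) (𝒜.pullbackForm (EQ := EQ) φ θ) where
  isOpen := h.isOpen.preimage hφ.continuous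
  mapsTo q hq := hp hq
  contMDiffOn_base := h.contMDiffOn_base.comp hφ.contMDiffOn fun _ hq => hq
  anchor q hq w := by
    rw [mvfderiv_comp_mfderiv (h.contMDiffOn_base.mdifferentiableAt_of_isOpen h.isOpen hq)
      ((hφ q).mdifferentiableAt (by simp)), ← anchor_fst, ← h.anchor _ hq]
    rfl
  cartesian q hq k' X hX := by
    rw [mvfderiv_comp_mfderiv (h.contMDiffOn_base.mdifferentiableAt_of_isOpen h.isOpen hq)
      ((hφ q).mdifferentiableAt (by simp))] at hX
    obtain ⟨v, ⟨hv, hv'⟩, hu⟩ := h.cartesian _ hq k' _ hX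
    refine ⟨⟨(v, X), hv'⟩, ⟨hv, rfl⟩, ?_⟩
    rintro ⟨⟨w, Y⟩, hw⟩ ⟨hw1, hw2⟩
    change Y = X at hw2
    subst hw2
    exact Subtype.ext (Prod.ext (hu w ⟨hw1, hw⟩) rfl)
  smooth_iff V hV hVU s := by
    constructor
    · intro hs
      exact ⟨h.isSmoothForm.comp hs.1 fun q hq => hVU hq, hs.2⟩
    · rintro ⟨h1, h2⟩
      exact ⟨fun q hq => (h.contMDiffAt_section hV hφ.contMDiffOn (fun q hq => hVU hq) h1 h2
        hq).contMDiffWithinAt, h2⟩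
  bracket_iff V hV hVU s t hs ht q hq w :=
    h.hasPullbackBracketAt_iff hφ hV (fun q hq => hVU hq) hs ht hq w

end LieAlgebroid

end PullbackOfNormalForm

/-! ### Submersions, immersions and smooth charts with values in a vector space. -/

noncomputable section LocalCoordinates

set_option linter.unusedSectionVars false

attribute [-instance]
  Bundle.instNormedAddCommGroupOfRiemannianBundleOfIsTopologicalAddGroupOfContinuousConstSMulReal

variable {E : Type*} [NormedAddCommGroup E] [NormedSpace ℝ E]
  {M : Type*} [TopologicalSpace M] [ChartedSpace E M]
  {E₁ : Type*} [NormedAddCommGroup E₁] [NormedSpace ℝ E₁]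
  {N : Type*} [TopologicalSpace N] [ChartedSpace E₁ N]
  {V : Type*} [NormedAddCommGroup V] [NormedSpace ℝ V]

theorem mfderiv_leftInverse {f : M → N} {g : N → M} {x : M}
    (hf : MDifferentiableAt 𝓘(ℝ, E) 𝓘(ℝ, E₁) f x)
    (hg : MDifferentiableAt 𝓘(ℝ, E₁) 𝓘(ℝ, E) g (f x)) (h : ∀ᶠ y in 𝓝 x, g (f y) = y)
    (v : TangentSpace 𝓘(ℝ, E) x) :
    mfderiv 𝓘(ℝ, E₁) 𝓘(ℝ, E) g (f x) (mfderiv 𝓘(ℝ, E) 𝓘(ℝ, E₁) f x v) = v := by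
  have h1 := mfderiv_comp_apply x hg hf v
  have h2 : g ∘ f =ᶠ[𝓝 x] id := h
  have h3 := h2.mfderiv_eq (I := 𝓘(ℝ, E)) (I' := 𝓘(ℝ, E))
  have h4 : mfderiv 𝓘(ℝ, E) 𝓘(ℝ, E) (g ∘ f) x v = v := by
    have := DFunLike.congr_fun h3 v
    rw [mfderiv_id] at this
    exact this
  exact h1.symm.trans h4

/-- In adapted charts `f` is a projection, so freezing the complementary coordinates at those of `x`
gives a local section through `x`, whose derivative is a right inverse. -/
theorem Manifold.IsSubmersion.surjective_mfderiv {f : M → N}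
    (hf : Manifold.IsSubmersion 𝓘(ℝ, E) 𝓘(ℝ, E₁) ∞ f) (x : M) :
    Function.Surjective (mfderiv 𝓘(ℝ, E) 𝓘(ℝ, E₁) f x) := by
  have h := hf.isSubmersionAt x
  let d := h.domChart
  let c := h.codChart
  have hd : x ∈ d.source := h.mem_domChart_source
  have hc : f x ∈ c.source := h.mem_codChart_source
  let g : N → M := fun y => d.symm (h.equiv.symm (c y, (h.equiv (d x)).2))
  have hw : ∀ z ∈ d.target, c (f (d.symm z)) = (h.equiv z).1 := fun z hz =>
    h.writtenInCharts (by simpa [d] using hz)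
  have h0 : h.equiv.symm (c (f x), (h.equiv (d x)).2) = d x := by
    have := hw (d x) (d.map_source hd)
    rw [d.left_inv hd] at this
    rw [this, Prod.mk.eta, ContinuousLinearEquiv.symm_apply_apply]
  have hgx : g (f x) = x := by
    change d.symm (h.equiv.symm (c (f x), (h.equiv (d x)).2)) = x
    rw [h0, d.left_inv hd]
  have hcs : ContMDiffAt 𝓘(ℝ, E₁) 𝓘(ℝ, E₁) ∞ c (f x) :=
    contMDiffAt_of_mem_maximalAtlas h.codChart_mem_maximalAtlas hc
  let L : E₁ → E := fun y => h.equiv.symm (y, (h.equiv (d x)).2)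
  have h0' : L (c (f x)) ∈ d.target := by
    change h.equiv.symm _ ∈ d.target
    rw [h0]
    exact d.map_source hd
  have hL : ContDiff ℝ ∞ L := h.equiv.symm.contDiff.comp (contDiff_id.prodMk contDiff_const)
  have hLc : ContMDiffAt 𝓘(ℝ, E₁) 𝓘(ℝ, E) ∞ (fun y => L (c y)) (f x) :=
    hL.contMDiff.contMDiffAt.comp (f x) hcs
  have hds : ContMDiffAt 𝓘(ℝ, E) 𝓘(ℝ, E) ∞ d.symm (L (c (f x))) := by
    refine contMDiffAt_symm_of_mem_maximalAtlas h.domChart_mem_maximalAtlas h0'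
  have hg : ContMDiffAt 𝓘(ℝ, E₁) 𝓘(ℝ, E) ∞ g (f x) := hds.comp (f x) hLc
  have hfx : ContMDiffAt 𝓘(ℝ, E) 𝓘(ℝ, E₁) ∞ f (g (f x)) := by
    rw [hgx]
    exact hf.contMDiff x
  have hev : ∀ᶠ y in 𝓝 (f x), f (g y) = y := by
    have h1 : ∀ᶠ y in 𝓝 (f x), L (c y) ∈ d.target := by
      exact hLc.continuousAt.eventually_mem (d.open_target.mem_nhds h0')
    filter_upwards [h1, c.open_source.mem_nhds hc] with y hy hyc
    refine c.injOn (h.source_subset_preimage_source (d.map_target hy)) hyc ?_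
    refine (hw _ hy).trans ?_
    simp [L]
  intro v
  have h2 := mfderiv_leftInverse (hg.mdifferentiableAt (by simp))
    (hfx.mdifferentiableAt (by simp)) hev v
  rw [hgx] at h2
  exact ⟨_, h2⟩

/-- Adapted charts provide a local retraction onto the source; its derivative is a left inverse. -/
theorem Manifold.IsImmersion.injective_mfderiv [IsManifold 𝓘(ℝ, E) ∞ M] [IsManifold 𝓘(ℝ, E₁) ∞ N]
    {f : M → N} (hf : Manifold.IsImmersion 𝓘(ℝ, E) 𝓘(ℝ, E₁) ∞ f) (x : M) :
    Function.Injective (mfderiv 𝓘(ℝ, E) 𝓘(ℝ, E₁) f x) := by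
  have h := hf.isImmersionAt x
  let d := h.domChart
  let c := h.codChart
  have hd : x ∈ d.source := h.mem_domChart_source
  have hc : f x ∈ c.source := h.mem_codChart_source
  have hw : ∀ z ∈ d.target, c (f (d.symm z)) = h.equiv (z, 0) := fun z hz =>
    h.writtenInCharts (by simpa [d] using hz)
  let L : E₁ → E := fun y => (h.equiv.symm y).1
  have hL : ContDiff ℝ ∞ L := contDiff_fst.comp h.equiv.symm.contDiff
  have hLf : ∀ y ∈ d.source, L (c (f y)) = d y := fun y hy => by
    have := hw (d y) (d.map_source hy)
    rw [d.left_inv hy] at this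
    simp [L, this]
  have hLc : ContMDiffAt 𝓘(ℝ, E₁) 𝓘(ℝ, E) ∞ (fun y => L (c y)) (f x) :=
    hL.contMDiff.contMDiffAt.comp (f x)
      (contMDiffAt_of_mem_maximalAtlas h.codChart_mem_maximalAtlas hc)
  have hds : ContMDiffAt 𝓘(ℝ, E) 𝓘(ℝ, E) ∞ d.symm (L (c (f x))) := by
    refine contMDiffAt_symm_of_mem_maximalAtlas h.domChart_mem_maximalAtlas ?_
    exact (hLf x hd).symm ▸ d.map_source hd
  have hg : ContMDiffAt 𝓘(ℝ, E₁) 𝓘(ℝ, E) ∞ (fun y => d.symm (L (c y))) (f x) := hds.comp (f x) hLc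
  have hev : ∀ᶠ y in 𝓝 x, d.symm (L (c (f y))) = y := by
    filter_upwards [d.open_source.mem_nhds hd] with y hy
    rw [hLf y hy, d.left_inv hy]
  intro v w hvw
  have h1 := mfderiv_leftInverse ((hf.contMDiff x).mdifferentiableAt (by simp))
    (hg.mdifferentiableAt (by simp)) hev
  rw [← h1 v, ← h1 w, hvw]

/-- A diffeomorphism from an open subset of a manifold onto an open subset of a vector space. -/
structure IsSmoothChart (E : Type*) [NormedAddCommGroup E] [NormedSpace ℝ E] {M : Type*}
    [TopologicalSpace M] [ChartedSpace E M] {V : Type*} [NormedAddCommGroup V] [NormedSpace ℝ V]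
    (h : OpenPartialHomeomorph M V) : Prop where
  contMDiffOn : ContMDiffOn 𝓘(ℝ, E) 𝓘(ℝ, V) ∞ h h.source
  contMDiffOn_symm : ContMDiffOn 𝓘(ℝ, V) 𝓘(ℝ, E) ∞ h.symm h.target

/-- The vector field with given coordinates. -/
def coordField (E : Type*) [NormedAddCommGroup E] [NormedSpace ℝ E] {M : Type*}
    [TopologicalSpace M] [ChartedSpace E M] {V : Type*} [NormedAddCommGroup V] [NormedSpace ℝ V]
    (h : OpenPartialHomeomorph M V) (k : M → V) (x : M) : TangentSpace 𝓘(ℝ, E) x :=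
  mfderiv 𝓘(ℝ, V) 𝓘(ℝ, E) h.symm (h x) (k x)

namespace IsSmoothChart

variable {h : OpenPartialHomeomorph M V} {x : M}

theorem mdifferentiableAt (hh : IsSmoothChart E h) (hx : x ∈ h.source) :
    MDifferentiableAt 𝓘(ℝ, E) 𝓘(ℝ, V) h x :=
  hh.contMDiffOn.mdifferentiableAt_of_isOpen h.open_source hx

theorem mdifferentiableAt_symm (hh : IsSmoothChart E h) {y : V} (hy : y ∈ h.target) :
    MDifferentiableAt 𝓘(ℝ, V) 𝓘(ℝ, E) h.symm y :=
  hh.contMDiffOn_symm.mdifferentiableAt_of_isOpen h.open_target hy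

theorem coordField_mvfderiv (hh : IsSmoothChart E h) (hx : x ∈ h.source)
    (X : TangentSpace 𝓘(ℝ, E) x) :
    mfderiv 𝓘(ℝ, V) 𝓘(ℝ, E) h.symm (h x) (mvfderiv 𝓘(ℝ, E) h x X) = X :=
  mfderiv_leftInverse (hh.mdifferentiableAt hx) (hh.mdifferentiableAt_symm (h.map_source hx))
    (by filter_upwards [h.open_source.mem_nhds hx] with y hy using h.left_inv hy) X

theorem mvfderiv_symm (hh : IsSmoothChart E h) (hx : x ∈ h.source) (k : V) :
    mvfderiv 𝓘(ℝ, E) h x (mfderiv 𝓘(ℝ, V) 𝓘(ℝ, E) h.symm (h x) k) = k := by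
  have h1 := mfderiv_leftInverse (x := h x) (f := h.symm) (g := h)
    (hh.mdifferentiableAt_symm (h.map_source hx)) (by
      rw [h.left_inv hx]
      exact hh.mdifferentiableAt hx)
    (by filter_upwards [h.open_target.mem_nhds (h.map_source hx)] with y hy using h.right_inv hy) k
  rw [h.left_inv hx] at h1
  exact h1

theorem mvfderiv_coordField (hh : IsSmoothChart E h) (hx : x ∈ h.source) (k : M → V) :
    mvfderiv 𝓘(ℝ, E) h x (coordField E h k x) = k x :=
  hh.mvfderiv_symm hx _

theorem injective_mvfderiv (hh : IsSmoothChart E h) (hx : x ∈ h.source) :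
    Function.Injective (mvfderiv 𝓘(ℝ, E) h x) := fun X Y hXY => by
  rw [← hh.coordField_mvfderiv hx X, ← hh.coordField_mvfderiv hx Y, hXY]

theorem contMDiffOn_coordField [IsManifold 𝓘(ℝ, E) ∞ M] (hh : IsSmoothChart E h) {U : Set M}
    (hU : U ⊆ h.source) {k : M → V} (hk : ContMDiffOn 𝓘(ℝ, E) 𝓘(ℝ, V) ∞ k U) :
    ContMDiffOn 𝓘(ℝ, E) 𝓘(ℝ, E).tangent ∞
      (fun x => (⟨x, coordField E h k x⟩ : TangentBundle 𝓘(ℝ, E) M)) U := by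
  have h1 : ContMDiffOn 𝓘(ℝ, V).tangent 𝓘(ℝ, E).tangent ∞
      (tangentMapWithin 𝓘(ℝ, V) 𝓘(ℝ, E) h.symm h.target) (TotalSpace.proj ⁻¹' h.target) :=
    hh.contMDiffOn_symm.contMDiffOn_tangentMapWithin (by simp) h.open_target.uniqueMDiffOn
  have h2 : ContMDiffOn 𝓘(ℝ, E) 𝓘(ℝ, V).tangent ∞
      (fun x => (⟨h x, k x⟩ : TangentBundle 𝓘(ℝ, V) V)) U := by
    intro x hx
    rw [contMDiffWithinAt_totalSpace]
    refine ⟨hh.contMDiffOn.mono hU x hx, ?_⟩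
    simpa using hk x hx
  refine (h1.comp h2 fun x hx => h.map_source (hU hx)).congr fun x hx => ?_
  have hx' := h.map_source (hU hx)
  simp only [Function.comp_apply, tangentMapWithin]
  rw [mfderivWithin_of_mem_nhds (h.open_target.mem_nhds hx')]
  have : h.symm (h x) = x := h.left_inv (hU hx)
  simp only [coordField]
  congr 1
  · exact this.symm

end IsSmoothChart

end LocalCoordinates

/-! ### Charts adapted to a submersion. -/

noncomputable section AdaptedCoordinates

set_option linter.unusedSectionVars false

attribute [-instance]
  Bundle.instNormedAddCommGroupOfRiemannianBundleOfIsTopologicalAddGroupOfContinuousConstSMulReal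

variable {E : Type*} [NormedAddCommGroup E] [NormedSpace ℝ E] [FiniteDimensional ℝ E]
  {M : Type*} [TopologicalSpace M] [ChartedSpace E M] [IsManifold 𝓘(ℝ, E) ∞ M]
  {V : Type*} [NormedAddCommGroup V] [NormedSpace ℝ V]

theorem isSmoothChart_chartAt (x : M) : IsSmoothChart E (chartAt E x) :=
  ⟨contMDiffOn_of_mem_maximalAtlas (IsManifold.chart_mem_maximalAtlas x),
    contMDiffOn_symm_of_mem_maximalAtlas (IsManifold.chart_mem_maximalAtlas x)⟩

/-- The inverse function theorem on a manifold. -/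
theorem exists_isSmoothChart_of_bijective {f : M → V} {U : Set M} (hU : IsOpen U)
    (hf : ContMDiffOn 𝓘(ℝ, E) 𝓘(ℝ, V) ∞ f U) {x : M} (hx : x ∈ U)
    (hb : Function.Bijective (mvfderiv 𝓘(ℝ, E) f x)) :
    ∃ h : OpenPartialHomeomorph M V, IsSmoothChart E h ∧ x ∈ h.source ∧ h.source ⊆ U ∧
      ∀ y, y ∈ h.source → h y = f y := by
  have : CompleteSpace E := FiniteDimensional.complete ℝ E
  let e : OpenPartialHomeomorph M E := chartAt E x
  have he : IsSmoothChart E e := isSmoothChart_chartAt x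
  have hxe : x ∈ e.source := mem_chart_source E x
  let O : Set E := e.target ∩ e.symm ⁻¹' U
  have hO : IsOpen O := he.contMDiffOn_symm.continuousOn.isOpen_inter_preimage e.open_target hU
  have hxO : e x ∈ O := ⟨e.map_source hxe, by rwa [mem_preimage, e.left_inv hxe]⟩
  have hg : ContMDiffOn 𝓘(ℝ, E) 𝓘(ℝ, V) ∞ (fun y => f (e.symm y)) O :=
    hf.comp (he.contMDiffOn_symm.mono inter_subset_left) fun y hy => hy.2
  have hg' : ContDiffOn ℝ ∞ (fun y => f (e.symm y)) O := hg.contDiffOn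
  have hfx : MDifferentiableAt 𝓘(ℝ, E) 𝓘(ℝ, V) f (e.symm (e x)) := by
    rw [e.left_inv hxe]
    exact hf.mdifferentiableAt_of_isOpen hU hx
  have hd : ∀ v, fderiv ℝ (fun y => f (e.symm y)) (e x) v =
      mvfderiv 𝓘(ℝ, E) f x (mfderiv 𝓘(ℝ, E) 𝓘(ℝ, E) e.symm (e x) v) := fun v => by
    have h1 := mvfderiv_comp_mfderiv hfx (he.mdifferentiableAt_symm (e.map_source hxe)) v
    rw [e.left_inv hxe, mvfderiv_eq_fderiv] at h1
    exact h1
  have hbij : Function.Bijective (fderiv ℝ (fun y => f (e.symm y)) (e x)) := by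
    have h1 : Function.Bijective (mfderiv 𝓘(ℝ, E) 𝓘(ℝ, E) e.symm (e x)) := by
      refine ⟨fun v w hvw => ?_, fun X => ⟨_, he.coordField_mvfderiv hxe X⟩⟩
      have h2 := congrArg (mvfderiv 𝓘(ℝ, E) e x) hvw
      exact (he.mvfderiv_symm hxe v).symm.trans (h2.trans (he.mvfderiv_symm hxe w))
    have h2 : ⇑(fderiv ℝ (fun y => f (e.symm y)) (e x)) =
        mvfderiv 𝓘(ℝ, E) f x ∘ mfderiv 𝓘(ℝ, E) 𝓘(ℝ, E) e.symm (e x) := funext hd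
    rw [h2]
    exact hb.comp h1
  obtain ⟨T, hT⟩ := exists_continuousLinearEquiv_of_bijective _ hbij
  obtain ⟨e', he', hxe', hes, hesymm, -⟩ := exists_openPartialHomeomorph_of_hasFDerivAt hO hg' hxO T
    (by rw [hT]; exact (hg'.differentiableAt_of_isOpen hO hxO).hasFDerivAt)
  have hsrc : ∀ y ∈ (e.trans e').source, y ∈ e.source ∧ e y ∈ e'.source := fun y hy => by
    simpa using hy
  have htgt : ∀ y ∈ (e.trans e').target, y ∈ e'.target ∧ e'.symm y ∈ e.target := fun y hy => by
    simpa using hy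
  have hval : ∀ y ∈ (e.trans e').source, e.trans e' y = f y := fun y hy => by
    change e' (e y) = f y
    rw [he', e.left_inv (hsrc y hy).1]
  have hsub : (e.trans e').source ⊆ U := fun y hy => by
    have := (hes (hsrc y hy).2).2
    rwa [mem_preimage, e.left_inv (hsrc y hy).1] at this
  refine ⟨e.trans e', ⟨(hf.mono hsub).congr hval, ?_⟩, ?_, hsub, hval⟩
  · exact he.contMDiffOn_symm.comp (hesymm.contMDiffOn.mono fun y hy => (htgt y hy).1)
      fun y hy => (htgt y hy).2
  · simpa using ⟨hxe, hxe'⟩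

/-- A function whose differential at `x` is surjective is the first component of a chart at `x`. -/
theorem exists_isSmoothChart_of_surjective {f : M → V} {U : Set M} (hU : IsOpen U)
    (hf : ContMDiffOn 𝓘(ℝ, E) 𝓘(ℝ, V) ∞ f U) {x : M} (hx : x ∈ U)
    (hs : Function.Surjective (mvfderiv 𝓘(ℝ, E) f x)) :
    ∃ (T : Submodule ℝ E) (h : OpenPartialHomeomorph M (V × T)), IsSmoothChart E h ∧
      x ∈ h.source ∧ h.source ⊆ U ∧ (h x).2 = 0 ∧ ∀ y, y ∈ h.source → (h y).1 = f y := by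
  let e : OpenPartialHomeomorph M E := chartAt E x
  have he : IsSmoothChart E e := isSmoothChart_chartAt x
  have hxe : x ∈ e.source := mem_chart_source E x
  let D : E →ₗ[ℝ] V :=
    (mvfderiv 𝓘(ℝ, E) f x).toLinearMap ∘ₗ (mfderiv 𝓘(ℝ, E) 𝓘(ℝ, E) e.symm (e x)).toLinearMap
  have hD : ∀ X, D (mvfderiv 𝓘(ℝ, E) e x X) = mvfderiv 𝓘(ℝ, E) f x X := fun X =>
    congrArg (mvfderiv 𝓘(ℝ, E) f x) (he.coordField_mvfderiv hxe X)
  let T : Submodule ℝ E := LinearMap.ker D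
  obtain ⟨P₀, hP₀⟩ := T.subtype.exists_leftInverse_of_injective (Submodule.ker_subtype T)
  let P : E →L[ℝ] T := LinearMap.toContinuousLinearMap P₀
  have hP : ∀ v (hv : v ∈ T), P v = ⟨v, hv⟩ := fun v hv => DFunLike.congr_fun hP₀ ⟨v, hv⟩
  -- The missing coordinates: a projection onto the kernel of the differential of `f` at `x`,
  -- centred so that they vanish at `x`.
  let τ : M → T := fun y => P (e y - e x)
  have hτ₀ : ContDiff ℝ ∞ (fun y => P (y - e x)) := P.contDiff.comp (contDiff_id.sub contDiff_const)
  have hτ : ContMDiffOn 𝓘(ℝ, E) 𝓘(ℝ, T) ∞ τ e.source :=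
    hτ₀.contMDiff.comp_contMDiffOn he.contMDiffOn
  have hO : IsOpen (U ∩ e.source) := hU.inter e.open_source
  have hτ' : ∀ X, mvfderiv 𝓘(ℝ, E) τ x X = P (mvfderiv 𝓘(ℝ, E) e x X) := fun X => by
    rw [show τ = fun y => (fun y => P (y - e x)) (e y) from rfl, mvfderiv_comp_fderiv
      ((hτ₀.differentiable (by simp)) _) (he.mdifferentiableAt hxe)]
    have h1 : HasFDerivAt (fun y => P (y - e x)) P (e x) :=
      P.hasFDerivAt.comp (e x) ((hasFDerivAt_id (e x)).sub_const (e x))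
    rw [h1.fderiv]
  have hd := mvfderiv_prodMk (hf.mdifferentiableAt_of_isOpen hU hx)
    (hτ.mdifferentiableAt_of_isOpen e.open_source hxe)
  have hbij : Function.Bijective (mvfderiv 𝓘(ℝ, E) (fun y => (f y, τ y)) x) := by
    constructor
    · intro X Y hXY
      rw [hd, hd, Prod.mk.injEq, hτ', hτ'] at hXY
      have h1 : mvfderiv 𝓘(ℝ, E) e x X - mvfderiv 𝓘(ℝ, E) e x Y ∈ T := by
        rw [LinearMap.mem_ker, map_sub, hD, hD, hXY.1, sub_self]
      have h2 := hP _ h1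
      rw [map_sub, hXY.2, sub_self] at h2
      have h3 := congrArg Subtype.val h2
      exact he.injective_mvfderiv hxe (sub_eq_zero.1 h3.symm)
    · rintro ⟨v, w⟩
      obtain ⟨X, hX⟩ := hs v
      let y : E := mvfderiv 𝓘(ℝ, E) e x X
      have hy : D y = v := (hD X).trans hX
      let z : T := w - P y
      refine ⟨mfderiv 𝓘(ℝ, E) 𝓘(ℝ, E) e.symm (e x) (y + (z : E)), ?_⟩
      refine (hd _).trans (Prod.ext ?_ ?_)
      · change D (y + (z : E)) = v
        rw [map_add, hy, LinearMap.mem_ker.1 z.2, add_zero]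
      · refine (hτ' _).trans ((congrArg P (he.mvfderiv_symm hxe _)).trans ?_)
        change P (y + (z : E)) = w
        rw [map_add, hP _ z.2]
        change P y + (w - P y) = w
        abel
  obtain ⟨h, hh, hxh, hsub, hval⟩ := exists_isSmoothChart_of_bijective hO
    ((hf.mono inter_subset_left).prodMk_space (hτ.mono inter_subset_right)) ⟨hx, hxe⟩ hbij
  refine ⟨T, h, hh, hxh, hsub.trans inter_subset_left, ?_, fun y hy => by rw [hval y hy]⟩
  rw [hval x hxh]
  simp [τ]

/-- A map whose differential at `x` is surjective is open at `x`. -/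
theorem map_mem_nhds_of_surjective_mfderiv {E₁ : Type*} [NormedAddCommGroup E₁] [NormedSpace ℝ E₁]
    [FiniteDimensional ℝ E₁] {N : Type*} [TopologicalSpace N] [ChartedSpace E₁ N]
    [IsManifold 𝓘(ℝ, E₁) ∞ N] {φ : M → N} (hφ : ContMDiff 𝓘(ℝ, E) 𝓘(ℝ, E₁) ∞ φ) {x : M}
    (hs : Function.Surjective (mfderiv 𝓘(ℝ, E) 𝓘(ℝ, E₁) φ x)) {S : Set M} (hS : S ∈ 𝓝 x) :
    φ '' S ∈ 𝓝 (φ x) := by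
  let e : OpenPartialHomeomorph N E₁ := chartAt E₁ (φ x)
  have he : IsSmoothChart E₁ e := isSmoothChart_chartAt (φ x)
  have hxe : φ x ∈ e.source := mem_chart_source E₁ (φ x)
  have hO : IsOpen (φ ⁻¹' e.source) := e.open_source.preimage hφ.continuous
  obtain ⟨T, h, hh, hxh, hsub, -, hval⟩ := exists_isSmoothChart_of_surjective hO
    (he.contMDiffOn.comp hφ.contMDiffOn fun y hy => hy) hxe (fun v => by
      obtain ⟨X, hX⟩ := hs (mfderiv 𝓘(ℝ, E₁) 𝓘(ℝ, E₁) e.symm (e (φ x)) v)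
      refine ⟨X, ?_⟩
      have h1 := mvfderiv_comp_mfderiv (he.mdifferentiableAt hxe)
        ((hφ x).mdifferentiableAt (by simp)) X
      rw [hX] at h1
      exact h1.trans (he.mvfderiv_symm hxe v))
  have h1 : h '' (h.source ∩ S) ∈ 𝓝 (h x) := by
    rw [← h.map_nhds_eq hxh]
    exact Filter.image_mem_map (Filter.inter_mem (h.open_source.mem_nhds hxh) hS)
  have h2 : Prod.fst '' (h '' (h.source ∩ S)) ∈ 𝓝 (h x).1 :=
    isOpenMap_fst.image_mem_nhds h1
  rw [hval x hxh] at h2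
  have h3 : e ⁻¹' (Prod.fst '' (h '' (h.source ∩ S))) ∈ 𝓝 (φ x) :=
    (e.continuousAt hxe).preimage_mem_nhds h2
  filter_upwards [h3, e.open_source.mem_nhds hxe] with y hy hye
  obtain ⟨-, ⟨z, ⟨hz, hzS⟩, rfl⟩, hzy⟩ := hy
  rw [hval z hz] at hzy
  exact ⟨z, hzS, e.injOn (hsub hz) hye hzy⟩

end AdaptedCoordinates

/-! ### Localizing isomorphisms of pull-backs over the identity. -/

noncomputable section PullbackIsomorphism

set_option linter.unusedSectionVars false

attribute [-instance]
  Bundle.instNormedAddCommGroupOfRiemannianBundleOfIsTopologicalAddGroupOfContinuousConstSMulReal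

section

variable {E : Type*} [NormedAddCommGroup E] [NormedSpace ℝ E]
  {M : Type*} [TopologicalSpace M] [ChartedSpace E M] [IsManifold 𝓘(ℝ, E) ∞ M]
  {F : Type*} [NormedAddCommGroup F] [NormedSpace ℝ F]
  {A : M → Type*} [TopologicalSpace (TotalSpace F A)]
  [∀ x, AddCommGroup (A x)] [∀ x, Module ℝ (A x)] [∀ x, TopologicalSpace (A x)]
  [FiberBundle F A] [VectorBundle ℝ F A]
  {EQ : Type*} [NormedAddCommGroup EQ] [NormedSpace ℝ EQ]
  {Q : Type*} [TopologicalSpace Q] [ChartedSpace EQ Q] [IsManifold 𝓘(ℝ, EQ) ∞ Q]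

namespace LieAlgebroid

variable {𝒜 : LieAlgebroid E F A} {φ : Q → M} {s s' t t' : ∀ q, 𝒜.pullbackFiber (EQ := EQ) φ q}
  {U : Set Q}

theorem HasPullbackBracketAt.congr {q : Q} {w : 𝒜.pullbackFiber (EQ := EQ) φ q}
    (h : 𝒜.HasPullbackBracketAt φ s t q w) (hs : ∀ᶠ p in 𝓝 q, s' p = s p)
    (ht : ∀ᶠ p in 𝓝 q, t' p = t p) : 𝒜.HasPullbackBracketAt φ s' t' q w := by
  obtain ⟨m, n, f, a, g, b, W, hW, hf, hg, hsf, htg, hw, hw'⟩ := h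
  refine ⟨m, n, f, a, g, b, W ∩ {p | s' p = s p ∧ t' p = t p},
    Filter.inter_mem hW (hs.and ht), fun i => (hf i).mono inter_subset_left,
    fun i => (hg i).mono inter_subset_left, fun p hp => ?_, fun p hp => ?_, ?_, ?_⟩
  · rw [hp.2.1]
    exact hsf p hp.1
  · rw [hp.2.2]
    exact htg p hp.1
  · rw [hw, hs.self_of_nhds, ht.self_of_nhds]
  · rw [hw']
    refine Filter.EventuallyEq.mlieBracket_vectorField_eq ?_ ?_
    · exact hs.mono fun p hp => (congrArg (fun v => v.1.2) hp).symm
    · exact ht.mono fun p hp => (congrArg (fun v => v.1.2) hp).symm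

theorem hasPullbackBracketAt_congr {q : Q} {w : 𝒜.pullbackFiber (EQ := EQ) φ q}
    (hs : ∀ᶠ p in 𝓝 q, s' p = s p) (ht : ∀ᶠ p in 𝓝 q, t' p = t p) :
    𝒜.HasPullbackBracketAt φ s' t' q w ↔ 𝒜.HasPullbackBracketAt φ s t q w :=
  ⟨fun h => h.congr (hs.mono fun _ hp => hp.symm) (ht.mono fun _ hp => hp.symm),
    fun h => h.congr hs ht⟩

theorem IsSmoothPullbackSection.mono (h : 𝒜.IsSmoothPullbackSection φ s U) {V : Set Q}
    (hV : V ⊆ U) : 𝒜.IsSmoothPullbackSection φ s V :=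
  ⟨h.1.mono hV, h.2.mono hV⟩

theorem IsSmoothPullbackSection.congr (h : 𝒜.IsSmoothPullbackSection φ s U)
    (hs : ∀ q ∈ U, s' q = s q) : 𝒜.IsSmoothPullbackSection φ s' U :=
  ⟨h.1.congr fun q hq => by rw [hs q hq], h.2.congr fun q hq => by rw [hs q hq]⟩

theorem isSmoothPullbackSection_of_forall_mem (h : ∀ q ∈ U, ∃ V, IsOpen V ∧ q ∈ V ∧
    𝒜.IsSmoothPullbackSection φ s V) : 𝒜.IsSmoothPullbackSection φ s U := by
  constructor
  · intro q hq
    obtain ⟨V, hV, hqV, h1⟩ := h q hq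
    exact (h1.1.contMDiffAt (hV.mem_nhds hqV)).contMDiffWithinAt
  · intro q hq
    obtain ⟨V, hV, hqV, h1⟩ := h q hq
    exact (h1.2.contMDiffAt (hV.mem_nhds hqV)).contMDiffWithinAt

/-- Cutting off a section over an open set gives a global section. -/
theorem IsSmoothPullbackSection.smul_of_tsupport [ContMDiffVectorBundle ∞ F A 𝓘(ℝ, E)]
    (hφ : ContMDiff 𝓘(ℝ, EQ) 𝓘(ℝ, E) ∞ φ) (hU : IsOpen U) (h : 𝒜.IsSmoothPullbackSection φ s U)
    {χ : Q → ℝ} (hχ : ContMDiff 𝓘(ℝ, EQ) 𝓘(ℝ, ℝ) ∞ χ) (hχU : tsupport χ ⊆ U) :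
    𝒜.IsSmoothPullbackSection φ (fun q => χ q • s q) univ := by
  constructor
  · rw [contMDiffOn_univ]
    intro q
    rw [contMDiffAt_totalSpace]
    refine ⟨hφ q, ?_⟩
    let e := trivializationAt F A (φ q)
    have hqe : φ q ∈ e.baseSet := mem_baseSet_trivializationAt F A (φ q)
    have hev : ∀ᶠ p in 𝓝 q, φ p ∈ e.baseSet :=
      hφ.continuous.continuousAt.eventually_mem (e.open_baseSet.mem_nhds hqe)
    have h1 : ∀ p, φ p ∈ e.baseSet → (e ⟨φ p, (χ p • s p).1.1⟩).2 =
        χ p • (e ⟨φ p, (s p).1.1⟩).2 := fun p hp => (e.linear ℝ hp).map_smul _ _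
    by_cases hq : q ∈ U
    · have h2 := (h.1.contMDiffAt (hU.mem_nhds hq))
      rw [contMDiffAt_totalSpace] at h2
      refine ((hχ q).smul h2.2).congr_of_eventuallyEq ?_
      filter_upwards [hev] with p hp using h1 p hp
    · have h2 : ∀ᶠ p in 𝓝 q, χ p = 0 :=
        notMem_tsupport_iff_eventuallyEq.1 fun hh => hq (hχU hh)
      refine (contMDiffAt_const (c := (0 : F))).congr_of_eventuallyEq ?_
      filter_upwards [hev, h2] with p hp hp2
      rw [h1 p hp, hp2, zero_smul]
  · rw [contMDiffOn_univ]
    exact ContMDiffOn.smul_section_of_tsupport (V := TangentSpace 𝓘(ℝ, EQ)) hχ.contMDiffOn hU hχU h.2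

end LieAlgebroid

end

variable
  {E₁ : Type*} [NormedAddCommGroup E₁] [NormedSpace ℝ E₁]
  {M₁ : Type*} [TopologicalSpace M₁] [ChartedSpace E₁ M₁] [IsManifold 𝓘(ℝ, E₁) ∞ M₁]
  {F₁ : Type*} [NormedAddCommGroup F₁] [NormedSpace ℝ F₁]
  {A₁ : M₁ → Type*} [TopologicalSpace (TotalSpace F₁ A₁)]
  [∀ x, AddCommGroup (A₁ x)] [∀ x, Module ℝ (A₁ x)] [∀ x, TopologicalSpace (A₁ x)]
  [FiberBundle F₁ A₁] [VectorBundle ℝ F₁ A₁]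
  {E₂ : Type*} [NormedAddCommGroup E₂] [NormedSpace ℝ E₂]
  {M₂ : Type*} [TopologicalSpace M₂] [ChartedSpace E₂ M₂] [IsManifold 𝓘(ℝ, E₂) ∞ M₂]
  {F₂ : Type*} [NormedAddCommGroup F₂] [NormedSpace ℝ F₂]
  {A₂ : M₂ → Type*} [TopologicalSpace (TotalSpace F₂ A₂)]
  [∀ x, AddCommGroup (A₂ x)] [∀ x, Module ℝ (A₂ x)] [∀ x, TopologicalSpace (A₂ x)]
  [FiberBundle F₂ A₂] [VectorBundle ℝ F₂ A₂]
  {EQ : Type*} [NormedAddCommGroup EQ] [NormedSpace ℝ EQ]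
  {Q : Type*} [TopologicalSpace Q] [ChartedSpace EQ Q] [IsManifold 𝓘(ℝ, EQ) ∞ Q]
  {E' F' : Type*} [NormedAddCommGroup E'] [NormedSpace ℝ E'] [NormedAddCommGroup F']
  [NormedSpace ℝ F']

namespace LieAlgebroid

/-- An isomorphism of pull-back Lie algebroids over the identity of `Q`. -/
structure IsIsoOverId (𝒜₁ : LieAlgebroid E₁ F₁ A₁) (𝒜₂ : LieAlgebroid E₂ F₂ A₂) (φ₁ : Q → M₁)
    (φ₂ : Q → M₂) (Ψ : ∀ q : Q, 𝒜₁.pullbackFiber (EQ := EQ) φ₁ q ≃ₗ[ℝ]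
      𝒜₂.pullbackFiber (EQ := EQ) φ₂ q) : Prop where
  anchor : ∀ q v, (Ψ q v).1.2 = v.1.2
  smooth_iff : ∀ s, 𝒜₁.IsSmoothPullbackSection φ₁ s univ ↔
    𝒜₂.IsSmoothPullbackSection φ₂ (fun q => Ψ q (s q)) univ
  bracket_iff : ∀ s t, 𝒜₁.IsSmoothPullbackSection φ₁ s univ →
    𝒜₁.IsSmoothPullbackSection φ₁ t univ → ∀ q w, 𝒜₁.HasPullbackBracketAt φ₁ s t q w ↔
      𝒜₂.HasPullbackBracketAt φ₂ (fun q => Ψ q (s q)) (fun q => Ψ q (t q)) q (Ψ q w)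

variable {𝒜₁ : LieAlgebroid E₁ F₁ A₁} {𝒜₂ : LieAlgebroid E₂ F₂ A₂} {φ₁ : Q → M₁} {φ₂ : Q → M₂}
  {Ψ : ∀ q : Q, 𝒜₁.pullbackFiber (EQ := EQ) φ₁ q ≃ₗ[ℝ] 𝒜₂.pullbackFiber (EQ := EQ) φ₂ q}

theorem IsMoritaEquivalence.exists_isIsoOverId
    (h : IsMoritaEquivalence 𝒜₁ 𝒜₂ (EQ := EQ) φ₁ φ₂) :
    ∃ Ψ : ∀ q : Q, 𝒜₁.pullbackFiber (EQ := EQ) φ₁ q ≃ₗ[ℝ] 𝒜₂.pullbackFiber (EQ := EQ) φ₂ q,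
      IsIsoOverId 𝒜₁ 𝒜₂ φ₁ φ₂ Ψ := by
  obtain ⟨Ψ, hΨ⟩ := h.isomorphic
  refine ⟨fun q => LinearEquiv.ofBijective (Ψ q) (hΨ.bijective q trivial), ?_, ?_, ?_⟩
  · intro q v
    refine (hΨ.anchor q trivial v).trans ?_
    exact DFunLike.congr_fun (mfderiv_id (I := 𝓘(ℝ, EQ)) (x := q)) v.1.2
  · intro s
    exact hΨ.smooth_iff s (fun q => Ψ q (s q)) fun q _ => rfl
  · intro s t hs ht q w
    exact hΨ.bracket_iff s t (fun q => Ψ q (s q)) (fun q => Ψ q (t q)) (fun q _ => rfl)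
      (fun q _ => rfl) hs ht q trivial w

theorem IsIsoOverId.symm (h : IsIsoOverId 𝒜₁ 𝒜₂ φ₁ φ₂ Ψ) :
    IsIsoOverId 𝒜₂ 𝒜₁ φ₂ φ₁ (fun q => (Ψ q).symm) where
  anchor q v := by
    have := h.anchor q ((Ψ q).symm v)
    rw [LinearEquiv.apply_symm_apply] at this
    exact this.symm
  smooth_iff s := by
    have := h.smooth_iff fun q => (Ψ q).symm (s q)
    simp only [LinearEquiv.apply_symm_apply] at this
    exact this.symm
  bracket_iff s t hs ht q w := by
    have h1 := fun s : ∀ q, 𝒜₂.pullbackFiber (EQ := EQ) φ₂ q =>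
      h.smooth_iff fun q => (Ψ q).symm (s q)
    have h2 := h.bracket_iff (fun q => (Ψ q).symm (s q)) (fun q => (Ψ q).symm (t q))
    simp only [LinearEquiv.apply_symm_apply] at h1 h2
    have h3 := h2 ((h1 s).2 hs) ((h1 t).2 ht) q ((Ψ q).symm w)
    rw [LinearEquiv.apply_symm_apply] at h3
    exact h3.symm

section

variable [FiniteDimensional ℝ EQ] [T2Space Q] [ContMDiffVectorBundle ∞ F₁ A₁ 𝓘(ℝ, E₁)]
  [ContMDiffVectorBundle ∞ F₂ A₂ 𝓘(ℝ, E₂)]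

/-- The isomorphism is tested on global sections; multiplying by a bump function equal to `1` near a
point globalizes a local section without changing it there. -/
theorem IsIsoOverId.isSmoothPullbackSection (h : IsIsoOverId 𝒜₁ 𝒜₂ φ₁ φ₂ Ψ)
    (hφ₁ : ContMDiff 𝓘(ℝ, EQ) 𝓘(ℝ, E₁) ∞ φ₁) {V : Set Q}
    (hV : IsOpen V) {s : ∀ q, 𝒜₁.pullbackFiber (EQ := EQ) φ₁ q}
    (hs : 𝒜₁.IsSmoothPullbackSection φ₁ s V) :
    𝒜₂.IsSmoothPullbackSection φ₂ (fun q => Ψ q (s q)) V := by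
  refine isSmoothPullbackSection_of_forall_mem fun q hq => ?_
  obtain ⟨χ, hχ, hχV, h1⟩ := exists_contMDiff_bump (E := EQ) hV hq
  obtain ⟨W, hW, hWo, hqW⟩ := eventually_nhds_iff.1 h1
  refine ⟨W, hWo, hqW, ?_⟩
  have h2 := (h.smooth_iff _).1 (hs.smul_of_tsupport hφ₁ hV hχ hχV)
  refine (h2.mono (subset_univ W)).congr fun p hp => ?_
  rw [hW p hp, Pi.one_apply, one_smul]

theorem IsIsoOverId.hasPullbackBracketAt_iff (h : IsIsoOverId 𝒜₁ 𝒜₂ φ₁ φ₂ Ψ)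
    (hφ₁ : ContMDiff 𝓘(ℝ, EQ) 𝓘(ℝ, E₁) ∞ φ₁) {V : Set Q} (hV : IsOpen V)
    {s t : ∀ q, 𝒜₁.pullbackFiber (EQ := EQ) φ₁ q}
    (hs : 𝒜₁.IsSmoothPullbackSection φ₁ s V) (ht : 𝒜₁.IsSmoothPullbackSection φ₁ t V) {q : Q}
    (hq : q ∈ V) (w : 𝒜₁.pullbackFiber (EQ := EQ) φ₁ q) :
    𝒜₁.HasPullbackBracketAt φ₁ s t q w ↔
      𝒜₂.HasPullbackBracketAt φ₂ (fun q => Ψ q (s q)) (fun q => Ψ q (t q)) q (Ψ q w) := by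
  obtain ⟨χ, hχ, hχV, h1⟩ := exists_contMDiff_bump (E := EQ) hV hq
  have h2 := h.bracket_iff _ _ (hs.smul_of_tsupport hφ₁ hV hχ hχV)
    (ht.smul_of_tsupport hφ₁ hV hχ hχV) q w
  have h3 : ∀ s : ∀ q, 𝒜₁.pullbackFiber (EQ := EQ) φ₁ q, ∀ᶠ p in 𝓝 q, s p = χ p • s p :=
    fun s => by
      filter_upwards [h1] with p hp
      rw [hp, Pi.one_apply, one_smul]
  rw [hasPullbackBracketAt_congr (h3 s) (h3 t), h2]
  exact (hasPullbackBracketAt_congr ((h3 s).mono fun p hp => congrArg (Ψ p) hp)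
    ((h3 t).mono fun p hp => congrArg (Ψ p) hp)).symm

/-- A normal form depends only on the isomorphism class over `Q`: the same map `u` serves both
pull-backs. This is where the two sides of the equivalence meet. -/
theorem IsIsoOverId.isPNF (h : IsIsoOverId 𝒜₁ 𝒜₂ φ₁ φ₂ Ψ)
    (hφ₁ : ContMDiff 𝓘(ℝ, EQ) 𝓘(ℝ, E₁) ∞ φ₁) (hφ₂ : ContMDiff 𝓘(ℝ, EQ) 𝓘(ℝ, E₂) ∞ φ₂)
    {C : LocalModel E' F'} {U : Set Q} {u : Q → E'}
    {Θ : ∀ q, 𝒜₁.pullbackFiber (EQ := EQ) φ₁ q →ₗ[ℝ] F'} (hΘ : 𝒜₁.IsPNF φ₁ C U u Θ) :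
    𝒜₂.IsPNF φ₂ C U u (fun q => Θ q ∘ₗ (Ψ q).symm.toLinearMap) where
  isOpen := hΘ.isOpen
  mapsTo := hΘ.mapsTo
  contMDiffOn_base := hΘ.contMDiffOn_base
  anchor q hq w := by
    have := hΘ.anchor q hq ((Ψ q).symm w)
    rw [h.symm.anchor q w] at this
    exact this
  cartesian q hq k' X hX := by
    obtain ⟨v, ⟨hv, hv'⟩, hu⟩ := hΘ.cartesian q hq k' X hX
    refine ⟨Ψ q v, ⟨?_, (h.anchor q v).trans hv'⟩, ?_⟩
    · change Θ q ((Ψ q).symm (Ψ q v)) = k'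
      rw [LinearEquiv.symm_apply_apply, hv]
    · rintro w ⟨hw, hw'⟩
      rw [← hu ((Ψ q).symm w) ⟨hw, (h.symm.anchor q w).trans hw'⟩, LinearEquiv.apply_symm_apply]
  smooth_iff V hV hVU s := by
    have h1 : 𝒜₂.IsSmoothPullbackSection φ₂ s V ↔
        𝒜₁.IsSmoothPullbackSection φ₁ (fun q => (Ψ q).symm (s q)) V := by
      refine ⟨fun hs => h.symm.isSmoothPullbackSection hφ₂ hV hs, fun hs => ?_⟩
      have := h.isSmoothPullbackSection hφ₁ hV hs
      simpa only [LinearEquiv.apply_symm_apply] using this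
    rw [h1, hΘ.smooth_iff V hV hVU]
    simp only [h.symm.anchor]
    rfl
  bracket_iff V hV hVU s t hs ht q hq w := by
    have h1 := hΘ.bracket_iff V hV hVU _ _ (h.symm.isSmoothPullbackSection hφ₂ hV hs)
      (h.symm.isSmoothPullbackSection hφ₂ hV ht) q hq ((Ψ q).symm w)
    rw [h.symm.hasPullbackBracketAt_iff hφ₂ hV hs ht hq, h1]
    simp only [h.symm.anchor]
    rfl

end

end LieAlgebroid

end PullbackIsomorphism

/-! ### Lifting a model to a pull-back along slices. -/

noncomputable section SpansOfNormalForms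

set_option linter.unusedSectionVars false

attribute [-instance]
  Bundle.instNormedAddCommGroupOfRiemannianBundleOfIsTopologicalAddGroupOfContinuousConstSMulReal

/-- Composition with a right inverse of `G x` gives an operator near the identity, hence invertible.
-/
theorem ContinuousAt.eventually_surjective {P V W : Type*} [TopologicalSpace P]
    [NormedAddCommGroup V] [NormedSpace ℝ V] [NormedAddCommGroup W] [NormedSpace ℝ W]
    [FiniteDimensional ℝ W] {G : P → V →L[ℝ] W} {x : P} (hG : ContinuousAt G x)
    (hs : Function.Surjective (G x)) : ∀ᶠ y in 𝓝 x, Function.Surjective (G y) := by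
  have : CompleteSpace W := FiniteDimensional.complete ℝ W
  obtain ⟨R₀, hR₀⟩ := (G x).toLinearMap.exists_rightInverse_of_surjective
    (LinearMap.range_eq_top.2 hs)
  let R : W →L[ℝ] V := LinearMap.toContinuousLinearMap R₀
  have h1 : ContinuousAt (fun y => (G y).comp R) x := hG.clm_comp continuousAt_const
  have h2 : (G x).comp R = (ContinuousLinearEquiv.refl ℝ W : W →L[ℝ] W) := by
    ext w
    exact DFunLike.congr_fun hR₀ w
  have h3 := h1.eventually_mem (s := range ((↑) : (W ≃L[ℝ] W) → W →L[ℝ] W)) (by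
    rw [h2]
    exact ContinuousLinearEquiv.nhds _)
  filter_upwards [h3] with y hy w
  obtain ⟨e, he⟩ := hy
  exact ⟨R (e.symm w), (DFunLike.congr_fun he.symm _).trans (e.apply_symm_apply w)⟩

section

variable {E : Type*} [NormedAddCommGroup E] [NormedSpace ℝ E] {M : Type*} [TopologicalSpace M]
  [ChartedSpace E M] {V : Type*} [NormedAddCommGroup V] [NormedSpace ℝ V]

theorem coordField_add (h : OpenPartialHomeomorph M V) (k l : M → V) (x : M) :
    coordField E h (fun y => k y + l y) x = coordField E h k x + coordField E h l x :=
  map_add (mfderiv 𝓘(ℝ, V) 𝓘(ℝ, E) h.symm (h x)) _ _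

theorem coordField_smul (h : OpenPartialHomeomorph M V) (r : ℝ) (k : M → V) (x : M) :
    coordField E h (fun y => r • k y) x = r • coordField E h k x :=
  map_smul (mfderiv 𝓘(ℝ, V) 𝓘(ℝ, E) h.symm (h x)) _ _

end

variable {E : Type*} [NormedAddCommGroup E] [NormedSpace ℝ E]
  {M : Type*} [TopologicalSpace M] [ChartedSpace E M] [IsManifold 𝓘(ℝ, E) ∞ M]
  {F : Type*} [NormedAddCommGroup F] [NormedSpace ℝ F]
  {A : M → Type*} [TopologicalSpace (TotalSpace F A)]
  [∀ x, AddCommGroup (A x)] [∀ x, Module ℝ (A x)] [∀ x, TopologicalSpace (A x)]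
  [FiberBundle F A] [VectorBundle ℝ F A]
  {EQ : Type*} [NormedAddCommGroup EQ] [NormedSpace ℝ EQ]
  {Q : Type*} [TopologicalSpace Q] [ChartedSpace EQ Q] [IsManifold 𝓘(ℝ, EQ) ∞ Q]
  {E' F' : Type*} [NormedAddCommGroup E'] [NormedSpace ℝ E'] [NormedAddCommGroup F']
  [NormedSpace ℝ F']
  {E'' F'' : Type*} [NormedAddCommGroup E''] [NormedSpace ℝ E''] [NormedAddCommGroup F'']
  [NormedSpace ℝ F'']

namespace LieAlgebroid

variable {𝒜 : LieAlgebroid E F A} {φ : Q → M} {C : LocalModel E' F'} {U : Set Q} {u : Q → E'}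
  {Θ : ∀ q, 𝒜.pullbackFiber (EQ := EQ) φ q →ₗ[ℝ] F'}

theorem IsPNF.injective (h : 𝒜.IsPNF φ C U u Θ) {q : Q} (hq : q ∈ U)
    {v w : 𝒜.pullbackFiber (EQ := EQ) φ q} (h1 : Θ q v = Θ q w) (h2 : v.1.2 = w.1.2) : v = w :=
  (h.cartesian q hq _ _ (h.anchor q hq w)).unique ⟨h1, h2⟩ ⟨rfl, rfl⟩

section Lift

variable {T : Type*} [NormedAddCommGroup T] [NormedSpace ℝ T]
  {H : OpenPartialHomeomorph Q (E' × T)}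

/-- In coordinates `(u, τ)`, the local model lifts to sections of the pull-back which are tangent to
the slices `τ = const`. -/
theorem IsPNF.exists_lift (h : 𝒜.IsPNF φ C U u Θ) (hH : IsSmoothChart EQ H) (hHU : H.source ⊆ U)
    (hHu : ∀ q ∈ H.source, (H q).1 = u q) (q : Q) :
    ∃ l : F' →ₗ[ℝ] 𝒜.pullbackFiber (EQ := EQ) φ q, q ∈ H.source → ∀ k, Θ q (l k) = k ∧
      (l k).1.2 = coordField EQ H (fun p => (C.anchor (u p) k, (0 : T))) q := by
  by_cases hq : q ∈ H.source
  · have hu : ∀ X, mvfderiv 𝓘(ℝ, EQ) u q X = (mvfderiv 𝓘(ℝ, EQ) H q X).1 := fun X => by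
      have h1 : u =ᶠ[𝓝 q] fun p => (H p).1 := by
        filter_upwards [H.open_source.mem_nhds hq] with p hp using (hHu p hp).symm
      rw [h1.mvfderiv_eq, mvfderiv_comp_fderiv (g := Prod.fst) differentiableAt_fst
        (hH.mdifferentiableAt hq), fderiv_fst]
      rfl
    have h1 : ∀ k, ∃ w, Θ q w = k ∧
        w.1.2 = coordField EQ H (fun p => (C.anchor (u p) k, (0 : T))) q := fun k => by
      refine (h.cartesian q (hHU hq) k _ ?_).exists
      rw [hu, hH.mvfderiv_coordField hq]
    choose l hl hl' using h1
    refine ⟨⟨⟨l, fun k k' => h.injective (hHU hq) ?_ ?_⟩, fun r k =>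
      h.injective (hHU hq) ?_ ?_⟩, fun _ k => ⟨hl k, hl' k⟩⟩
    · rw [map_add, hl, hl, hl]
    · refine (hl' _).trans (Eq.trans ?_ (congrArg₂ (· + ·) (hl' k) (hl' k')).symm)
      refine Eq.trans (congrArg (coordField EQ H · q) (funext fun p => ?_)) (coordField_add _ _ _ _)
      rw [map_add, Prod.mk_add_mk, add_zero]
    · rw [map_smul, hl, hl]
      rfl
    · refine (hl' _).trans (Eq.trans ?_ (congrArg (r • ·) (hl' k)).symm)
      refine Eq.trans (congrArg (coordField EQ H · q) (funext fun p => ?_)) (coordField_smul _ _ _ _)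
      rw [map_smul, Prod.smul_mk, smul_zero]
  · exact ⟨0, fun h => absurd h hq⟩

theorem IsPNF.isSmoothPullbackSection_lift (h : 𝒜.IsPNF φ C U u Θ) (hH : IsSmoothChart EQ H)
    (hHU : H.source ⊆ U) {s : ∀ q, 𝒜.pullbackFiber (EQ := EQ) φ q} {k : F'}
    (hs : ∀ q ∈ H.source, Θ q (s q) = k)
    (hs' : ∀ q ∈ H.source,
      (s q).1.2 = coordField EQ H (fun p => (C.anchor (u p) k, (0 : T))) q) :
    𝒜.IsSmoothPullbackSection φ s H.source := by
  refine (h.smooth_iff _ H.open_source hHU _).2 ⟨contMDiffOn_const.congr hs, ?_⟩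
  have h1 : ContMDiffOn 𝓘(ℝ, EQ) 𝓘(ℝ, E') ∞ (fun p => C.anchor (u p) k) H.source :=
    (C.contDiffOn_anchor.clm_apply contDiffOn_const).contMDiffOn.comp
      (h.contMDiffOn_base.mono hHU) fun q hq => h.mapsTo (hHU hq)
  refine (hH.contMDiffOn_coordField subset_rfl (h1.prodMk_space (contMDiffOn_const (c := (0 : T))))).congr
    fun q hq => ?_
  exact congrArg (fun X => (⟨q, X⟩ : TangentBundle 𝓘(ℝ, EQ) Q)) (hs' q hq)

/-- Lifts of constants have constant image in the model, so only the tensor remains. Their vector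
fields have no component along `T`, and the anchor condition of `C` computes their Lie bracket. -/
theorem IsPNF.hasPullbackBracketAt_lift [CompleteSpace EQ] (h : 𝒜.IsPNF φ C U u Θ)
    (hH : IsSmoothChart EQ H) (hHU : H.source ⊆ U) (hHu : ∀ q ∈ H.source, (H q).1 = u q)
    {s t : ∀ q, 𝒜.pullbackFiber (EQ := EQ) φ q} {k l : F'}
    (hs : ∀ q ∈ H.source, Θ q (s q) = k)
    (hs' : ∀ q ∈ H.source, (s q).1.2 = coordField EQ H (fun p => (C.anchor (u p) k, (0 : T))) q)
    (ht : ∀ q ∈ H.source, Θ q (t q) = l)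
    (ht' : ∀ q ∈ H.source, (t q).1.2 = coordField EQ H (fun p => (C.anchor (u p) l, (0 : T))) q)
    {q : Q} (hq : q ∈ H.source) {w : 𝒜.pullbackFiber (EQ := EQ) φ q}
    (hw : Θ q w = C.tensor (u q) k l) (hw' : w.1.2 =
      coordField EQ H (fun p => (C.anchor (u p) (C.tensor (u q) k l), (0 : T))) q) :
    𝒜.HasPullbackBracketAt φ s t q w := by
  have hss := h.isSmoothPullbackSection_lift hH hHU hs hs'
  have hst := h.isSmoothPullbackSection_lift hH hHU ht ht'
  have hud : MDifferentiableAt 𝓘(ℝ, EQ) 𝓘(ℝ, E') u q :=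
    h.contMDiffOn_base.mdifferentiableAt_of_isOpen h.isOpen (hHU hq)
  have huC : u q ∈ C.dom := h.mapsTo (hHU hq)
  rw [h.bracket_iff _ H.open_source hHU _ _ hss hst q hq]
  have hconst : ∀ {t : ∀ q, 𝒜.pullbackFiber (EQ := EQ) φ q} {l : F'},
      (∀ q ∈ H.source, Θ q (t q) = l) → ∀ X,
      mvfderiv 𝓘(ℝ, EQ) (fun p => Θ p (t p)) q X = 0 := fun {t l} ht X => by
    have h1 : (fun p => Θ p (t p)) =ᶠ[𝓝 q] fun _ => l := by
      filter_upwards [H.open_source.mem_nhds hq] with p hp using ht p hp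
    rw [h1.mvfderiv_eq, mvfderiv_const]
    rfl
  have hd : ∀ {t : ∀ q, 𝒜.pullbackFiber (EQ := EQ) φ q} {l : F'}, (∀ q ∈ H.source, (t q).1.2 =
      coordField EQ H (fun p => (C.anchor (u p) l, (0 : T))) q) → ∀ p ∈ H.source,
      mvfderiv 𝓘(ℝ, EQ) H p (t p).1.2 = (C.anchor (u p) l, 0) := fun {t l} ht p hp =>
    (congrArg (mvfderiv 𝓘(ℝ, EQ) H p) (ht p hp)).trans (hH.mvfderiv_coordField hp _)
  have hu : ∀ X, mvfderiv 𝓘(ℝ, EQ) u q X = (mvfderiv 𝓘(ℝ, EQ) H q X).1 := fun X => by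
    have h1 : u =ᶠ[𝓝 q] fun p => (H p).1 := by
      filter_upwards [H.open_source.mem_nhds hq] with p hp using (hHu p hp).symm
    rw [h1.mvfderiv_eq, mvfderiv_comp_fderiv (g := Prod.fst) differentiableAt_fst
      (hH.mdifferentiableAt hq), fderiv_fst]
    rfl
  have hρ : ∀ l, DifferentiableAt ℝ (fun y => C.anchor y l) (u q) := fun l =>
    (C.contDiffOn_anchor.clm_apply contDiffOn_const).differentiableAt_of_isOpen C.isOpen_dom huC
  have hdd : ∀ {t : ∀ q, 𝒜.pullbackFiber (EQ := EQ) φ q} {l : F'}, (∀ q ∈ H.source, (t q).1.2 =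
      coordField EQ H (fun p => (C.anchor (u p) l, (0 : T))) q) → ∀ X,
      mvfderiv 𝓘(ℝ, EQ) (fun p => mvfderiv 𝓘(ℝ, EQ) H p (t p).1.2) q X =
        (fderiv ℝ (fun y => C.anchor y l) (u q) (mvfderiv 𝓘(ℝ, EQ) u q X), 0) := by
    intro t l ht X
    have h1 : (fun p => mvfderiv 𝓘(ℝ, EQ) H p (t p).1.2) =ᶠ[𝓝 q]
        fun p => ((fun y => (C.anchor y l, (0 : T))) (u p)) := by
      filter_upwards [H.open_source.mem_nhds hq] with p hp using hd ht p hp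
    refine (h1.mvfderiv_eq X).trans ((mvfderiv_comp_fderiv (g := fun y => (C.anchor y l, (0 : T)))
      ((hρ l).prodMk (differentiableAt_const _)) hud X).trans ?_)
    rw [((hρ l).hasFDerivAt.prodMk (hasFDerivAt_const (0 : T) (u q))).fderiv]
    rfl
  refine ⟨?_, ?_⟩
  · rw [hconst ht, hconst hs, hs q hq, ht q hq, hw, sub_zero, zero_add]
  · refine hH.injective_mvfderiv hq ?_
    have h1 := mvfderiv_mlieBracket H.open_source hH.contMDiffOn hss.2 hst.2 hq
    refine Eq.trans ?_ h1.symm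
    rw [hdd ht', hdd hs', hu, hu, hd hs' q hq, hd ht' q hq]
    refine ((congrArg (mvfderiv 𝓘(ℝ, EQ) H q) hw').trans (hH.mvfderiv_coordField hq _)).trans ?_
    have h2 := C.anchor_bracket C.dom C.isOpen_dom subset_rfl (fun _ => k) (fun _ => l)
      contDiffOn_const contDiffOn_const (u q) huC
    have h3 := C.bracket_const k l (u q)
    rw [LocalModel.bracket] at h3
    rw [h3] at h2
    rw [h2, Prod.mk_sub_mk, sub_zero]
    rfl

end Lift

end LieAlgebroid

end SpansOfNormalForms

/-! ### Comparing two models of the same pull-back. -/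

noncomputable section SpanHomomorphism

set_option linter.unusedSectionVars false

attribute [-instance]
  Bundle.instNormedAddCommGroupOfRiemannianBundleOfIsTopologicalAddGroupOfContinuousConstSMulReal

variable {E : Type*} [NormedAddCommGroup E] [NormedSpace ℝ E]
  {M : Type*} [TopologicalSpace M] [ChartedSpace E M] [IsManifold 𝓘(ℝ, E) ∞ M]
  {F : Type*} [NormedAddCommGroup F] [NormedSpace ℝ F]
  {A : M → Type*} [TopologicalSpace (TotalSpace F A)]
  [∀ x, AddCommGroup (A x)] [∀ x, Module ℝ (A x)] [∀ x, TopologicalSpace (A x)]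
  [FiberBundle F A] [VectorBundle ℝ F A]
  {EQ : Type*} [NormedAddCommGroup EQ] [NormedSpace ℝ EQ] [FiniteDimensional ℝ EQ]
  {Q : Type*} [TopologicalSpace Q] [ChartedSpace EQ Q] [IsManifold 𝓘(ℝ, EQ) ∞ Q]
  {E' F' : Type*} [NormedAddCommGroup E'] [NormedSpace ℝ E'] [NormedAddCommGroup F']
  [NormedSpace ℝ F'] [FiniteDimensional ℝ E']
  {E'' F'' : Type*} [NormedAddCommGroup E''] [NormedSpace ℝ E''] [NormedAddCommGroup F'']
  [NormedSpace ℝ F''] [FiniteDimensional ℝ F'']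

namespace LieAlgebroid

variable {𝒜 : LieAlgebroid E F A} {φ : Q → M} {C : LocalModel E' F'} {U : Set Q} {u : Q → E'}
  {Θ : ∀ q, 𝒜.pullbackFiber (EQ := EQ) φ q →ₗ[ℝ] F'}
  {C₀ : LocalModel E'' F''} {U₀ : Set Q} {u₀ : Q → E''}
  {Θ₀ : ∀ q, 𝒜.pullbackFiber (EQ := EQ) φ q →ₗ[ℝ] F''}

/-- Two normal forms of a pull-back Lie algebroid, the second with vanishing anchor, are related by
a morphism of local models. -/
theorem IsPNF.exists_isHom (h₀ : 𝒜.IsPNF φ C₀ U₀ u₀ Θ₀) (h : 𝒜.IsPNF φ C U u Θ) {q₀ : Q}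
    (hq₀ : q₀ ∈ U₀) (hq : q₀ ∈ U) (hs₀ : Function.Surjective (mvfderiv 𝓘(ℝ, EQ) u₀ q₀))
    (hs : Function.Surjective (mvfderiv 𝓘(ℝ, EQ) u q₀)) (hC : C.anchor (u q₀) = 0) :
    ∃ (W : Set E'') (v : E'' → E') (η : E'' → F'' →L[ℝ] F'), C₀.IsHom C W v η ∧ u₀ q₀ ∈ W ∧
      v (u₀ q₀) = u q₀ := by
  have : CompleteSpace EQ := FiniteDimensional.complete ℝ EQ
  obtain ⟨T, H, hH, hqH, hHU', hH2, hHu⟩ := exists_isSmoothChart_of_surjective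
    (h₀.isOpen.inter h.isOpen) (h₀.contMDiffOn_base.mono inter_subset_left) ⟨hq₀, hq⟩ hs₀
  have hHU₀ : H.source ⊆ U₀ := fun q hq => (hHU' hq).1
  have hHU : H.source ⊆ U := fun q hq => (hHU' hq).2
  choose l hl using h₀.exists_lift hH hHU₀ hHu
  have hΘl : ∀ k, ∀ q ∈ H.source, Θ₀ q (l q k) = k := fun k q hq => (hl q hq k).1
  have hXl : ∀ k, ∀ q ∈ H.source, (l q k).1.2 =
      coordField EQ H (fun p => (C₀.anchor (u₀ p) k, (0 : T))) q := fun k q hq => (hl q hq k).2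
  have hsm : ∀ k, 𝒜.IsSmoothPullbackSection φ (fun q => l q k) H.source := fun k =>
    h₀.isSmoothPullbackSection_lift hH hHU₀ (hΘl k) (hXl k)
  let W₀ : Set E'' := (fun y => (y, (0 : T))) ⁻¹' H.target
  have hW₀ : IsOpen W₀ := H.open_target.preimage (by fun_prop)
  -- The slice through `q₀`, a local section of `u₀`. The morphism will be `(u, Θ)` restricted to
  -- it, with `Θ` evaluated on the lifts `l`.
  let σ : E'' → Q := fun y => H.symm (y, 0)
  have hσs : ∀ y ∈ W₀, σ y ∈ H.source := fun y hy => H.map_target hy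
  have hHσ : ∀ y ∈ W₀, H (σ y) = (y, 0) := fun y hy => H.right_inv hy
  have huσ : ∀ y ∈ W₀, u₀ (σ y) = y := fun y hy => by rw [← hHu _ (hσs y hy), hHσ y hy]
  have hHq : H q₀ = (u₀ q₀, 0) := Prod.ext (hHu q₀ hqH) hH2
  have hyW₀ : u₀ q₀ ∈ W₀ := by
    change (u₀ q₀, (0 : T)) ∈ H.target
    rw [← hHq]
    exact H.map_source hqH
  have hσq : σ (u₀ q₀) = q₀ := by
    change H.symm (u₀ q₀, 0) = q₀
    rw [← hHq, H.left_inv hqH]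
  have hi : ContDiff ℝ ∞ (fun y : E'' => (y, (0 : T))) := contDiff_id.prodMk contDiff_const
  have hi' : ∀ y v, mfderiv 𝓘(ℝ, E'') 𝓘(ℝ, E'' × T) (fun y : E'' => (y, (0 : T))) y v = (v, 0) := by
    intro y v
    have h1 := ((hasFDerivAt_id (𝕜 := ℝ) y).prodMk (hasFDerivAt_const (0 : T) y)).fderiv
    have h2 := mvfderiv_eq_fderiv (fun y : E'' => (y, (0 : T))) y v
    exact h2.trans (DFunLike.congr_fun h1 v)
  have hσ : ContMDiffOn 𝓘(ℝ, E'') 𝓘(ℝ, EQ) ∞ σ W₀ :=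
    hH.contMDiffOn_symm.comp hi.contMDiff.contMDiffOn fun y hy => hy
  have hσd : ∀ y ∈ W₀, ∀ v, mfderiv 𝓘(ℝ, E'') 𝓘(ℝ, EQ) σ y v =
      mfderiv 𝓘(ℝ, E'' × T) 𝓘(ℝ, EQ) H.symm (y, 0) (v, 0) := fun y hy v => by
    have h1 := mfderiv_comp_apply (I := 𝓘(ℝ, E'')) (I' := 𝓘(ℝ, E'' × T)) (I'' := 𝓘(ℝ, EQ)) y
      (g := H.symm) (f := fun y : E'' => (y, (0 : T))) (hH.mdifferentiableAt_symm hy)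
      ((hi.differentiable (by simp) y).mdifferentiableAt) v
    exact h1.trans (congrArg (mfderiv 𝓘(ℝ, E'' × T) 𝓘(ℝ, EQ) H.symm (y, 0)) (hi' y v))
  have hσX : ∀ y ∈ W₀, ∀ k, (l (σ y) k).1.2 =
      mfderiv 𝓘(ℝ, E'') 𝓘(ℝ, EQ) σ y (C₀.anchor y k) := fun y hy k => by
    have h1 := hXl k _ (hσs y hy)
    rw [coordField, huσ y hy, hHσ y hy] at h1
    exact h1.trans (hσd y hy _).symm
  have hu₀σ : ∀ y ∈ W₀, ∀ v, mvfderiv 𝓘(ℝ, EQ) u₀ (σ y) (mfderiv 𝓘(ℝ, E'') 𝓘(ℝ, EQ) σ y v) = v := by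
    intro y hy v
    refine mfderiv_leftInverse (hσ.mdifferentiableAt_of_isOpen hW₀ hy)
      (h₀.contMDiffOn_base.mdifferentiableAt_of_isOpen h₀.isOpen (hHU₀ (hσs y hy))) ?_ v
    filter_upwards [hW₀.mem_nhds hy] with z hz using huσ z hz
  let v : E'' → E' := fun y => u (σ y)
  have hvm : ContMDiffOn 𝓘(ℝ, E'') 𝓘(ℝ, E') ∞ v W₀ :=
    h.contMDiffOn_base.comp hσ fun y hy => hHU (hσs y hy)
  have hv : ContDiffOn ℝ ∞ v W₀ := hvm.contDiffOn
  have hvd : ∀ y ∈ W₀, ∀ X, fderiv ℝ v y X =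
      mvfderiv 𝓘(ℝ, EQ) u (σ y) (mfderiv 𝓘(ℝ, E'') 𝓘(ℝ, EQ) σ y X) := fun y hy X => by
    rw [← mvfderiv_eq_fderiv]
    exact mvfderiv_comp_mfderiv
      (h.contMDiffOn_base.mdifferentiableAt_of_isOpen h.isOpen (hHU (hσs y hy)))
      (hσ.mdifferentiableAt_of_isOpen hW₀ hy) X
  let η : E'' → F'' →L[ℝ] F' := fun y => LinearMap.toContinuousLinearMap (Θ (σ y) ∘ₗ l (σ y))
  have hΘs : ∀ k, ContMDiffOn 𝓘(ℝ, EQ) 𝓘(ℝ, F') ∞ (fun q => Θ q (l q k)) H.source := fun k =>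
    ((h.smooth_iff _ H.open_source hHU _).1 (hsm k)).1
  have hη : ContDiffOn ℝ ∞ η W₀ := contDiffOn_clm_apply.2 fun k =>
    ((hΘs k).comp hσ fun y hy => hσs y hy).contDiffOn
  have hηd : ∀ y ∈ W₀, ∀ X k, fderiv ℝ η y X k = mvfderiv 𝓘(ℝ, EQ) (fun q => Θ q (l q k)) (σ y)
      (mfderiv 𝓘(ℝ, E'') 𝓘(ℝ, EQ) σ y X) := fun y hy X k => by
    have h1 := (hη.differentiableAt_of_isOpen hW₀ hy).hasFDerivAt.clm_apply
      (hasFDerivAt_const k y)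
    have h2 : fderiv ℝ (fun y => η y k) y X = fderiv ℝ η y X k := by
      rw [h1.fderiv]
      simp
    rw [← h2, ← mvfderiv_eq_fderiv]
    exact mvfderiv_comp_mfderiv ((hΘs k).mdifferentiableAt_of_isOpen H.open_source (hσs y hy))
      (hσ.mdifferentiableAt_of_isOpen hW₀ hy) X
  have hanchor : ∀ y ∈ W₀, ∀ k, C.anchor (v y) (η y k) = fderiv ℝ v y (C₀.anchor y k) := by
    intro y hy k
    rw [hvd y hy, ← hσX y hy]
    exact h.anchor _ (hHU (hσs y hy)) _
  -- A vector killed by `du₀` is the anchor of some `w` over `0`; since the anchor of `C` vanishes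
  -- at `u q₀`, `du` kills it too. So `du` factors through `du₀` at `q₀` and its image is already
  -- attained on the slice.
  have hsurj : Function.Surjective (fderiv ℝ v (u₀ q₀)) := by
    intro e
    obtain ⟨X, hX⟩ := hs e
    refine ⟨mvfderiv 𝓘(ℝ, EQ) u₀ q₀ X, ?_⟩
    have h1 : ∀ q, q = q₀ → ∀ X : TangentSpace 𝓘(ℝ, EQ) q, mvfderiv 𝓘(ℝ, EQ) u₀ q X = 0 →
        mvfderiv 𝓘(ℝ, EQ) u q X = 0 := by
      rintro q rfl X hX
      have h2 : C₀.anchor (u₀ q) 0 = mvfderiv 𝓘(ℝ, EQ) u₀ q X := by rw [hX, map_zero]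
      obtain ⟨w, -, hw⟩ := (h₀.cartesian q hq₀ 0 X h2).exists
      rw [← hw, ← h.anchor q hq, hC]
      rfl
    have h2 := hvd _ hyW₀ (mvfderiv 𝓘(ℝ, EQ) u₀ q₀ X)
    have h3 := hu₀σ _ hyW₀ (mvfderiv 𝓘(ℝ, EQ) u₀ q₀ X)
    have h4 : ∀ q (hq : q = q₀) (Y : TangentSpace 𝓘(ℝ, EQ) q),
        mvfderiv 𝓘(ℝ, EQ) u₀ q Y = mvfderiv 𝓘(ℝ, EQ) u₀ q₀ X →
        mvfderiv 𝓘(ℝ, EQ) u q Y = mvfderiv 𝓘(ℝ, EQ) u q₀ X := by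
      rintro q rfl Y hY
      have h5 := h1 q rfl (Y - X) (by rw [map_sub, hY, sub_self])
      rwa [map_sub, sub_eq_zero] at h5
    exact h2.trans ((h4 _ hσq _ h3).trans hX)
  have hev := ((hv.fderiv_of_isOpen hW₀ (m := 0) (by simp)).continuousOn.continuousAt
    (hW₀.mem_nhds hyW₀)).eventually_surjective hsurj
  obtain ⟨W, hW, hWo, hyW⟩ := eventually_nhds_iff.1 (hev.and (hW₀.eventually_mem hyW₀))
  have hWW₀ : W ⊆ W₀ := fun y hy => (hW y hy).2
  refine ⟨W, v, η, ?_, hyW, congrArg u hσq⟩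
  exact
    { isOpen := hWo
      mapsTo := fun y hy => h.mapsTo (hHU (hσs y (hWW₀ hy)))
      contDiffOn_base := hv.mono hWW₀
      contDiffOn_fiber := hη.mono hWW₀
      surjective := fun y hy => (hW y hy).1
      anchor := fun y hy => hanchor y (hWW₀ hy)
      cartesian := fun y hy k' X hX => by
        have hy' := hWW₀ hy
        have hyH := hσs y hy'
        rw [hvd y hy'] at hX
        obtain ⟨w, ⟨hw, hw'⟩, huniq⟩ := h.cartesian _ (hHU hyH) k' _ hX
        have h1 : C₀.anchor y (Θ₀ (σ y) w) = X := by
          have h2 := h₀.anchor _ (hHU₀ hyH) w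
          rw [huσ y hy', hw'] at h2
          exact h2.trans (hu₀σ y hy' X)
        refine ⟨Θ₀ (σ y) w, ⟨?_, h1⟩, ?_⟩
        -- The vector part of `w` is tangent to the slice and its image in `C₀` is the argument of
        -- the lift, so it equals the lift.
        · have h3 : l (σ y) (Θ₀ (σ y) w) = w := by
            refine h₀.injective (hHU₀ hyH) (hΘl _ _ hyH) ?_
            rw [hσX y hy', h1, hw']
          exact (congrArg (Θ (σ y)) h3).trans hw
        · rintro k ⟨hk, hk'⟩
          have h3 : l (σ y) k = w := huniq _ ⟨hk, by rw [hσX y hy', hk']⟩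
          rw [← h3, hΘl _ _ hyH]
      tensor := fun y hy k k' => by
        have hy' := hWW₀ hy
        have hyH := hσs y hy'
        -- The bracket of two lifts is found through `C₀`, and reading the same bracket through `C`
        -- gives the tensor condition.
        have h1 := h₀.hasPullbackBracketAt_lift hH hHU₀ hHu (hΘl k) (hXl k) (hΘl k') (hXl k') hyH
          (hΘl (C₀.tensor (u₀ (σ y)) k k') _ hyH) (hXl _ _ hyH)
        rw [h.bracket_iff _ H.open_source hHU _ _ (hsm k) (hsm k') _ hyH] at h1
        have h2 := h1.1
        rw [hσX y hy', hσX y hy', ← hηd y hy', ← hηd y hy', huσ y hy'] at h2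
        exact h2 }

end LieAlgebroid

end SpanHomomorphism

/-! ### Invariance of the transverse model along leaves. -/

noncomputable section Plaques

set_option linter.unusedSectionVars false

attribute [-instance]
  Bundle.instNormedAddCommGroupOfRiemannianBundleOfIsTopologicalAddGroupOfContinuousConstSMulReal

/-- A solution of a linear-type equation `f' = ρ(f) g` is constant near a zero of `ρ`. -/
theorem eventually_eq_of_hasDerivWithinAt {V W : Type*} [NormedAddCommGroup V] [NormedSpace ℝ V]
    [NormedAddCommGroup W] [NormedSpace ℝ W] {f : ℝ → V} {g : ℝ → W} {ρ : V → W →L[ℝ] V} {a b t₀ : ℝ}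
    (ht₀ : t₀ ∈ Icc a b) (hρ : ContDiffAt ℝ 1 ρ (f t₀)) (h0 : ρ (f t₀) = 0)
    (hg : ContinuousWithinAt g (Icc a b) t₀)
    (hf : ∀ᶠ t in 𝓝[Icc a b] t₀, HasDerivWithinAt f (ρ (f t) (g t)) (Icc a b) t) :
    ∀ᶠ t in 𝓝[Icc a b] t₀, f t = f t₀ := by
  obtain ⟨K, s, hs, hK⟩ := hρ.exists_lipschitzOnWith
  obtain ⟨B, hB⟩ : ∃ B : NNReal, ‖g t₀‖ < B := ⟨‖g t₀‖₊ + 1, by simp⟩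
  have hfc : ContinuousWithinAt f (Icc a b) t₀ :=
    (hf.self_of_nhdsWithin ht₀).continuousWithinAt
  obtain ⟨δ, hδ, hball⟩ := Metric.mem_nhdsWithin_iff.1
    (hf.and ((hfc.eventually_mem hs).and (hg.norm.eventually_lt_const hB)))
  have hP : ∀ t ∈ Icc a b, |t - t₀| < δ → HasDerivWithinAt f (ρ (f t) (g t)) (Icc a b) t ∧
      f t ∈ s ∧ ‖g t‖ < B := fun t ht htδ => hball ⟨by rwa [Metric.mem_ball, Real.dist_eq], ht⟩
  have hLip : ∀ t ∈ Icc a b, |t - t₀| < δ → LipschitzOnWith (K * B) (fun x => ρ x (g t)) s := by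
    intro t ht htδ
    refine LipschitzOnWith.of_dist_le_mul fun x hx y hy => ?_
    rw [dist_eq_norm, ← sub_apply]
    refine ((ρ x - ρ y).le_opNorm (g t)).trans ?_
    have h1 := hK.dist_le_mul x hx y hy
    rw [dist_eq_norm] at h1
    calc ‖ρ x - ρ y‖ * ‖g t‖ ≤ (K * dist x y) * B :=
          mul_le_mul h1 (hP t ht htδ).2.2.le (norm_nonneg _) (by positivity)
      _ = _ := by push_cast; ring
  -- The constant `f t₀` solves the same equation because `ρ` vanishes there. Uniqueness, with
  -- Lipschitz constant `K * B`, applies on each side of `t₀`.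
  have hconst : ∀ t S, HasDerivWithinAt (fun _ => f t₀) (ρ (f t₀) (g t)) S t := fun t S => by
    rw [h0]
    exact hasDerivWithinAt_const t S (f t₀)
  rw [Filter.eventually_iff, Metric.mem_nhdsWithin_iff]
  refine ⟨δ, hδ, fun t ht => ?_⟩
  obtain ⟨htb, ht⟩ := ht
  rw [Metric.mem_ball, Real.dist_eq] at htb
  rcases le_total t₀ t with h | h
  · have hsub : ∀ τ ∈ Icc t₀ t, τ ∈ Icc a b ∧ |τ - t₀| < δ := fun τ hτ =>
      ⟨⟨ht₀.1.trans hτ.1, hτ.2.trans ht.2⟩, by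
        rw [abs_of_nonneg (sub_nonneg.2 hτ.1)]
        rw [abs_of_nonneg (sub_nonneg.2 h)] at htb
        linarith [hτ.2]⟩
    refine ODE_solution_unique_of_mem_Icc_right (v := fun t x => ρ x (g t)) (s := fun _ => s)
      (g := fun _ => f t₀) (K := K * B) (a := t₀) (b := t) ?_ ?_ ?_ ?_ continuousOn_const
      (fun τ _ => hconst τ _) (fun τ _ => mem_of_mem_nhds hs) rfl ⟨h, le_rfl⟩
    · exact fun τ hτ => hLip τ (hsub τ (Ico_subset_Icc_self hτ)).1 (hsub τ (Ico_subset_Icc_self hτ)).2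
    · exact fun τ hτ => ((hP τ (hsub τ hτ).1 (hsub τ hτ).2).1.continuousWithinAt).mono
        fun x hx => (hsub x hx).1
    · intro τ hτ
      have hτ' := hsub τ (Ico_subset_Icc_self hτ)
      refine (hP τ hτ'.1 hτ'.2).1.mono_of_mem_nhdsWithin ?_
      exact mem_nhdsWithin.2 ⟨Iio t, isOpen_Iio, hτ.2, fun x hx =>
        ⟨hτ'.1.1.trans hx.2, hx.1.le.trans ht.2⟩⟩
    · exact fun τ hτ => (hP τ (hsub τ (Ico_subset_Icc_self hτ)).1
        (hsub τ (Ico_subset_Icc_self hτ)).2).2.1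
  · have hsub : ∀ τ ∈ Icc t t₀, τ ∈ Icc a b ∧ |τ - t₀| < δ := fun τ hτ =>
      ⟨⟨ht.1.trans hτ.1, hτ.2.trans ht₀.2⟩, by
        rw [abs_of_nonpos (sub_nonpos.2 hτ.2)]
        rw [abs_of_nonpos (sub_nonpos.2 h)] at htb
        linarith [hτ.1]⟩
    refine ODE_solution_unique_of_mem_Icc_left (v := fun t x => ρ x (g t)) (s := fun _ => s)
      (g := fun _ => f t₀) (K := K * B) (a := t) (b := t₀) ?_ ?_ ?_ ?_ continuousOn_const
      (fun τ _ => hconst τ _) (fun τ _ => mem_of_mem_nhds hs) rfl ⟨le_rfl, h⟩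
    · exact fun τ hτ => hLip τ (hsub τ (Ioc_subset_Icc_self hτ)).1 (hsub τ (Ioc_subset_Icc_self hτ)).2
    · exact fun τ hτ => ((hP τ (hsub τ hτ).1 (hsub τ hτ).2).1.continuousWithinAt).mono
        fun x hx => (hsub x hx).1
    · intro τ hτ
      have hτ' := hsub τ (Ioc_subset_Icc_self hτ)
      refine (hP τ hτ'.1 hτ'.2).1.mono_of_mem_nhdsWithin ?_
      exact mem_nhdsWithin.2 ⟨Ioi t, isOpen_Ioi, hτ.1, fun x hx =>
        ⟨ht.1.trans hx.1.le, hx.2.trans hτ'.1.2⟩⟩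
    · exact fun τ hτ => (hP τ (hsub τ (Ioc_subset_Icc_self hτ)).1
        (hsub τ (Ioc_subset_Icc_self hτ)).2).2.1

variable {E : Type*} [NormedAddCommGroup E] [NormedSpace ℝ E]
  {M : Type*} [TopologicalSpace M] [ChartedSpace E M] [IsManifold 𝓘(ℝ, E) ∞ M]
  {F : Type*} [NormedAddCommGroup F] [NormedSpace ℝ F]
  {A : M → Type*} [TopologicalSpace (TotalSpace F A)]
  [∀ x, AddCommGroup (A x)] [∀ x, Module ℝ (A x)] [∀ x, TopologicalSpace (A x)]
  [FiberBundle F A] [VectorBundle ℝ F A]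
  {E' F' : Type*} [NormedAddCommGroup E'] [NormedSpace ℝ E'] [NormedAddCommGroup F']
  [NormedSpace ℝ F']

namespace LieAlgebroid

variable {𝒜 : LieAlgebroid E F A} {C : LocalModel E' F'} {U : Set M} {p : M → E'}
  {θ : ∀ z, A z →ₗ[ℝ] F'}

/-- An `A`-path does not leave the fibres of a normal form over zeros of the anchor. -/
theorem IsNF.eventually_eq_of_isAPath (h : 𝒜.IsNF C.anchor C.tensor U p θ) (hm : MapsTo p U C.dom)
    {a : ℝ → TotalSpace F A} (ha : 𝒜.IsAPath a) {t₀ : ℝ} (ht₀ : t₀ ∈ Icc (0 : ℝ) 1)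
    (hU : (a t₀).proj ∈ U) (h0 : C.anchor (p (a t₀).proj) = 0) :
    ∀ᶠ t in 𝓝[Icc 0 1] t₀, p (a t).proj = p (a t₀).proj := by
  have hc : ContinuousWithinAt (fun t => (a t).proj) (Icc 0 1) t₀ :=
    (ha.2 t₀ ht₀).continuousWithinAt
  refine eventually_eq_of_hasDerivWithinAt (f := fun t => p (a t).proj)
    (g := fun t => θ (a t).proj (a t).snd) ht₀
    ((C.contDiffOn_anchor.contDiffAt (C.isOpen_dom.mem_nhds (hm hU))).of_le (by simp)) h0 ?_ ?_
  · have h1 : ContinuousAt (fun z : TotalSpace F A => θ z.proj z.snd) (a t₀) :=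
      h.isSmoothForm.continuousOn.continuousAt
        ((h.isOpen.preimage (FiberBundle.continuous_proj F A)).mem_nhds hU)
    exact h1.comp_continuousWithinAt (ha.1.continuousOn t₀ ht₀)
  · filter_upwards [hc.eventually_mem (h.isOpen.mem_nhds hU), self_mem_nhdsWithin] with t htU ht
    have h1 := (h.contMDiffOn_base.mdifferentiableAt_of_isOpen h.isOpen htU).hasMFDerivAt
    have h2 := h1.comp_hasMFDerivWithinAt t (ha.2 t ht)
    let L : ℝ →L[ℝ] E' := (mfderiv 𝓘(ℝ, E) 𝓘(ℝ, E') p (a t).proj).comp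
      ((1 : ℝ →L[ℝ] ℝ).smulRight (𝒜.anchor (a t).proj (a t).snd))
    have h3 : HasFDerivWithinAt (fun t => p (a t).proj) L (Icc 0 1) t :=
      hasMFDerivWithinAt_iff_hasFDerivWithinAt.1 h2
    refine h3.hasDerivWithinAt.congr_deriv ?_
    rw [h.anchor _ htU]
    refine congrArg (mvfderiv 𝓘(ℝ, E) p (a t).proj) ?_
    exact one_smul ℝ (𝒜.anchor (a t).proj (a t).snd)

section

variable [FiniteDimensional ℝ E] [T2Space M] [ContMDiffVectorBundle ∞ F A 𝓘(ℝ, E)]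
  [FiniteDimensional ℝ F] [FiniteDimensional ℝ E'] [FiniteDimensional ℝ F']

/-- Two normal forms at the same point, the second with vanishing anchor, are related by a morphism
of local models. -/
theorem HasNF.exists_isHom {E'' F'' : Type*} [NormedAddCommGroup E''] [NormedSpace ℝ E'']
    [NormedAddCommGroup F''] [NormedSpace ℝ F''] [FiniteDimensional ℝ F'']
    {C₀ : LocalModel E'' F''} {y₀ : E''} {y : E'} {z : M} (h₀ : 𝒜.HasNF C₀ y₀ z)
    (h : 𝒜.HasNF C y z) (hC : C.anchor y = 0) :
    ∃ (W : Set E'') (v : E'' → E') (η : E'' → F'' →L[ℝ] F'), C₀.IsHom C W v η ∧ y₀ ∈ W ∧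
      v y₀ = y := by
  obtain ⟨U₀, p₀, θ₀, hz₀, rfl, hm₀, h₀⟩ := h₀
  obtain ⟨U, p, θ, hz, rfl, hm, h⟩ := h
  exact (h₀.isPNF (φ := (id : M → M)) hm₀ contMDiff_id).exists_isHom
    (h.isPNF (φ := (id : M → M)) hm contMDiff_id) hz₀ hz (h₀.surjective z hz₀) (h.surjective z hz) hC

/-- The transverse local model is constant along the leaves. -/
theorem HasNF.of_isAPath {y : E'} (hC : C.anchor y = 0) {a : ℝ → TotalSpace F A}
    (ha : 𝒜.IsAPath a) : 𝒜.HasNF C y (a 0).proj ↔ 𝒜.HasNF C y (a 1).proj := by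
  refine isPreconnected_Icc.induction₂' (s := Icc (0 : ℝ) 1)
    (fun s t => 𝒜.HasNF C y (a s).proj ↔ 𝒜.HasNF C y (a t).proj) (fun t₀ ht₀ => ?_)
    (fun _ _ _ _ _ _ h h' => h.trans h') (left_mem_Icc.2 zero_le_one) (right_mem_Icc.2 zero_le_one)
  -- An auxiliary model with vanishing anchor at `a t₀` keeps the nearby part of the path in one
  -- fibre. All its points thus have the same normal form, so a morphism `C₀ → C` found at one of
  -- them serves at the other.
  obtain ⟨E'', F'', _, _, _, _, _, _, C₀, y₀, hC₀, U, p, θ, hz, rfl, hm, h⟩ :=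
    𝒜.exists_hasNF (a t₀).proj
  have hc : ContinuousWithinAt (fun t => (a t).proj) (Icc 0 1) t₀ :=
    (ha.2 t₀ ht₀).continuousWithinAt
  filter_upwards [h.eventually_eq_of_isAPath hm ha ht₀ hz hC₀,
    hc.eventually_mem (h.isOpen.mem_nhds hz)] with t ht htU
  have h1 : ∀ s s', 𝒜.HasNF C₀ (p (a t₀).proj) (a s).proj →
      𝒜.HasNF C₀ (p (a t₀).proj) (a s').proj → 𝒜.HasNF C y (a s).proj →
      𝒜.HasNF C y (a s').proj := fun s s' hs hs' hy => by
    obtain ⟨W, v, η, hom, hW, hv⟩ := hs.exists_isHom hy hC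
    rw [← hv]
    exact hs'.comp_isHom hom hW
  have h2 : 𝒜.HasNF C₀ (p (a t₀).proj) (a t₀).proj := ⟨U, p, θ, hz, rfl, hm, h⟩
  have h3 : 𝒜.HasNF C₀ (p (a t₀).proj) (a t).proj := ⟨U, p, θ, htU, ht, hm, h⟩
  exact and_comm.1 ⟨⟨h1 _ _ h3 h2, h1 _ _ h2 h3⟩, ⟨h1 _ _ h2 h3, h1 _ _ h3 h2⟩⟩

theorem HasNF.of_orbitSetoid {y : E'} (hC : C.anchor y = 0) {z z' : M} (hz : 𝒜.orbitSetoid z z')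
    (h : 𝒜.HasNF C y z) : 𝒜.HasNF C y z' := by
  -- Proving an equivalence lets the induction on the generated relation handle the symmetric case.
  refine Iff.mp ?_ h
  clear h
  induction hz with
  | rel x y h =>
    obtain ⟨a, ha, rfl, rfl⟩ := h
    exact HasNF.of_isAPath hC ha
  | refl x => rfl
  | symm x y _ ih => exact ih.symm
  | trans x y z _ _ ih ih' => exact ih.trans ih'

end

end LieAlgebroid

end Plaques

/-! ### Fibres of a normal form of a pull-back lie locally in leaves. -/

noncomputable section LeavesOfPullbacks

set_option linter.unusedSectionVars false

attribute [-instance]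
  Bundle.instNormedAddCommGroupOfRiemannianBundleOfIsTopologicalAddGroupOfContinuousConstSMulReal

namespace LieAlgebroid

section

variable {E : Type*} [NormedAddCommGroup E] [NormedSpace ℝ E]
  {M : Type*} [TopologicalSpace M] [ChartedSpace E M] [IsManifold 𝓘(ℝ, E) ∞ M]
  {F : Type*} [NormedAddCommGroup F] [NormedSpace ℝ F]
  {A : M → Type*} [TopologicalSpace (TotalSpace F A)]
  [∀ x, AddCommGroup (A x)] [∀ x, Module ℝ (A x)] [∀ x, TopologicalSpace (A x)]
  [FiberBundle F A] [VectorBundle ℝ F A]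
  {EQ : Type*} [NormedAddCommGroup EQ] [NormedSpace ℝ EQ] [FiniteDimensional ℝ EQ]
  {Q : Type*} [TopologicalSpace Q] [ChartedSpace EQ Q] [IsManifold 𝓘(ℝ, EQ) ∞ Q]
  {E' F' : Type*} [NormedAddCommGroup E'] [NormedSpace ℝ E'] [NormedAddCommGroup F']
  [NormedSpace ℝ F']
  {𝒜 : LieAlgebroid E F A} {φ : Q → M} {C : LocalModel E' F'} {U : Set Q} {u : Q → E'}
  {Θ : ∀ q, 𝒜.pullbackFiber (EQ := EQ) φ q →ₗ[ℝ] F'}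

/-- The fibres of a normal form of the pull-back are locally mapped into leaves. -/
theorem IsPNF.eventually_orbitSetoid (h : 𝒜.IsPNF φ C U u Θ)
    (hφ : ContMDiff 𝓘(ℝ, EQ) 𝓘(ℝ, E) ∞ φ) {q₀ : Q} (hq₀ : q₀ ∈ U)
    (hs : Function.Surjective (mvfderiv 𝓘(ℝ, EQ) u q₀)) :
    ∀ᶠ q in 𝓝 q₀, u q = u q₀ → 𝒜.orbitSetoid (φ q₀) (φ q) := by
  obtain ⟨T, H, hH, hqH, hHU, hH2, hHu⟩ := exists_isSmoothChart_of_surjective h.isOpen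
    h.contMDiffOn_base hq₀ hs
  obtain ⟨ε, hε, hball⟩ := Metric.isOpen_iff.1 H.open_target (H q₀) (H.map_source hqH)
  have hHq : H q₀ = (u q₀, 0) := Prod.ext (hHu q₀ hqH) hH2
  filter_upwards [H.open_source.mem_nhds hqH,
    (H.continuousAt hqH).preimage_mem_nhds (Metric.ball_mem_nhds _ hε)] with q hq hqε huq
  let τ : T := (H q).2
  have hHq' : H q = (u q₀, τ) := Prod.ext ((hHu q hq).trans huq) rfl
  -- In a chart `(u, τ)` the point `q` is joined to `q₀` by a straight segment with `u` fixed. Its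
  -- velocity is killed by `du`, so it lifts to an element with `Θ = 0`, whose `A`-component is the
  -- required path.
  let γ : ℝ → E' × T := fun s => (u q₀, s • τ)
  have hγd : ∀ s, HasFDerivAt γ ((1 : ℝ →L[ℝ] ℝ).smulRight ((0 : E'), τ)) s := fun s => by
    have h1 : HasDerivAt γ ((0 : E'), τ) s := by
      have := (hasDerivAt_const s (u q₀)).prodMk ((hasDerivAt_id s).smul_const τ)
      rwa [one_smul] at this
    exact h1.hasFDerivAt
  have hγs : ContDiff ℝ ∞ γ := contDiff_const.prodMk (contDiff_id.smul contDiff_const)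
  have hγt : ∀ s ∈ Icc (0 : ℝ) 1, γ s ∈ H.target := fun s hs => by
    refine hball ?_
    have h1 := (convex_ball (H q₀) ε).add_smul_sub_mem (Metric.mem_ball_self hε) hqε hs
    rw [hHq', hHq] at h1
    rw [hHq]
    convert h1 using 1
    simp [γ]
  let X : ∀ q, TangentSpace 𝓘(ℝ, EQ) q := coordField EQ H fun _ => ((0 : E'), τ)
  have hw : ∀ p, ∃ w : 𝒜.pullbackFiber (EQ := EQ) φ p, p ∈ H.source → Θ p w = 0 ∧ w.1.2 = X p := by
    intro p
    by_cases hp : p ∈ H.source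
    · have h1 : u =ᶠ[𝓝 p] fun p => (H p).1 := by
        filter_upwards [H.open_source.mem_nhds hp] with p hp using (hHu p hp).symm
      have h2 : mvfderiv 𝓘(ℝ, EQ) u p (X p) = 0 := by
        rw [h1.mvfderiv_eq, mvfderiv_comp_fderiv (g := Prod.fst) differentiableAt_fst
          (hH.mdifferentiableAt hp), fderiv_fst, hH.mvfderiv_coordField hp]
        rfl
      obtain ⟨w, hw⟩ := (h.cartesian p (hHU hp) 0 (X p) (by rw [h2, map_zero])).exists
      exact ⟨w, fun _ => hw⟩
    · exact ⟨0, fun h => absurd h hp⟩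
  choose w hw using hw
  have hsm : 𝒜.IsSmoothPullbackSection φ w H.source := by
    refine (h.smooth_iff _ H.open_source hHU _).2
      ⟨contMDiffOn_const.congr fun p hp => (hw p hp).1, ?_⟩
    refine (hH.contMDiffOn_coordField subset_rfl (contMDiffOn_const (c := ((0 : E'), τ)))).congr
      fun p hp => ?_
    exact congrArg (fun X => (⟨p, X⟩ : TangentBundle 𝓘(ℝ, EQ) Q)) (hw p hp).2
  let c : ℝ → Q := fun s => H.symm (γ s)
  have hcs : ∀ s ∈ Icc (0 : ℝ) 1, c s ∈ H.source := fun s hs => H.map_target (hγt s hs)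
  have hc : ContMDiffOn 𝓘(ℝ, ℝ) 𝓘(ℝ, EQ) ∞ c (Icc 0 1) :=
    hH.contMDiffOn_symm.comp hγs.contMDiff.contMDiffOn hγt
  refine Relation.EqvGen.rel _ _ ⟨fun s => ⟨φ (c s), (w (c s)).1.1⟩, ⟨?_, ?_⟩, ?_, ?_⟩
  · exact hsm.1.comp hc hcs
  · intro s hs
    have h1 : HasMFDerivAt 𝓘(ℝ, ℝ) 𝓘(ℝ, E' × T) γ s
      ((1 : ℝ →L[ℝ] ℝ).smulRight ((0 : E'), τ)) := (hγd s).hasMFDerivAt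
    have h2 := ((hφ (c s)).mdifferentiableAt (by simp)).hasMFDerivAt.comp s
      ((hH.mdifferentiableAt_symm (hγt s hs)).hasMFDerivAt.comp s h1)
    refine HasMFDerivAt.hasMFDerivWithinAt (h2.congr_mfderiv ?_)
    refine ContinuousLinearMap.ext_ring ?_
    have h3 : X (c s) = mfderiv 𝓘(ℝ, E' × T) 𝓘(ℝ, EQ) H.symm (γ s) ((0 : E'), τ) := by
      change mfderiv 𝓘(ℝ, E' × T) 𝓘(ℝ, EQ) H.symm (H (H.symm (γ s))) ((0 : E'), τ) = _
      rw [H.right_inv (hγt s hs)]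
    have h4 := anchor_fst (c s) (w (c s))
    rw [(hw _ (hcs s hs)).2, h3] at h4
    have h5 : ∀ v : E' × T, (1 : ℝ →L[ℝ] ℝ).smulRight v (1 : ℝ) = v := fun v => one_smul ℝ v
    refine Eq.trans ?_ ((one_smul ℝ (𝒜.anchor (φ (c s)) (w (c s)).1.1)).trans h4).symm
    exact congrArg (fun v => mfderiv 𝓘(ℝ, EQ) 𝓘(ℝ, E) φ (c s)
      (mfderiv 𝓘(ℝ, E' × T) 𝓘(ℝ, EQ) H.symm (γ s) v)) (h5 _)
  · change φ (H.symm (u q₀, (0 : ℝ) • τ)) = φ q₀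
    rw [zero_smul, ← hHq, H.left_inv hqH]
  · change φ (H.symm (u q₀, (1 : ℝ) • τ)) = φ q
    rw [one_smul, ← hHq', H.left_inv hq]

end

end LieAlgebroid

end LeavesOfPullbacks

/-! ### Transfer of models and leaves across a Morita equivalence. -/

noncomputable section LeavesOfMoritaEquivalence

set_option linter.unusedSectionVars false

attribute [-instance]
  Bundle.instNormedAddCommGroupOfRiemannianBundleOfIsTopologicalAddGroupOfContinuousConstSMulReal

namespace LieAlgebroid

variable
  {E₁ : Type*} [NormedAddCommGroup E₁] [NormedSpace ℝ E₁] [FiniteDimensional ℝ E₁]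
  {M₁ : Type*} [TopologicalSpace M₁] [T2Space M₁] [ChartedSpace E₁ M₁] [IsManifold 𝓘(ℝ, E₁) ∞ M₁]
  {F₁ : Type*} [NormedAddCommGroup F₁] [NormedSpace ℝ F₁] [FiniteDimensional ℝ F₁]
  {A₁ : M₁ → Type*} [TopologicalSpace (TotalSpace F₁ A₁)]
  [∀ x, AddCommGroup (A₁ x)] [∀ x, Module ℝ (A₁ x)] [∀ x, TopologicalSpace (A₁ x)]
  [FiberBundle F₁ A₁] [VectorBundle ℝ F₁ A₁] [ContMDiffVectorBundle ∞ F₁ A₁ 𝓘(ℝ, E₁)]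
  {E₂ : Type*} [NormedAddCommGroup E₂] [NormedSpace ℝ E₂] [FiniteDimensional ℝ E₂]
  {M₂ : Type*} [TopologicalSpace M₂] [T2Space M₂] [ChartedSpace E₂ M₂] [IsManifold 𝓘(ℝ, E₂) ∞ M₂]
  {F₂ : Type*} [NormedAddCommGroup F₂] [NormedSpace ℝ F₂] [FiniteDimensional ℝ F₂]
  {A₂ : M₂ → Type*} [TopologicalSpace (TotalSpace F₂ A₂)]
  [∀ x, AddCommGroup (A₂ x)] [∀ x, Module ℝ (A₂ x)] [∀ x, TopologicalSpace (A₂ x)]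
  [FiberBundle F₂ A₂] [VectorBundle ℝ F₂ A₂] [ContMDiffVectorBundle ∞ F₂ A₂ 𝓘(ℝ, E₂)]
  {EQ : Type*} [NormedAddCommGroup EQ] [NormedSpace ℝ EQ] [FiniteDimensional ℝ EQ]
  {Q : Type*} [TopologicalSpace Q] [T2Space Q] [ChartedSpace EQ Q] [IsManifold 𝓘(ℝ, EQ) ∞ Q]
  {E' F' : Type*} [NormedAddCommGroup E'] [NormedSpace ℝ E'] [NormedAddCommGroup F']
  [NormedSpace ℝ F'] [FiniteDimensional ℝ F']
  {𝒜₁ : LieAlgebroid E₁ F₁ A₁} {𝒜₂ : LieAlgebroid E₂ F₂ A₂} {φ₁ : Q → M₁} {φ₂ : Q → M₂}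
  {Ψ : ∀ q : Q, 𝒜₁.pullbackFiber (EQ := EQ) φ₁ q ≃ₗ[ℝ] 𝒜₂.pullbackFiber (EQ := EQ) φ₂ q}
  {C : LocalModel E' F'}

theorem IsNF.surjective_comp {U : Set M₁} {p : M₁ → E'} {θ : ∀ z, A₁ z →ₗ[ℝ] F'}
    (h : 𝒜₁.IsNF C.anchor C.tensor U p θ) {q : Q}
    (hφ : MDifferentiableAt 𝓘(ℝ, EQ) 𝓘(ℝ, E₁) φ₁ q)
    (hs : Function.Surjective (mfderiv 𝓘(ℝ, EQ) 𝓘(ℝ, E₁) φ₁ q)) (hq : φ₁ q ∈ U) :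
    Function.Surjective (mvfderiv 𝓘(ℝ, EQ) (fun q => p (φ₁ q)) q) := fun e => by
  obtain ⟨Y, hY⟩ := h.surjective _ hq e
  obtain ⟨X, hX⟩ := hs Y
  refine ⟨X, ?_⟩
  rw [mvfderiv_comp_mfderiv (h.contMDiffOn_base.mdifferentiableAt_of_isOpen h.isOpen hq) hφ, hX, hY]

/-- Morita equivalent Lie algebroids have the same transverse local models at corresponding
points. -/
theorem IsIsoOverId.hasNF [FiniteDimensional ℝ E'] (h : IsIsoOverId 𝒜₁ 𝒜₂ φ₁ φ₂ Ψ)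
    (hφ₁ : Manifold.IsSubmersion 𝓘(ℝ, EQ) 𝓘(ℝ, E₁) ∞ φ₁)
    (hφ₂ : Manifold.IsSubmersion 𝓘(ℝ, EQ) 𝓘(ℝ, E₂) ∞ φ₂) {y : E'} (hC : C.anchor y = 0) {q : Q}
    (hy : 𝒜₁.HasNF C y (φ₁ q)) : 𝒜₂.HasNF C y (φ₂ q) := by
  obtain ⟨U, p, θ, hq, rfl, hm, hNF⟩ := hy
  -- The transported normal form lives on `Q`. A chart normal form lives on `M₂` itself, and
  -- composing it with the morphism from its model to `C` descends the result to `M₂`.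
  obtain ⟨C₀, U₀, p₀, θ₀, hq₀, hm₀, hNF₀⟩ := 𝒜₂.exists_isNF_chart (φ₂ q)
  obtain ⟨W, v, η, hom, hW, hv⟩ := (hNF₀.isPNF hm₀ hφ₂.contMDiff).exists_isHom
    (h.isPNF hφ₁.contMDiff hφ₂.contMDiff (hNF.isPNF hm hφ₁.contMDiff)) hq₀ hq
    (hNF₀.surjective_comp ((hφ₂.contMDiff q).mdifferentiableAt (by simp))
      (hφ₂.surjective_mfderiv q) hq₀)
    (hNF.surjective_comp ((hφ₁.contMDiff q).mdifferentiableAt (by simp))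
      (hφ₁.surjective_mfderiv q) hq) hC
  rw [← hv]
  exact HasNF.comp_isHom ⟨U₀, p₀, θ₀, hq₀, rfl, hm₀, hNF₀⟩ hom hW

theorem IsIsoOverId.eventually_orbitSetoid (h : IsIsoOverId 𝒜₁ 𝒜₂ φ₁ φ₂ Ψ)
    (hφ₁ : Manifold.IsSubmersion 𝓘(ℝ, EQ) 𝓘(ℝ, E₁) ∞ φ₁)
    (hφ₂ : ContMDiff 𝓘(ℝ, EQ) 𝓘(ℝ, E₂) ∞ φ₂) {U : Set M₁} {p : M₁ → E'}
    {θ : ∀ z, A₁ z →ₗ[ℝ] F'} (hNF : 𝒜₁.IsNF C.anchor C.tensor U p θ) (hm : MapsTo p U C.dom)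
    {q₀ : Q} (hq₀ : φ₁ q₀ ∈ U) :
    ∀ᶠ q in 𝓝 q₀, p (φ₁ q) = p (φ₁ q₀) → 𝒜₂.orbitSetoid (φ₂ q₀) (φ₂ q) :=
  (h.isPNF hφ₁.contMDiff hφ₂ (hNF.isPNF hm hφ₁.contMDiff)).eventually_orbitSetoid hφ₂ hq₀
    (hNF.surjective_comp ((hφ₁.contMDiff q₀).mdifferentiableAt (by simp))
      (hφ₁.surjective_mfderiv q₀) hq₀)

/-- On a fibre of `φ₁` every map `p ∘ φ₁` is constant, so `φ₂` is locally constant on the fibre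
modulo orbits; connectedness finishes. -/
theorem IsIsoOverId.orbitSetoid_of_eq (h : IsIsoOverId 𝒜₁ 𝒜₂ φ₁ φ₂ Ψ)
    (hφ₁ : Manifold.IsSubmersion 𝓘(ℝ, EQ) 𝓘(ℝ, E₁) ∞ φ₁)
    (hφ₂ : ContMDiff 𝓘(ℝ, EQ) 𝓘(ℝ, E₂) ∞ φ₂) (hc : ∀ x, IsPreconnected (φ₁ ⁻¹' {x})) {q q' : Q}
    (hq : φ₁ q = φ₁ q') : 𝒜₂.orbitSetoid (φ₂ q) (φ₂ q') := by
  refine (hc (φ₁ q')).induction₂' (fun q q' => 𝒜₂.orbitSetoid (φ₂ q) (φ₂ q')) (fun q₀ hq₀ => ?_)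
    (fun _ _ _ _ _ _ h h' => 𝒜₂.orbitSetoid.trans h h') hq rfl
  obtain ⟨C, U, p, θ, hz, hm, hNF⟩ := 𝒜₁.exists_isNF_chart (φ₁ q₀)
  filter_upwards [mem_nhdsWithin_of_mem_nhds (h.eventually_orbitSetoid hφ₁ hφ₂ hNF hm hz),
    self_mem_nhdsWithin] with q hq hq'
  have h1 := hq (congrArg p (Eq.trans hq' (Eq.symm hq₀)))
  exact ⟨h1, 𝒜₂.orbitSetoid.symm h1⟩

/-- Near each time the path stays in a fibre of a normal form with vanishing anchor and lifts to
points of `Q` close to a chosen one. The choice of lifts is immaterial by connectedness of the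
fibres, and connectedness of `[0, 1]` joins the local statements. -/
theorem IsIsoOverId.orbitSetoid_of_isAPath (h : IsIsoOverId 𝒜₁ 𝒜₂ φ₁ φ₂ Ψ)
    (hφ₁ : Manifold.IsSubmersion 𝓘(ℝ, EQ) 𝓘(ℝ, E₁) ∞ φ₁) (hs : Function.Surjective φ₁)
    (hφ₂ : ContMDiff 𝓘(ℝ, EQ) 𝓘(ℝ, E₂) ∞ φ₂) (hc : ∀ x, IsPreconnected (φ₁ ⁻¹' {x}))
    {a : ℝ → TotalSpace F₁ A₁} (ha : 𝒜₁.IsAPath a) {q q' : Q} (hq : φ₁ q = (a 0).proj)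
    (hq' : φ₁ q' = (a 1).proj) : 𝒜₂.orbitSetoid (φ₂ q) (φ₂ q') := by
  refine isPreconnected_Icc.induction₂' (s := Icc (0 : ℝ) 1)
    (fun s t => ∀ q q', φ₁ q = (a s).proj → φ₁ q' = (a t).proj → 𝒜₂.orbitSetoid (φ₂ q) (φ₂ q'))
    (fun t₀ ht₀ => ?_) (fun r s t _ _ _ h h' q q' hq hq' => ?_) (left_mem_Icc.2 zero_le_one)
    (right_mem_Icc.2 zero_le_one) q q' hq hq'
  · obtain ⟨E'', F'', _, _, _, _, _, _, C, y, hC, U, p, θ, hz, rfl, hm, hNF⟩ :=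
      𝒜₁.exists_hasNF (a t₀).proj
    obtain ⟨q₀, hq₀⟩ := hs (a t₀).proj
    rw [← hq₀] at hz
    have hcont : ContinuousWithinAt (fun t => (a t).proj) (Icc 0 1) t₀ :=
      (ha.2 t₀ ht₀).continuousWithinAt
    -- Openness of `φ₁` at `q₀` provides lifts of nearby path points inside the neighbourhood where
    -- the local orbit statement holds.
    have h1 := map_mem_nhds_of_surjective_mfderiv hφ₁.contMDiff (hφ₁.surjective_mfderiv q₀)
      (h.eventually_orbitSetoid hφ₁ hφ₂ hNF hm hz)
    rw [hq₀] at h1 hz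
    filter_upwards [hcont.eventually_mem h1, hNF.eventually_eq_of_isAPath hm ha ht₀ hz hC]
      with t ⟨q₁, hq₁, hq₁'⟩ ht
    have h2 : 𝒜₂.orbitSetoid (φ₂ q₀) (φ₂ q₁) := hq₁ (by rw [hq₁', ht])
    have h3 : ∀ q q', φ₁ q = (a t₀).proj → φ₁ q' = (a t).proj →
        𝒜₂.orbitSetoid (φ₂ q) (φ₂ q') := fun q q' hq hq' =>
      𝒜₂.orbitSetoid.trans (h.orbitSetoid_of_eq hφ₁ hφ₂ hc (hq.trans hq₀.symm))
        (𝒜₂.orbitSetoid.trans h2 (h.orbitSetoid_of_eq hφ₁ hφ₂ hc (hq₁'.trans hq'.symm)))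
    exact ⟨h3, fun q q' hq hq' => 𝒜₂.orbitSetoid.symm (h3 q' q hq' hq)⟩
  · obtain ⟨q₁, hq₁⟩ := hs (a s).proj
    exact 𝒜₂.orbitSetoid.trans (h q q₁ hq hq₁) (h' q₁ q' hq₁ hq')

theorem IsIsoOverId.orbitSetoid (h : IsIsoOverId 𝒜₁ 𝒜₂ φ₁ φ₂ Ψ)
    (hφ₁ : Manifold.IsSubmersion 𝓘(ℝ, EQ) 𝓘(ℝ, E₁) ∞ φ₁) (hs : Function.Surjective φ₁)
    (hφ₂ : ContMDiff 𝓘(ℝ, EQ) 𝓘(ℝ, E₂) ∞ φ₂) (hc : ∀ x, IsPreconnected (φ₁ ⁻¹' {x}))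
    {q q' : Q} (hq : 𝒜₁.orbitSetoid (φ₁ q) (φ₁ q')) : 𝒜₂.orbitSetoid (φ₂ q) (φ₂ q') := by
  have h1 : ∀ {x x'}, 𝒜₁.orbitSetoid x x' → ∀ q q', φ₁ q = x → φ₁ q' = x' →
      𝒜₂.orbitSetoid (φ₂ q) (φ₂ q') := by
    intro x x' hx
    induction hx with
    | rel x y hxy =>
      obtain ⟨a, ha, h0, h1⟩ := hxy
      intro q q' hq hq'
      exact h.orbitSetoid_of_isAPath hφ₁ hs hφ₂ hc ha (hq.trans h0.symm) (hq'.trans h1.symm)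
    | refl x =>
      intro q q' hq hq'
      exact h.orbitSetoid_of_eq hφ₁ hφ₂ hc (hq.trans hq'.symm)
    | symm x y _ ih =>
      intro q q' hq hq'
      exact 𝒜₂.orbitSetoid.symm (ih q' q hq' hq)
    | trans x y z _ _ ih ih' =>
      intro q q' hq hq'
      obtain ⟨q₁, hq₁⟩ := hs y
      exact 𝒜₂.orbitSetoid.trans (ih q q₁ hq hq₁) (ih' q₁ q' hq₁ hq')
  exact h1 hq q q' rfl rfl

/-- The hypotheses are symmetric in the two sides, and simple connectedness of the fibres enters
through their connectedness. -/
theorem IsMoritaEquivalence.orbitSetoid_iff (h : IsMoritaEquivalence 𝒜₁ 𝒜₂ (EQ := EQ) φ₁ φ₂)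
    {q q' : Q} : 𝒜₁.orbitSetoid (φ₁ q) (φ₁ q') ↔ 𝒜₂.orbitSetoid (φ₂ q) (φ₂ q') := by
  obtain ⟨Ψ, hΨ⟩ := h.exists_isIsoOverId
  have h1 : ∀ x, IsPreconnected (φ₁ ⁻¹' {x}) := fun x => by
    have := h.simplyConnected₁ x
    exact isPreconnected_iff_preconnectedSpace.2 inferInstance
  have h2 : ∀ x, IsPreconnected (φ₂ ⁻¹' {x}) := fun x => by
    have := h.simplyConnected₂ x
    exact isPreconnected_iff_preconnectedSpace.2 inferInstance
  exact ⟨hΨ.orbitSetoid h.isSubmersion₁ h.surjective₁ h.isSubmersion₂.contMDiff h1,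
    hΨ.symm.orbitSetoid h.isSubmersion₂ h.surjective₂ h.isSubmersion₁.contMDiff h2⟩

theorem IsMoritaEquivalence.bijOn_leaves (h : IsMoritaEquivalence 𝒜₁ 𝒜₂ (EQ := EQ) φ₁ φ₂) :
    BijOn (fun L : Set M₁ => φ₂ '' (φ₁ ⁻¹' L)) 𝒜₁.leaves 𝒜₂.leaves := by
  have h1 : ∀ q, φ₂ '' (φ₁ ⁻¹' {x | 𝒜₁.orbitSetoid x (φ₁ q)}) =
      {x | 𝒜₂.orbitSetoid x (φ₂ q)} := by
    intro q
    ext x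
    constructor
    · rintro ⟨q', hq', rfl⟩
      exact h.orbitSetoid_iff.1 hq'
    · intro hx
      obtain ⟨q', rfl⟩ := h.surjective₂ x
      exact ⟨q', h.orbitSetoid_iff.2 hx, rfl⟩
  refine ⟨?_, ?_, ?_⟩
  · rintro _ ⟨x, rfl⟩
    obtain ⟨q, rfl⟩ := h.surjective₁ x
    exact ⟨φ₂ q, h1 q⟩
  · rintro _ ⟨x, rfl⟩ _ ⟨x', rfl⟩ hxx'
    obtain ⟨q, rfl⟩ := h.surjective₁ x
    obtain ⟨q', rfl⟩ := h.surjective₁ x'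
    have h2 : {x | 𝒜₂.orbitSetoid x (φ₂ q)} = {x | 𝒜₂.orbitSetoid x (φ₂ q')} :=
      (h1 q).symm.trans (hxx'.trans (h1 q'))
    have h3 : φ₂ q ∈ {x | 𝒜₂.orbitSetoid x (φ₂ q')} := by
      rw [← h2]
      exact 𝒜₂.orbitSetoid.refl _
    have h4 := h.orbitSetoid_iff.2 h3
    ext x
    exact ⟨fun hx => 𝒜₁.orbitSetoid.trans hx h4,
      fun hx => 𝒜₁.orbitSetoid.trans hx (𝒜₁.orbitSetoid.symm h4)⟩
  · rintro _ ⟨x, rfl⟩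
    obtain ⟨q, rfl⟩ := h.surjective₂ x
    exact ⟨_, ⟨φ₁ q, rfl⟩, h1 q⟩

end LieAlgebroid

end LeavesOfMoritaEquivalence

/-! ### Normal forms given by local diffeomorphisms. -/

noncomputable section EtaleNormalForms

set_option linter.unusedSectionVars false

attribute [-instance]
  Bundle.instNormedAddCommGroupOfRiemannianBundleOfIsTopologicalAddGroupOfContinuousConstSMulReal

namespace LieAlgebroid

section

variable {E : Type*} [NormedAddCommGroup E] [NormedSpace ℝ E]
  {M : Type*} [TopologicalSpace M] [ChartedSpace E M] [IsManifold 𝓘(ℝ, E) ∞ M]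
  {F : Type*} [NormedAddCommGroup F] [NormedSpace ℝ F]
  {A : M → Type*} [TopologicalSpace (TotalSpace F A)]
  [∀ x, AddCommGroup (A x)] [∀ x, Module ℝ (A x)] [∀ x, TopologicalSpace (A x)]
  [FiberBundle F A] [VectorBundle ℝ F A]
  {EQ : Type*} [NormedAddCommGroup EQ] [NormedSpace ℝ EQ]
  {Q : Type*} [TopologicalSpace Q] [ChartedSpace EQ Q] [IsManifold 𝓘(ℝ, EQ) ∞ Q]
  {E' F' : Type*} [NormedAddCommGroup E'] [NormedSpace ℝ E'] [NormedAddCommGroup F']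
  [NormedSpace ℝ F']
  {𝒜 : LieAlgebroid E F A} {φ : Q → M} {C : LocalModel E' F'} {U : Set Q} {u : Q → E'}
  {Θ : ∀ q, 𝒜.pullbackFiber (EQ := EQ) φ q →ₗ[ℝ] F'} {e : OpenPartialHomeomorph Q E'}

theorem IsPNF.anchor_chart (h : 𝒜.IsPNF φ C U u Θ)
    (heU : e.source ⊆ U) (heu : ∀ q ∈ e.source, e q = u q) {q : Q} (hq : q ∈ e.source)
    (w : 𝒜.pullbackFiber (EQ := EQ) φ q) :
    mvfderiv 𝓘(ℝ, EQ) e q w.1.2 = C.anchor (e q) (Θ q w) := by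
  have h1 : e =ᶠ[𝓝 q] u := by
    filter_upwards [e.open_source.mem_nhds hq] with p hp using heu p hp
  rw [h1.mvfderiv_eq, heu q hq, h.anchor q (heU hq)]

theorem IsPNF.snd_eq_coordField (h : 𝒜.IsPNF φ C U u Θ) (he : IsSmoothChart EQ e)
    (heU : e.source ⊆ U) (heu : ∀ q ∈ e.source, e q = u q)
    (s : ∀ q, 𝒜.pullbackFiber (EQ := EQ) φ q) {q : Q} (hq : q ∈ e.source) :
    (s q).1.2 = coordField EQ e (fun q => C.anchor (e q) (Θ q (s q))) q := by
  have h1 := he.coordField_mvfderiv hq (s q).1.2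
  rw [h.anchor_chart heU heu hq] at h1
  exact h1.symm

/-- When `u` is a chart, the vector part of an element is determined by its anchor in the model, so
the model value carries all the information. -/
theorem IsPNF.bijective (h : 𝒜.IsPNF φ C U u Θ) (he : IsSmoothChart EQ e) (heU : e.source ⊆ U)
    (heu : ∀ q ∈ e.source, e q = u q) {q : Q} (hq : q ∈ e.source) : Function.Bijective (Θ q) := by
  constructor
  · intro v w hvw
    refine h.injective (heU hq) hvw (he.injective_mvfderiv hq ?_)
    rw [h.anchor_chart heU heu hq, h.anchor_chart heU heu hq, hvw]
  · intro k
    have h1 : e =ᶠ[𝓝 q] u := by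
      filter_upwards [e.open_source.mem_nhds hq] with p hp using heu p hp
    have h2 := he.mvfderiv_coordField hq fun _ => C.anchor (e q) k
    rw [h1.mvfderiv_eq, heu q hq] at h2
    obtain ⟨w, hw, -⟩ := (h.cartesian q (heU hq) k _ h2.symm).exists
    exact ⟨w, hw⟩

theorem IsPNF.isSmoothPullbackSection_iff (h : 𝒜.IsPNF φ C U u Θ) (he : IsSmoothChart EQ e)
    (heU : e.source ⊆ U) (heu : ∀ q ∈ e.source, e q = u q) {V : Set Q} (hV : IsOpen V)
    (hVe : V ⊆ e.source) (s : ∀ q, 𝒜.pullbackFiber (EQ := EQ) φ q) :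
    𝒜.IsSmoothPullbackSection φ s V ↔
      ContMDiffOn 𝓘(ℝ, EQ) 𝓘(ℝ, F') ∞ (fun q => Θ q (s q)) V := by
  rw [h.smooth_iff V hV (hVe.trans heU), and_iff_left_iff_imp]
  intro hs
  have h1 : ContMDiffOn 𝓘(ℝ, EQ) 𝓘(ℝ, F' →L[ℝ] E') ∞ (fun q => C.anchor (e q)) V :=
    C.contDiffOn_anchor.contMDiffOn.comp (he.contMDiffOn.mono hVe) fun q hq => by
      rw [mem_preimage, heu q (hVe hq)]
      exact h.mapsTo (heU (hVe hq))
  refine (he.contMDiffOn_coordField hVe (h1.clm_apply hs)).congr fun q hq => ?_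
  exact congrArg (fun X => (⟨q, X⟩ : TangentBundle 𝓘(ℝ, EQ) Q))
    (h.snd_eq_coordField he heU heu s (hVe hq))

/-- In a chart given by `u`, sections are functions on the model and their bracket is that of `C`.
The condition on vector fields follows from the compatibility of the anchor of `C` with brackets. -/
theorem IsPNF.hasPullbackBracketAt_iff [CompleteSpace EQ] (h : 𝒜.IsPNF φ C U u Θ)
    (he : IsSmoothChart EQ e) (heU : e.source ⊆ U) (heu : ∀ q ∈ e.source, e q = u q) {V : Set Q}
    (hV : IsOpen V) (hVe : V ⊆ e.source) {s t : ∀ q, 𝒜.pullbackFiber (EQ := EQ) φ q}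
    (hs : 𝒜.IsSmoothPullbackSection φ s V) (ht : 𝒜.IsSmoothPullbackSection φ t V)
    {D : Set E'} (hD : IsOpen D) (hDC : D ⊆ C.dom) (hVD : MapsTo e V D) {k l : E' → F'}
    (hk : ContDiffOn ℝ ∞ k D) (hl : ContDiffOn ℝ ∞ l D) (hsk : ∀ q ∈ V, Θ q (s q) = k (e q))
    (htl : ∀ q ∈ V, Θ q (t q) = l (e q)) {q : Q} (hq : q ∈ V)
    (w : 𝒜.pullbackFiber (EQ := EQ) φ q) :
    𝒜.HasPullbackBracketAt φ s t q w ↔ Θ q w = C.bracket k l (e q) := by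
  have hqe := hVe hq
  have hqD : e q ∈ D := hVD hq
  have hev : ∀ᶠ p in 𝓝 q, p ∈ V := hV.eventually_mem hq
  have hed := he.mdifferentiableAt hqe
  have hfun : ∀ {t : ∀ q, 𝒜.pullbackFiber (EQ := EQ) φ q} {l : E' → F'}, ContDiffOn ℝ ∞ l D →
      (∀ q ∈ V, Θ q (t q) = l (e q)) → ∀ w : 𝒜.pullbackFiber (EQ := EQ) φ q,
      mvfderiv 𝓘(ℝ, EQ) (fun p => Θ p (t p)) q w.1.2 =
        fderiv ℝ l (e q) (C.anchor (e q) (Θ q w)) := by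
    intro t l hl htl w
    have h1 : (fun p => Θ p (t p)) =ᶠ[𝓝 q] fun p => l (e p) := hev.mono htl
    rw [h1.mvfderiv_eq, mvfderiv_comp_fderiv (hl.differentiableAt_of_isOpen hD hqD) hed,
      h.anchor_chart heU heu hqe]
  have hfield : ∀ {t : ∀ q, 𝒜.pullbackFiber (EQ := EQ) φ q} {l : E' → F'}, ContDiffOn ℝ ∞ l D →
      (∀ q ∈ V, Θ q (t q) = l (e q)) → ∀ w : 𝒜.pullbackFiber (EQ := EQ) φ q,
      mvfderiv 𝓘(ℝ, EQ) (fun p => mvfderiv 𝓘(ℝ, EQ) e p (t p).1.2) q w.1.2 =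
        fderiv ℝ (fun y => C.anchor y (l y)) (e q) (C.anchor (e q) (Θ q w)) := by
    intro t l hl htl w
    have h1 : (fun p => mvfderiv 𝓘(ℝ, EQ) e p (t p).1.2) =ᶠ[𝓝 q]
        fun p => (fun y => C.anchor y (l y)) (e p) := by
      filter_upwards [hev] with p hp
      rw [h.anchor_chart heU heu (hVe hp), htl p hp]
    have h2 : DifferentiableAt ℝ (fun y => C.anchor y (l y)) (e q) :=
      ((C.contDiffOn_anchor.mono hDC).clm_apply hl).differentiableAt_of_isOpen hD hqD
    refine (h1.mvfderiv_eq _).trans ((mvfderiv_comp_fderiv h2 hed _).trans ?_)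
    rw [h.anchor_chart heU heu hqe]
  rw [h.bracket_iff V hV (hVe.trans heU) s t hs ht q hq, hfun hl htl, hfun hk hsk, ← heu q hqe,
    hsk q hq, htl q hq, ← LocalModel.bracket_apply, and_iff_left_iff_imp]
  intro hw
  refine he.injective_mvfderiv hqe ?_
  refine Eq.trans ?_ (mvfderiv_mlieBracket hV (he.contMDiffOn.mono hVe) hs.2 ht.2 hq).symm
  rw [hfield hl htl, hfield hk hsk, h.anchor_chart heU heu hqe, hw, hsk q hq, htl q hq]
  exact C.anchor_bracket D hD hDC k l hk hl _ hqD

end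

variable
  {E₁ : Type*} [NormedAddCommGroup E₁] [NormedSpace ℝ E₁]
  {M₁ : Type*} [TopologicalSpace M₁] [ChartedSpace E₁ M₁] [IsManifold 𝓘(ℝ, E₁) ∞ M₁]
  {F₁ : Type*} [NormedAddCommGroup F₁] [NormedSpace ℝ F₁]
  {A₁ : M₁ → Type*} [TopologicalSpace (TotalSpace F₁ A₁)]
  [∀ x, AddCommGroup (A₁ x)] [∀ x, Module ℝ (A₁ x)] [∀ x, TopologicalSpace (A₁ x)]
  [FiberBundle F₁ A₁] [VectorBundle ℝ F₁ A₁]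
  {E₂ : Type*} [NormedAddCommGroup E₂] [NormedSpace ℝ E₂]
  {M₂ : Type*} [TopologicalSpace M₂] [ChartedSpace E₂ M₂] [IsManifold 𝓘(ℝ, E₂) ∞ M₂]
  {F₂ : Type*} [NormedAddCommGroup F₂] [NormedSpace ℝ F₂]
  {A₂ : M₂ → Type*} [TopologicalSpace (TotalSpace F₂ A₂)]
  [∀ x, AddCommGroup (A₂ x)] [∀ x, Module ℝ (A₂ x)] [∀ x, TopologicalSpace (A₂ x)]
  [FiberBundle F₂ A₂] [VectorBundle ℝ F₂ A₂]
  {EN₁ : Type*} [NormedAddCommGroup EN₁] [NormedSpace ℝ EN₁] [CompleteSpace EN₁]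
  {N₁ : Type*} [TopologicalSpace N₁] [ChartedSpace EN₁ N₁] [IsManifold 𝓘(ℝ, EN₁) ∞ N₁]
  {EN₂ : Type*} [NormedAddCommGroup EN₂] [NormedSpace ℝ EN₂] [CompleteSpace EN₂]
  {N₂ : Type*} [TopologicalSpace N₂] [ChartedSpace EN₂ N₂] [IsManifold 𝓘(ℝ, EN₂) ∞ N₂]
  {E' F' : Type*} [NormedAddCommGroup E'] [NormedSpace ℝ E'] [NormedAddCommGroup F']
  [NormedSpace ℝ F']
  {𝒜₁ : LieAlgebroid E₁ F₁ A₁} {𝒜₂ : LieAlgebroid E₂ F₂ A₂} {ι₁ : N₁ → M₁} {ι₂ : N₂ → M₂}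
  {C : LocalModel E' F'} {U₁ : Set N₁} {u₁ : N₁ → E'}
  {Θ₁ : ∀ q, 𝒜₁.pullbackFiber (EQ := EN₁) ι₁ q →ₗ[ℝ] F'} {U₂ : Set N₂} {u₂ : N₂ → E'}
  {Θ₂ : ∀ q, 𝒜₂.pullbackFiber (EQ := EN₂) ι₂ q →ₗ[ℝ] F'} {e₁ : OpenPartialHomeomorph N₁ E'}
  {e₂ : OpenPartialHomeomorph N₂ E'}

/-- Pull-backs which are locally diffeomorphic to the same local model have isomorphic germs. -/
theorem IsPNF.pullbackGermsIsomorphic (h₁ : 𝒜₁.IsPNF ι₁ C U₁ u₁ Θ₁) (h₂ : 𝒜₂.IsPNF ι₂ C U₂ u₂ Θ₂)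
    (he₁ : IsSmoothChart EN₁ e₁) (heU₁ : e₁.source ⊆ U₁) (heu₁ : ∀ q ∈ e₁.source, e₁ q = u₁ q)
    (he₂ : IsSmoothChart EN₂ e₂) (heU₂ : e₂.source ⊆ U₂) (heu₂ : ∀ q ∈ e₂.source, e₂ q = u₂ q)
    {n₁ : N₁} {n₂ : N₂} (hn₁ : n₁ ∈ e₁.source) (hn₂ : n₂ ∈ e₂.source) (hn : u₁ n₁ = u₂ n₂) :
    PullbackGermsIsomorphic (EQ₁ := EN₁) (EQ₂ := EN₂) 𝒜₁ ι₁ n₁ 𝒜₂ ι₂ n₂ := by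
  -- Both sides are identified with the same open part of the model, and `Ψ` is `Θ₁` followed by the
  -- inverse of `Θ₂`.
  let ψ := e₁.trans e₂.symm
  have hsrc : ∀ q ∈ ψ.source, q ∈ e₁.source ∧ e₁ q ∈ e₂.target := fun q hq => by simpa [ψ] using hq
  have htgt : ∀ q ∈ ψ.target, q ∈ e₂.source ∧ e₂ q ∈ e₁.target := fun q hq => by simpa [ψ] using hq
  have heψ : ∀ q ∈ ψ.source, e₂ (ψ q) = e₁ q := fun q hq => e₂.right_inv (hsrc q hq).2
  have hψ : ContMDiffOn 𝓘(ℝ, EN₁) 𝓘(ℝ, EN₂) ∞ ψ ψ.source :=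
    he₂.contMDiffOn_symm.comp (he₁.contMDiffOn.mono fun q hq => (hsrc q hq).1)
      fun q hq => (hsrc q hq).2
  have hψ' : ContMDiffOn 𝓘(ℝ, EN₂) 𝓘(ℝ, EN₁) ∞ ψ.symm ψ.target :=
    he₁.contMDiffOn_symm.comp (he₂.contMDiffOn.mono fun q hq => (htgt q hq).1)
      fun q hq => (htgt q hq).2
  have hb₁ : ∀ q ∈ ψ.source, Function.Bijective (Θ₁ q) := fun q hq =>
    h₁.bijective he₁ heU₁ heu₁ (hsrc q hq).1
  have hb₂ : ∀ q ∈ ψ.source, Function.Bijective (Θ₂ (ψ q)) := fun q hq =>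
    h₂.bijective he₂ heU₂ heu₂ (htgt _ (ψ.map_source hq)).1
  have hΨ : ∀ q, ∃ Ψ : 𝒜₁.pullbackFiber (EQ := EN₁) ι₁ q →ₗ[ℝ]
      𝒜₂.pullbackFiber (EQ := EN₂) ι₂ (ψ q), q ∈ ψ.source → ∀ v, Θ₂ (ψ q) (Ψ v) = Θ₁ q v := by
    intro q
    by_cases hq : q ∈ ψ.source
    · let T := LinearEquiv.ofBijective (Θ₂ (ψ q)) (hb₂ q hq)
      exact ⟨T.symm.toLinearMap ∘ₗ Θ₁ q, fun _ v => T.apply_symm_apply (Θ₁ q v)⟩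
    · exact ⟨0, fun h => absurd h hq⟩
  choose Ψ hΨ using hΨ
  have hsec : ∀ {s : ∀ q, 𝒜₁.pullbackFiber (EQ := EN₁) ι₁ q}
      {s' : ∀ q, 𝒜₂.pullbackFiber (EQ := EN₂) ι₂ q}, (∀ q ∈ ψ.source, s' (ψ q) = Ψ q (s q)) →
      ∀ q ∈ ψ.source, Θ₂ (ψ q) (s' (ψ q)) = Θ₁ q (s q) := fun hs q hq => by
    rw [hs q hq, hΨ q hq]
  have hsmooth : ∀ {s : ∀ q, 𝒜₁.pullbackFiber (EQ := EN₁) ι₁ q}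
      {s' : ∀ q, 𝒜₂.pullbackFiber (EQ := EN₂) ι₂ q}, (∀ q ∈ ψ.source, s' (ψ q) = Ψ q (s q)) →
      (𝒜₁.IsSmoothPullbackSection ι₁ s ψ.source ↔ 𝒜₂.IsSmoothPullbackSection ι₂ s' ψ.target) := by
    intro s s' hs
    rw [h₁.isSmoothPullbackSection_iff he₁ heU₁ heu₁ ψ.open_source fun q hq => (hsrc q hq).1,
      h₂.isSmoothPullbackSection_iff he₂ heU₂ heu₂ ψ.open_target fun q hq => (htgt q hq).1]
    constructor
    · intro h
      refine (h.comp hψ' fun q hq => ψ.map_target hq).congr fun q hq => ?_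
      have h3 := hsec hs _ (ψ.map_target hq)
      rw [ψ.right_inv hq] at h3
      exact h3
    · intro h
      exact (h.comp hψ fun q hq => ψ.map_source hq).congr fun q hq => (hsec hs q hq).symm
  refine ⟨ψ, ?_, ?_, Ψ, hψ, hψ', fun q hq => ?_, fun q hq v => ?_, fun s s' hs => hsmooth hs,
    fun s t s' t' hs ht hss hst q hq w => ?_⟩
  · have h1 : e₁ n₁ ∈ e₂.target := by
      rw [heu₁ _ hn₁, hn, ← heu₂ _ hn₂]
      exact e₂.map_source hn₂
    simpa [ψ] using ⟨hn₁, h1⟩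
  · change e₂.symm (e₁ n₁) = n₂
    rw [heu₁ _ hn₁, hn, ← heu₂ _ hn₂, e₂.left_inv hn₂]
  · have h1 : ⇑(Θ₂ (ψ q)) ∘ ⇑(Ψ q) = Θ₁ q := funext (hΨ q hq)
    have h2 : Function.Bijective (⇑(Θ₂ (ψ q)) ∘ ⇑(Ψ q)) := by
      rw [h1]
      exact hb₁ q hq
    exact (Function.Bijective.of_comp_iff' (hb₂ q hq) _).1 h2
  · have hq' := (htgt _ (ψ.map_source hq)).1
    refine he₂.injective_mvfderiv hq' ?_
    rw [h₂.anchor_chart heU₂ heu₂ hq', hΨ q hq, heψ q hq, ← h₁.anchor_chart heU₁ heu₁ (hsrc q hq).1]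
    have h1 : e₁ =ᶠ[𝓝 q] fun p => e₂ (ψ p) := by
      filter_upwards [ψ.open_source.mem_nhds hq] with p hp using (heψ p hp).symm
    rw [h1.mvfderiv_eq]
    exact mvfderiv_comp_mfderiv (he₂.mdifferentiableAt hq')
      (hψ.mdifferentiableAt_of_isOpen ψ.open_source hq) v.1.2
  -- Corresponding sections are represented by the same functions on `D`, so both bracket conditions
  -- become the same condition on `C.bracket`.
  · let D : Set E' := e₁.target ∩ e₁.symm ⁻¹' ψ.source
    have hD : IsOpen D := e₁.isOpen_inter_preimage_symm ψ.open_source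
    have hDC : D ⊆ C.dom := fun y hy => by
      have h1 := e₁.map_target hy.1
      rw [← e₁.right_inv hy.1, heu₁ _ h1]
      exact h₁.mapsTo (heU₁ h1)
    have hD₁ : MapsTo e₁ ψ.source D := fun p hp => by
      refine ⟨e₁.map_source (hsrc p hp).1, ?_⟩
      rwa [mem_preimage, e₁.left_inv (hsrc p hp).1]
    have hD₂ : MapsTo e₂ ψ.target D := fun p hp => by
      rw [← ψ.right_inv hp, heψ _ (ψ.map_target hp)]
      exact hD₁ (ψ.map_target hp)
    have hk : ∀ {s : ∀ q, 𝒜₁.pullbackFiber (EQ := EN₁) ι₁ q},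
        𝒜₁.IsSmoothPullbackSection ι₁ s ψ.source →
        ContDiffOn ℝ ∞ (fun y => Θ₁ (e₁.symm y) (s (e₁.symm y))) D := fun {s} hs =>
      (((h₁.isSmoothPullbackSection_iff he₁ heU₁ heu₁ ψ.open_source
        fun q hq => (hsrc q hq).1) s).1 hs |>.comp (he₁.contMDiffOn_symm.mono inter_subset_left)
          fun y hy => hy.2).contDiffOn
    have hk₁ : ∀ s : ∀ q, 𝒜₁.pullbackFiber (EQ := EN₁) ι₁ q, ∀ p ∈ ψ.source,
        Θ₁ p (s p) = Θ₁ (e₁.symm (e₁ p)) (s (e₁.symm (e₁ p))) := fun s p hp => by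
      rw [e₁.left_inv (hsrc p hp).1]
    have hk₂ : ∀ {s : ∀ q, 𝒜₁.pullbackFiber (EQ := EN₁) ι₁ q}
        {s' : ∀ q, 𝒜₂.pullbackFiber (EQ := EN₂) ι₂ q}, (∀ q ∈ ψ.source, s' (ψ q) = Ψ q (s q)) →
        ∀ p ∈ ψ.target, Θ₂ p (s' p) = Θ₁ (e₁.symm (e₂ p)) (s (e₁.symm (e₂ p))) := by
      intro s s' hs p hp
      have h3 := hsec hs _ (ψ.map_target hp)
      rw [hk₁ s _ (ψ.map_target hp), ← heψ _ (ψ.map_target hp), ψ.right_inv hp] at h3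
      exact h3
    rw [h₁.hasPullbackBracketAt_iff he₁ heU₁ heu₁ ψ.open_source (fun q hq => (hsrc q hq).1) hss hst
      hD hDC hD₁ (hk hss) (hk hst) (hk₁ s) (hk₁ t) hq,
      h₂.hasPullbackBracketAt_iff he₂ heU₂ heu₂ ψ.open_target (fun q hq => (htgt q hq).1)
      ((hsmooth hs).1 hss) ((hsmooth ht).1 hst) hD hDC hD₂ (hk hss) (hk hst) (hk₂ hs) (hk₂ ht)
      (ψ.map_source hq), hΨ q hq, heψ q hq]

end LieAlgebroid

end EtaleNormalForms

/-! ### Transversals as charts of the transverse model. -/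

noncomputable section Transversals

set_option linter.unusedSectionVars false

attribute [-instance]
  Bundle.instNormedAddCommGroupOfRiemannianBundleOfIsTopologicalAddGroupOfContinuousConstSMulReal

namespace LieAlgebroid

variable {E : Type*} [NormedAddCommGroup E] [NormedSpace ℝ E] [FiniteDimensional ℝ E]
  {M : Type*} [TopologicalSpace M] [T2Space M] [ChartedSpace E M] [IsManifold 𝓘(ℝ, E) ∞ M]
  {F : Type*} [NormedAddCommGroup F] [NormedSpace ℝ F] [FiniteDimensional ℝ F]
  {A : M → Type*} [TopologicalSpace (TotalSpace F A)]
  [∀ x, AddCommGroup (A x)] [∀ x, Module ℝ (A x)] [∀ x, TopologicalSpace (A x)]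
  [FiberBundle F A] [VectorBundle ℝ F A] [ContMDiffVectorBundle ∞ F A 𝓘(ℝ, E)]
  {EN : Type*} [NormedAddCommGroup EN] [NormedSpace ℝ EN] [FiniteDimensional ℝ EN]
  {N : Type*} [TopologicalSpace N] [ChartedSpace EN N] [IsManifold 𝓘(ℝ, EN) ∞ N]
  {E' F' : Type*} [NormedAddCommGroup E'] [NormedSpace ℝ E'] [NormedAddCommGroup F']
  [NormedSpace ℝ F'] [FiniteDimensional ℝ F']
  {𝒜 : LieAlgebroid E F A} {ι : N → M} {n₀ : N} {C : LocalModel E' F'}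

/-- Since the anchor of `C` vanishes at `p (ι n₀)`, the kernel of `dp` at `ι n₀` is the image of the
anchor of `A`, that is, the tangent space of the leaf. The tangent space of `N` is a complement of
it. -/
theorem IsTransversal.bijective_mvfderiv (hι : 𝒜.IsTransversal (EN := EN) ι n₀) {U : Set M}
    {p : M → E'} {θ : ∀ z, A z →ₗ[ℝ] F'} (h : 𝒜.IsNF C.anchor C.tensor U p θ) (hU : ι n₀ ∈ U)
    (hC : C.anchor (p (ι n₀)) = 0) :
    Function.Bijective (mvfderiv 𝓘(ℝ, EN) (fun n => p (ι n)) n₀) := by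
  have hd : ∀ X, mvfderiv 𝓘(ℝ, EN) (fun n => p (ι n)) n₀ X =
      mvfderiv 𝓘(ℝ, E) p (ι n₀) (mfderiv 𝓘(ℝ, EN) 𝓘(ℝ, E) ι n₀ X) := fun X =>
    mvfderiv_comp_mfderiv (h.contMDiffOn_base.mdifferentiableAt_of_isOpen h.isOpen hU)
      ((hι.isSmoothEmbedding.isImmersion.contMDiff n₀).mdifferentiableAt (by simp)) X
  constructor
  · refine (injective_iff_map_eq_zero _).2 fun X hX => ?_
    rw [hd] at hX
    obtain ⟨v, -, hv⟩ := (h.cartesian _ hU 0 _ ((map_zero _).trans hX.symm)).exists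
    have h1 := Submodule.disjoint_def.1 hι.isCompl.disjoint
      (mfderiv 𝓘(ℝ, EN) 𝓘(ℝ, E) ι n₀ X) ⟨X, rfl⟩ ⟨v, hv⟩
    exact hι.isSmoothEmbedding.isImmersion.injective_mfderiv n₀ (h1.trans (map_zero _).symm)
  · intro e
    obtain ⟨Y, hY⟩ := h.surjective _ hU e
    have h1 : Y ∈ (mfderiv 𝓘(ℝ, EN) 𝓘(ℝ, E) ι n₀).toLinearMap.range ⊔
        (𝒜.anchor (ι n₀)).range := by
      rw [hι.isCompl.sup_eq_top]
      exact Submodule.mem_top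
    obtain ⟨_, ⟨X, rfl⟩, _, ⟨v, rfl⟩, hXv⟩ := Submodule.mem_sup.1 h1
    refine ⟨X, ?_⟩
    have h2 := h.anchor _ hU v
    rw [hC] at h2
    have h3 := congrArg (mvfderiv 𝓘(ℝ, E) p (ι n₀)) hXv
    rw [map_add, ← h2, hY] at h3
    exact (hd X).trans ((add_zero _).symm.trans h3)

/-- A transversal is locally identified with the transverse local model. -/
theorem IsTransversal.exists_isPNF (hι : 𝒜.IsTransversal (EN := EN) ι n₀) {y : E'}
    (hC : C.anchor y = 0) (hy : 𝒜.HasNF C y (ι n₀)) :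
    ∃ (U : Set N) (u : N → E') (Θ : ∀ q, 𝒜.pullbackFiber (EQ := EN) ι q →ₗ[ℝ] F')
      (e : OpenPartialHomeomorph N E'), 𝒜.IsPNF ι C U u Θ ∧ IsSmoothChart EN e ∧ e.source ⊆ U ∧
        (∀ q ∈ e.source, e q = u q) ∧ n₀ ∈ e.source ∧ u n₀ = y := by
  obtain ⟨U, p, θ, hz, rfl, hm, h⟩ := hy
  have hP := h.isPNF hm hι.isSmoothEmbedding.isImmersion.contMDiff
  obtain ⟨e, he, hne, heU, heu⟩ := exists_isSmoothChart_of_bijective hP.isOpen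
    hP.contMDiffOn_base hz (hι.bijective_mvfderiv h hz hC)
  exact ⟨_, _, _, e, hP, he, heU, heu, hne, rfl⟩

end LieAlgebroid

end Transversals

/-! ### The theorem. -/

theorem mainTheorem1
    {E₁ : Type*} [NormedAddCommGroup E₁] [NormedSpace ℝ E₁] [FiniteDimensional ℝ E₁]
    {M₁ : Type*} [TopologicalSpace M₁] [T2Space M₁] [SecondCountableTopology M₁]
    [ChartedSpace E₁ M₁] [IsManifold 𝓘(ℝ, E₁) ∞ M₁]
    {F₁ : Type*} [NormedAddCommGroup F₁] [NormedSpace ℝ F₁] [FiniteDimensional ℝ F₁]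
    {A₁ : M₁ → Type*} [TopologicalSpace (TotalSpace F₁ A₁)]
    [∀ x, AddCommGroup (A₁ x)] [∀ x, Module ℝ (A₁ x)] [∀ x, TopologicalSpace (A₁ x)]
    [FiberBundle F₁ A₁] [VectorBundle ℝ F₁ A₁] [ContMDiffVectorBundle ∞ F₁ A₁ 𝓘(ℝ, E₁)]
    {E₂ : Type*} [NormedAddCommGroup E₂] [NormedSpace ℝ E₂] [FiniteDimensional ℝ E₂]
    {M₂ : Type*} [TopologicalSpace M₂] [T2Space M₂] [SecondCountableTopology M₂]
    [ChartedSpace E₂ M₂] [IsManifold 𝓘(ℝ, E₂) ∞ M₂]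
    {F₂ : Type*} [NormedAddCommGroup F₂] [NormedSpace ℝ F₂] [FiniteDimensional ℝ F₂]
    {A₂ : M₂ → Type*} [TopologicalSpace (TotalSpace F₂ A₂)]
    [∀ x, AddCommGroup (A₂ x)] [∀ x, Module ℝ (A₂ x)] [∀ x, TopologicalSpace (A₂ x)]
    [FiberBundle F₂ A₂] [VectorBundle ℝ F₂ A₂] [ContMDiffVectorBundle ∞ F₂ A₂ 𝓘(ℝ, E₂)]
    (𝒜₁ : LieAlgebroid E₁ F₁ A₁) (𝒜₂ : LieAlgebroid E₂ F₂ A₂)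
    {EQ : Type*} [NormedAddCommGroup EQ] [NormedSpace ℝ EQ] [FiniteDimensional ℝ EQ]
    {Q : Type*} [TopologicalSpace Q] [T2Space Q] [SecondCountableTopology Q]
    [ChartedSpace EQ Q] [IsManifold 𝓘(ℝ, EQ) ∞ Q]
    (φ₁ : Q → M₁) (φ₂ : Q → M₂)
    (hφ : LieAlgebroid.IsMoritaEquivalence 𝒜₁ 𝒜₂ (EQ := EQ) φ₁ φ₂) :
    Set.BijOn (fun L : Set M₁ => φ₂ '' (φ₁ ⁻¹' L)) 𝒜₁.leaves 𝒜₂.leaves ∧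
    ∀ L ∈ 𝒜₁.leaves,
      ∀ {EN₁ : Type*} [NormedAddCommGroup EN₁] [NormedSpace ℝ EN₁] [FiniteDimensional ℝ EN₁]
        {N₁ : Type*} [TopologicalSpace N₁] [ChartedSpace EN₁ N₁] [IsManifold 𝓘(ℝ, EN₁) ∞ N₁]
        {EN₂ : Type*} [NormedAddCommGroup EN₂] [NormedSpace ℝ EN₂] [FiniteDimensional ℝ EN₂]
        {N₂ : Type*} [TopologicalSpace N₂] [ChartedSpace EN₂ N₂] [IsManifold 𝓘(ℝ, EN₂) ∞ N₂]
        (ι₁ : N₁ → M₁) (n₁ : N₁) (ι₂ : N₂ → M₂) (n₂ : N₂),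
        ι₁ n₁ ∈ L → 𝒜₁.IsTransversal (EN := EN₁) ι₁ n₁ →
        ι₂ n₂ ∈ φ₂ '' (φ₁ ⁻¹' L) → 𝒜₂.IsTransversal (EN := EN₂) ι₂ n₂ →
        LieAlgebroid.PullbackGermsIsomorphic (EQ₁ := EN₁) (EQ₂ := EN₂)
          𝒜₁ ι₁ n₁ 𝒜₂ ι₂ n₂ := by
  refine ⟨hφ.bijOn_leaves, ?_⟩
  rintro _ ⟨x₀, rfl⟩ EN₁ _ _ _ N₁ _ _ _ EN₂ _ _ _ N₂ _ _ _ ι₁ n₁ ι₂ n₂ hx₁ hι₁ ⟨q, hq, hqn⟩ hι₂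
  have : CompleteSpace EN₁ := FiniteDimensional.complete ℝ EN₁
  have : CompleteSpace EN₂ := FiniteDimensional.complete ℝ EN₂
  obtain ⟨Ψ, hΨ⟩ := hφ.exists_isIsoOverId
  -- A model at `ι₁ n₁` is carried along the leaf to `φ₁ q`, then across the equivalence to `φ₂ q =
  -- ι₂ n₂`. Both transversals are thereby charts of the same model at the same point `y`.
  obtain ⟨E', F', _, _, _, _, _, _, C, y, hC, h₁⟩ := 𝒜₁.exists_hasNF (ι₁ n₁)
  have h₂ := h₁.of_orbitSetoid hC (𝒜₁.orbitSetoid.trans hx₁ (𝒜₁.orbitSetoid.symm hq))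
  have h₃ := hΨ.hasNF hφ.isSubmersion₁ hφ.isSubmersion₂ hC h₂
  rw [hqn] at h₃
  obtain ⟨U₁, u₁, Θ₁, e₁, hP₁, he₁, heU₁, heu₁, hn₁, hu₁⟩ := hι₁.exists_isPNF hC h₁
  obtain ⟨U₂, u₂, Θ₂, e₂, hP₂, he₂, heU₂, heu₂, hn₂, hu₂⟩ := hι₂.exists_isPNF hC h₃
  exact hP₁.pullbackGermsIsomorphic hP₂ he₁ heU₁ heu₁ he₂ heU₂ heu₂ hn₁ hn₂ (hu₁.trans hu₂.symm)
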